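/- Let $M$ be a smooth manifold (Hausdorff, second countable, without boundary) of dimension $d\ge 3$, and let $(M^d,g,f,m,\mu)$ be a smooth metric measure space: $g$ is a smooth Riemannian metric, $f\in C^\infty(M)$ is positive, $m\in[0,\infty)$ and $\mu\in\mathbb R$. **Definitions.** For a metric measure structure $(\widetilde g,\widetilde f)$ put $$\widetilde{\mathrm{Ric}}{}_\phi^m=\mathrm{Ric}_{\widetilde g}-\frac{m}{\widetilde f}\widetilde\nabla^2\widetilde f,\qquad \widetilde F_\phi^m=\widetilde f\,\widetilde\Delta\widetilde f+(m-1)\bigl(|\widetilde\nabla\widetilde f|^2-\mu\bigr).$$ The ray bundle $\mathcal G=\{(s^2g_x,sf(x),x): s>0,\ x\in M\}$ is identified with $\mathbb R_+\times M$ by $(t^2g_x,tf(x),x)\mapsto(t,x)$. Points of $\mathcal G\times\mathbb R$ are written $(t,x,\rho)$, and $\delta_s(t,x,\rho)=(st,x,\rho)$ for $s>0$. The indices $0$, $i$, $\infty$ refer to $t$, to coordinates on $M$, and to $\rho$. A *weighted pre-ambient space* is a triple $(\widetilde{\mathcal G},\widetilde g,\widetilde f)$ where $\widetilde{\mathcal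 G}\subset\mathcal G\times\mathbb R$ is a dilation-invariant open neighborhood of $\mathcal G\times\{0\}$, $\widetilde g$ is a smooth metric of signature $(d+1,1)$ and $\widetilde f$ a smooth function on $\widetilde{\mathcal G}$, with $\delta_s^*\widetilde g=s^2\widetilde g$, $\delta_s^*\widetilde f=s\widetilde f$, and whose pullbacks under $(t,x)\mapsto(t,x,0)$ are $t^2g$ and $tf$. It is *normal* (relative to $(g,f)$) if for each $z\in\mathcal G$ the set $I_z=\{\rho:(z,\rho)\in\widetilde{\mathcal G}\}$ is an open interval containing $0$, the curve $\rho\mapsto(z,\rho)$, $\rho\in I_z$, is a geodesic of $\widetilde g$, and $\widetilde g=t^2g+2t\,d\rho\,dt$ at $\rho=0$. It is *straight* if for each $p\in\widetilde{\mathcal G}$ the dilation orbit $s\mapsto\delta_sp$, $s>0$, is a geodesic of $\widetilde g$. For a symmetric 2-tensor $S$ and a function $h$ near $\mathcal G\times\{0\}$, $(S,h)=O(\rho^n)$ means that $h$ and all components $S_{IJ}$ are $O(\rho^n)$ as $\rho\to0$; $O(\rho^\infty)$ means $O(\rho^n)$ for all $n$; and $(S,h)=O^{k,+}_{IJ}(\rho^n)$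 means that $(S,h)=O(\rho^n)$, that $S_{00},S_{0i}=O(\rho^{n+1})$, and that $mf^{-k}h-g^{ij}S_{ij}=O(\rho^{n+1})$, where $g,f,m$ are those of the given space. A *weighted ambient space* for $(M^d,g,f,m,\mu)$ is a weighted pre-ambient space such that $(\widetilde{\mathrm{Ric}}{}_\phi^m,\widetilde F_\phi^m)=O(\rho^\infty)$ if $d+m\notin2\mathbb N$, and $(\widetilde{\mathrm{Ric}}{}_\phi^m,\widetilde F_\phi^m)=O^{2,+}_{IJ}(\rho^{\frac{d+m}2-1})$ if $d+m\in2\mathbb N$. **Theorem.** There is a straight and normal weighted ambient space $(\widetilde{\mathcal G},\widetilde g,\widetilde f)$ for $(M^d,g,f,m,\mu)$ with $$\widetilde g=2\rho\,dt^2+2t\,d\rho\,dt+t^2g_\rho,\qquad \widetilde f=tf_\rho,$$ where $g_\rho$ and $f_\rho$ are one-parameter families of Riemannian metrics and of functions on $M$ with $g_0=g$, $f_0=f$ ($g_\rho$ and $f_\rho$ being defined at $x$ for those $\rho$ with $(t,x,\rho)\in\widetilde{\mathcal G}$). Moreover, if $(\widetilde{\mathcal G}_j,\widetilde g_j,\widetilde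 f_j)$, $j\in\{1,2\}$, are any two straight and normal weighted ambient spaces for $(M^d,g,f,m,\mu)$, then 1. if $d+m\notin2\mathbb N$, then $\bigl(\widetilde g_1-\widetilde g_2,\,-2(\widetilde f_1-\widetilde f_2)\bigr)=O(\rho^\infty)$; 2. if $d+m\in2\mathbb N$, then $\bigl(\widetilde g_1-\widetilde g_2,\,-2(\widetilde f_1-\widetilde f_2)\bigr)=O^{1,+}_{IJ}(\rho^{\frac{d+m}2-1})$. -/

import Mathlib

open scoped Manifold ContDiff Topology

noncomputable section

namespace WeightedAmbient

/-! ### Coordinate calculus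

`V` is the model space of a chart, with a basis `b` giving the coordinate directions. A metric on an
open subset of `V` is given by its matrix of components `G`. -/

section Coordinates

variable {V ι : Type*} [NormedAddCommGroup V] [NormedSpace ℝ V] [Fintype ι] [DecidableEq ι]
  (b : Module.Basis ι ℝ V)

/-- The partial derivative `∂_i F`. -/
def pd (i : ι) (F : V → ℝ) (y : V) : ℝ := fderiv ℝ F y (b i)

/-- The Christoffel symbol `Γ^k_ij = (1/2) G^{kl} (∂_i G_jl + ∂_j G_il - ∂_l G_ij)`. -/
def christoffel (G : V → Matrix ι ι ℝ) (k i j : ι) (y : V) : ℝ :=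
  (1 / 2) * ∑ l, (G y)⁻¹ k l *
    (pd b i (fun z => G z j l) y + pd b j (fun z => G z i l) y - pd b l (fun z => G z i j) y)

/-- The Ricci tensor `R_ij = ∂_k Γ^k_ij - ∂_j Γ^k_ik + Γ^k_kl Γ^l_ij - Γ^k_jl Γ^l_ik`
(positive on round spheres). -/
def ricciCoord (G : V → Matrix ι ι ℝ) (i j : ι) (y : V) : ℝ :=
  (∑ k, (pd b k (christoffel b G k i j) y - pd b j (christoffel b G k i k) y))
    + ∑ k, ∑ l, (christoffel b G k k l y * christoffel b G l i j y
      - christoffel b G k j l y * christoffel b G l i k y)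

/-- The Hessian `(∇²u)_ij = ∂_i ∂_j u - Γ^k_ij ∂_k u`. -/
def hessCoord (G : V → Matrix ι ι ℝ) (u : V → ℝ) (i j : ι) (y : V) : ℝ :=
  pd b i (pd b j u) y - ∑ k, christoffel b G k i j y * pd b k u y

/-- The Laplacian `Δu = G^{ij} (∇²u)_ij`. -/
def laplacianCoord (G : V → Matrix ι ι ℝ) (u : V → ℝ) (y : V) : ℝ :=
  ∑ i, ∑ j, (G y)⁻¹ i j * hessCoord b G u i j y

/-- The squared length of the gradient `|∇u|² = G^{ij} ∂_i u ∂_j u`. -/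
def gradSqCoord (G : V → Matrix ι ι ℝ) (u : V → ℝ) (y : V) : ℝ :=
  ∑ i, ∑ j, (G y)⁻¹ i j * pd b i u y * pd b j u y

end Coordinates

/-! ### Metric measure structures on a manifold, through charts -/

section Manifold

variable {V H : Type*} [NormedAddCommGroup V] [NormedSpace ℝ V] [TopologicalSpace H]
  (I : ModelWithCorners ℝ V H) {N : Type*} [TopologicalSpace N] [ChartedSpace H N]
  {ι : Type*} [Fintype ι] [DecidableEq ι] (b : Module.Basis ι ℝ V)

/-- Fields of bilinear forms on the tangent spaces of `N`. -/
abbrev TwoTensor (N : Type*) [TopologicalSpace N] [ChartedSpace H N] :=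
  ∀ p : N, TangentSpace I p →L[ℝ] TangentSpace I p →L[ℝ] ℝ

/-- The matrix of components `h(∂_i, ∂_j)` of a two-tensor `h`, as a function on the target of the
preferred chart at `p`: the components of the pullback of `h` by the inverse of the chart. -/
def chartMatrix (h : TwoTensor I N) (p : N) (y : V) : Matrix ι ι ℝ :=
  Matrix.of fun i j => h ((extChartAt I p).symm y)
    (mfderiv 𝓘(ℝ, V) I (extChartAt I p).symm y (b i))
    (mfderiv 𝓘(ℝ, V) I (extChartAt I p).symm y (b j))

/-- A function read in the preferred chart at `p`. -/
def chartFun (u : N → ℝ) (p : N) (y : V) : ℝ := u ((extChartAt I p).symm y)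

/-- The components at `p` of a two-tensor. The tangent space at `p` is identified with `V` by the
preferred chart at `p`, so these are the components in the coordinates of that chart. -/
def componentsAt (h : TwoTensor I N) (p : N) (i j : ι) : ℝ :=
  h p (show TangentSpace I p from b i) (show TangentSpace I p from b j)

/-- The components at `p`, in the preferred chart at `p`, of the Bakry-Émery Ricci tensor
`Ric_φ^m = Ric - (m / f) ∇²f` of the metric measure structure `(h, f)` with parameter `m`. -/
def bakryEmeryRicci (h : TwoTensor I N) (f : N → ℝ) (m : ℝ) (p : N) (i j : ι) : ℝ :=
  ricciCoord b (chartMatrix I b h p) i j (extChartAt I p p)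
    - m / f p * hessCoord b (chartMatrix I b h p) (chartFun I f p) i j (extChartAt I p p)

/-- The scalar `F_φ^m = f Δf + (m - 1) (|∇f|² - μ)`. -/
def weightedF (h : TwoTensor I N) (f : N → ℝ) (m μ : ℝ) (p : N) : ℝ :=
  f p * laplacianCoord b (chartMatrix I b h p) (chartFun I f p) (extChartAt I p p)
    + (m - 1) *
      (gradSqCoord b (chartMatrix I b h p) (chartFun I f p) (extChartAt I p p) - μ)

/-- `γ` is a smooth (affinely parametrized) geodesic of `h` on the open set `J` of times: in the
preferred chart at `γ s`, the equation `c''^k + Γ^k_ij c'^i c'^j = 0` holds at time `s`. -/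
def IsGeodesicOn (h : TwoTensor I N) (γ : ℝ → N) (J : Set ℝ) : Prop :=
  ContMDiffOn 𝓘(ℝ, ℝ) I ∞ γ J ∧
  ∀ s ∈ J, ∀ k : ι,
    b.repr (deriv (deriv (fun r => extChartAt I (γ s) (γ r))) s) k
      + ∑ i, ∑ j, christoffel b (chartMatrix I b h (γ s)) k i j (extChartAt I (γ s) (γ s))
        * b.repr (deriv (fun r => extChartAt I (γ s) (γ r)) s) i
        * b.repr (deriv (fun r => extChartAt I (γ s) (γ r)) s) j = 0

/-- A bilinear form on a finite-dimensional space is symmetric and has signature `(q₁, q₂)`: `q₁`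
plus and `q₂` minus signs in a diagonalization. It is nondegenerate if `q₁ + q₂ = dim W`. -/
def HasSignature {W : Type*} [AddCommGroup W] [Module ℝ W] [TopologicalSpace W]
    (B : W →L[ℝ] W →L[ℝ] ℝ) (q₁ q₂ : ℕ) : Prop :=
  (∀ v w, B v w = B w v) ∧
  sigPos (LinearMap.BilinMap.toQuadraticMap
    (LinearMap.mk₂ ℝ (fun v w => B v w) (by simp) (by simp) (by simp) (by simp))) = q₁ ∧
  sigNeg (LinearMap.BilinMap.toQuadraticMap
    (LinearMap.mk₂ ℝ (fun v w => B v w) (by simp) (by simp) (by simp) (by simp))) = q₂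

end Manifold

/-! ### Smooth metric measure spaces and weighted ambient spaces -/

section Ambient

/-- The model space of `M^d`. -/
abbrev BaseVec (d : ℕ) := EuclideanSpace ℝ (Fin d)

/-- The coordinate directions of `M^d`. -/
def baseBasis (d : ℕ) : Module.Basis (Fin d) ℝ (BaseVec d) :=
  (EuclideanSpace.basisFun (Fin d) ℝ).toBasis

/-- The model with corners of the manifold `ℝ × M^d × ℝ`. -/
abbrev ambI (d : ℕ) := 𝓘(ℝ, ℝ).prod ((𝓡 d).prod 𝓘(ℝ, ℝ))

/-- The model space of `ℝ × M^d × ℝ`. -/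
abbrev AmbVec (d : ℕ) := ℝ × BaseVec d × ℝ

/-- Indices of the coordinates `(t, x¹, …, x^d, ρ)`: first `0`, then `i`, then `∞`. -/
abbrev AmbIdx (d : ℕ) := Unit ⊕ (Fin d ⊕ Unit)

/-- The index `0`, of the coordinate `t`. -/
def idx0 {d : ℕ} : AmbIdx d := Sum.inl ()

/-- The index `i` of a coordinate on `M`. -/
def idxM {d : ℕ} (i : Fin d) : AmbIdx d := Sum.inr (Sum.inl i)

/-- The coordinate directions `∂_t, ∂_1, …, ∂_d, ∂_ρ`. -/
def ambBasis (d : ℕ) : Module.Basis (AmbIdx d) ℝ (AmbVec d) :=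
  (Module.Basis.singleton Unit ℝ).prod
    ((baseBasis d).prod (Module.Basis.singleton Unit ℝ))

variable (d : ℕ) (M : Type*) [TopologicalSpace M] [ChartedSpace (BaseVec d) M]
  [IsManifold (𝓡 d) ∞ M]

/-- A smooth metric measure space `(M^d, g, f, m, μ)` with finite dimensional parameter `m`. -/
structure SmoothMetricMeasureSpace where
  /-- the Riemannian metric -/
  g : Bundle.ContMDiffRiemannianMetric (𝓡 d) ∞ (BaseVec d)
    (fun x : M => TangentSpace (𝓡 d) x)
  /-- the density function -/
  f : M → ℝ
  contMDiff_f : ContMDiff (𝓡 d) 𝓘(ℝ, ℝ) ∞ f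
  f_pos : ∀ x, 0 < f x
  /-- the dimensional parameter -/
  m : ℝ
  m_nonneg : 0 ≤ m
  /-- the curvature parameter -/
  μ : ℝ

/-- The data `(G̃, g̃, f̃)`. The metric measure structure `(g, f)` identifies the ray bundle
`{(s² g_x, s f(x), x) : s > 0, x ∈ M}` with `ℝ₊ × M` by `(t² g_x, t f(x), x) ↦ (t, x)`, so `G̃` is a
set of points `(t, x, ρ)`. Only the values of `g̃` and `f̃` on `G̃` matter. -/
structure MetricMeasureStructure where
  /-- the domain `G̃` -/
  space : Set (ℝ × M × ℝ)
  /-- the metric `g̃` -/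
  g : TwoTensor (ambI d) (ℝ × M × ℝ)
  /-- the function `f̃` -/
  f : ℝ × M × ℝ → ℝ

variable {d M}

/-- The value of a two-tensor on `ℝ × M × ℝ` at the point `(t, x, ρ)` on the tangent vectors
`a ∂_t + v + c ∂_ρ` and `a' ∂_t + v' + c' ∂_ρ`. -/
def evalAt (h : TwoTensor (ambI d) (ℝ × M × ℝ)) (t : ℝ) (x : M) (ρ : ℝ)
    (a : ℝ) (v : TangentSpace (𝓡 d) x) (c : ℝ)
    (a' : ℝ) (v' : TangentSpace (𝓡 d) x) (c' : ℝ) : ℝ :=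
  h (t, x, ρ) (show TangentSpace (ambI d) ((t, x, ρ) : ℝ × M × ℝ) from (a, v, c))
    (show TangentSpace (ambI d) ((t, x, ρ) : ℝ × M × ℝ) from (a', v', c'))

/-- Weighted pre-ambient spaces for `(M, g, f, m, μ)`. -/
structure IsPreAmbient (S : SmoothMetricMeasureSpace d M) (A : MetricMeasureStructure d M) :
    Prop where
  /-- `G̃` is a dilation-invariant open neighborhood of `ℝ₊ × M × {0}` in `ℝ₊ × M × ℝ`. -/
  isOpen_space : IsOpen A.space
  pos_of_mem : ∀ p ∈ A.space, 0 < p.1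
  mem_zero : ∀ t > 0, ∀ x : M, (t, x, 0) ∈ A.space
  dilation_mem : ∀ s > 0, ∀ t x ρ, (t, x, ρ) ∈ A.space → (s * t, x, ρ) ∈ A.space
  /-- `g̃` is a smooth metric of signature `(d + 1, 1)` on `G̃`. -/
  contMDiffOn_g : ContMDiffOn (ambI d)
    ((ambI d).prod 𝓘(ℝ, AmbVec d →L[ℝ] AmbVec d →L[ℝ] ℝ)) ∞
    (fun p : ℝ × M × ℝ => Bundle.TotalSpace.mk' (AmbVec d →L[ℝ] AmbVec d →L[ℝ] ℝ)
      (E := fun p : ℝ × M × ℝ => TangentSpace (ambI d) p →L[ℝ] TangentSpace (ambI d) p →L[ℝ] ℝ)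
      p (A.g p)) A.space
  signature_g : ∀ p ∈ A.space, HasSignature (A.g p) (d + 1) 1
  /-- `f̃` is a smooth function on `G̃`. -/
  contMDiffOn_f : ContMDiffOn (ambI d) 𝓘(ℝ, ℝ) ∞ A.f A.space
  /-- `δ_s^* g̃ = s² g̃`, where `δ_s (t, x, ρ) = (s t, x, ρ)` has the differential
  `(a, v, c) ↦ (s a, v, c)`. -/
  homogeneous_g : ∀ s > 0, ∀ t x ρ, (t, x, ρ) ∈ A.space → ∀ a v c a' v' c',
    evalAt A.g (s * t) x ρ (s * a) v c (s * a') v' c' = s ^ 2 * evalAt A.g t x ρ a v c a' v' c'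
  /-- `δ_s^* f̃ = s f̃`. -/
  homogeneous_f : ∀ s > 0, ∀ t x ρ, (t, x, ρ) ∈ A.space → A.f (s * t, x, ρ) = s * A.f (t, x, ρ)
  /-- `ι^* g̃ = t² g`, where `ι (t, x) = (t, x, 0)`. -/
  initial_g : ∀ t > 0, ∀ (x : M) (a : ℝ) (v : TangentSpace (𝓡 d) x) (a' : ℝ)
    (v' : TangentSpace (𝓡 d) x), evalAt A.g t x 0 a v 0 a' v' 0 = t ^ 2 * S.g.inner x v v'
  /-- `ι^* f̃ = t f`. -/
  initial_f : ∀ t > 0, ∀ x : M, A.f (t, x, 0) = t * S.f x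

/-- Normal form relative to `(g, f)`. -/
structure IsNormal (S : SmoothMetricMeasureSpace d M) (A : MetricMeasureStructure d M) :
    Prop where
  /-- For each `z = (t, x)`, the set of `ρ` with `(z, ρ) ∈ G̃` is an open interval containing `0`. -/
  interval : ∀ t > 0, ∀ x : M, IsOpen {ρ : ℝ | (t, x, ρ) ∈ A.space} ∧
    Set.OrdConnected {ρ : ℝ | (t, x, ρ) ∈ A.space} ∧ (0 : ℝ) ∈ {ρ : ℝ | (t, x, ρ) ∈ A.space}
  /-- The curves `ρ ↦ (z, ρ)` are geodesics. -/
  geodesic : ∀ t > 0, ∀ x : M, IsGeodesicOn (ambI d) (ambBasis d) A.g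
    (fun ρ : ℝ => (t, x, ρ)) {ρ : ℝ | (t, x, ρ) ∈ A.space}
  /-- `g̃ = t² g + 2 t dρ dt` at the points `(t, x, 0)`. -/
  initial : ∀ t > 0, ∀ (x : M) a v c a' v' c', evalAt A.g t x 0 a v c a' v' c' =
    t ^ 2 * S.g.inner x v v' + t * (a * c' + a' * c)

/-- Straight: the dilation orbits `s ↦ δ_s p` are geodesics. -/
def IsStraight (A : MetricMeasureStructure d M) : Prop :=
  ∀ t x ρ, (t, x, ρ) ∈ A.space → IsGeodesicOn (ambI d) (ambBasis d) A.g
    (fun s : ℝ => (s * t, x, ρ)) (Set.Ioi 0)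

/-- `u = O(ρ^n)` at `ρ = 0`, at every `(t, x)`. It is applied to functions `u` that are smooth in
`ρ` near `0`: scalar functions, and components of tensors in the chart centered at `x` (these refer
to the same coordinates `(t, x¹, …, x^d, ρ)` along the line `ρ ↦ (t, x, ρ)`). -/
def IsOrder (u : ℝ × M × ℝ → ℝ) (n : ℕ) : Prop :=
  ∀ t > 0, ∀ x : M, (fun ρ : ℝ => u (t, x, ρ)) =O[𝓝 0] fun ρ : ℝ => ρ ^ n

/-- `(T_IJ, h) = O(ρ^n)`. -/
def PairIsOrder (T : ℝ × M × ℝ → AmbIdx d → AmbIdx d → ℝ) (h : ℝ × M × ℝ → ℝ) (n : ℕ) :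
    Prop :=
  (∀ i j, IsOrder (fun p => T p i j) n) ∧ IsOrder h n

/-- `(T_IJ, h) = O^{k,+}_IJ(ρ^n)`: besides `(T_IJ, h) = O(ρ^n)`, also `T_00, T_0i = O(ρ^{n+1})` and
`m f^{-k} h - g^{ij} T_ij = O(ρ^{n+1})`. -/
def PairIsOrderPlus (S : SmoothMetricMeasureSpace d M) (k : ℕ)
    (T : ℝ × M × ℝ → AmbIdx d → AmbIdx d → ℝ) (h : ℝ × M × ℝ → ℝ) (n : ℕ) : Prop :=
  PairIsOrder T h n ∧
  IsOrder (fun p => T p idx0 idx0) (n + 1) ∧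
  (∀ i, IsOrder (fun p => T p idx0 (idxM i)) (n + 1)) ∧
  IsOrder (fun p => S.m * (S.f p.2.1 ^ k)⁻¹ * h p
    - ∑ i, ∑ j, (Matrix.of (componentsAt (𝓡 d) (baseBasis d) S.g.inner p.2.1))⁻¹ i j
      * T p (idxM i) (idxM j)) (n + 1)

/-- The Bakry-Émery Ricci tensor of `(g̃, f̃)`, by components. -/
def ambRicci (S : SmoothMetricMeasureSpace d M) (A : MetricMeasureStructure d M) :
    ℝ × M × ℝ → AmbIdx d → AmbIdx d → ℝ :=
  bakryEmeryRicci (ambI d) (ambBasis d) A.g A.f S.m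

/-- The scalar `F_φ^m` of `(g̃, f̃)`. -/
def ambF (S : SmoothMetricMeasureSpace d M) (A : MetricMeasureStructure d M) :
    ℝ × M × ℝ → ℝ :=
  weightedF (ambI d) (ambBasis d) A.g A.f S.m S.μ

/-- Weighted ambient spaces for `(M, g, f, m, μ)`. For `d + m = 2 n ≥ 2`, the order `n - 1` is
`(d + m) / 2 - 1`. -/
structure IsWeightedAmbient (S : SmoothMetricMeasureSpace d M) (A : MetricMeasureStructure d M) :
    Prop extends IsPreAmbient S A where
  order_of_not_even : (¬ ∃ n : ℕ, (d : ℝ) + S.m = 2 * n) →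
    ∀ k : ℕ, PairIsOrder (ambRicci S A) (ambF S A) k
  order_of_even : ∀ n : ℕ, (d : ℝ) + S.m = 2 * n →
    PairIsOrderPlus S 2 (ambRicci S A) (ambF S A) (n - 1)

/-- `g̃ = 2 ρ dt² + 2 t dρ dt + t² g_ρ` and `f̃ = t f_ρ` on `G̃`, for a one-parameter family of
Riemannian metrics `g_ρ` and of functions `f_ρ` on `M` with `g_0 = g` and `f_0 = f`, where
`g_ρ` and `f_ρ` are defined at `x` for those `ρ` with `(t, x, ρ) ∈ G̃`. -/
def HasStraightNormalForm (S : SmoothMetricMeasureSpace d M) (A : MetricMeasureStructure d M) :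
    Prop :=
  ∃ (gρ : ℝ → TwoTensor (𝓡 d) M) (fρ : ℝ → M → ℝ),
    (∀ x v v', gρ 0 x v v' = S.g.inner x v v') ∧ (∀ x, fρ 0 x = S.f x) ∧
    ∀ t x ρ, (t, x, ρ) ∈ A.space →
      (∀ v v', gρ ρ x v v' = gρ ρ x v' v) ∧ (∀ v, v ≠ 0 → 0 < gρ ρ x v v) ∧
      (∀ a v c a' v' c', evalAt A.g t x ρ a v c a' v' c' =
        2 * ρ * (a * a') + t * (a * c' + a' * c) + t ^ 2 * gρ ρ x v v') ∧
      A.f (t, x, ρ) = t * fρ ρ x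

end Ambient

end WeightedAmbient

end

open WeightedAmbient

/-!
In coordinates, the geodesic equations of a straight and normal pre-ambient metric determine the
components in the directions `∂_t` and `∂_ρ`, so that the metric is `2 ρ dt² + 2 t dρ dt + t² g_ρ`
(`IsNormal.isReduced`), and the density is `t f_ρ` by homogeneity. For such a metric the components
`P_0J` of the Bakry-Émery Ricci tensor `P` vanish identically, and the other components and the scalar
`F` are explicit expressions in `g_ρ`, `f_ρ` and their derivatives (`ambRic_zero`, `ambRic_tan`,
`ambRic_rad`, `wF_amb`). The question is therefore about a system for the families `g_ρ`, `f_ρ`, which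
has a regular singular point at `ρ = 0`.

Write `n = d + m`. The tangential components and the scalar are modified by multiples of `ρ P_∞∞`
(`modTan`, `modScal`), which does not change the set of solutions. Comparing coefficients of `ρ ^ k`,
the coefficient of order `k + 1` of `(g_ρ, f_ρ)` enters through a linear map with constant coefficients
(`AgreeTo.dvd_modified`). It is invertible for `n ≠ 2 (k + 1)` (`linear_injective`, `lin_sol`), and its
weighted trace is a nonzero multiple of the weighted trace of the unknown for all `k`
(`trEqn_lin`). This gives uniqueness below the critical order (`AgreesTo.succ`, `uniqueness`) and a
formal solution, which at the critical order solves the weighted trace of the equations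
(`formal`, `formal_solves`). The components `P_i∞` and `P_∞∞` of the formal solution vanish
to the same order by the two components of the weighted contracted Bianchi identity
(`weighted_bianchi`, `dvd_of_bianchi`).

All these computations are carried out in a commutative `ℝ`-algebra with commuting derivations
`∂_i`, where a metric is an invertible symmetric matrix. They then apply both to the ring of smooth
functions on an open set of coordinates (`smoothFun`) and to power series in `ρ` over such a ring; the
two are connected by the Taylor expansion in `ρ`, a homomorphism compatible with the
derivations (`taylor`, `isExpansion_ambTaylor`).

The formal solution is computed in the preferred charts. It is natural under changes of coordinates
(`IsCoordChange.formal_pull`), hence its coefficients are tensors `coefG` and functions `coefF` on the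
manifold (`chartMatrix_coefG`, `coefF_symm`). A Borel sum turns the formal series into smooth
families; by second countability a single sequence of cutoff scales is sufficient
(`exists_isGoodScale`), so no partition of unity is needed. The ambient space consists of the points
`(t, x, ρ)` for which `g_r` is positive definite and `f_r` is positive at `x` for all `r` between
`0` and `ρ` (`ambientSpace`); it is open, dilation-invariant, straight and normal, and its curvature
vanishes to the required order since its expansion is the formal solution
(`IsGoodScale.isWeightedAmbient`).
-/

open scoped Manifold ContDiff Topology

noncomputable section

set_option linter.unusedSimpArgs false
set_option linter.unusedSectionVars false

namespace WeightedAmbient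

/-! ### Riemannian geometry over a differential ring -/

section DifferentialRing

variable {R ι : Type*} [CommRing R] [Algebra ℝ R] [Fintype ι]

/-- Christoffel symbols `Γ^k_ij` of a metric `H` with inverse `Hi`, with entries in a commutative
ring `R` on which the coordinate derivations `D i` act. -/
def chr (D : ι → Derivation ℝ R R) (H Hi : Matrix ι ι R) (k i j : ι) : R :=
  algebraMap ℝ R (1 / 2) * ∑ l, Hi k l * (D i (H j l) + D j (H i l) - D l (H i j))

/-- The Ricci tensor of the connection with symbols `Γ k i j`. -/
def ric (D : ι → Derivation ℝ R R) (Γ : ι → ι → ι → R) (i j : ι) : R :=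
  (∑ k, (D k (Γ k i j) - D j (Γ k i k)))
    + ∑ k, ∑ l, (Γ k k l * Γ l i j - Γ k j l * Γ l i k)

/-- The Hessian of `u` for the connection with symbols `Γ k i j`. -/
def hess (D : ι → Derivation ℝ R R) (Γ : ι → ι → ι → R) (u : R) (i j : ι) : R :=
  D i (D j u) - ∑ k, Γ k i j * D k u

/-- The Laplacian of `u`. -/
def lap (D : ι → Derivation ℝ R R) (H Hi : Matrix ι ι R) (u : R) : R :=
  ∑ i, ∑ j, Hi i j * hess D (chr D H Hi) u i j

/-- The squared length of the gradient of `u`. -/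
def gradSq (D : ι → Derivation ℝ R R) (Hi : Matrix ι ι R) (u : R) : R :=
  ∑ i, ∑ j, Hi i j * D i u * D j u

/-- The Bakry-Émery Ricci tensor; `fi` is the inverse of `f`. -/
def beRic (D : ι → Derivation ℝ R R) (H Hi : Matrix ι ι R) (f fi : R) (m : ℝ) (i j : ι) : R :=
  ric D (chr D H Hi) i j - algebraMap ℝ R m * fi * hess D (chr D H Hi) f i j

/-- The scalar `f Δf + (m - 1) (|∇f|² - μ)`. -/
def wF (D : ι → Derivation ℝ R R) (H Hi : Matrix ι ι R) (f : R) (m μ : ℝ) : R :=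
  f * lap D H Hi f + algebraMap ℝ R (m - 1) * (gradSq D Hi f - algebraMap ℝ R μ)

/-- A derivation applied to the entries of a matrix. -/
def dMat {κ κ' : Type*} (δ : Derivation ℝ R R) (A : Matrix κ κ' R) : Matrix κ κ' R := A.map δ

/-- The connection matrix `(Γ_a)^k_j = Γ^k_aj`. -/
def conn (Γ : ι → ι → ι → R) (a : ι) : Matrix ι ι R := Matrix.of fun k j => Γ k a j

/-- The curvature matrix `Ω_ab = ∂_a Γ_b - ∂_b Γ_a + [Γ_a, Γ_b]`. -/
def curv (D : ι → Derivation ℝ R R) (Γ : ι → ι → ι → R) (a b : ι) : Matrix ι ι R :=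
  dMat (D a) (conn Γ b) - dMat (D b) (conn Γ a) + conn Γ a * conn Γ b - conn Γ b * conn Γ a

section dMat

variable {κ κ' κ'' : Type*} (δ : Derivation ℝ R R)

@[simp] lemma dMat_apply (A : Matrix κ κ' R) (i : κ) (j : κ') : dMat δ A i j = δ (A i j) := rfl

omit [CommRing R] [Algebra ℝ R] [Fintype ι] in
@[simp] lemma conn_apply (Γ : ι → ι → ι → R) (a k j : ι) : conn Γ a k j = Γ k a j := rfl

lemma dMat_add (A B : Matrix κ κ' R) : dMat δ (A + B) = dMat δ A + dMat δ B := by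
  ext; simp

lemma dMat_sub (A B : Matrix κ κ' R) : dMat δ (A - B) = dMat δ A - dMat δ B := by
  ext; simp

lemma dMat_transpose (A : Matrix κ κ' R) : dMat δ A.transpose = (dMat δ A).transpose := by
  ext; simp

lemma dMat_mul [Fintype κ'] (A : Matrix κ κ' R) (B : Matrix κ' κ'' R) :
    dMat δ (A * B) = dMat δ A * B + A * dMat δ B := by
  ext i j
  simp only [dMat_apply, Matrix.mul_apply, map_sum, Derivation.leibniz, smul_eq_mul,
    Matrix.add_apply, ← Finset.sum_add_distrib]
  exact Finset.sum_congr rfl fun l _ => by ring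

lemma dMat_one [DecidableEq κ] : dMat δ (1 : Matrix κ κ R) = 0 := by
  ext i j
  by_cases h : i = j <;> simp [h]

lemma dMat_trace [Fintype κ] (A : Matrix κ κ R) : δ A.trace = (dMat δ A).trace := by
  simp [Matrix.trace]

end dMat

lemma half_mul_two : algebraMap ℝ R (1 / 2) * 2 = 1 := by
  rw [← map_ofNat (algebraMap ℝ R) 2, ← map_mul]; norm_num

lemma half_add_half (x : R) : algebraMap ℝ R (1 / 2) * (x + x) = x := by
  linear_combination x * half_mul_two (R := R)

variable {D : ι → Derivation ℝ R R} {H Hi : Matrix ι ι R}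

lemma chr_symm (hH : H.IsSymm) (k i j : ι) : chr D H Hi k i j = chr D H Hi k j i := by
  unfold chr
  congr 1
  refine Finset.sum_congr rfl fun l _ => ?_
  rw [hH.apply i j]
  ring

variable [DecidableEq ι]

/-- Lowering the upper index of the Christoffel symbols. -/
lemma sum_mul_chr (h : H * Hi = 1) (l i j : ι) :
    ∑ k, H l k * chr D H Hi k i j
      = algebraMap ℝ R (1 / 2) * (D i (H j l) + D j (H i l) - D l (H i j)) := by
  set v : ι → R := fun l => D i (H j l) + D j (H i l) - D l (H i j) with hv
  have h1 : H.mulVec (Hi.mulVec v) = v := by rw [Matrix.mulVec_mulVec, h, Matrix.one_mulVec]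
  have h2 := congrFun h1 l
  simp only [Matrix.mulVec, dotProduct] at h2
  change _ = algebraMap ℝ R (1 / 2) * v l
  rw [← h2, Finset.mul_sum]
  refine Finset.sum_congr rfl fun k _ => ?_
  unfold chr
  simp only [hv]
  ring

/-- The Levi-Civita connection is metric. -/
lemma dMat_metric (hH : H.IsSymm) (h : H * Hi = 1) (a : ι) :
    dMat (D a) H = (conn (chr D H Hi) a).transpose * H + H * conn (chr D H Hi) a := by
  ext i j
  have e1 : ((conn (chr D H Hi) a).transpose * H) i j = ∑ k, H j k * chr D H Hi k a i := by
    simp only [Matrix.mul_apply, Matrix.transpose_apply, conn_apply]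
    exact Finset.sum_congr rfl fun k _ => by rw [hH.apply j k]; ring
  have e2 : (H * conn (chr D H Hi) a) i j = ∑ k, H i k * chr D H Hi k a j := by
    simp only [Matrix.mul_apply, conn_apply]
  rw [Matrix.add_apply, e1, e2, sum_mul_chr h, sum_mul_chr h, dMat_apply]
  rw [hH.apply i j, hH.apply j a, hH.apply i a]
  linear_combination -(D a (H i j)) * half_mul_two (R := R)

lemma dMat_metric_inv (hH : H.IsSymm) (h : H * Hi = 1) (a : ι) :
    dMat (D a) Hi = -(Hi * (conn (chr D H Hi) a).transpose) - conn (chr D H Hi) a * Hi := by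
  have h' : Hi * H = 1 := mul_eq_one_comm.mp h
  have h0 : dMat (D a) H * Hi + H * dMat (D a) Hi = 0 := by rw [← dMat_mul, h, dMat_one]
  have h1 : Hi * (dMat (D a) H * Hi + H * dMat (D a) Hi) = 0 := by rw [h0, Matrix.mul_zero]
  rw [Matrix.mul_add, ← Matrix.mul_assoc Hi H, h', Matrix.one_mul, dMat_metric hH h a] at h1
  rw [eq_neg_of_add_eq_zero_right h1]
  rw [Matrix.add_mul, Matrix.mul_assoc, h, Matrix.mul_one, Matrix.mul_add, ← Matrix.mul_assoc,
    ← Matrix.mul_assoc, h', Matrix.one_mul]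
  abel

omit [Algebra ℝ R] in
lemma isSymm_inv (hH : H.IsSymm) (h : H * Hi = 1) : Hi.IsSymm := by
  have h' : Hi * H = 1 := mul_eq_one_comm.mp h
  have : Hi.transpose * H = 1 := by
    have := congrArg Matrix.transpose h
    rw [Matrix.transpose_mul, hH.eq, Matrix.transpose_one] at this
    exact this
  calc Hi.transpose = Hi.transpose * (H * Hi) := by rw [h, Matrix.mul_one]
    _ = Hi := by rw [← Matrix.mul_assoc, this, Matrix.one_mul]

/-- A connection matrix as a family of covariant derivatives: the second Bianchi identity. -/
lemma second_bianchi (hD : ∀ i j x, D i (D j x) = D j (D i x)) (Γ : ι → ι → ι → R) (a b c : ι) :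
    (dMat (D a) (curv D Γ b c) + conn Γ a * curv D Γ b c - curv D Γ b c * conn Γ a)
    + (dMat (D b) (curv D Γ c a) + conn Γ b * curv D Γ c a - curv D Γ c a * conn Γ b)
    + (dMat (D c) (curv D Γ a b) + conn Γ c * curv D Γ a b - curv D Γ a b * conn Γ c) = 0 := by
  have hc : ∀ i j (A : Matrix ι ι R), dMat (D i) (dMat (D j) A) = dMat (D j) (dMat (D i) A) :=
    fun i j A => by ext; simp [hD i j]
  simp only [curv, dMat_add, dMat_sub, dMat_mul]
  rw [hc b a (conn Γ c), hc c a (conn Γ b), hc c b (conn Γ a)]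
  noncomm_ring

omit [DecidableEq ι] in
lemma ric_eq_curv (Γ : ι → ι → ι → R) (hΓ : ∀ k i j, Γ k i j = Γ k j i) (i j : ι) :
    ric D Γ i j = ∑ k, curv D Γ k j k i := by
  rw [ric, ← Finset.sum_add_distrib]
  refine Finset.sum_congr rfl fun k _ => ?_
  simp only [curv, Matrix.add_apply, Matrix.sub_apply, dMat_apply, conn_apply, Matrix.mul_apply,
    Finset.sum_sub_distrib]
  have e1 : ∀ b c, ∑ l, Γ k b l * Γ l i c = ∑ l, Γ k b l * Γ l c i :=
    fun b c => Finset.sum_congr rfl fun l _ => by rw [hΓ l i c]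
  rw [hΓ k i j, hΓ k i k, e1, e1]
  ring

omit [DecidableEq ι] in
lemma curv_anti (Γ : ι → ι → ι → R) (a b : ι) : curv D Γ a b = -curv D Γ b a := by
  simp only [curv]; abel

lemma curv_metric (hD : ∀ i j x, D i (D j x) = D j (D i x)) (hH : H.IsSymm) (h : H * Hi = 1)
    (a b : ι) :
    (curv D (chr D H Hi) a b).transpose * H + H * curv D (chr D H Hi) a b = 0 := by
  have hc : dMat (D a) (dMat (D b) H) = dMat (D b) (dMat (D a) H) := by
    ext; simp [hD a b]
  rw [dMat_metric hH h b, dMat_metric hH h a] at hc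
  simp only [dMat_add, dMat_mul, dMat_transpose, dMat_metric hH h] at hc
  rw [← sub_eq_zero] at hc
  rw [← hc]
  simp only [curv, Matrix.transpose_add, Matrix.transpose_sub, Matrix.transpose_mul]
  noncomm_ring

/-- The curvature with both matrix indices raised is skew. -/
lemma curv_mul_inv_skew (hD : ∀ i j x, D i (D j x) = D j (D i x)) (hH : H.IsSymm) (h : H * Hi = 1)
    (a b : ι) : (curv D (chr D H Hi) a b * Hi).transpose = -(curv D (chr D H Hi) a b * Hi) := by
  have h' : Hi * H = 1 := mul_eq_one_comm.mp h
  have h1 := curv_metric hD hH h a b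
  set Ω := curv D (chr D H Hi) a b
  have h2 : Hi * (Ω.transpose * H + H * Ω) * Hi = 0 := by rw [h1]; simp
  rw [Matrix.mul_add, Matrix.add_mul, ← Matrix.mul_assoc, Matrix.mul_assoc _ H Hi, h,
    Matrix.mul_one, ← Matrix.mul_assoc, h', Matrix.one_mul] at h2
  rw [Matrix.transpose_mul, (isSymm_inv hH h).eq]
  exact eq_neg_of_add_eq_zero_left h2

lemma ric_symm (hD : ∀ i j x, D i (D j x) = D j (D i x)) (hH : H.IsSymm) (h : H * Hi = 1)
    (i j : ι) : ric D (chr D H Hi) i j = ric D (chr D H Hi) j i := by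
  have hΓ := chr_symm (D := D) (Hi := Hi) hH
  set Γ := chr D H Hi with hΓd
  -- the first Bianchi identity
  have hb : ∀ k, curv D Γ k j k i + curv D Γ j i k k + curv D Γ i k k j = 0 := by
    intro k
    simp only [curv, Matrix.add_apply, Matrix.sub_apply, dMat_apply, conn_apply, Matrix.mul_apply]
    rw [hΓ k j i, hΓ k k i, hΓ k k j]
    have e : ∀ a b c : ι, ∑ x, Γ k a x * Γ x b c = ∑ x, Γ k a x * Γ x c b :=
      fun a b c => Finset.sum_congr rfl fun x _ => by rw [hΓ x b c]
    rw [e k j i, e j k i, e i k j]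
    ring
  have htr : (curv D Γ j i).trace = 0 := by
    have hs := curv_mul_inv_skew hD hH h j i
    have h' : Hi * H = 1 := mul_eq_one_comm.mp h
    have e1 : curv D Γ j i = (curv D Γ j i * Hi) * H := by
      rw [Matrix.mul_assoc, h', Matrix.mul_one]
    have e2 : (curv D Γ j i).trace = -(curv D Γ j i).trace := by
      conv_lhs => rw [e1, ← Matrix.trace_transpose, Matrix.transpose_mul, hs, hH.eq,
        Matrix.trace_mul_comm, Matrix.neg_mul, Matrix.trace_neg, ← e1]
    have e3 : algebraMap ℝ R (1 / 2) * ((curv D Γ j i).trace + (curv D Γ j i).trace) = 0 := by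
      nth_rewrite 1 [e2]; simp
    rwa [half_add_half] at e3
  rw [ric_eq_curv Γ hΓ, ric_eq_curv Γ hΓ]
  have := Finset.sum_congr rfl fun k (_ : k ∈ Finset.univ) => hb k
  simp only [Finset.sum_add_distrib, Finset.sum_const_zero] at this
  have e4 : ∑ k, curv D Γ j i k k = 0 := htr
  have e5 : ∑ k, curv D Γ i k k j = -∑ k, curv D Γ k i k j := by
    rw [← Finset.sum_neg_distrib]
    exact Finset.sum_congr rfl fun k _ => by rw [curv_anti Γ i k]; rfl
  rw [e4, e5] at this
  linear_combination this

/-- `2 div S - d (tr S)` for a symmetric two-tensor `S`, in the form in which the Christoffel symbols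
enter only through the contraction `H^{ab} Γ^l_ab`. -/
def divForm (D : ι → Derivation ℝ R R) (Hi : Matrix ι ι R) (Γ : ι → ι → ι → R)
    (S : Matrix ι ι R) (c : ι) : R :=
  ∑ a, ∑ b, Hi a b * (2 * D a (S b c) - D c (S a b) - 2 * ∑ l, Γ l a b * S l c)

/-- `2 div S - d (tr S)` in terms of the tensor `S^a_c` with one index raised. -/
lemma divForm_eq_mixed (hH : H.IsSymm) (h : H * Hi = 1) (S : Matrix ι ι R) (hS : S.IsSymm)
    (c : ι) :
    divForm D Hi (chr D H Hi) S c =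
      2 * ∑ a, D a ((Hi * S) a c) + 2 * ∑ a, (conn (chr D H Hi) a * (Hi * S)) a c
        - 2 * (conn (chr D H Hi) c * (Hi * S)).trace - D c (Hi * S).trace := by
  set Γ := chr D H Hi with hΓ
  have hi := isSymm_inv hH h
  have e1 : D c (Hi * S).trace
      = -(2 * (conn Γ c * (Hi * S)).trace) + (Hi * dMat (D c) S).trace := by
    rw [dMat_trace, dMat_mul, dMat_metric_inv hH h c, ← hΓ, Matrix.sub_mul, Matrix.neg_mul,
      Matrix.trace_add, Matrix.trace_sub, Matrix.trace_neg]
    have : (Hi * (conn Γ c).transpose * S).trace = (conn Γ c * (Hi * S)).trace := by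
      rw [← Matrix.trace_transpose, Matrix.transpose_mul, Matrix.transpose_mul,
        Matrix.transpose_transpose, hS.eq, hi.eq, Matrix.trace_mul_comm, Matrix.mul_assoc]
    rw [this, Matrix.mul_assoc]
    ring
  have e2 : ∑ a, D a ((Hi * S) a c) = -(∑ a, (Hi * (conn Γ a).transpose * S) a c)
      - ∑ a, (conn Γ a * (Hi * S)) a c + ∑ a, (Hi * dMat (D a) S) a c := by
    rw [← Finset.sum_neg_distrib, ← Finset.sum_sub_distrib, ← Finset.sum_add_distrib]
    refine Finset.sum_congr rfl fun a _ => ?_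
    rw [← dMat_apply (D a), dMat_mul, dMat_metric_inv hH h a, ← hΓ, Matrix.sub_mul, Matrix.neg_mul,
      Matrix.mul_assoc (conn Γ a)]
    rfl
  rw [e1, e2]
  have e3 : ∑ a, (Hi * (conn Γ a).transpose * S) a c
      = ∑ a, ∑ b, Hi a b * ∑ l, Γ l a b * S l c := by
    refine Finset.sum_congr rfl fun a _ => ?_
    rw [Matrix.mul_assoc]
    simp [Matrix.mul_apply]
  have e4 : ∑ a, (Hi * dMat (D a) S) a c = ∑ a, ∑ b, Hi a b * D a (S b c) := by
    simp [Matrix.mul_apply]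
  have e5 : (Hi * dMat (D c) S).trace = ∑ a, ∑ b, Hi a b * D c (S a b) := by
    simp only [Matrix.trace, Matrix.diag_apply, Matrix.mul_apply, dMat_apply]
    exact Finset.sum_congr rfl fun a _ => Finset.sum_congr rfl fun b _ => by rw [hS.apply a b]
  rw [e3, e4, e5]
  simp only [divForm, mul_sub, Finset.sum_sub_distrib]
  have e6 : ∀ X : ι → ι → R, ∑ a, ∑ b, Hi a b * (2 * X a b) = 2 * ∑ a, ∑ b, Hi a b * X a b := by
    intro X
    simp only [Finset.mul_sum]
    exact Finset.sum_congr rfl fun a _ => Finset.sum_congr rfl fun b _ => by ring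
  rw [e6 (fun a b => D a (S b c)), e6 (fun a b => ∑ l, Γ l a b * S l c)]
  ring

/-- The contracted second Bianchi identity `2 div Ric = d Scal`. -/
theorem divForm_ric (hD : ∀ i j x, D i (D j x) = D j (D i x)) (hH : H.IsSymm) (h : H * Hi = 1)
    (c : ι) :
    divForm D Hi (chr D H Hi) (Matrix.of (ric D (chr D H Hi))) c = 0 := by
  have hS : (Matrix.of (ric D (chr D H Hi))).IsSymm :=
    Matrix.IsSymm.ext fun i j => ric_symm hD hH h j i
  rw [divForm_eq_mixed hH h _ hS]
  have hΓ := chr_symm (D := D) (Hi := Hi) hH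
  have hi := isSymm_inv hH h
  have hskew := curv_mul_inv_skew hD hH h
  set Γ := chr D H Hi with hΓd
  set Q : ι → ι → Matrix ι ι R := fun a b => curv D Γ a b * Hi with hQ
  set r : Matrix ι ι R := Hi * Matrix.of (ric D Γ) with hr
  have qskew : ∀ a b k l, Q a b k l = -Q a b l k := fun a b k l => by
    have := congrFun (congrFun (hskew a b) l) k
    simpa [hQ] using this
  have qanti : ∀ a b k l, Q a b k l = -Q b a k l := fun a b k l => by
    simp only [hQ]; rw [curv_anti Γ a b]; simp
  -- the second Bianchi identity with an index raised
  have hB : ∀ a b c, (dMat (D a) (Q b c) + conn Γ a * Q b c + Q b c * (conn Γ a).transpose)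
      + (dMat (D b) (Q c a) + conn Γ b * Q c a + Q c a * (conn Γ b).transpose)
      + (dMat (D c) (Q a b) + conn Γ c * Q a b + Q a b * (conn Γ c).transpose) = 0 := by
    intro a b c
    have h1 := second_bianchi hD Γ a b c
    have h2 : ∀ a b c, dMat (D a) (Q b c) + conn Γ a * Q b c + Q b c * (conn Γ a).transpose
        = (dMat (D a) (curv D Γ b c) + conn Γ a * curv D Γ b c - curv D Γ b c * conn Γ a) * Hi := by
      intro a b c
      simp only [hQ, dMat_mul, dMat_metric_inv hH h a, ← hΓd]
      noncomm_ring
    rw [h2, h2, h2, ← Matrix.add_mul, ← Matrix.add_mul, h1, Matrix.zero_mul]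
  have hr1 : ∀ b c, ∑ a, Q a c a b = r b c := by
    intro b c
    simp only [hQ, hr, Matrix.mul_apply, Matrix.of_apply]
    rw [Finset.sum_comm]
    refine Finset.sum_congr rfl fun k _ => ?_
    rw [ric_eq_curv Γ hΓ, ← Finset.sum_mul, hi.apply k b]
    ring
  have hr2 : ∀ a c, ∑ b, Q b c a b = -r a c := by
    intro a c
    rw [← hr1, ← Finset.sum_neg_distrib]
    exact Finset.sum_congr rfl fun b _ => qskew _ _ _ _
  have hr3 : ∀ b c, ∑ a, Q c a a b = -r b c := by
    intro b c
    rw [← hr1, ← Finset.sum_neg_distrib]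
    exact Finset.sum_congr rfl fun b _ => qanti _ _ _ _
  have hr4 : ∀ p a, ∑ b, Q a b p b = r p a := by
    intro p a
    rw [← hr1]
    exact Finset.sum_congr rfl fun b _ => by rw [qanti, qskew]; ring
  have hsum : ∑ a, ∑ b, ((dMat (D a) (Q b c) + conn Γ a * Q b c + Q b c * (conn Γ a).transpose)
      + (dMat (D b) (Q c a) + conn Γ b * Q c a + Q c a * (conn Γ b).transpose)
      + (dMat (D c) (Q a b) + conn Γ c * Q a b + Q a b * (conn Γ c).transpose)) a b = 0 := by
    exact Finset.sum_eq_zero fun a _ => Finset.sum_eq_zero fun b _ => by rw [hB]; rfl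
  simp only [Matrix.add_apply, Finset.sum_add_distrib] at hsum
  -- the contractions of the nine terms
  have t1 : ∑ a, ∑ b, dMat (D a) (Q b c) a b = -∑ a, D a (r a c) := by
    rw [← Finset.sum_neg_distrib]
    refine Finset.sum_congr rfl fun a _ => ?_
    rw [← map_neg, ← hr2, map_sum]; rfl
  have t2 : ∑ a, ∑ b, (conn Γ a * Q b c) a b = -∑ a, (conn Γ a * r) a c := by
    rw [← Finset.sum_neg_distrib]
    refine Finset.sum_congr rfl fun a _ => ?_
    simp only [Matrix.mul_apply]
    rw [Finset.sum_comm, ← Finset.sum_neg_distrib]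
    refine Finset.sum_congr rfl fun p _ => ?_
    rw [← Finset.mul_sum, hr2]; ring
  have skew_sym : ∀ (q s : ι → ι → R), (∀ a b, q a b = -q b a) → (∀ a b, s a b = s b a) →
      ∑ a, ∑ p, q a p * s a p = 0 := by
    intro q s hq hs
    have e : ∑ a, ∑ p, q a p * s a p = -∑ a, ∑ p, q a p * s a p := by
      conv_lhs => rw [Finset.sum_comm]
      simp only [← Finset.sum_neg_distrib]
      refine Finset.sum_congr rfl fun a _ => Finset.sum_congr rfl fun b _ => ?_
      rw [hq b a, hs b a]; ring
    have e3 : algebraMap ℝ R (1 / 2) * ((∑ a, ∑ p, q a p * s a p) + ∑ a, ∑ p, q a p * s a p) = 0 := by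
      nth_rewrite 1 [e]; simp
    rwa [half_add_half] at e3
  have t3 : ∑ a, ∑ b, (Q b c * (conn Γ a).transpose) a b = 0 := by
    simp only [Matrix.mul_apply, Matrix.transpose_apply, conn_apply]
    rw [Finset.sum_comm]
    exact Finset.sum_eq_zero fun b _ => skew_sym _ (fun a p => Γ b a p) (fun a p => qskew b c a p)
      fun a p => hΓ _ _ _
  have t4 : ∑ a, ∑ b, dMat (D b) (Q c a) a b = -∑ a, D a (r a c) := by
    rw [Finset.sum_comm, ← Finset.sum_neg_distrib]
    refine Finset.sum_congr rfl fun a _ => ?_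
    rw [← map_neg, ← hr3, map_sum]; rfl
  have t5 : ∑ a, ∑ b, (conn Γ b * Q c a) a b = 0 := by
    simp only [Matrix.mul_apply, conn_apply]
    refine Finset.sum_eq_zero fun a _ => ?_
    have := skew_sym (fun b p => Q c a p b) (fun b p => Γ a b p) (fun b p => qskew c a p b)
      fun b p => hΓ _ _ _
    rw [← this]
    exact Finset.sum_congr rfl fun b _ => Finset.sum_congr rfl fun p _ => by ring
  have t6 : ∑ a, ∑ b, (Q c a * (conn Γ b).transpose) a b = -∑ b, (conn Γ b * r) b c := by
    rw [Finset.sum_comm, ← Finset.sum_neg_distrib]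
    refine Finset.sum_congr rfl fun b _ => ?_
    simp only [Matrix.mul_apply, Matrix.transpose_apply, conn_apply]
    rw [Finset.sum_comm, ← Finset.sum_neg_distrib]
    refine Finset.sum_congr rfl fun p _ => ?_
    rw [← Finset.sum_mul, hr3]; ring
  have t7 : ∑ a, ∑ b, dMat (D c) (Q a b) a b = D c r.trace := by
    simp only [Matrix.trace, Matrix.diag_apply, map_sum]
    refine Finset.sum_congr rfl fun a _ => ?_
    rw [← hr4, map_sum]; rfl
  have t8 : ∑ a, ∑ b, (conn Γ c * Q a b) a b = (conn Γ c * r).trace := by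
    simp only [Matrix.trace, Matrix.diag_apply, Matrix.mul_apply, conn_apply]
    refine Finset.sum_congr rfl fun a _ => ?_
    rw [Finset.sum_comm]
    refine Finset.sum_congr rfl fun p _ => ?_
    rw [← Finset.mul_sum, hr4]
  have t9 : ∑ a, ∑ b, (Q a b * (conn Γ c).transpose) a b = (conn Γ c * r).trace := by
    simp only [Matrix.trace, Matrix.diag_apply, Matrix.mul_apply, Matrix.transpose_apply,
      conn_apply]
    rw [Finset.sum_comm]
    refine Finset.sum_congr rfl fun b _ => ?_
    rw [Finset.sum_comm]
    refine Finset.sum_congr rfl fun p _ => ?_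
    rw [← Finset.sum_mul, hr1]; ring
  rw [t1, t2, t3, t4, t5, t6, t7, t8, t9] at hsum
  linear_combination -hsum

end DifferentialRing

section WeightedBianchi

variable {R ι : Type*} [CommRing R] [Algebra ℝ R] [Fintype ι] [DecidableEq ι]
  {D : ι → Derivation ℝ R R} {H Hi : Matrix ι ι R}

omit [DecidableEq ι] in
lemma hess_symm (hD : ∀ i j x, D i (D j x) = D j (D i x)) (hH : H.IsSymm) (u : R) (i j : ι) :
    hess D (chr D H Hi) u i j = hess D (chr D H Hi) u j i := by
  unfold hess
  rw [hD i j]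
  congr 1
  exact Finset.sum_congr rfl fun k _ => by rw [chr_symm hH k i j]

/-- The gradient of `u`, with upper index. -/
def grad (D : ι → Derivation ℝ R R) (Hi : Matrix ι ι R) (u : R) (a : ι) : R :=
  ∑ b, Hi a b * D b u

/-- The covariant derivative of the gradient is the Hessian with an index raised. -/
lemma deriv_grad (hD : ∀ i j x, D i (D j x) = D j (D i x)) (hH : H.IsSymm) (h : H * Hi = 1) (u : R) (a k : ι) :
    D a (grad D Hi u k) + ∑ p, chr D H Hi k a p * grad D Hi u p
      = (Hi * Matrix.of (hess D (chr D H Hi) u)) k a := by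
  set Γ := chr D H Hi with hΓ
  have e1 : D a (grad D Hi u k) = ∑ b, dMat (D a) Hi k b * D b u + ∑ b, Hi k b * D a (D b u) := by
    simp only [grad, map_sum, Derivation.leibniz, smul_eq_mul, dMat_apply, ← Finset.sum_add_distrib]
    exact Finset.sum_congr rfl fun b _ => by ring
  have e2 : ∑ b, dMat (D a) Hi k b * D b u
      = -(∑ b, ∑ l, Hi k b * (Γ l a b * D l u)) - ∑ p, Γ k a p * grad D Hi u p := by
    rw [dMat_metric_inv hH h a, ← hΓ]
    simp only [grad, Matrix.sub_apply, Matrix.neg_apply, Matrix.mul_apply, Matrix.transpose_apply,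
      conn_apply, sub_mul, neg_mul, Finset.sum_sub_distrib, Finset.sum_neg_distrib, Finset.sum_mul,
      Finset.mul_sum]
    congr 1
    · congr 1
      rw [Finset.sum_comm]
      exact Finset.sum_congr rfl fun b _ => Finset.sum_congr rfl fun l _ => by ring
    · rw [Finset.sum_comm]
      exact Finset.sum_congr rfl fun b _ => Finset.sum_congr rfl fun l _ => by ring
  have e3 : ∀ j, hess D Γ u j a = D a (D j u) - ∑ l, Γ l a j * D l u := fun j => by
    rw [hΓ, hess_symm hD hH u j a]; rfl
  rw [e1, e2, Matrix.mul_apply]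
  simp only [Matrix.of_apply, e3, mul_sub, Finset.sum_sub_distrib, Finset.mul_sum]
  ring

omit [DecidableEq ι] in
lemma lap_eq_trace (hD : ∀ i j x, D i (D j x) = D j (D i x)) (hH : H.IsSymm) (u : R) :
    lap D H Hi u = (Hi * Matrix.of (hess D (chr D H Hi) u)).trace := by
  simp only [lap, Matrix.trace, Matrix.diag_apply, Matrix.mul_apply, Matrix.of_apply]
  exact Finset.sum_congr rfl fun i _ => Finset.sum_congr rfl fun j _ => by
    rw [hess_symm hD hH u i j]

/-- The divergence of the Hessian, from the Ricci identity. -/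
lemma divForm_hess (hD : ∀ i j x, D i (D j x) = D j (D i x)) (hH : H.IsSymm) (h : H * Hi = 1)
    (u : R) (c : ι) :
    divForm D Hi (chr D H Hi) (Matrix.of (hess D (chr D H Hi) u)) c
      = D c (lap D H Hi u) + 2 * ∑ l, ric D (chr D H Hi) l c * grad D Hi u l := by
  have hΓ := chr_symm (D := D) (Hi := Hi) hH
  have hUs : (Matrix.of (hess D (chr D H Hi) u)).IsSymm :=
    Matrix.IsSymm.ext fun i j => hess_symm hD hH u j i
  rw [divForm_eq_mixed hH h _ hUs, lap_eq_trace hD hH]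
  have hN := fun a k => (deriv_grad hD hH h u a k).symm
  set Γ := chr D H Hi with hΓd
  set N := Hi * Matrix.of (hess D Γ u) with hNd
  set v : Matrix ι Unit R := Matrix.of fun k _ => grad D Hi u k with hv
  have hcol : ∀ a, (Matrix.of fun k (_ : Unit) => N k a) = dMat (D a) v + conn Γ a * v := by
    intro a
    ext k x
    simp [hN, hv, Matrix.mul_apply]
  have key : ∀ a, dMat (D a) (dMat (D c) v + conn Γ c * v)
        + conn Γ a * (dMat (D c) v + conn Γ c * v)
      - (dMat (D c) (dMat (D a) v + conn Γ a * v) + conn Γ c * (dMat (D a) v + conn Γ a * v))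
      = curv D Γ a c * v := by
    intro a
    have hc : dMat (D a) (dMat (D c) v) = dMat (D c) (dMat (D a) v) := by ext; simp [hD a c]
    simp only [curv, dMat_add, dMat_mul, Matrix.mul_add, Matrix.add_mul, Matrix.sub_mul,
      Matrix.mul_assoc, hc]
    abel
  have key2 : ∀ a, D a (N a c) + (conn Γ a * N) a c - (D c (N a a) + (conn Γ c * N) a a)
      = ∑ l, curv D Γ a c a l * grad D Hi u l := by
    intro a
    have := congrFun (congrFun (key a) a) ()
    rw [← hcol, ← hcol] at this
    simpa [Matrix.mul_apply, hv] using this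
  have key3 := Finset.sum_congr rfl fun a (_ : a ∈ Finset.univ) => key2 a
  rw [Finset.sum_comm] at key3
  have e : ∀ l, ∑ a, curv D Γ a c a l * grad D Hi u l = ric D Γ l c * grad D Hi u l := fun l => by
    rw [← Finset.sum_mul, ric_eq_curv Γ hΓ]
  simp only [e, Finset.sum_add_distrib, Finset.sum_sub_distrib] at key3
  have e2 : ∑ a, (conn Γ c * N) a a = (conn Γ c * N).trace := rfl
  have e3 : ∑ a, D c (N a a) = D c N.trace := by simp [Matrix.trace]
  rw [e2, e3] at key3
  linear_combination 2 * key3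

lemma deriv_gradSq (hD : ∀ i j x, D i (D j x) = D j (D i x)) (hH : H.IsSymm) (h : H * Hi = 1)
    (u : R) (c : ι) :
    D c (gradSq D Hi u) = 2 * ∑ a, grad D Hi u a * hess D (chr D H Hi) u a c := by
  have hN := fun a k => deriv_grad hD hH h u a k
  have hs := hess_symm (Hi := Hi) hD hH u
  have hi := isSymm_inv hH h
  set Γ := chr D H Hi with hΓd
  have e0 : gradSq D Hi u = ∑ k, grad D Hi u k * D k u := by
    simp only [gradSq, grad, Finset.sum_mul]
    rw [Finset.sum_comm]
    exact Finset.sum_congr rfl fun i _ => Finset.sum_congr rfl fun j _ => by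
      rw [hi.apply i j]
  have e1 : ∀ k, D c (grad D Hi u k)
      = (Hi * Matrix.of (hess D Γ u)) k c - ∑ p, Γ k c p * grad D Hi u p := fun k => by
    rw [← hN]; ring
  have e2 : ∀ k, D c (D k u) = hess D Γ u k c + ∑ l, Γ l c k * D l u := fun k => by
    rw [hs k c, hess]; ring
  simp only [e0, map_sum, Derivation.leibniz, smul_eq_mul, e1, e2, Finset.sum_add_distrib,
    mul_add, mul_sub, Finset.sum_sub_distrib]
  have e3 : ∑ k, grad D Hi u k * ∑ l, Γ l c k * D l u
      = ∑ k, D k u * ∑ p, Γ k c p * grad D Hi u p := by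
    simp only [Finset.mul_sum]
    rw [Finset.sum_comm]
    exact Finset.sum_congr rfl fun i _ => Finset.sum_congr rfl fun j _ => by ring
  have e4 : ∑ k, D k u * (Hi * Matrix.of (hess D Γ u)) k c
      = ∑ a, grad D Hi u a * hess D Γ u a c := by
    simp only [Matrix.mul_apply, grad, Finset.mul_sum, Finset.sum_mul, Matrix.of_apply]
    rw [Finset.sum_comm]
    exact Finset.sum_congr rfl fun i _ => Finset.sum_congr rfl fun j _ => by
      rw [hi.apply i j]; ring
  rw [e3, e4]
  ring

/-- The weighted contracted Bianchi identity, for the Bakry-Émery Ricci tensor and the scalar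
`F = f Δf + (m - 1) (|∇f|² - μ)`. For integral `m` it is the contracted Bianchi identity of the warped
product with an Einstein manifold of dimension `m`. -/
theorem weighted_bianchi (hD : ∀ i j x, D i (D j x) = D j (D i x)) (hH : H.IsSymm)
    (h : H * Hi = 1) (f fi : R) (hf : f * fi = 1) (m μ : ℝ) (c : ι) :
    divForm D Hi (chr D H Hi) (Matrix.of (beRic D H Hi f fi m)) c
      + 2 * algebraMap ℝ R m * fi * ∑ a, grad D Hi f a * beRic D H Hi f fi m a c
      + algebraMap ℝ R m * fi ^ 2 * D c (wF D H Hi f m μ) = 0 := by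
  have hR := divForm_ric hD hH h c
  have hU := divForm_hess hD hH h f c
  have hG := deriv_gradSq hD hH h f c
  have hfi : ∀ a, D a fi = -(fi ^ 2 * D a f) := by
    intro a
    have h1 := congrArg (D a) hf
    simp only [Derivation.leibniz, smul_eq_mul, Derivation.map_one_eq_zero] at h1
    linear_combination fi * h1 - D a fi * hf
  set Γ := chr D H Hi with hΓd
  set φ := algebraMap ℝ R m with hφ
  have e1 : divForm D Hi Γ (Matrix.of (beRic D H Hi f fi m)) c
      = divForm D Hi Γ (Matrix.of (ric D Γ)) c
        - φ * fi * divForm D Hi Γ (Matrix.of (hess D Γ f)) c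
        + 2 * φ * fi ^ 2 * ∑ a, grad D Hi f a * hess D Γ f a c
        - φ * fi ^ 2 * D c f * lap D H Hi f := by
    have e0 : ∑ a, grad D Hi f a * hess D Γ f a c
        = ∑ a, ∑ b, Hi a b * D a f * hess D Γ f b c := by
      simp only [grad, Finset.sum_mul]
      rw [Finset.sum_comm]
      exact Finset.sum_congr rfl fun i _ => Finset.sum_congr rfl fun j _ => by
        rw [(isSymm_inv hH h).apply i j]
    rw [e0]
    simp only [divForm, lap, Finset.mul_sum, ← Finset.sum_add_distrib, ← Finset.sum_sub_distrib]
    refine Finset.sum_congr rfl fun a _ => Finset.sum_congr rfl fun b _ => ?_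
    simp only [Matrix.of_apply, beRic, ← hΓd, ← hφ, map_sub, Derivation.leibniz, smul_eq_mul, hfi]
    have e2 : ∑ l, 2 * (Γ l a b * (ric D Γ l c - φ * fi * hess D Γ f l c))
        = ∑ l, 2 * (Γ l a b * ric D Γ l c) - φ * fi * ∑ l, 2 * (Γ l a b * hess D Γ f l c) := by
      rw [Finset.mul_sum, ← Finset.sum_sub_distrib]
      exact Finset.sum_congr rfl fun l _ => by ring
    rw [e2, hφ, Derivation.map_algebraMap, Derivation.map_algebraMap]
    ring
  have e2 : ∑ a, grad D Hi f a * beRic D H Hi f fi m a c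
      = ∑ l, ric D Γ l c * grad D Hi f l - φ * fi * ∑ a, grad D Hi f a * hess D Γ f a c := by
    rw [Finset.mul_sum, ← Finset.sum_sub_distrib]
    exact Finset.sum_congr rfl fun l _ => by rw [beRic]; ring
  have e3 : D c (wF D H Hi f m μ) = D c f * lap D H Hi f + f * D c (lap D H Hi f)
      + (φ - 1) * D c (gradSq D Hi f) := by
    simp only [wF, map_add, map_sub, Derivation.leibniz, smul_eq_mul, Derivation.map_algebraMap,
      map_one, Derivation.map_one_eq_zero, ← hφ]
    rw [hφ, Derivation.map_algebraMap]
    ring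
  rw [e1, hR, hU, e2, e3, hG]
  linear_combination φ * fi * D c (lap D H Hi f) * hf

end WeightedBianchi

/-! ### The curvature of a metric in straight and normal form -/

section NormalForm

variable {R κ : Type*} [CommRing R] [Algebra ℝ R] [Fintype κ]

/-- The weighted trace `τ = g^{kl} g'_kl + 2 m f' / f` of the first derivative of `(g_ρ, f_ρ)`. -/
def wTrace (δ : Derivation ℝ R R) (g gi : Matrix κ κ R) (f fi : R) (m : ℝ) : R :=
  ∑ k, ∑ l, gi k l * δ (g k l) + 2 * algebraMap ℝ R m * fi * δ f

/-- The tangential components of the Bakry-Émery Ricci tensor of `2 ρ dt² + 2 t dρ dt + t² g_ρ` and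
`t f_ρ`, where `δ = ∂_ρ`. -/
def tanRic (D : κ → Derivation ℝ R R) (δ : Derivation ℝ R R) (ρ : R) (g gi : Matrix κ κ R)
    (f fi : R) (m : ℝ) (i j : κ) : R :=
  ρ * δ (δ (g i j)) - ρ * ∑ k, ∑ l, δ (g i k) * gi k l * δ (g l j)
    + algebraMap ℝ R (1 / 2) * ρ * wTrace δ g gi f fi m * δ (g i j)
    - algebraMap ℝ R ((Fintype.card κ + m) / 2 - 1) * δ (g i j)
    - algebraMap ℝ R (1 / 2) * wTrace δ g gi f fi m * g i j
    + beRic D g gi f fi m i j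

/-- The component `(∂_ρ, ∂_ρ)` of the Bakry-Émery Ricci tensor of `2 ρ dt² + 2 t dρ dt + t² g_ρ` and
`t f_ρ`, where `δ = ∂_ρ`. -/
def radRic (δ : Derivation ℝ R R) (g gi : Matrix κ κ R) (f fi : R) (m : ℝ) : R :=
  -(algebraMap ℝ R (1 / 2) * ∑ k, ∑ l, gi k l * δ (δ (g k l)))
    + algebraMap ℝ R (1 / 4) * (gi * dMat δ g * gi * dMat δ g).trace
    - algebraMap ℝ R m * fi * δ (δ f)

/-- The scalar `F` of `2 ρ dt² + 2 t dρ dt + t² g_ρ` and `t f_ρ`, where `δ = ∂_ρ`. -/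
def ambScalar (D : κ → Derivation ℝ R R) (δ : Derivation ℝ R R) (ρ : R) (g gi : Matrix κ κ R)
    (f fi : R) (m μ : ℝ) : R :=
  -(2 * ρ * f * δ (δ f) - 2 * ρ * δ f ^ 2 + ρ * wTrace δ g gi f fi m * f * δ f
    - algebraMap ℝ R (Fintype.card κ + m - 2) * f * δ f
    - algebraMap ℝ R (1 / 2) * wTrace δ g gi f fi m * f ^ 2) + wF D g gi f m μ

/-- The matrix of the metric `2 ρ dt² + 2 t dρ dt + t² g`. -/
def ambMat (t ρ : R) (g : Matrix κ κ R) : Matrix (Unit ⊕ (κ ⊕ Unit)) (Unit ⊕ (κ ⊕ Unit)) R :=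
  Matrix.of fun
    | .inl _, .inl _ => ρ + ρ
    | .inl _, .inr (.inr _) => t
    | .inr (.inr _), .inl _ => t
    | .inr (.inl i), .inr (.inl j) => t * t * g i j
    | _, _ => 0

/-- The inverse of the matrix of the metric `2 ρ dt² + 2 t dρ dt + t² g`; here `ti` and `gi` are the
inverses of `t` and `g`. -/
def ambInv (ti ρ : R) (gi : Matrix κ κ R) : Matrix (Unit ⊕ (κ ⊕ Unit)) (Unit ⊕ (κ ⊕ Unit)) R :=
  Matrix.of fun
    | .inl _, .inr (.inr _) => ti
    | .inr (.inr _), .inl _ => ti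
    | .inr (.inr _), .inr (.inr _) => -((ρ + ρ) * (ti * ti))
    | .inr (.inl i), .inr (.inl j) => ti * ti * gi i j
    | _, _ => 0

/-- The functions `t`, `ρ`, and `t`-independent `g`, `f`, with inverses, in a differential ring with
derivations `∂_t, ∂_i, ∂_ρ`. -/
structure IsNormalFrame (D : Unit ⊕ (κ ⊕ Unit) → Derivation ℝ R R) (t ti ρ : R)
    (g gi : Matrix κ κ R) (f fi : R) [DecidableEq κ] : Prop where
  comm : ∀ i j x, D i (D j x) = D j (D i x)
  d0_t : D (.inl ()) t = 1
  di_t : ∀ i, D (.inr i) t = 0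
  d0_ρ : D (.inl ()) ρ = 0
  di_ρ : ∀ i, D (.inr (.inl i)) ρ = 0
  dr_ρ : D (.inr (.inr ())) ρ = 1
  d0_g : ∀ i j, D (.inl ()) (g i j) = 0
  d0_f : D (.inl ()) f = 0
  ht : t * ti = 1
  hg : g.IsSymm
  hgi : g * gi = 1
  hf : f * fi = 1

/-- The Christoffel symbols of `2 ρ dt² + 2 t dρ dt + t² g_ρ`. -/
def ambChr (D : κ → Derivation ℝ R R) (δ : Derivation ℝ R R) (t ti ρ : R) (g gi : Matrix κ κ R)
    [DecidableEq κ] : (Unit ⊕ (κ ⊕ Unit)) → (Unit ⊕ (κ ⊕ Unit)) → (Unit ⊕ (κ ⊕ Unit)) → R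
  | .inl _, .inr (.inl i), .inr (.inl j) => -(algebraMap ℝ R (1 / 2) * t * δ (g i j))
  | .inr (.inl k), .inl _, .inr (.inl j) => if k = j then ti else 0
  | .inr (.inl k), .inr (.inl j), .inl _ => if k = j then ti else 0
  | .inr (.inl k), .inr (.inl i), .inr (.inl j) => chr D g gi k i j
  | .inr (.inl k), .inr (.inl i), .inr (.inr _) => algebraMap ℝ R (1 / 2) * (gi * dMat δ g) k i
  | .inr (.inl k), .inr (.inr _), .inr (.inl i) => algebraMap ℝ R (1 / 2) * (gi * dMat δ g) k i
  | .inr (.inr _), .inl _, .inr (.inr _) => ti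
  | .inr (.inr _), .inr (.inr _), .inl _ => ti
  | .inr (.inr _), .inr (.inl i), .inr (.inl j) => -g i j + ρ * δ (g i j)
  | _, _, _ => 0

variable [DecidableEq κ]

omit [Algebra ℝ R] [Fintype κ] [DecidableEq κ] in
lemma ambMat_isSymm {t ρ : R} {g : Matrix κ κ R} (hg : g.IsSymm) : (ambMat t ρ g).IsSymm := by
  refine Matrix.IsSymm.ext ?_
  rintro (_ | i | _) (_ | j | _) <;> simp [ambMat, hg.apply]

omit [Algebra ℝ R] in
lemma ambMat_mul_ambInv {t ti ρ : R} {g gi : Matrix κ κ R} (ht : t * ti = 1)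
    (hgi : g * gi = 1) : ambMat t ρ g * ambInv ti ρ gi = 1 := by
  have hij : ∀ i j, ∑ k, t * t * g i k * (ti * ti * gi k j) = (1 : Matrix κ κ R) i j := by
    intro i j
    rw [← hgi, Matrix.mul_apply]
    exact Finset.sum_congr rfl fun k _ => by linear_combination g i k * gi k j * (t * ti + 1) * ht
  ext (_ | i | _) (_ | j | _)
  all_goals simp [Matrix.mul_apply, Fintype.sum_sum_type, ambMat, ambInv, Matrix.one_apply, ht, hij]
  linear_combination -(2 * ρ * ti) * ht

variable {D : Unit ⊕ (κ ⊕ Unit) → Derivation ℝ R R} {t ti ρ : R} {g gi : Matrix κ κ R} {f fi : R}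

lemma chr_ambMat (h : IsNormalFrame D t ti ρ g gi f fi) :
    chr D (ambMat t ρ g) (ambInv ti ρ gi)
      = ambChr (fun i => D (.inr (.inl i))) (D (.inr (.inr ()))) t ti ρ g gi := by
  have h2 := half_mul_two (R := R)
  have ht := h.ht
  have hgi' : gi * g = 1 := mul_eq_one_comm.mp h.hgi
  have htt : ti * ti * (t * t) = 1 := by linear_combination (t * ti + 1) * ht
  have hdelta : ∀ k j, algebraMap ℝ R (1 / 2) * ∑ l, ti * ti * gi k l * (g j l * (t + t))
      = if k = j then ti else 0 := by
    intro k j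
    have e1 : ∑ l, ti * ti * gi k l * (g j l * (t + t)) = ti * ti * (t + t) * (gi * g) k j := by
      rw [Matrix.mul_apply, Finset.mul_sum]
      exact Finset.sum_congr rfl fun l _ => by rw [h.hg.apply l j]; ring
    rw [e1, hgi', Matrix.one_apply]
    split_ifs
    · linear_combination algebraMap ℝ R (1 / 2) * 2 * ti * ht + ti * h2
    · ring
  have hN : ∀ k j, algebraMap ℝ R (1 / 2)
      * ∑ l, ti * ti * gi k l * (t * t * D (.inr (.inr ())) (g j l))
      = algebraMap ℝ R (1 / 2) * (gi * dMat (D (.inr (.inr ()))) g) k j := by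
    intro k j
    rw [Matrix.mul_apply]
    congr 1
    exact Finset.sum_congr rfl fun l _ => by
      rw [dMat_apply, h.hg.apply l j]
      linear_combination gi k l * D (.inr (.inr ())) (g l j) * htt
  funext K I J
  rcases K with _ | k | _ <;> rcases I with _ | i | _ <;> rcases J with _ | j | _
  all_goals simp only [chr, Fintype.sum_sum_type, ambMat, ambInv, ambChr, Matrix.of_apply,
    Finset.univ_unique, Finset.sum_singleton, PUnit.default_eq_unit, Derivation.leibniz,
    map_add, h.d0_t, h.di_t, h.d0_ρ, h.di_ρ, h.dr_ρ, h.d0_g, map_zero, zero_mul,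
    mul_zero, add_zero, zero_add, sub_zero, smul_eq_mul, Finset.sum_const_zero, mul_one,
    zero_sub]
  all_goals try ring1
  · linear_combination -(algebraMap ℝ R (1 / 2) * t * D (.inr (.inr ())) (g i j)) * ht
  · exact hdelta k j
  · exact hdelta k i
  · congr 1
    exact Finset.sum_congr rfl fun l _ => by
      linear_combination gi k l * (D (.inr (.inl i)) (g j l) + D (.inr (.inl j)) (g i l)
        - D (.inr (.inl l)) (g i j)) * htt
  · exact hN k i
  · exact hN k j
  · linear_combination ti * h2
  · linear_combination -(g i j) * h2 - algebraMap ℝ R (1 / 2) * 2 * g i j * ht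
      + algebraMap ℝ R (1 / 2) * 2 * ρ * D (.inr (.inr ())) (g i j) * htt
      + ρ * D (.inr (.inr ())) (g i j) * h2
  · linear_combination ti * h2

end NormalForm

section NormalForm

variable {R κ : Type*} [CommRing R] [Algebra ℝ R] [Fintype κ] [DecidableEq κ]
variable {D : Unit ⊕ (κ ⊕ Unit) → Derivation ℝ R R} {t ti ρ : R} {g gi : Matrix κ κ R} {f fi : R}

lemma deriv_inverse (δ : Derivation ℝ R R) {a b : R} (h : a * b = 1) :
    δ b = -(b * b * δ a) := by
  have h1 := congrArg δ h
  simp only [Derivation.leibniz, smul_eq_mul, Derivation.map_one_eq_zero] at h1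
  linear_combination b * h1 - δ b * h

lemma dMat_inverse (δ : Derivation ℝ R R) (h : g * gi = 1) :
    dMat δ gi = -(gi * dMat δ g * gi) := by
  have h' : gi * g = 1 := mul_eq_one_comm.mp h
  have h1 : gi * dMat δ (g * gi) = 0 := by rw [h, dMat_one, Matrix.mul_zero]
  rw [dMat_mul, Matrix.mul_add, ← Matrix.mul_assoc gi g, h', Matrix.one_mul] at h1
  rw [eq_neg_of_add_eq_zero_right h1, Matrix.mul_assoc]

namespace IsNormalFrame

lemma d0_gi (h : IsNormalFrame D t ti ρ g gi f fi) (i j : κ) : D (.inl ()) (gi i j) = 0 := by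
  have h1 : dMat (D (.inl ())) g = 0 := by ext i j; exact h.d0_g i j
  have := dMat_inverse (D (.inl ())) h.hgi
  rw [h1] at this
  simpa using congrFun (congrFun this i) j

lemma d0_chr (h : IsNormalFrame D t ti ρ g gi f fi) (k i j : κ) :
    D (.inl ()) (chr (fun i => D (.inr (.inl i))) g gi k i j) = 0 := by
  simp [chr, h.d0_gi, h.comm (.inl ()), h.d0_g]

lemma d0_N (h : IsNormalFrame D t ti ρ g gi f fi) (i j : κ) :
    D (.inl ()) ((gi * dMat (D (.inr (.inr ()))) g) i j) = 0 := by
  simp [Matrix.mul_apply, h.d0_gi, h.comm (.inl ()), h.d0_g]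

lemma d_ti (h : IsNormalFrame D t ti ρ g gi f fi) (i : κ ⊕ Unit) : D (.inr i) ti = 0 := by
  simp [deriv_inverse _ h.ht, h.di_t]

lemma d0_ti (h : IsNormalFrame D t ti ρ g gi f fi) : D (.inl ()) ti = -(ti * ti) := by
  simp [deriv_inverse _ h.ht, h.d0_t]

lemma d0_fi (h : IsNormalFrame D t ti ρ g gi f fi) : D (.inl ()) fi = 0 := by
  simp [deriv_inverse _ h.hf, h.d0_f]

lemma ric_zero (h : IsNormalFrame D t ti ρ g gi f fi) (J : Unit ⊕ (κ ⊕ Unit)) :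
    ric D (chr D (ambMat t ρ g) (ambInv ti ρ gi)) (.inl ()) J = 0 := by
  rw [chr_ambMat h]
  have hs := chr_symm (D := fun i => D (.inr (.inl i))) (Hi := gi) h.hg
  rcases J with _ | j | _
  all_goals simp only [ric, Fintype.sum_sum_type, ambChr, apply_ite (D _), map_add, map_neg,
    map_zero, h.d_ti, h.d0_ti, h.d0_chr, h.d0_N, h.d0_t, h.d0_g, h.d0_ρ, h.di_t,
    Finset.univ_unique, Finset.sum_singleton, PUnit.default_eq_unit, ite_self,
    zero_mul, mul_zero, add_zero, zero_add, sub_zero, zero_sub, Finset.sum_const_zero,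
    neg_zero, mul_one, Finset.sum_add_distrib, Finset.sum_sub_distrib, Finset.sum_neg_distrib,
    mul_ite, ite_mul, Finset.sum_ite_eq, Finset.sum_ite_eq', Finset.mem_univ, if_true]
  · simp
    ring
  · simp [hs]
  · simp

lemma trace_N (h : IsNormalFrame D t ti ρ g gi f fi) :
    ∑ x, (gi * dMat (D (.inr (.inr ()))) g) x x
      = ∑ k, ∑ l, gi k l * D (.inr (.inr ())) (g k l) := by
  simp only [Matrix.mul_apply, dMat_apply]
  exact Finset.sum_congr rfl fun i _ => Finset.sum_congr rfl fun j _ => by rw [h.hg.apply j i]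

lemma ric_tan (h : IsNormalFrame D t ti ρ g gi f fi) (i j : κ) :
    ric D (chr D (ambMat t ρ g) (ambInv ti ρ gi)) (.inr (.inl i)) (.inr (.inl j))
      = tanRic (fun i => D (.inr (.inl i))) (D (.inr (.inr ()))) ρ g gi f fi 0 i j := by
  have e4 := h.trace_N
  have hgN : g * (gi * dMat (D (.inr (.inr ()))) g) = dMat (D (.inr (.inr ()))) g := by
    rw [← Matrix.mul_assoc, h.hgi, Matrix.one_mul]
  have hst : ∀ a b, D (.inr (.inr ())) (g a b) = D (.inr (.inr ())) (g b a) := fun a b => by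
    rw [h.hg.apply b a]
  have hN2 : ∀ a b, ∑ x, D (.inr (.inr ())) (g a x) * (gi * dMat (D (.inr (.inr ()))) g) x b
      = ∑ k, ∑ l, D (.inr (.inr ())) (g a k) * gi k l * D (.inr (.inr ())) (g l b) := by
    intro a b
    simp only [Matrix.mul_apply, dMat_apply, Finset.mul_sum, mul_assoc]
  have hN2s : ∀ a b,
      ∑ k, ∑ l, D (.inr (.inr ())) (g a k) * gi k l * D (.inr (.inr ())) (g l b)
      = ∑ k, ∑ l, D (.inr (.inr ())) (g b k) * gi k l * D (.inr (.inr ())) (g l a) := by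
    intro a b
    rw [Finset.sum_comm]
    refine Finset.sum_congr rfl fun k _ => Finset.sum_congr rfl fun l _ => ?_
    rw [hst a l, hst k b, (isSymm_inv h.hg h.hgi).apply k l]
    ring
  rw [chr_ambMat h]
  simp only [ric, Fintype.sum_sum_type, ambChr, apply_ite (D _), map_add, map_neg,
    map_zero, h.d_ti, h.d0_ti, h.d0_chr, h.d0_N, h.d0_t, h.d0_g, h.d0_ρ, h.di_t, h.dr_ρ,
    Derivation.leibniz, smul_eq_mul, h.comm (.inl ()), Derivation.map_algebraMap,
    Finset.univ_unique, Finset.sum_singleton, PUnit.default_eq_unit, ite_self,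
    zero_mul, mul_zero, add_zero, zero_add, sub_zero, zero_sub, Finset.sum_const_zero,
    neg_zero, mul_one, Finset.sum_add_distrib, Finset.sum_sub_distrib, Finset.sum_neg_distrib,
    mul_ite, ite_mul, Finset.sum_ite_eq, Finset.sum_ite_eq', Finset.mem_univ, if_true]
  set γ := chr (fun i => D (.inr (.inl i))) g gi with hγ
  set N := gi * dMat (D (.inr (.inr ()))) g with hN
  have hgN' : ∀ a b, ∑ x, g a x * N x b = D (.inr (.inr ())) (g a b) := fun a b => by
    rw [← Matrix.mul_apply, hgN]; rfl
  have s1 : ∑ x, algebraMap ℝ R (1 / 2) * N x x * (-g i j + ρ * D (.inr (.inr ())) (g i j))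
      = algebraMap ℝ R (1 / 2) * (-g i j + ρ * D (.inr (.inr ())) (g i j)) * ∑ x, N x x := by
    rw [Finset.mul_sum]; exact Finset.sum_congr rfl fun x _ => by ring
  have s2 : ∑ x, (-g j x + ρ * D (.inr (.inr ())) (g j x)) * (algebraMap ℝ R (1 / 2) * N x i)
      = algebraMap ℝ R (1 / 2) * (-∑ x, g j x * N x i
        + ρ * ∑ x, D (.inr (.inr ())) (g j x) * N x i) := by
    rw [Finset.mul_sum, ← Finset.sum_neg_distrib, ← Finset.sum_add_distrib, Finset.mul_sum]
    exact Finset.sum_congr rfl fun x _ => by ring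
  have s3 : ∑ x, algebraMap ℝ R (1 / 2) * N x j * (-g i x + ρ * D (.inr (.inr ())) (g i x))
      = algebraMap ℝ R (1 / 2) * (-∑ x, g i x * N x j
        + ρ * ∑ x, D (.inr (.inr ())) (g i x) * N x j) := by
    rw [Finset.mul_sum, ← Finset.sum_neg_distrib, ← Finset.sum_add_distrib, Finset.mul_sum]
    exact Finset.sum_congr rfl fun x _ => by ring
  have hc : algebraMap ℝ R ((Fintype.card κ : ℝ) / 2 - 1)
      = algebraMap ℝ R (1 / 2) * (Fintype.card κ : R) - 1 := by
    rw [div_eq_inv_mul, map_sub, map_mul, map_natCast, map_one, one_div]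
  rw [s1, s2, s3, hN2, hN2, hN2s j i, hgN', hgN', e4]
  simp only [tanRic, beRic, ric, wTrace, map_zero, mul_zero, zero_mul, sub_zero, add_zero,
    Finset.sum_const, Finset.card_univ, nsmul_eq_mul, Finset.sum_sub_distrib, ← hγ]
  rw [hst j i, hc]
  linear_combination (algebraMap ℝ R (1 / 2) * D (.inr (.inr ())) (g i j)
      * (1 - (Fintype.card κ : R))) * h.ht + (D (.inr (.inr ())) (g i j)
      - ρ * ∑ k, ∑ l, D (.inr (.inr ())) (g i k) * gi k l * D (.inr (.inr ())) (g l j))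
        * half_mul_two (R := R)

lemma ric_rad (h : IsNormalFrame D t ti ρ g gi f fi) :
    ric D (chr D (ambMat t ρ g) (ambInv ti ρ gi)) (.inr (.inr ())) (.inr (.inr ()))
      = radRic (D (.inr (.inr ()))) g gi f fi 0 := by
  have hδ := dMat_mul (D (.inr (.inr ()))) gi (dMat (D (.inr (.inr ()))) g)
  rw [dMat_inverse _ h.hgi, Matrix.neg_mul] at hδ
  rw [chr_ambMat h]
  simp only [ric, Fintype.sum_sum_type, ambChr, apply_ite (D _), map_add, map_neg,
    map_zero, h.d_ti, h.d0_ti, h.d0_chr, h.d0_N, h.d0_t, h.d0_g, h.d0_ρ, h.di_t, h.dr_ρ,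
    Derivation.leibniz, smul_eq_mul, h.comm (.inl ()), Derivation.map_algebraMap,
    Finset.univ_unique, Finset.sum_singleton, PUnit.default_eq_unit, ite_self,
    zero_mul, mul_zero, add_zero, zero_add, sub_zero, zero_sub, Finset.sum_const_zero,
    neg_zero, mul_one, Finset.sum_add_distrib, Finset.sum_sub_distrib, Finset.sum_neg_distrib,
    mul_ite, ite_mul, Finset.sum_ite_eq, Finset.sum_ite_eq', Finset.mem_univ, if_true]
  set N := gi * dMat (D (.inr (.inr ()))) g with hN
  have s1 : ∑ x, algebraMap ℝ R (1 / 2) * D (.inr (.inr ())) (N x x)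
      = algebraMap ℝ R (1 / 2) * (-(gi * dMat (D (.inr (.inr ()))) g * gi
          * dMat (D (.inr (.inr ()))) g).trace
        + ∑ k, ∑ l, gi k l * D (.inr (.inr ())) (D (.inr (.inr ())) (g k l))) := by
    have : ∑ x, D (.inr (.inr ())) (N x x) = (dMat (D (.inr (.inr ()))) N).trace := rfl
    rw [← Finset.mul_sum, this, hδ, Matrix.trace_add, Matrix.trace_neg]
    congr 2
    simp only [Matrix.trace, Matrix.diag_apply, Matrix.mul_apply, dMat_apply]
    exact Finset.sum_congr rfl fun i _ => Finset.sum_congr rfl fun j _ => by rw [h.hg.apply j i]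
  have s2 : ∑ x, ∑ y, algebraMap ℝ R (1 / 2) * N x y * (algebraMap ℝ R (1 / 2) * N y x)
      = algebraMap ℝ R (1 / 4) * (gi * dMat (D (.inr (.inr ()))) g * gi
          * dMat (D (.inr (.inr ()))) g).trace := by
    rw [Matrix.mul_assoc _ gi, ← hN]
    have e : (N * N).trace = ∑ x, ∑ y, N x y * N y x := by
      simp only [Matrix.trace, Matrix.diag_apply, Matrix.mul_apply]
    rw [e, Finset.mul_sum]
    simp only [Finset.mul_sum]
    have hq : algebraMap ℝ R (1 / 4) = algebraMap ℝ R (1 / 2) * algebraMap ℝ R (1 / 2) := by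
      rw [← map_mul]; norm_num
    exact Finset.sum_congr rfl fun i _ => Finset.sum_congr rfl fun j _ => by rw [hq]; ring
  have hq : algebraMap ℝ R (1 / 2) = algebraMap ℝ R (1 / 4) + algebraMap ℝ R (1 / 4) := by
    rw [← map_add]; norm_num
  rw [s1, s2]
  simp only [radRic, map_zero, zero_mul, sub_zero]
  rw [hq]
  ring

/-- The mixed components do not depend on `t`. -/
lemma d0_ric_mix (h : IsNormalFrame D t ti ρ g gi f fi) (j : κ) :
    D (.inl ()) (ric D (chr D (ambMat t ρ g) (ambInv ti ρ gi)) (.inr (.inl j)) (.inr (.inr ())))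
      = 0 := by
  rw [chr_ambMat h]
  simp only [ric, Fintype.sum_sum_type, ambChr, apply_ite (D _), map_add, map_neg,
    map_zero, h.d_ti, h.d0_ti, h.d0_chr, h.d0_N, h.d0_t, h.d0_g, h.d0_ρ, h.di_t, h.dr_ρ,
    Derivation.leibniz, smul_eq_mul, Derivation.map_algebraMap,
    Finset.univ_unique, Finset.sum_singleton, PUnit.default_eq_unit, ite_self,
    zero_mul, mul_zero, add_zero, zero_add, sub_zero, zero_sub, Finset.sum_const_zero,
    neg_zero, mul_one, Finset.sum_add_distrib, Finset.sum_sub_distrib, Finset.sum_neg_distrib,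
    mul_ite, ite_mul, Finset.sum_ite_eq, Finset.sum_ite_eq', Finset.mem_univ, if_true]
  simp only [map_add, map_sub, map_neg, map_sum, Derivation.leibniz, smul_eq_mul,
    h.comm (.inl ()), h.d0_chr, h.d0_N, h.d0_g, h.d0_ρ, map_zero, Derivation.map_algebraMap,
    h.d0_t, h.d0_ti, zero_mul, mul_zero, add_zero, Finset.sum_const_zero, sub_zero]

end IsNormalFrame
end NormalForm

section NormalForm

variable {R κ : Type*} [CommRing R] [Algebra ℝ R] [Fintype κ] [DecidableEq κ]
variable {D : Unit ⊕ (κ ⊕ Unit) → Derivation ℝ R R} {t ti ρ : R} {g gi : Matrix κ κ R} {f fi : R}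

/-- The Bakry-Émery Ricci tensor of `2 ρ dt² + 2 t dρ dt + t² g_ρ` and `t f_ρ`. -/
def ambRic (D : Unit ⊕ (κ ⊕ Unit) → Derivation ℝ R R) (t ti ρ : R) (g gi : Matrix κ κ R)
    (f fi : R) (m : ℝ) (I J : Unit ⊕ (κ ⊕ Unit)) : R :=
  beRic D (ambMat t ρ g) (ambInv ti ρ gi) (t * f) (ti * fi) m I J

namespace IsNormalFrame

lemma hess_zero (h : IsNormalFrame D t ti ρ g gi f fi) (J : Unit ⊕ (κ ⊕ Unit)) :
    hess D (chr D (ambMat t ρ g) (ambInv ti ρ gi)) (t * f) (.inl ()) J = 0 := by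
  have ht := h.ht
  rw [chr_ambMat h]
  rcases J with _ | j | _
  all_goals simp [hess, Fintype.sum_sum_type, ambChr, h.d0_t, h.di_t, h.d0_f, h.comm (.inl ())]
  · linear_combination -(D (.inr (.inl j)) f) * ht
  · linear_combination -(D (.inr (.inr ())) f) * ht

lemma hess_tan (h : IsNormalFrame D t ti ρ g gi f fi) (i j : κ) :
    hess D (chr D (ambMat t ρ g) (ambInv ti ρ gi)) (t * f) (.inr (.inl i)) (.inr (.inl j))
      = t * (hess (fun i => D (.inr (.inl i))) (chr (fun i => D (.inr (.inl i))) g gi) f i j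
        + algebraMap ℝ R (1 / 2) * D (.inr (.inr ())) (g i j) * f
        - (-g i j + ρ * D (.inr (.inr ())) (g i j)) * D (.inr (.inr ())) f) := by
  rw [chr_ambMat h]
  have : ∀ X : κ → R, ∑ k, X k * (t * D (.inr (.inl k)) f) = t * ∑ k, X k * D (.inr (.inl k)) f := by
    intro X
    rw [Finset.mul_sum]; exact Finset.sum_congr rfl fun k _ => by ring
  simp [hess, Fintype.sum_sum_type, ambChr, h.d0_t, h.di_t, h.d0_f, this]
  ring

lemma hess_mix (h : IsNormalFrame D t ti ρ g gi f fi) (i : κ) :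
    hess D (chr D (ambMat t ρ g) (ambInv ti ρ gi)) (t * f) (.inr (.inl i)) (.inr (.inr ()))
      = t * (D (.inr (.inl i)) (D (.inr (.inr ())) f)
        - ∑ k, algebraMap ℝ R (1 / 2) * (gi * dMat (D (.inr (.inr ()))) g) k i
          * D (.inr (.inl k)) f) := by
  rw [chr_ambMat h]
  have : ∀ X : κ → R, ∑ k, X k * (t * D (.inr (.inl k)) f) = t * ∑ k, X k * D (.inr (.inl k)) f := by
    intro X
    rw [Finset.mul_sum]; exact Finset.sum_congr rfl fun k _ => by ring
  simp only [hess, Fintype.sum_sum_type, ambChr]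
  simp [h.d0_t, h.di_t, h.d0_f, this]
  ring

lemma hess_rad (h : IsNormalFrame D t ti ρ g gi f fi) :
    hess D (chr D (ambMat t ρ g) (ambInv ti ρ gi)) (t * f) (.inr (.inr ())) (.inr (.inr ()))
      = t * D (.inr (.inr ())) (D (.inr (.inr ())) f) := by
  rw [chr_ambMat h]
  simp [hess, Fintype.sum_sum_type, ambChr, h.d0_t, h.di_t, h.d0_f]

lemma ambRic_symm (h : IsNormalFrame D t ti ρ g gi f fi) (m : ℝ) (I J : Unit ⊕ (κ ⊕ Unit)) :
    ambRic D t ti ρ g gi f fi m I J = ambRic D t ti ρ g gi f fi m J I := by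
  have hs := ambMat_isSymm (t := t) (ρ := ρ) h.hg
  simp only [ambRic, beRic]
  rw [ric_symm h.comm hs (ambMat_mul_ambInv h.ht h.hgi) I J, hess_symm h.comm hs]

lemma ambRic_zero (h : IsNormalFrame D t ti ρ g gi f fi) (m : ℝ) (J : Unit ⊕ (κ ⊕ Unit)) :
    ambRic D t ti ρ g gi f fi m (.inl ()) J = 0 := by
  simp [ambRic, beRic, h.ric_zero, h.hess_zero]

lemma ambRic_zero' (h : IsNormalFrame D t ti ρ g gi f fi) (m : ℝ) (J : Unit ⊕ (κ ⊕ Unit)) :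
    ambRic D t ti ρ g gi f fi m J (.inl ()) = 0 := by
  rw [h.ambRic_symm, h.ambRic_zero]

lemma ambRic_tan (h : IsNormalFrame D t ti ρ g gi f fi) (m : ℝ) (i j : κ) :
    ambRic D t ti ρ g gi f fi m (.inr (.inl i)) (.inr (.inl j))
      = tanRic (fun i => D (.inr (.inl i))) (D (.inr (.inr ()))) ρ g gi f fi m i j := by
  have hc : algebraMap ℝ R ((Fintype.card κ + m) / 2 - 1)
      = algebraMap ℝ R ((Fintype.card κ + 0) / 2 - 1)
        + algebraMap ℝ R (1 / 2) * algebraMap ℝ R m := by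
    rw [← map_mul, ← map_add]; congr 1; ring
  simp only [ambRic, beRic]
  rw [h.ric_tan, h.hess_tan]
  simp only [tanRic, beRic, wTrace, map_zero]
  rw [hc]
  set X := hess (fun i => D (.inr (.inl i))) (chr (fun i => D (.inr (.inl i))) g gi) f i j
  set φ := algebraMap ℝ R m
  set δg := D (.inr (.inr ())) (g i j)
  set δf := D (.inr (.inr ())) f
  linear_combination -φ * fi * (X + algebraMap ℝ R (1 / 2) * δg * f - (-g i j + ρ * δg) * δf)
    * h.ht - algebraMap ℝ R (1 / 2) * φ * δg * h.hf
    - (φ * fi * δf * (ρ * δg - g i j)) * half_mul_two (R := R)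

lemma ambRic_rad (h : IsNormalFrame D t ti ρ g gi f fi) (m : ℝ) :
    ambRic D t ti ρ g gi f fi m (.inr (.inr ())) (.inr (.inr ()))
      = radRic (D (.inr (.inr ()))) g gi f fi m := by
  simp only [ambRic, beRic]
  rw [h.ric_rad, h.hess_rad]
  simp only [radRic, map_zero]
  linear_combination -(algebraMap ℝ R m * fi * D (.inr (.inr ())) (D (.inr (.inr ())) f)) * h.ht

lemma d0_ambRic_mix (h : IsNormalFrame D t ti ρ g gi f fi) (m : ℝ) (j : κ) :
    D (.inl ()) (ambRic D t ti ρ g gi f fi m (.inr (.inl j)) (.inr (.inr ()))) = 0 := by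
  simp only [ambRic, beRic]
  rw [h.hess_mix, map_sub, h.d0_ric_mix]
  have e : ∀ X : R, algebraMap ℝ R m * (ti * fi) * (t * X) = algebraMap ℝ R m * fi * X :=
    fun X => by linear_combination algebraMap ℝ R m * fi * X * h.ht
  rw [e]
  simp only [map_sub, map_sum, Derivation.leibniz, smul_eq_mul, h.comm (.inl ()), h.d0_f, h.d0_fi,
    h.d0_N, map_zero, mul_zero, Derivation.map_algebraMap, Finset.sum_const_zero, add_zero,
    sub_zero]

lemma d0_ambRic_rad (h : IsNormalFrame D t ti ρ g gi f fi) (m : ℝ) :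
    D (.inl ()) (ambRic D t ti ρ g gi f fi m (.inr (.inr ())) (.inr (.inr ()))) = 0 := by
  rw [h.ambRic_rad]
  simp only [radRic, Matrix.trace, Matrix.diag_apply, Matrix.mul_apply, dMat_apply, map_add,
    map_sub, map_neg, map_sum, Derivation.leibniz, smul_eq_mul, h.comm (.inl ()), h.d0_f, h.d0_fi,
    h.d0_g, h.d0_gi, map_zero, mul_zero, Derivation.map_algebraMap, Finset.sum_const_zero, add_zero,
    sub_zero, neg_zero]

lemma lap_amb (h : IsNormalFrame D t ti ρ g gi f fi) :
    lap D (ambMat t ρ g) (ambInv ti ρ gi) (t * f) = ti *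
      (-(2 * ρ * D (.inr (.inr ())) (D (.inr (.inr ())) f))
        + lap (fun i => D (.inr (.inl i))) g gi f
        + algebraMap ℝ R (1 / 2) * (∑ k, ∑ l, gi k l * D (.inr (.inr ())) (g k l)) * f
        + (Fintype.card κ : R) * D (.inr (.inr ())) f
        - ρ * (∑ k, ∑ l, gi k l * D (.inr (.inr ())) (g k l)) * D (.inr (.inr ())) f) := by
  have hgi' : gi * g = 1 := mul_eq_one_comm.mp h.hgi
  have hcard : (Fintype.card κ : R) = ∑ k, ∑ l, gi k l * g k l := by
    have : ∑ k, ∑ l, gi k l * g k l = (gi * g).trace := by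
      simp only [Matrix.trace, Matrix.diag_apply, Matrix.mul_apply]
      exact Finset.sum_congr rfl fun i _ => Finset.sum_congr rfl fun j _ => by rw [h.hg.apply j i]
    rw [this, hgi', Matrix.trace_one]
  have hs : ∀ I, hess D (chr D (ambMat t ρ g) (ambInv ti ρ gi)) (t * f) I (.inl ()) = 0 := fun I => by
    rw [hess_symm h.comm (ambMat_isSymm h.hg), h.hess_zero]
  have e1 : ∑ i, ∑ j, ti * ti * gi i j *
      (t * (hess (fun i => D (.inr (.inl i))) (chr (fun i => D (.inr (.inl i))) g gi) f i j
        + algebraMap ℝ R (1 / 2) * D (.inr (.inr ())) (g i j) * f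
        - (-g i j + ρ * D (.inr (.inr ())) (g i j)) * D (.inr (.inr ())) f))
      = ti * (lap (fun i => D (.inr (.inl i))) g gi f
        + algebraMap ℝ R (1 / 2) * (∑ k, ∑ l, gi k l * D (.inr (.inr ())) (g k l)) * f
        + (∑ k, ∑ l, gi k l * g k l) * D (.inr (.inr ())) f
        - ρ * (∑ k, ∑ l, gi k l * D (.inr (.inr ())) (g k l)) * D (.inr (.inr ())) f) := by
    simp only [lap, Finset.mul_sum, Finset.sum_mul, ← Finset.sum_add_distrib,
      ← Finset.sum_sub_distrib]
    refine Finset.sum_congr rfl fun i _ => Finset.sum_congr rfl fun j _ => ?_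
    linear_combination (ti * gi i j *
      (hess (fun i => D (.inr (.inl i))) (chr (fun i => D (.inr (.inl i))) g gi) f i j
        + algebraMap ℝ R (1 / 2) * D (.inr (.inr ())) (g i j) * f
        - (-g i j + ρ * D (.inr (.inr ())) (g i j)) * D (.inr (.inr ())) f)) * h.ht
  rw [hcard, lap]
  simp only [Fintype.sum_sum_type, Finset.univ_unique, Finset.sum_singleton,
    PUnit.default_eq_unit, h.hess_zero, hs, h.hess_tan, h.hess_rad, mul_zero, zero_add, add_zero,
    Finset.sum_const_zero]
  simp only [ambInv, Matrix.of_apply, zero_mul, add_zero, zero_add, Finset.sum_const_zero]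
  rw [e1]
  linear_combination -(2 * ρ * ti * D (.inr (.inr ())) (D (.inr (.inr ())) f)) * h.ht

lemma gradSq_amb (h : IsNormalFrame D t ti ρ g gi f fi) :
    gradSq D (ambInv ti ρ gi) (t * f) = 2 * f * D (.inr (.inr ())) f
      - 2 * ρ * D (.inr (.inr ())) f ^ 2 + gradSq (fun i => D (.inr (.inl i))) gi f := by
  have e1 : ∑ i, ∑ j, ti * ti * gi i j * (t * D (.inr (.inl i)) f) * (t * D (.inr (.inl j)) f)
      = gradSq (fun i => D (.inr (.inl i))) gi f := by
    simp only [gradSq]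
    refine Finset.sum_congr rfl fun i _ => Finset.sum_congr rfl fun j _ => ?_
    linear_combination (t * ti + 1) * gi i j * D (.inr (.inl i)) f * D (.inr (.inl j)) f * h.ht
  rw [gradSq]
  simp only [Fintype.sum_sum_type, Finset.univ_unique, Finset.sum_singleton,
    PUnit.default_eq_unit, Derivation.leibniz, h.d0_t, h.d0_f, h.di_t, smul_eq_mul, mul_zero,
    zero_add, add_zero, mul_one, ambInv, Matrix.of_apply, zero_mul, Finset.sum_const_zero, e1]
  set δf := D (.inr (.inr ())) f
  linear_combination (2 * f * δf - 2 * ρ * δf ^ 2 * (t * ti + 1)) * h.ht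

lemma wF_amb (h : IsNormalFrame D t ti ρ g gi f fi) (m μ : ℝ) :
    wF D (ambMat t ρ g) (ambInv ti ρ gi) (t * f) m μ
      = ambScalar (fun i => D (.inr (.inl i))) (D (.inr (.inr ()))) ρ g gi f fi m μ := by
  have hc : algebraMap ℝ R (Fintype.card κ + m - 2) = (Fintype.card κ : R) + algebraMap ℝ R m - 2 := by
    rw [map_sub, map_add, map_natCast, map_ofNat]
  rw [wF, h.lap_amb, h.gradSq_amb]
  simp only [ambScalar, wF, wTrace, hc, map_sub, map_one]
  set δf := D (.inr (.inr ())) f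
  set T := ∑ k, ∑ l, gi k l * D (.inr (.inr ())) (g k l)
  set φ := algebraMap ℝ R m
  set half := algebraMap ℝ R (1 / 2)
  set L := lap (fun i => D (.inr (.inl i))) g gi f
  linear_combination f * (-(2 * ρ * D (.inr (.inr ())) δf) + L + half * T * f
    + (Fintype.card κ : R) * δf - ρ * T * δf) * h.ht
    + (2 * ρ * φ * δf ^ 2 - half * 2 * φ * f * δf) * h.hf - φ * f * δf * half_mul_two (R := R)

end IsNormalFrame
end NormalForm

section NormalForm

variable {R κ : Type*} [CommRing R] [Algebra ℝ R] [Fintype κ] [DecidableEq κ]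
variable {D : Unit ⊕ (κ ⊕ Unit) → Derivation ℝ R R} {t ti ρ : R} {g gi : Matrix κ κ R} {f fi : R}

namespace IsNormalFrame

lemma isUnit_ti_sq (h : IsNormalFrame D t ti ρ g gi f fi) : IsUnit (ti ^ 2) :=
  (IsUnit.of_mul_eq_one t (by rw [mul_comm]; exact h.ht)).pow 2

lemma card_eq (h : IsNormalFrame D t ti ρ g gi f fi) :
    (Fintype.card κ : R) = ∑ k, ∑ l, gi k l * g k l := by
  have hgi' : gi * g = 1 := mul_eq_one_comm.mp h.hgi
  have : ∑ k, ∑ l, gi k l * g k l = (gi * g).trace := by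
    simp only [Matrix.trace, Matrix.diag_apply, Matrix.mul_apply]
    exact Finset.sum_congr rfl fun i _ => Finset.sum_congr rfl fun j _ => by rw [h.hg.apply j i]
  rw [this, hgi', Matrix.trace_one]

/-- The `∂_j` component of the weighted Bianchi identity of `2 ρ dt² + 2 t dρ dt + t² g_ρ`. -/
theorem bianchi_tan (h : IsNormalFrame D t ti ρ g gi f fi) (m μ : ℝ) (j : κ) :
    let P := ambRic D t ti ρ g gi f fi m
    let D' : κ → Derivation ℝ R R := fun i => D (.inr (.inl i))
    2 * ((Fintype.card κ : R) + algebraMap ℝ R m - 2) * P (.inr (.inl j)) (.inr (.inr ()))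
      - 4 * ρ * D (.inr (.inr ())) (P (.inr (.inl j)) (.inr (.inr ())))
      + 2 * ρ * D' j (P (.inr (.inr ())) (.inr (.inr ())))
      - 2 * ρ * wTrace (D (.inr (.inr ()))) g gi f fi m * P (.inr (.inl j)) (.inr (.inr ()))
      + divForm D' gi (chr D' g gi) (Matrix.of fun a b => P (.inr (.inl a)) (.inr (.inl b))) j
      + 2 * algebraMap ℝ R m * fi * ∑ a, grad D' gi f a * P (.inr (.inl a)) (.inr (.inl j))
      + algebraMap ℝ R m * fi ^ 2 * D' j (wF D (ambMat t ρ g) (ambInv ti ρ gi) (t * f) m μ) = 0 := by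
  intro P D'
  have hW := weighted_bianchi h.comm (ambMat_isSymm (t := t) (ρ := ρ) h.hg)
    (ambMat_mul_ambInv h.ht h.hgi) (t * f) (ti * fi)
    (by linear_combination f * fi * h.ht + h.hf) m μ (.inr (.inl j))
  have hP : beRic D (ambMat t ρ g) (ambInv ti ρ gi) (t * f) (ti * fi) m = P := rfl
  rw [hP, chr_ambMat h] at hW
  generalize wF D (ambMat t ρ g) (ambInv ti ρ gi) (t * f) m μ = W at hW ⊢
  have h0 : ∀ J, P (.inl ()) J = 0 := h.ambRic_zero m
  have h0' : ∀ J, P J (.inl ()) = 0 := h.ambRic_zero' m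
  have hA : ∀ k, P (.inr (.inr ())) (.inr (.inl k)) = P (.inr (.inl k)) (.inr (.inr ())) :=
    fun k => h.ambRic_symm m _ _
  have hA0 : ∀ k, D (.inl ()) (P (.inr (.inl k)) (.inr (.inr ()))) = 0 := h.d0_ambRic_mix m
  have hg' : gi * g = 1 := mul_eq_one_comm.mp h.hgi
  simp only [divForm, grad, Fintype.sum_sum_type, ambInv, ambChr, Matrix.of_apply,
    Finset.univ_unique, Finset.sum_singleton, PUnit.default_eq_unit, h0, h0', hA, hA0, map_zero,
    mul_zero, zero_mul, add_zero, zero_add, sub_zero, zero_sub, Finset.sum_const_zero, neg_zero,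
    Derivation.leibniz, smul_eq_mul, h.d0_t, h.di_t, h.d0_f, mul_one] at hW
  set δ := D (.inr (.inr ())) with hδ
  set A : κ → R := fun k => P (.inr (.inl k)) (.inr (.inr ())) with hAd
  have s1 : ∑ x, ∑ y, ti * ti * gi x y *
      (2 * D' x (P (.inr (.inl y)) (.inr (.inl j))) - D' j (P (.inr (.inl x)) (.inr (.inl y)))
        - 2 * (∑ z, chr D' g gi z x y * P (.inr (.inl z)) (.inr (.inl j))
          + (-g x y + ρ * δ (g x y)) * A j))
      = ti ^ 2 * (divForm D' gi (chr D' g gi)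
          (Matrix.of fun a b => P (.inr (.inl a)) (.inr (.inl b))) j
        + 2 * (Fintype.card κ : R) * A j
        - 2 * ρ * (∑ k, ∑ l, gi k l * δ (g k l)) * A j) := by
    rw [h.card_eq]
    simp only [divForm, Finset.mul_sum, Finset.sum_mul, ← Finset.sum_add_distrib,
      ← Finset.sum_sub_distrib, Matrix.of_apply]
    refine Finset.sum_congr rfl fun x _ => Finset.sum_congr rfl fun y _ => ?_
    simp only [← Finset.mul_sum]
    ring
  have s2 : ∑ x, (∑ y, ti * ti * gi x y * (t * D' y f)) * P (.inr (.inl x)) (.inr (.inl j))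
      = ti * ∑ a, grad D' gi f a * P (.inr (.inl a)) (.inr (.inl j)) := by
    simp only [grad, Finset.mul_sum, Finset.sum_mul]
    refine Finset.sum_congr rfl fun x _ => Finset.sum_congr rfl fun y _ => ?_
    linear_combination (ti * gi x y * D' y f * P (.inr (.inl x)) (.inr (.inl j))) * h.ht
  rw [s1, s2] at hW
  rw [wTrace]
  refine (h.isUnit_ti_sq.mul_right_eq_zero).mp ?_
  rw [← hW]
  linear_combination (-(2 * algebraMap ℝ R m * ti ^ 2 * A j)) * h.hf
    + (4 * ρ * algebraMap ℝ R m * ti ^ 2 * fi * δ f * A j) * h.ht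

/-- The `∂_ρ` component of the weighted Bianchi identity of `2 ρ dt² + 2 t dρ dt + t² g_ρ`. -/
theorem bianchi_rad (h : IsNormalFrame D t ti ρ g gi f fi) (m μ : ℝ) :
    let P := ambRic D t ti ρ g gi f fi m
    let D' : κ → Derivation ℝ R R := fun i => D (.inr (.inl i))
    2 * ((Fintype.card κ : R) + algebraMap ℝ R m - 2) * P (.inr (.inr ())) (.inr (.inr ()))
      - 2 * ρ * D (.inr (.inr ())) (P (.inr (.inr ())) (.inr (.inr ())))
      - 2 * ρ * wTrace (D (.inr (.inr ()))) g gi f fi m * P (.inr (.inr ())) (.inr (.inr ()))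
      + ∑ a, ∑ b, gi a b * (2 * D' a (P (.inr (.inl b)) (.inr (.inr ())))
          - 2 * ∑ l, chr D' g gi l a b * P (.inr (.inl l)) (.inr (.inr ())))
      + 2 * algebraMap ℝ R m * fi * ∑ a, grad D' gi f a * P (.inr (.inl a)) (.inr (.inr ()))
      - ∑ a, ∑ b, gi a b * D (.inr (.inr ())) (P (.inr (.inl a)) (.inr (.inl b)))
      + algebraMap ℝ R m * fi ^ 2
        * D (.inr (.inr ())) (wF D (ambMat t ρ g) (ambInv ti ρ gi) (t * f) m μ) = 0 := by
  intro P D'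
  have hW := weighted_bianchi h.comm (ambMat_isSymm (t := t) (ρ := ρ) h.hg)
    (ambMat_mul_ambInv h.ht h.hgi) (t * f) (ti * fi)
    (by linear_combination f * fi * h.ht + h.hf) m μ (.inr (.inr ()))
  have hP : beRic D (ambMat t ρ g) (ambInv ti ρ gi) (t * f) (ti * fi) m = P := rfl
  rw [hP, chr_ambMat h] at hW
  generalize wF D (ambMat t ρ g) (ambInv ti ρ gi) (t * f) m μ = W at hW ⊢
  have h0 : ∀ J, P (.inl ()) J = 0 := h.ambRic_zero m
  have h0' : ∀ J, P J (.inl ()) = 0 := h.ambRic_zero' m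
  have hA : ∀ k, P (.inr (.inr ())) (.inr (.inl k)) = P (.inr (.inl k)) (.inr (.inr ())) :=
    fun k => h.ambRic_symm m _ _
  have hB0 : D (.inl ()) (P (.inr (.inr ())) (.inr (.inr ()))) = 0 := h.d0_ambRic_rad m
  simp only [divForm, grad, Fintype.sum_sum_type, ambInv, ambChr, Matrix.of_apply,
    Finset.univ_unique, Finset.sum_singleton, PUnit.default_eq_unit, h0, h0', hA, hB0, map_zero,
    mul_zero, zero_mul, add_zero, zero_add, sub_zero, zero_sub, Finset.sum_const_zero, neg_zero,
    Derivation.leibniz, smul_eq_mul, h.d0_t, h.di_t, h.d0_f, mul_one] at hW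
  set δ := D (.inr (.inr ())) with hδ
  set B : R := P (.inr (.inr ())) (.inr (.inr ())) with hBd
  have s1 : ∑ x, ∑ y, ti * ti * gi x y *
      (2 * D' x (P (.inr (.inl y)) (.inr (.inr ()))) - δ (P (.inr (.inl x)) (.inr (.inl y)))
        - 2 * (∑ z, chr D' g gi z x y * P (.inr (.inl z)) (.inr (.inr ()))
          + (-g x y + ρ * δ (g x y)) * B))
      = ti ^ 2 * (∑ a, ∑ b, gi a b * (2 * D' a (P (.inr (.inl b)) (.inr (.inr ())))
          - 2 * ∑ l, chr D' g gi l a b * P (.inr (.inl l)) (.inr (.inr ())))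
        - ∑ a, ∑ b, gi a b * δ (P (.inr (.inl a)) (.inr (.inl b)))
        + 2 * (Fintype.card κ : R) * B
        - 2 * ρ * (∑ k, ∑ l, gi k l * δ (g k l)) * B) := by
    rw [h.card_eq]
    simp only [Finset.mul_sum, Finset.sum_mul, ← Finset.sum_add_distrib,
      ← Finset.sum_sub_distrib]
    refine Finset.sum_congr rfl fun x _ => Finset.sum_congr rfl fun y _ => ?_
    simp only [← Finset.mul_sum]
    ring
  have s2 : ∑ x, (∑ y, ti * ti * gi x y * (t * D' y f)) * P (.inr (.inl x)) (.inr (.inr ()))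
      = ti * ∑ a, grad D' gi f a * P (.inr (.inl a)) (.inr (.inr ())) := by
    simp only [grad, Finset.mul_sum, Finset.sum_mul]
    refine Finset.sum_congr rfl fun x _ => Finset.sum_congr rfl fun y _ => ?_
    linear_combination (ti * gi x y * D' y f * P (.inr (.inl x)) (.inr (.inr ()))) * h.ht
  rw [s1, s2] at hW
  rw [wTrace]
  refine (h.isUnit_ti_sq.mul_right_eq_zero).mp ?_
  rw [← hW]
  linear_combination (-(2 * algebraMap ℝ R m * ti ^ 2 * B)) * h.hf
    + (4 * ρ * algebraMap ℝ R m * ti ^ 2 * fi * δ f * B) * h.ht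

end IsNormalFrame
end NormalForm

/-! ### Change of coordinates -/

section ChangeOfCoordinates

variable {R R' κ : Type*} [CommRing R] [Algebra ℝ R] [CommRing R'] [Algebra ℝ R'] [Fintype κ]
  [DecidableEq κ]

/-- The Levi-Civita connection is the only torsion-free metric connection. -/
lemma chr_unique {D : κ → Derivation ℝ R R} {H Hi : Matrix κ κ R} (hH : H.IsSymm) (h : H * Hi = 1)
    (Γ : κ → κ → κ → R) (hs : ∀ k i j, Γ k i j = Γ k j i)
    (hm : ∀ a, dMat (D a) H = (conn Γ a).transpose * H + H * conn Γ a) : Γ = chr D H Hi := by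
  have h' : Hi * H = 1 := mul_eq_one_comm.mp h
  have e : ∀ a i j, D a (H i j) = ∑ k, H j k * Γ k a i + ∑ k, H i k * Γ k a j := by
    intro a i j
    have := congrFun (congrFun (hm a) i) j
    simp only [dMat_apply, Matrix.add_apply, Matrix.mul_apply, Matrix.transpose_apply,
      conn_apply] at this
    rw [this]
    congr 1
    exact Finset.sum_congr rfl fun k _ => by rw [hH.apply j k]; ring
  funext k i j
  have e2 : ∀ l, D i (H j l) + D j (H i l) - D l (H i j) = 2 * ∑ k, H l k * Γ k i j := by
    intro l
    rw [e, e, e]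
    simp only [hs _ j i, hs _ l j, hs _ l i]
    ring
  have e3 : ∑ l, Hi k l * ∑ p, H l p * Γ p i j = Γ k i j := by
    have : Hi.mulVec (H.mulVec fun p => Γ p i j) = fun p => Γ p i j := by
      rw [Matrix.mulVec_mulVec, h', Matrix.one_mulVec]
    exact congrFun this k
  rw [chr]
  simp only [e2]
  have e4 : ∑ l, Hi k l * (2 * ∑ p, H l p * Γ p i j) = 2 * Γ k i j := by
    rw [← e3, Finset.mul_sum]
    exact Finset.sum_congr rfl fun l _ => by ring
  rw [e4]
  linear_combination -(Γ k i j) * half_mul_two (R := R)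

/-- A change of coordinates: the homomorphism `π` pulls functions back, and `J` is the Jacobian
matrix, with inverse `Ji`. -/
structure IsCoordChange (π : R →ₐ[ℝ] R') (D : κ → Derivation ℝ R R) (D' : κ → Derivation ℝ R' R')
    (J Ji : Matrix κ κ R') : Prop where
  comm : ∀ i j x, D' i (D' j x) = D' j (D' i x)
  chain : ∀ i x, D' i (π x) = ∑ a, J a i * π (D a x)
  jac : ∀ i j a, D' i (J a j) = D' j (J a i)
  inv : J * Ji = 1

/-- The components, in the new coordinates, of a tensor with components `S`. -/
def pullTensor (π : R →ₐ[ℝ] R') (J : Matrix κ κ R') (S : Matrix κ κ R) : Matrix κ κ R' :=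
  J.transpose * S.map π * J

/-- The components, in the new coordinates, of a contravariant tensor with components `S`. -/
def pullInv (π : R →ₐ[ℝ] R') (Ji : Matrix κ κ R') (S : Matrix κ κ R) : Matrix κ κ R' :=
  Ji * S.map π * Ji.transpose

variable {π : R →ₐ[ℝ] R'} {D : κ → Derivation ℝ R R} {D' : κ → Derivation ℝ R' R'}
  {J Ji : Matrix κ κ R'}

omit [DecidableEq κ] in
lemma map_mul_alg (A B : Matrix κ κ R) : (A * B).map π = A.map π * B.map π :=
  Matrix.map_mul (f := π.toRingHom)

omit [Fintype κ] in
lemma map_one_alg : (1 : Matrix κ κ R).map π = 1 := Matrix.map_one π (map_zero π) (map_one π)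

omit [DecidableEq κ] in
lemma pullTensor_apply (S : Matrix κ κ R) (i j : κ) :
    pullTensor π J S i j = ∑ a, ∑ b, J a i * J b j * π (S a b) := by
  simp only [pullTensor, Matrix.mul_apply, Matrix.transpose_apply, Matrix.map_apply,
    Finset.sum_mul]
  rw [Finset.sum_comm]
  exact Finset.sum_congr rfl fun a _ => Finset.sum_congr rfl fun b _ => by ring

omit [DecidableEq κ] in
lemma pullTensor_isSymm {S : Matrix κ κ R} (hS : S.IsSymm) : (pullTensor π J S).IsSymm := by
  have : (S.map π).IsSymm := hS.map π
  rw [Matrix.IsSymm, pullTensor, Matrix.transpose_mul, Matrix.transpose_mul,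
    Matrix.transpose_transpose, this.eq, Matrix.mul_assoc]

namespace IsCoordChange

lemma inv' (h : IsCoordChange π D D' J Ji) : Ji * J = 1 := mul_eq_one_comm.mp h.inv

lemma pull_mul_pullInv (h : IsCoordChange π D D' J Ji) {g gi : Matrix κ κ R} (hg : g * gi = 1) :
    pullTensor π J g * pullInv π Ji gi = 1 := by
  have e : g.map π * gi.map π = 1 := by rw [← map_mul_alg, hg, map_one_alg]
  have e2 : J.transpose * Ji.transpose = 1 := by
    rw [← Matrix.transpose_mul, h.inv', Matrix.transpose_one]
  calc _ = J.transpose * (g.map π * (J * Ji) * gi.map π) * Ji.transpose := by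
        simp only [pullTensor, pullInv, Matrix.mul_assoc]
    _ = 1 := by rw [h.inv, Matrix.mul_one, e, Matrix.mul_one, e2]

/-- The pullback of a connection matrix. -/
def pullConn (π : R →ₐ[ℝ] R') (J : Matrix κ κ R') (Γ : κ → κ → κ → R) (i : κ) : Matrix κ κ R' :=
  ∑ a, J a i • (conn Γ a).map π

lemma dMat_map (h : IsCoordChange π D D' J Ji) (i : κ) (A : Matrix κ κ R) :
    dMat (D' i) (A.map π) = ∑ a, J a i • (dMat (D a) A).map π := by
  ext k l
  simp [h.chain, Matrix.sum_apply]

/-- The transformation law of the Christoffel symbols, as a gauge transformation. -/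
lemma mul_conn_chr (h : IsCoordChange π D D' J Ji) {g gi : Matrix κ κ R} (hg : g.IsSymm)
    (hgi : g * gi = 1) (i : κ) :
    J * conn (chr D' (pullTensor π J g) (pullInv π Ji gi)) i
      = pullConn π J (chr D g gi) i * J + dMat (D' i) J := by
  set Γ := chr D g gi with hΓ
  set G : κ → κ → κ → R' := fun k i j => (Ji * (pullConn π J Γ i * J + dMat (D' i) J)) k j with hG
  have hconn : ∀ i, conn G i = Ji * (pullConn π J Γ i * J + dMat (D' i) J) := fun i => rfl
  have hJG : ∀ i, J * conn G i = pullConn π J Γ i * J + dMat (D' i) J := fun i => by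
    rw [hconn, ← Matrix.mul_assoc, h.inv, Matrix.one_mul]
  suffices hs : G = chr D' (pullTensor π J g) (pullInv π Ji gi) by rw [← hs, hJG]
  refine chr_unique (pullTensor_isSymm hg) (h.pull_mul_pullInv hgi) G ?_ ?_
  · intro k i j
    simp only [hG]
    rw [Matrix.mul_apply, Matrix.mul_apply]
    refine Finset.sum_congr rfl fun a _ => ?_
    congr 1
    simp only [Matrix.add_apply, dMat_apply, h.jac i j a]
    congr 1
    simp only [Matrix.mul_apply, pullConn, Matrix.sum_apply, Matrix.smul_apply, Matrix.map_apply,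
      conn_apply, smul_eq_mul, Finset.sum_mul]
    rw [Finset.sum_comm]
    refine Finset.sum_congr rfl fun b _ => Finset.sum_congr rfl fun c _ => ?_
    rw [hΓ, chr_symm hg a b c]; ring
  · intro i
    have e1 : dMat (D' i) (g.map π)
        = (pullConn π J Γ i).transpose * g.map π + g.map π * pullConn π J Γ i := by
      rw [h.dMat_map, pullConn, Matrix.transpose_sum, Matrix.sum_mul, Matrix.mul_sum,
        ← Finset.sum_add_distrib]
      refine Finset.sum_congr rfl fun a _ => ?_
      rw [dMat_metric hg hgi a, ← hΓ, Matrix.map_add _ (map_add π), map_mul_alg, map_mul_alg,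
        Matrix.transpose_smul, Matrix.smul_mul, Matrix.mul_smul, ← smul_add]
      rfl
    have e2 : (conn G i).transpose * J.transpose
        = J.transpose * (pullConn π J Γ i).transpose + (dMat (D' i) J).transpose := by
      rw [← Matrix.transpose_mul, hJG, Matrix.transpose_add, Matrix.transpose_mul]
    calc dMat (D' i) (pullTensor π J g)
        = (J.transpose * (pullConn π J Γ i).transpose + (dMat (D' i) J).transpose) * g.map π * J
          + J.transpose * g.map π * (pullConn π J Γ i * J + dMat (D' i) J) := by
          rw [pullTensor, dMat_mul, dMat_mul, e1, dMat_transpose]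
          noncomm_ring
      _ = _ := by
          rw [← e2, ← hJG, pullTensor]
          simp only [Matrix.mul_assoc]

/-- The curvature is tensorial. -/
lemma mul_curv_chr (h : IsCoordChange π D D' J Ji) {g gi : Matrix κ κ R} (hg : g.IsSymm)
    (hgi : g * gi = 1) (i j : κ) :
    J * curv D' (chr D' (pullTensor π J g) (pullInv π Ji gi)) i j
      = (∑ a, ∑ b, (J a i * J b j) • (curv D (chr D g gi) a b).map π) * J := by
  have hJ := h.mul_conn_chr hg hgi
  set Γ := chr D g gi with hΓ
  set Γ' := chr D' (pullTensor π J g) (pullInv π Ji gi) with hΓ'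
  set A := pullConn π J Γ with hA
  have hd : ∀ i j, dMat (D' i) J * conn Γ' j + J * dMat (D' i) (conn Γ' j)
      = dMat (D' i) (A j) * J + A j * dMat (D' i) J + dMat (D' i) (dMat (D' j) J) := fun i j => by
    rw [← dMat_mul, hJ, dMat_add, dMat_mul]
  have hc : dMat (D' i) (dMat (D' j) J) = dMat (D' j) (dMat (D' i) J) := by
    ext; simp [h.comm i j]
  have hF : J * curv D' Γ' i j
      = (dMat (D' i) (A j) - dMat (D' j) (A i) + A i * A j - A j * A i) * J := by
    have e1 : J * curv D' Γ' i j = J * dMat (D' i) (conn Γ' j) - J * dMat (D' j) (conn Γ' i)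
        + (J * conn Γ' i) * conn Γ' j - (J * conn Γ' j) * conn Γ' i := by
      rw [curv]; noncomm_ring
    rw [e1, hJ i, hJ j]
    have e2 : J * dMat (D' i) (conn Γ' j) = dMat (D' i) (A j) * J + A j * dMat (D' i) J
        + dMat (D' i) (dMat (D' j) J) - dMat (D' i) J * conn Γ' j := by rw [← hd]; abel
    have e3 : J * dMat (D' j) (conn Γ' i) = dMat (D' j) (A i) * J + A i * dMat (D' j) J
        + dMat (D' i) (dMat (D' j) J) - dMat (D' j) J * conn Γ' i := by rw [hc, ← hd]; abel
    rw [e2, e3]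
    have e4 : (A i * J + dMat (D' i) J) * conn Γ' j
        = A i * (A j * J + dMat (D' j) J) + dMat (D' i) J * conn Γ' j := by
      rw [← hJ j]; noncomm_ring
    have e5 : (A j * J + dMat (D' j) J) * conn Γ' i
        = A j * (A i * J + dMat (D' i) J) + dMat (D' j) J * conn Γ' i := by
      rw [← hJ i]; noncomm_ring
    rw [e4, e5]
    noncomm_ring
  have hdA : ∀ i j, dMat (D' i) (A j) = ∑ a, D' i (J a j) • (conn Γ a).map π
      + ∑ a, ∑ b, (J a i * J b j) • (dMat (D a) (conn Γ b)).map π := by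
    intro i j
    ext k l
    simp only [hA, pullConn, dMat_apply, Matrix.sum_apply, Matrix.smul_apply, Matrix.map_apply,
      smul_eq_mul, map_sum, Derivation.leibniz, h.chain, Matrix.add_apply, Finset.sum_add_distrib]
    rw [add_comm]
    congr 1
    · exact Finset.sum_congr rfl fun a _ => by ring
    · simp only [Finset.mul_sum]
      rw [Finset.sum_comm]
      exact Finset.sum_congr rfl fun a _ => Finset.sum_congr rfl fun b _ => by ring
  have hAA : ∀ i j, A i * A j = ∑ a, ∑ b, (J a i * J b j) • (conn Γ a * conn Γ b).map π := by
    intro i j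
    simp only [hA, pullConn, Matrix.sum_mul, Matrix.mul_sum, Matrix.smul_mul, Matrix.mul_smul,
      Finset.smul_sum, smul_smul, map_mul_alg]
    rw [Finset.sum_comm]
    exact Finset.sum_congr rfl fun a _ => Finset.sum_congr rfl fun b _ => by rw [mul_comm (J b j)]
  have hsw : ∀ X : κ → κ → Matrix κ κ R', ∑ a, ∑ b, (J a j * J b i) • X a b
      = ∑ a, ∑ b, (J a i * J b j) • X b a := by
    intro X
    rw [Finset.sum_comm]
    exact Finset.sum_congr rfl fun a _ => Finset.sum_congr rfl fun b _ => by rw [mul_comm]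
  have hj : ∑ a, D' i (J a j) • (conn Γ a).map π = ∑ a, D' j (J a i) • (conn Γ a).map π :=
    Finset.sum_congr rfl fun a _ => by rw [h.jac]
  rw [hF, hdA, hdA, hAA, hAA, hj, hsw, hsw]
  congr 1
  simp only [curv, Matrix.map_add _ (map_add π), Matrix.map_sub _ (map_sub π), smul_add, smul_sub,
    Finset.sum_add_distrib, Finset.sum_sub_distrib]
  abel

/-- The Ricci tensor is tensorial. -/
lemma ric_pull (h : IsCoordChange π D D' J Ji) {g gi : Matrix κ κ R} (hg : g.IsSymm)
    (hgi : g * gi = 1) (i j : κ) :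
    ric D' (chr D' (pullTensor π J g) (pullInv π Ji gi)) i j
      = pullTensor π J (Matrix.of (ric D (chr D g gi))) i j := by
  have hc := fun k => h.mul_curv_chr hg hgi k j
  have hs := chr_symm (D := D) (Hi := gi) hg
  have hs' := chr_symm (D := D') (Hi := pullInv π Ji gi) (pullTensor_isSymm (π := π) (J := J) hg)
  rw [ric_eq_curv _ hs', pullTensor_apply]
  set Γ := chr D g gi with hΓ
  set Γ' := chr D' (pullTensor π J g) (pullInv π Ji gi) with hΓ'
  have hc2 : ∀ k, curv D' Γ' k j
      = Ji * ((∑ a, ∑ b, (J a k * J b j) • (curv D Γ a b).map π) * J) := fun k => by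
    rw [← hc, ← Matrix.mul_assoc, h.inv', Matrix.one_mul]
  have hc3 : ∀ k, curv D' Γ' k j k i
      = ∑ p, ∑ a, ∑ b, ∑ c, Ji k p * J a k * (J b j * J c i * π (curv D Γ a b p c)) := by
    intro k
    rw [hc2, Matrix.mul_apply]
    refine Finset.sum_congr rfl fun p _ => ?_
    simp only [Matrix.sum_mul, Matrix.sum_apply, Matrix.smul_mul, Matrix.smul_apply,
      Matrix.mul_apply, Matrix.map_apply, smul_eq_mul, Finset.mul_sum, Finset.sum_mul]
    rw [Finset.sum_comm]
    refine Finset.sum_congr rfl fun a _ => ?_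
    rw [Finset.sum_comm]
    exact Finset.sum_congr rfl fun b _ => Finset.sum_congr rfl fun c _ => by ring
  simp only [hc3]
  rw [Finset.sum_comm]
  have hJ : ∀ a p, ∑ k, Ji k p * J a k = if a = p then 1 else 0 := by
    intro a p
    rw [← Matrix.one_apply, ← h.inv, Matrix.mul_apply]
    exact Finset.sum_congr rfl fun k _ => by ring
  have e1 : ∀ p, ∑ k, ∑ a, ∑ b, ∑ c, Ji k p * J a k * (J b j * J c i * π (curv D Γ a b p c))
      = ∑ b, ∑ c, J b j * J c i * π (curv D Γ p b p c) := by
    intro p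
    rw [Finset.sum_comm]
    have : ∀ a, ∑ k, ∑ b, ∑ c, Ji k p * J a k * (J b j * J c i * π (curv D Γ a b p c))
        = (if a = p then 1 else 0) * ∑ b, ∑ c, J b j * J c i * π (curv D Γ a b p c) := by
      intro a
      rw [← hJ, Finset.sum_mul]
      simp only [Finset.mul_sum]
    simp only [this, ite_mul, one_mul, zero_mul, Finset.sum_ite_eq', Finset.mem_univ, if_true]
  simp only [e1, Matrix.of_apply]
  rw [Finset.sum_comm]
  have e2 : ∀ a b, π (ric D Γ a b) = ∑ p, π (curv D Γ p b p a) := fun a b => by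
    rw [ric_eq_curv Γ hs, map_sum]
  simp only [e2]
  rw [Finset.sum_congr rfl fun b (_ : b ∈ Finset.univ) => Finset.sum_comm, Finset.sum_comm]
  refine Finset.sum_congr rfl fun a _ => Finset.sum_congr rfl fun b _ => ?_
  rw [Finset.mul_sum]
  exact Finset.sum_congr rfl fun p _ => by ring

/-- The Hessian is tensorial. -/
lemma hess_pull (h : IsCoordChange π D D' J Ji) {g gi : Matrix κ κ R} (hg : g.IsSymm)
    (hgi : g * gi = 1) (u : R) (i j : κ) :
    hess D' (chr D' (pullTensor π J g) (pullInv π Ji gi)) (π u) i j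
      = pullTensor π J (Matrix.of (hess D (chr D g gi) u)) i j := by
  have hJ := h.mul_conn_chr hg hgi i
  set Γ := chr D g gi with hΓ
  set Γ' := chr D' (pullTensor π J g) (pullInv π Ji gi) with hΓ'
  have hJ' : ∀ a, ∑ k, J a k * Γ' k i j = ∑ b, ∑ c, J c i * J b j * π (Γ a c b) + D' i (J a j) := by
    intro a
    have := congrFun (congrFun hJ a) j
    simp only [Matrix.mul_apply, conn_apply, Matrix.add_apply, dMat_apply, pullConn,
      Matrix.sum_apply, Matrix.smul_apply, Matrix.map_apply, smul_eq_mul, Finset.sum_mul] at this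
    rw [this]
    congr 1
    rw [Finset.sum_comm]
    exact Finset.sum_congr rfl fun a _ => Finset.sum_congr rfl fun b _ => by ring
  have e1 : ∑ k, Γ' k i j * ∑ a, J a k * π (D a u)
      = ∑ a, (∑ b, ∑ c, J c i * J b j * π (Γ a c b) + D' i (J a j)) * π (D a u) := by
    simp only [Finset.mul_sum, ← hJ', Finset.sum_mul]
    rw [Finset.sum_comm]
    exact Finset.sum_congr rfl fun a _ => Finset.sum_congr rfl fun b _ => by ring
  rw [hess, h.chain, pullTensor_apply]
  simp only [h.chain]
  rw [e1]
  simp only [h.chain, map_sum, Derivation.leibniz, smul_eq_mul, Matrix.of_apply, hess, map_sub,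
    map_mul, mul_sub, Finset.sum_sub_distrib, Finset.sum_add_distrib, add_mul, Finset.sum_mul,
    Finset.mul_sum]
  have e2 : ∑ a, ∑ b, J b j * (J a i * π (D a (D b u)))
      = ∑ a, ∑ b, J a i * J b j * π (D a (D b u)) :=
    Finset.sum_congr rfl fun a _ => Finset.sum_congr rfl fun b _ => by ring
  have e3 : ∑ a, π (D a u) * D' i (J a j) = ∑ a, D' i (J a j) * π (D a u) :=
    Finset.sum_congr rfl fun a _ => by ring
  have e4 : ∑ a, ∑ b, ∑ c, J c i * J b j * π (Γ a c b) * π (D a u)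
      = ∑ a, ∑ b, ∑ c, J a i * J b j * (π (Γ c a b) * π (D c u)) := by
    rw [Finset.sum_congr rfl fun a (_ : a ∈ Finset.univ) => Finset.sum_comm, Finset.sum_comm]
    refine Finset.sum_congr rfl fun a _ => ?_
    rw [Finset.sum_comm]
    exact Finset.sum_congr rfl fun b _ => Finset.sum_congr rfl fun c _ => by ring
  rw [Finset.sum_comm, e2, e3, e4]
  ring

end IsCoordChange
end ChangeOfCoordinates

/-! ### The modified equations -/

section Modified

variable {R R' κ : Type*} [CommRing R] [Algebra ℝ R] [CommRing R'] [Algebra ℝ R'] [Fintype κ]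

/-- The tangential Ricci equations, modified by a multiple of `ρ P_∞∞ g`. With the factor
`c = 2 / (d + m)` the weighted trace of the modified equations can be solved at every order, also at
the critical one. -/
def modTan (D : κ → Derivation ℝ R R) (δ : Derivation ℝ R R) (ρ : R) (g gi : Matrix κ κ R)
    (f fi : R) (m c : ℝ) (i j : κ) : R :=
  tanRic D δ ρ g gi f fi m i j + algebraMap ℝ R c * ρ * radRic δ g gi f fi m * g i j

/-- The scalar equation, with the opposite sign, modified by a multiple of `ρ P_∞∞ f²`. -/
def modScal (D : κ → Derivation ℝ R R) (δ : Derivation ℝ R R) (ρ : R) (g gi : Matrix κ κ R)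
    (f fi : R) (m μ c : ℝ) : R :=
  -ambScalar D δ ρ g gi f fi m μ + algebraMap ℝ R c * ρ * radRic δ g gi f fi m * f ^ 2

variable [DecidableEq κ]
variable {π : R →ₐ[ℝ] R'} {D : κ → Derivation ℝ R R} {D' : κ → Derivation ℝ R' R'}
  {J Ji : Matrix κ κ R'} {δ : Derivation ℝ R R} {δ' : Derivation ℝ R' R'}

omit [Algebra ℝ R] [DecidableEq κ] in
lemma sum_mul_eq_trace (X Y : Matrix κ κ R) :
    ∑ k, ∑ l, X k l * Y k l = (X.transpose * Y).trace := by
  simp only [Matrix.trace, Matrix.diag_apply, Matrix.mul_apply, Matrix.transpose_apply]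
  rw [Finset.sum_comm]

namespace IsCoordChange

lemma inv_transpose (h : IsCoordChange π D D' J Ji) : Ji.transpose * J.transpose = 1 := by
  rw [← Matrix.transpose_mul, h.inv, Matrix.transpose_one]

/-- Full contractions are invariant. -/
lemma contract_pull (h : IsCoordChange π D D' J Ji) (gi S : Matrix κ κ R) :
    ∑ k, ∑ l, pullInv π Ji gi k l * pullTensor π J S k l = π (∑ k, ∑ l, gi k l * S k l) := by
  have e2 : ∀ X : Matrix κ κ R, (X.map π).trace = π X.trace := fun X => by
    simp [Matrix.trace]
  rw [sum_mul_eq_trace, sum_mul_eq_trace, ← e2, map_mul_alg]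
  calc ((pullInv π Ji gi).transpose * pullTensor π J S).trace
      = (Ji * (gi.transpose.map π) * (Ji.transpose * J.transpose) * S.map π * J).trace := by
        simp only [pullInv, pullTensor, Matrix.transpose_mul, Matrix.transpose_transpose,
          Matrix.mul_assoc]
        rfl
    _ = _ := by
        rw [h.inv_transpose, Matrix.mul_one, Matrix.trace_mul_comm, ← Matrix.mul_assoc,
          ← Matrix.mul_assoc, h.inv, Matrix.one_mul]

lemma dMat_pull (hδ : ∀ x, δ' (π x) = π (δ x)) (hJ : ∀ i j, δ' (J i j) = 0) (S : Matrix κ κ R) :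
    dMat δ' (pullTensor π J S) = pullTensor π J (dMat δ S) := by
  have e1 : dMat δ' J = 0 := by ext i j; exact hJ i j
  have e2 : dMat δ' (S.map π) = (dMat δ S).map π := by ext i j; exact hδ _
  rw [pullTensor, dMat_mul, dMat_mul, dMat_transpose, e1, e2]
  simp [pullTensor]

lemma deriv_pull (hδ : ∀ x, δ' (π x) = π (δ x)) (hJ : ∀ i j, δ' (J i j) = 0) (S : Matrix κ κ R)
    (i j : κ) : δ' (pullTensor π J S i j) = pullTensor π J (dMat δ S) i j := by
  rw [← dMat_pull hδ hJ]; rfl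

lemma wTrace_pull (h : IsCoordChange π D D' J Ji) (hδ : ∀ x, δ' (π x) = π (δ x))
    (hJ : ∀ i j, δ' (J i j) = 0) (g gi : Matrix κ κ R) (f fi : R) (m : ℝ) :
    wTrace δ' (pullTensor π J g) (pullInv π Ji gi) (π f) (π fi) m = π (wTrace δ g gi f fi m) := by
  have e := h.contract_pull gi (dMat δ g)
  simp only [dMat_apply] at e
  simp only [wTrace, deriv_pull hδ hJ, e, hδ, map_add, map_mul, AlgHom.commutes, map_ofNat]

lemma radRic_pull (h : IsCoordChange π D D' J Ji) (hδ : ∀ x, δ' (π x) = π (δ x))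
    (hJ : ∀ i j, δ' (J i j) = 0) (g gi : Matrix κ κ R) (f fi : R) (m : ℝ) :
    radRic δ' (pullTensor π J g) (pullInv π Ji gi) (π f) (π fi) m = π (radRic δ g gi f fi m) := by
  have e := h.contract_pull gi (dMat δ (dMat δ g))
  simp only [dMat_apply] at e
  have e2 : ∀ X : Matrix κ κ R, (X.map π).trace = π X.trace := fun X => by
    simp [Matrix.trace]
  have e3 : (pullInv π Ji gi * pullTensor π J (dMat δ g) * pullInv π Ji gi
      * pullTensor π J (dMat δ g)).trace = π (gi * dMat δ g * gi * dMat δ g).trace := by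
    have e4 : pullInv π Ji gi * pullTensor π J (dMat δ g)
        = Ji * (gi * dMat δ g).map π * J := by
      calc _ = Ji * gi.map π * (Ji.transpose * J.transpose) * (dMat δ g).map π * J := by
            simp only [pullInv, pullTensor, Matrix.mul_assoc]
        _ = _ := by rw [h.inv_transpose, Matrix.mul_one, map_mul_alg, Matrix.mul_assoc Ji]
    rw [Matrix.mul_assoc (_ * _) (pullInv π Ji gi), e4, ← e2, Matrix.mul_assoc (gi * dMat δ g) gi,
      map_mul_alg (gi * dMat δ g)]
    calc _ = (Ji * ((gi * dMat δ g).map π * (J * Ji) * (gi * dMat δ g).map π * J)).trace := by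
          simp only [Matrix.mul_assoc]
      _ = _ := by
          rw [h.inv, Matrix.mul_one, Matrix.trace_mul_comm, Matrix.mul_assoc _ J, h.inv,
            Matrix.mul_one]
  simp only [radRic, deriv_pull hδ hJ, e, e3, dMat_pull hδ hJ, hδ, map_add, map_sub, map_neg,
    map_mul, AlgHom.commutes]

lemma beRic_pull (h : IsCoordChange π D D' J Ji) {g gi : Matrix κ κ R} (hg : g.IsSymm)
    (hgi : g * gi = 1) (f fi : R) (m : ℝ) (i j : κ) :
    beRic D' (pullTensor π J g) (pullInv π Ji gi) (π f) (π fi) m i j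
      = pullTensor π J (Matrix.of (beRic D g gi f fi m)) i j := by
  rw [beRic, h.ric_pull hg hgi, h.hess_pull hg hgi]
  simp only [pullTensor_apply, Matrix.of_apply, beRic, map_sub, map_mul, AlgHom.commutes,
    Finset.mul_sum, ← Finset.sum_sub_distrib]
  exact Finset.sum_congr rfl fun a _ => Finset.sum_congr rfl fun b _ => by ring

lemma wF_pull (h : IsCoordChange π D D' J Ji) {g gi : Matrix κ κ R} (hg : g.IsSymm)
    (hgi : g * gi = 1) (f : R) (m μ : ℝ) :
    wF D' (pullTensor π J g) (pullInv π Ji gi) (π f) m μ = π (wF D g gi f m μ) := by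
  have e1 : lap D' (pullTensor π J g) (pullInv π Ji gi) (π f) = π (lap D g gi f) := by
    simp only [lap, h.hess_pull hg hgi]
    exact h.contract_pull gi _
  have e2 : gradSq D' (pullInv π Ji gi) (π f) = π (gradSq D gi f) := by
    have e3 : ∀ i j, D' i (π f) * D' j (π f)
        = pullTensor π J (Matrix.of fun i j => D i f * D j f) i j := by
      intro i j
      rw [h.chain, h.chain, pullTensor_apply, Finset.sum_mul_sum]
      exact Finset.sum_congr rfl fun a _ => Finset.sum_congr rfl fun b _ => by
        simp only [Matrix.of_apply, map_mul]; ring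
    simp only [gradSq, mul_assoc, e3]
    exact h.contract_pull gi _
  simp only [wF, e1, e2, map_add, map_mul, map_sub, AlgHom.commutes]

lemma modTan_pull (h : IsCoordChange π D D' J Ji) (hδ : ∀ x, δ' (π x) = π (δ x))
    (hJ : ∀ i j, δ' (J i j) = 0) {g gi : Matrix κ κ R} (hg : g.IsSymm) (hgi : g * gi = 1)
    (ρ f fi : R) (m c : ℝ) (i j : κ) :
    modTan D' δ' (π ρ) (pullTensor π J g) (pullInv π Ji gi) (π f) (π fi) m c i j
      = pullTensor π J (Matrix.of (modTan D δ ρ g gi f fi m c)) i j := by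
  have e1 : ∀ i j, ∑ k, ∑ l, pullTensor π J (dMat δ g) i k * pullInv π Ji gi k l
      * pullTensor π J (dMat δ g) l j = pullTensor π J (dMat δ g * gi * dMat δ g) i j := by
    intro i j
    have e2 : pullTensor π J (dMat δ g) * pullInv π Ji gi * pullTensor π J (dMat δ g)
        = pullTensor π J (dMat δ g * gi * dMat δ g) := by
      calc _ = J.transpose * (dMat δ g).map π * (J * Ji) * gi.map π
            * (Ji.transpose * J.transpose) * (dMat δ g).map π * J := by
            simp only [pullInv, pullTensor, Matrix.mul_assoc]
        _ = _ := by
            rw [h.inv, h.inv_transpose, Matrix.mul_one, Matrix.mul_one, pullTensor, map_mul_alg,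
              map_mul_alg]
            simp only [Matrix.mul_assoc]
    rw [← e2]
    simp only [Matrix.mul_apply, Finset.sum_mul]
    rw [Finset.sum_comm]
  have e3 : ∀ a b, (dMat δ g * gi * dMat δ g) a b = ∑ k, ∑ l, δ (g a k) * gi k l * δ (g l b) := by
    intro a b
    simp only [Matrix.mul_apply, Finset.sum_mul, dMat_apply]
    rw [Finset.sum_comm]
  simp only [modTan, tanRic, h.radRic_pull hδ hJ, h.wTrace_pull hδ hJ, h.beRic_pull hg hgi,
    deriv_pull hδ hJ, e1]
  simp only [pullTensor_apply, Matrix.of_apply, modTan, tanRic, e3, dMat_apply, map_add, map_sub, map_mul,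
    AlgHom.commutes, Finset.mul_sum, Finset.sum_mul, ← Finset.sum_sub_distrib,
    ← Finset.sum_add_distrib]
  refine Finset.sum_congr rfl fun a _ => Finset.sum_congr rfl fun b _ => ?_
  simp only [map_sum, ← Finset.mul_sum, ← Finset.sum_mul, map_mul]
  ring

lemma modScal_pull (h : IsCoordChange π D D' J Ji) (hδ : ∀ x, δ' (π x) = π (δ x))
    (hJ : ∀ i j, δ' (J i j) = 0) {g gi : Matrix κ κ R} (hg : g.IsSymm) (hgi : g * gi = 1)
    (ρ f fi : R) (m μ c : ℝ) :
    modScal D' δ' (π ρ) (pullTensor π J g) (pullInv π Ji gi) (π f) (π fi) m μ c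
      = π (modScal D δ ρ g gi f fi m μ c) := by
  simp only [modScal, ambScalar, h.radRic_pull hδ hJ, h.wTrace_pull hδ hJ, h.wF_pull hg hgi, hδ,
    map_add, map_sub, map_mul, map_neg, map_pow, map_ofNat, AlgHom.commutes]

end IsCoordChange
end Modified

/-! ### Formal power series in `ρ` -/

section FormalSeries

open PowerSeries

variable {S κ : Type*} [CommRing S] [Algebra ℝ S]

/-- A derivation of the coefficients, acting on power series. -/
def psD (d : Derivation ℝ S S) : Derivation ℝ S⟦X⟧ S⟦X⟧ :=
  Derivation.mk'
    { toFun := fun p => PowerSeries.mk fun n => d (coeff n p)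
      map_add' := fun p q => by ext n; simp
      map_smul' := fun c p => by ext n; simp }
    (fun p q => by
      ext n
      simp only [LinearMap.coe_mk, AddHom.coe_mk, coeff_mk, coeff_mul, map_sum, Derivation.leibniz,
        smul_eq_mul, map_add, Finset.sum_add_distrib]
      congr 1
      rw [← Finset.Nat.sum_antidiagonal_swap]
      rfl)

@[simp] lemma coeff_psD (d : Derivation ℝ S S) (p : S⟦X⟧) (n : ℕ) :
    coeff n (psD d p) = d (coeff n p) := by
  simp [psD]

/-- The derivation `d / dX`, over the real numbers. -/
def psδ (S : Type*) [CommRing S] [Algebra ℝ S] : Derivation ℝ S⟦X⟧ S⟦X⟧ :=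
  (PowerSeries.derivative S).restrictScalars ℝ

@[simp] lemma coeff_psδ (p : S⟦X⟧) (n : ℕ) :
    coeff n (psδ S p) = coeff (n + 1) p * (n + 1) :=
  PowerSeries.coeff_derivative p n

lemma psδ_X : psδ S X = 1 := PowerSeries.derivative_X

lemma X_pow_dvd_psD (d : Derivation ℝ S S) {n : ℕ} {p : S⟦X⟧} (h : X ^ n ∣ p) :
    X ^ n ∣ psD d p := by
  rw [X_pow_dvd_iff] at h ⊢
  intro k hk
  rw [coeff_psD, h k hk, map_zero]

lemma X_pow_dvd_psδ {n : ℕ} {p : S⟦X⟧} (h : X ^ (n + 1) ∣ p) : X ^ n ∣ psδ S p := by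
  rw [X_pow_dvd_iff] at h ⊢
  intro k hk
  rw [coeff_psδ, h (k + 1) (by omega), zero_mul]

lemma X_pow_dvd_X_mul_psδ {n : ℕ} {p : S⟦X⟧} (h : X ^ n ∣ p) : X ^ n ∣ X * psδ S p := by
  cases n with
  | zero => simp
  | succ n =>
    rw [pow_succ']
    exact mul_dvd_mul_left X (X_pow_dvd_psδ h)

omit [Algebra ℝ S] in
lemma coeff_mul_of_dvd {k : ℕ} (a : S⟦X⟧) {u : S⟦X⟧} (h : X ^ k ∣ u) :
    coeff k (a * u) = coeff 0 a * coeff k u := by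
  obtain ⟨w, rfl⟩ := h
  rw [show a * (X ^ k * w) = X ^ k * (a * w) by ring]
  have e : ∀ b : S⟦X⟧, coeff k (X ^ k * b) = coeff 0 b := fun b => by
    simpa using coeff_X_pow_mul b k 0
  rw [e, e]
  simp

variable [Fintype κ] [DecidableEq κ]

section Linearization

variable {A : Type*} [CommRing A]

/-- In a quotient ring: if `x a = x a'` and `x b = x b'` then `x a b = x a' b'`. -/
lemma mul_congr_left {x a a' b b' : A} (ha : x * a = x * a') (hb : x * b = x * b') :
    x * (a * b) = x * (a' * b') := by
  linear_combination b * ha + a' * hb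

end Linearization

variable (D : κ → Derivation ℝ S S) {g g' gi gi' : Matrix κ κ S⟦X⟧} {f f' fi fi' : S⟦X⟧}

/-- The weighted trace of the change of the coefficient of order `k + 1`. -/
def coeffTrace (k : ℕ) (g g' gi : Matrix κ κ S⟦X⟧) (f f' fi : S⟦X⟧) (m : ℝ) : S :=
  ∑ a, ∑ b, coeff 0 (gi a b) * coeff (k + 1) (g' a b - g a b)
    + 2 * algebraMap ℝ S m * coeff 0 fi * coeff (k + 1) (f' - f)

/-- Two invertible pairs `(g, f)`, `(g', f')` of series whose coefficients of order at most `k`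
agree. -/
structure AgreeTo (k : ℕ) (g g' gi gi' : Matrix κ κ S⟦X⟧) (f f' fi fi' : S⟦X⟧) : Prop where
  hgi : g * gi = 1
  hgi' : g' * gi' = 1
  hf : f * fi = 1
  hf' : f' * fi' = 1
  hg : ∀ i j, X ^ (k + 1) ∣ g' i j - g i j
  hff : X ^ (k + 1) ∣ f' - f

namespace AgreeTo

variable {D} {k : ℕ}

/-- The linearization modulo `X ^ (k + 1)` of the modified equations. Only the terms with a
`ρ`-derivative not multiplied by `ρ`, and those with two `ρ`-derivatives, contribute. -/
lemma dvd_modified (h : AgreeTo k g g' gi gi' f f' fi fi') (m μ c : ℝ) :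
    (∀ i j, X ^ (k + 1) ∣
      modTan (fun i => psD (D i)) (psδ S) X g' gi' f' fi' m c i j
      - modTan (fun i => psD (D i)) (psδ S) X g gi f fi m c i j
      - (X * psδ S (psδ S (g' i j - g i j))
        - algebraMap ℝ S⟦X⟧ ((Fintype.card κ + m) / 2 - 1) * psδ S (g' i j - g i j)
        - algebraMap ℝ S⟦X⟧ (1 / 2) * (∑ a, ∑ b, gi a b * psδ S (g' a b - g a b)
            + 2 * algebraMap ℝ S⟦X⟧ m * fi * psδ S (f' - f)) * g i j
        - algebraMap ℝ S⟦X⟧ (c / 2) * (∑ a, ∑ b, gi a b * (X * psδ S (psδ S (g' a b - g a b)))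
            + 2 * algebraMap ℝ S⟦X⟧ m * fi * (X * psδ S (psδ S (f' - f)))) * g i j)) ∧
    X ^ (k + 1) ∣
      modScal (fun i => psD (D i)) (psδ S) X g' gi' f' fi' m μ c
      - modScal (fun i => psD (D i)) (psδ S) X g gi f fi m μ c
      - (2 * f * (X * psδ S (psδ S (f' - f)))
        - algebraMap ℝ S⟦X⟧ (Fintype.card κ + m - 2) * f * psδ S (f' - f)
        - algebraMap ℝ S⟦X⟧ (1 / 2) * (∑ a, ∑ b, gi a b * psδ S (g' a b - g a b)
            + 2 * algebraMap ℝ S⟦X⟧ m * fi * psδ S (f' - f)) * f ^ 2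
        - algebraMap ℝ S⟦X⟧ (c / 2) * (∑ a, ∑ b, gi a b * (X * psδ S (psδ S (g' a b - g a b)))
            + 2 * algebraMap ℝ S⟦X⟧ m * fi * (X * psδ S (psδ S (f' - f)))) * f ^ 2) := by
  set q := Ideal.Quotient.mk (Ideal.span {(X : S⟦X⟧) ^ (k + 1)}) with hq
  have q_eq : ∀ a b : S⟦X⟧, q a = q b ↔ X ^ (k + 1) ∣ a - b := fun a b => by
    rw [hq, Ideal.Quotient.eq, Ideal.mem_span_singleton]
  have hD : ∀ i a b, q a = q b → q (psD (D i) a) = q (psD (D i) b) := by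
    intro i a b hab
    rw [q_eq] at hab ⊢
    rw [← map_sub]; exact X_pow_dvd_psD _ hab
  have hδ : ∀ a b, q a = q b → q X * q (psδ S a) = q X * q (psδ S b) := by
    intro a b hab
    rw [q_eq] at hab
    rw [← map_mul, ← map_mul, q_eq, ← mul_sub, ← map_sub]; exact X_pow_dvd_X_mul_psδ hab
  have hgq : ∀ i j, q (g' i j) = q (g i j) := fun i j => (q_eq _ _).2 (h.hg i j)
  have hfq : q f' = q f := (q_eq _ _).2 h.hff
  have hfiq : q fi' = q fi := by
    have e1 := congrArg q h.hf
    have e2 := congrArg q h.hf'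
    rw [map_mul, map_one] at e1 e2
    rw [hfq] at e2
    linear_combination q fi * e2 - q fi' * e1
  have hgiq : ∀ i j, q (gi' i j) = q (gi i j) := by
    have e1 : (gi'.map q) = gi.map q := by
      have e2 : g.map q * gi.map q = 1 := by
        rw [← Matrix.map_mul, h.hgi, Matrix.map_one _ (map_zero q) (map_one q)]
      have e3 : g.map q * gi'.map q = 1 := by
        have : g'.map q = g.map q := by ext i j; exact hgq i j
        rw [← this, ← Matrix.map_mul, h.hgi', Matrix.map_one _ (map_zero q) (map_one q)]
      have e4 : gi.map q * g.map q = 1 := mul_eq_one_comm.mp e2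
      calc gi'.map q = (gi.map q * g.map q) * gi'.map q := by rw [e4, Matrix.one_mul]
        _ = gi.map q := by rw [Matrix.mul_assoc, e3, Matrix.mul_one]
    intro i j
    exact congrFun (congrFun e1 i) j
  -- terms without `ρ`-derivatives
  have hDg : ∀ i a b, q (psD (D i) (g' a b)) = q (psD (D i) (g a b)) :=
    fun i a b => hD i _ _ (hgq a b)
  have hDf : ∀ i, q (psD (D i) f') = q (psD (D i) f) := fun i => hD i _ _ hfq
  have hDDf : ∀ i j, q (psD (D i) (psD (D j) f')) = q (psD (D i) (psD (D j) f)) :=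
    fun i j => hD i _ _ (hDf j)
  have hchr : ∀ a i j, q (chr (fun i => psD (D i)) g' gi' a i j)
      = q (chr (fun i => psD (D i)) g gi a i j) := by
    intro a i j
    simp only [chr, map_mul, map_sum, map_add, map_sub, hgiq, hDg]
  have hhess : ∀ i j, q (hess (fun i => psD (D i)) (chr (fun i => psD (D i)) g' gi') f' i j)
      = q (hess (fun i => psD (D i)) (chr (fun i => psD (D i)) g gi) f i j) := by
    intro i j
    simp only [hess, map_mul, map_sum, map_sub, hchr, hDf, hDDf]
  have hDchr : ∀ l a i j, q (psD (D l) (chr (fun i => psD (D i)) g' gi' a i j))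
      = q (psD (D l) (chr (fun i => psD (D i)) g gi a i j)) := fun l a i j => hD l _ _ (hchr a i j)
  have hbe : ∀ i j, q (beRic (fun i => psD (D i)) g' gi' f' fi' m i j)
      = q (beRic (fun i => psD (D i)) g gi f fi m i j) := by
    intro i j
    simp only [beRic, ric, map_mul, map_sum, map_sub, map_add, hchr, hhess, hfiq,
      hDchr]
  have hwF : q (wF (fun i => psD (D i)) g' gi' f' m μ)
      = q (wF (fun i => psD (D i)) g gi f m μ) := by
    simp only [wF, lap, gradSq, map_mul, map_sum, map_sub, map_add, hhess, hfq, hgiq, hDf]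
  -- terms with `ρ`-derivatives
  have hδg : ∀ a b, q X * q (psδ S (g' a b)) = q X * q (psδ S (g a b)) :=
    fun a b => hδ _ _ (hgq a b)
  have hδf : q X * q (psδ S f') = q X * q (psδ S f) := hδ _ _ hfq
  have hw : q X * q (wTrace (psδ S) g' gi' f' fi' m) = q X * q (wTrace (psδ S) g gi f fi m) := by
    simp only [wTrace, map_add, map_mul, map_sum, hgiq, hfiq, mul_add, Finset.mul_sum]
    congr 1
    · exact Finset.sum_congr rfl fun a _ => Finset.sum_congr rfl fun b _ => by
        linear_combination q (gi a b) * hδg a b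
    · linear_combination q 2 * q (algebraMap ℝ S⟦X⟧ m) * q fi * hδf
  have hw2 : q (wTrace (psδ S) g' gi' f' fi' m) = q (wTrace (psδ S) g gi f fi m)
      + q (∑ a, ∑ b, gi a b * psδ S (g' a b - g a b)
            + 2 * algebraMap ℝ S⟦X⟧ m * fi * psδ S (f' - f)) := by
    simp only [wTrace, map_add, map_mul, map_sum, map_sub, hgiq, hfiq, mul_sub,
      Finset.sum_sub_distrib]
    ring
  have htr : q X * q (gi' * dMat (psδ S) g' * gi' * dMat (psδ S) g').trace
      = q X * q (gi * dMat (psδ S) g * gi * dMat (psδ S) g).trace := by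
    have e1 : ∀ (G Gi : Matrix κ κ S⟦X⟧), (Gi * dMat (psδ S) G * Gi * dMat (psδ S) G).trace
        = ∑ x, ∑ y, (Gi * dMat (psδ S) G) x y * (Gi * dMat (psδ S) G) y x := by
      intro G Gi
      rw [Matrix.mul_assoc (Gi * dMat (psδ S) G)]
      simp only [Matrix.trace, Matrix.diag_apply]
      exact Finset.sum_congr rfl fun x _ => Matrix.mul_apply
    have e2 : ∀ x y, q X * q ((gi' * dMat (psδ S) g') x y) = q X * q ((gi * dMat (psδ S) g) x y) := by
      intro x y
      simp only [Matrix.mul_apply, dMat_apply, map_sum, map_mul, hgiq, Finset.mul_sum]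
      exact Finset.sum_congr rfl fun z _ => by linear_combination q (gi x z) * hδg z y
    rw [e1, e1]
    simp only [map_sum, map_mul, Finset.mul_sum]
    exact Finset.sum_congr rfl fun x _ => Finset.sum_congr rfl fun y _ =>
      mul_congr_left (e2 x y) (e2 y x)
  have hq4 : q (algebraMap ℝ S⟦X⟧ m) = q (algebraMap ℝ S⟦X⟧ (1 / 2))
      * (2 * q (algebraMap ℝ S⟦X⟧ m)) := by
    have := congrArg q (half_mul_two (R := S⟦X⟧))
    rw [map_mul, map_one, map_ofNat] at this
    linear_combination -(q (algebraMap ℝ S⟦X⟧ m)) * this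
  have hrad : q X * q (radRic (psδ S) g' gi' f' fi' m) = q X * q (radRic (psδ S) g gi f fi m)
      - q (algebraMap ℝ S⟦X⟧ (1 / 2))
        * q (∑ a, ∑ b, gi a b * (X * psδ S (psδ S (g' a b - g a b)))
            + 2 * algebraMap ℝ S⟦X⟧ m * fi * (X * psδ S (psδ S (f' - f)))) := by
    have e1 : ∀ Y : κ → κ → S⟦X⟧, q (∑ a, ∑ b, gi a b * (X * Y a b))
        = q X * q (∑ a, ∑ b, gi a b * Y a b) := by
      intro Y
      rw [← map_mul, Finset.mul_sum]
      congr 1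
      refine Finset.sum_congr rfl fun a _ => ?_
      rw [Finset.mul_sum]
      exact Finset.sum_congr rfl fun b _ => by ring
    rw [map_add q (∑ a, ∑ b, _), e1]
    simp only [radRic, map_add, map_sub, map_neg, map_mul, mul_sub, mul_add, Finset.sum_sub_distrib,
      map_sum, hgiq, hfiq, map_ofNat]
    linear_combination q (algebraMap ℝ S⟦X⟧ (1 / 4)) * htr
      - q X * q fi * (q (psδ S (psδ S f')) - q (psδ S (psδ S f))) * hq4
  have hch : q (algebraMap ℝ S⟦X⟧ (c / 2)) = q (algebraMap ℝ S⟦X⟧ c)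
      * q (algebraMap ℝ S⟦X⟧ (1 / 2)) := by
    rw [← map_mul, ← map_mul]; congr 2; ring
  set W := ∑ a, ∑ b, gi a b * psδ S (g' a b - g a b)
            + 2 * algebraMap ℝ S⟦X⟧ m * fi * psδ S (f' - f) with hW
  set W2 := ∑ a, ∑ b, gi a b * (X * psδ S (psδ S (g' a b - g a b)))
            + 2 * algebraMap ℝ S⟦X⟧ m * fi * (X * psδ S (psδ S (f' - f))) with hW2
  constructor
  · intro i j
    rw [← q_eq]
    have hquad : q X * q (∑ a, ∑ b, psδ S (g' i a) * gi' a b * psδ S (g' b j))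
        = q X * q (∑ a, ∑ b, psδ S (g i a) * gi a b * psδ S (g b j)) := by
      simp only [map_sum, map_mul, hgiq, Finset.mul_sum]
      refine Finset.sum_congr rfl fun a _ => Finset.sum_congr rfl fun b _ => ?_
      linear_combination q (gi a b) * mul_congr_left (hδg i a) (hδg b j)
    have hwg := mul_congr_left hw (hδg i j)
    simp only [modTan, tanRic, map_sub, map_add, map_mul, hbe, hch, hgq, hw2]
    rw [hw2] at hwg
    linear_combination -hquad + q (algebraMap ℝ S⟦X⟧ (1 / 2)) * hwg
      + q (algebraMap ℝ S⟦X⟧ c) * q (g i j) * hrad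
  · rw [← q_eq]
    have hff := mul_congr_left hδf hδf
    have hwf := mul_congr_left hw hδf
    simp only [modScal, ambScalar, map_sub, map_add, map_mul, map_neg, map_pow, map_ofNat, hwF, hch,
      hfq, hw2]
    rw [hw2] at hwf
    linear_combination -2 * hff + q f * hwf + q (algebraMap ℝ S⟦X⟧ c) * q f ^ 2 * hrad

omit [DecidableEq κ] [Algebra ℝ S] in
omit [Algebra ℝ S] in
lemma coeff_zero_mul (a b : S⟦X⟧) : coeff 0 (a * b) = coeff 0 a * coeff 0 b := by simp

omit [Algebra ℝ S] in
lemma coeff_zero_two : coeff 0 (2 : S⟦X⟧) = 2 :=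
  (coeff_zero_eq_constantCoeff_apply (R := S) 2).trans (map_ofNat (constantCoeff (R := S)) 2)

lemma coeff_zero_algebraMap (r : ℝ) : coeff 0 (algebraMap ℝ S⟦X⟧ r) = algebraMap ℝ S r := by
  simp [PowerSeries.algebraMap_apply]

lemma coeff_X_mul_psδ (k : ℕ) (p : S⟦X⟧) : coeff k (X * psδ S p) = k * coeff k p := by
  cases k with
  | zero => simp
  | succ k => rw [coeff_succ_X_mul, coeff_psδ]; push_cast; ring

omit [Algebra ℝ S] in
lemma dvd_and_coeff_of_dvd {k : ℕ} {P P' L : S⟦X⟧} (h : X ^ (k + 1) ∣ P' - P - L)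
    (hL : X ^ k ∣ L) : X ^ k ∣ P' - P ∧ coeff k P' - coeff k P = coeff k L := by
  constructor
  · have := dvd_add ((pow_dvd_pow X (Nat.le_succ k)).trans h) hL
    rwa [sub_add_cancel] at this
  · have := X_pow_dvd_iff.1 h k (Nat.lt_succ_self k)
    rw [map_sub, map_sub] at this
    linear_combination this

omit [DecidableEq κ] in
lemma coeff_weightedTrace (k : ℕ) (gi : Matrix κ κ S⟦X⟧) (u : κ → κ → S⟦X⟧) (fi v : S⟦X⟧) (m : ℝ)
    (hu : ∀ a b, X ^ k ∣ u a b) (hv : X ^ k ∣ v) :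
    X ^ k ∣ ∑ a, ∑ b, gi a b * u a b + 2 * algebraMap ℝ S⟦X⟧ m * fi * v ∧
    coeff k (∑ a, ∑ b, gi a b * u a b + 2 * algebraMap ℝ S⟦X⟧ m * fi * v)
      = ∑ a, ∑ b, coeff 0 (gi a b) * coeff k (u a b)
        + 2 * algebraMap ℝ S m * coeff 0 fi * coeff k v := by
  refine ⟨dvd_add (Finset.dvd_sum fun a _ => Finset.dvd_sum fun b _ => (hu a b).mul_left _)
    (hv.mul_left _), ?_⟩
  simp only [map_add, map_sum, coeff_mul_of_dvd _ (hu _ _), coeff_mul_of_dvd _ hv]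
  rw [coeff_zero_mul, coeff_zero_mul, coeff_zero_algebraMap, coeff_zero_two]

omit [DecidableEq κ] in
lemma coeff_linearization (k : ℕ) (g g' gi : Matrix κ κ S⟦X⟧) (f f' fi w r : S⟦X⟧) (m c A : ℝ)
    (hg : ∀ i j, X ^ (k + 1) ∣ g' i j - g i j) (hff : X ^ (k + 1) ∣ f' - f)
    (hw : X ^ (k + 1) ∣ w) (y : S⟦X⟧) :
    X ^ k ∣ r * (X * psδ S (psδ S w)) - algebraMap ℝ S⟦X⟧ A * r * psδ S w
        - algebraMap ℝ S⟦X⟧ (1 / 2) * (∑ a, ∑ b, gi a b * psδ S (g' a b - g a b)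
            + 2 * algebraMap ℝ S⟦X⟧ m * fi * psδ S (f' - f)) * y
        - algebraMap ℝ S⟦X⟧ (c / 2) * (∑ a, ∑ b, gi a b * (X * psδ S (psδ S (g' a b - g a b)))
            + 2 * algebraMap ℝ S⟦X⟧ m * fi * (X * psδ S (psδ S (f' - f)))) * y ∧
    coeff k (r * (X * psδ S (psδ S w)) - algebraMap ℝ S⟦X⟧ A * r * psδ S w
        - algebraMap ℝ S⟦X⟧ (1 / 2) * (∑ a, ∑ b, gi a b * psδ S (g' a b - g a b)
            + 2 * algebraMap ℝ S⟦X⟧ m * fi * psδ S (f' - f)) * y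
        - algebraMap ℝ S⟦X⟧ (c / 2) * (∑ a, ∑ b, gi a b * (X * psδ S (psδ S (g' a b - g a b)))
            + 2 * algebraMap ℝ S⟦X⟧ m * fi * (X * psδ S (psδ S (f' - f)))) * y)
      = algebraMap ℝ S ((k + 1) * (k - A)) * coeff 0 r * coeff (k + 1) w
        - algebraMap ℝ S ((k + 1) * (1 + c * k) / 2) * coeffTrace k g g' gi f f' fi m
          * coeff 0 y := by
  have hu : ∀ a b, X ^ k ∣ psδ S (g' a b - g a b) := fun a b => X_pow_dvd_psδ (hg a b)
  have hv : X ^ k ∣ psδ S (f' - f) := X_pow_dvd_psδ hff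
  have hw1 : X ^ k ∣ psδ S w := X_pow_dvd_psδ hw
  have hw2 := X_pow_dvd_X_mul_psδ hw1
  obtain ⟨d1, e1⟩ := coeff_weightedTrace k gi (fun a b => psδ S (g' a b - g a b))
    fi (psδ S (f' - f)) m hu hv
  obtain ⟨d2, e2⟩ := coeff_weightedTrace k gi
    (fun a b => X * psδ S (psδ S (g' a b - g a b)))
    fi (X * psδ S (psδ S (f' - f))) m (fun a b => X_pow_dvd_X_mul_psδ (hu a b))
    (X_pow_dvd_X_mul_psδ hv)
  simp only [coeff_X_mul_psδ, coeff_psδ] at d1 d2 e1 e2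
  have e1' : coeff k (∑ a, ∑ b, gi a b * psδ S (g' a b - g a b)
      + 2 * algebraMap ℝ S⟦X⟧ m * fi * psδ S (f' - f))
      = (k + 1) * coeffTrace k g g' gi f f' fi m := by
    rw [e1, coeffTrace]
    conv_rhs => rw [mul_add, Finset.mul_sum]
    congr 1
    · refine Finset.sum_congr rfl fun a _ => ?_
      rw [Finset.mul_sum]
      exact Finset.sum_congr rfl fun b _ => by ring
    · ring
  have e2' : coeff k (∑ a, ∑ b, gi a b * (X * psδ S (psδ S (g' a b - g a b)))
      + 2 * algebraMap ℝ S⟦X⟧ m * fi * (X * psδ S (psδ S (f' - f))))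
      = k * (k + 1) * coeffTrace k g g' gi f f' fi m := by
    rw [e2, coeffTrace]
    conv_rhs => rw [mul_add, Finset.mul_sum]
    congr 1
    · refine Finset.sum_congr rfl fun a _ => ?_
      rw [Finset.mul_sum]
      exact Finset.sum_congr rfl fun b _ => by ring
    · ring
  have e3 : ∀ (s : ℝ) (Y : S⟦X⟧), X ^ k ∣ Y → coeff k (algebraMap ℝ S⟦X⟧ s * Y * y)
      = algebraMap ℝ S s * coeff k Y * coeff 0 y := fun s Y hY => by
    rw [mul_comm (_ * Y), coeff_mul_of_dvd _ (hY.mul_left _), coeff_mul_of_dvd _ hY,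
      coeff_zero_algebraMap]; ring
  constructor
  · exact dvd_sub (dvd_sub (dvd_sub (hw2.mul_left _) (hw1.mul_left _))
      ((d1.mul_left _).mul_right _)) ((d2.mul_left _).mul_right _)
  · rw [map_sub, map_sub, map_sub, e3 _ _ d1, e3 _ _ d2, e1', e2', coeff_mul_of_dvd _ hw2,
      coeff_mul_of_dvd _ hw1, coeff_zero_mul, coeff_zero_algebraMap, coeff_X_mul_psδ, coeff_psδ]
    have e4 : algebraMap ℝ S ((k + 1) * (1 + c * k) / 2)
        = algebraMap ℝ S (1 / 2) * (k + 1) + algebraMap ℝ S (c / 2) * (k * (k + 1)) := by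
      rw [show ((k : ℝ) + 1) * (1 + c * k) / 2 = 1 / 2 * (k + 1) + c / 2 * (k * (k + 1)) by ring]
      simp only [map_add, map_mul, map_natCast, map_one]
    rw [e4]
    simp only [map_sub, map_add, map_mul, map_natCast, map_one]
    ring

/-- If two pairs agree to order `k`, then the modified equations agree to order `k - 1`, and the
coefficient of order `k` changes by a linear function of the change of the coefficient of order
`k + 1` of the pair. -/
lemma coeff_modTan (h : AgreeTo k g g' gi gi' f f' fi fi') (m c : ℝ) (i j : κ) :
    X ^ k ∣ modTan (fun i => psD (D i)) (psδ S) X g' gi' f' fi' m c i j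
      - modTan (fun i => psD (D i)) (psδ S) X g gi f fi m c i j ∧
    coeff k (modTan (fun i => psD (D i)) (psδ S) X g' gi' f' fi' m c i j)
      - coeff k (modTan (fun i => psD (D i)) (psδ S) X g gi f fi m c i j)
      = algebraMap ℝ S ((k + 1) * ((k + 1) - (Fintype.card κ + m) / 2))
          * coeff (k + 1) (g' i j - g i j)
        - algebraMap ℝ S ((k + 1) * (1 + c * k) / 2) * coeffTrace k g g' gi f f' fi m
          * coeff 0 (g i j) := by
  have h0 := (h.dvd_modified (D := D) m 0 c).1 i j
  obtain ⟨h1, h2⟩ := coeff_linearization k g g' gi f f' fi (g' i j - g i j) 1 m c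
    ((Fintype.card κ + m) / 2 - 1) h.hg h.hff (h.hg i j) (g i j)
  rw [one_mul, mul_one] at h1 h2
  obtain ⟨h3, h4⟩ := dvd_and_coeff_of_dvd h0 h1
  refine ⟨h3, h4.trans (h2.trans ?_)⟩
  rw [show coeff 0 (1 : S⟦X⟧) = 1 by simp, mul_one]
  congr 3
  ring

lemma coeff_modScal (h : AgreeTo k g g' gi gi' f f' fi fi') (m μ c : ℝ) :
    X ^ k ∣ modScal (fun i => psD (D i)) (psδ S) X g' gi' f' fi' m μ c
      - modScal (fun i => psD (D i)) (psδ S) X g gi f fi m μ c ∧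
    coeff k (modScal (fun i => psD (D i)) (psδ S) X g' gi' f' fi' m μ c)
      - coeff k (modScal (fun i => psD (D i)) (psδ S) X g gi f fi m μ c)
      = algebraMap ℝ S (2 * (k + 1) * ((k + 1) - (Fintype.card κ + m) / 2))
          * coeff 0 f * coeff (k + 1) (f' - f)
        - algebraMap ℝ S ((k + 1) * (1 + c * k) / 2) * coeffTrace k g g' gi f f' fi m
          * coeff 0 f ^ 2 := by
  have h0 := (h.dvd_modified (D := D) m μ c).2
  obtain ⟨h1, h2⟩ := coeff_linearization k g g' gi f f' fi (f' - f) (2 * f) m c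
    ((Fintype.card κ + m) / 2 - 1) h.hg h.hff h.hff (f ^ 2)
  have e : algebraMap ℝ S⟦X⟧ ((Fintype.card κ + m) / 2 - 1) * (2 * f)
      = algebraMap ℝ S⟦X⟧ (Fintype.card κ + m - 2) * f := by
    have : algebraMap ℝ S⟦X⟧ (Fintype.card κ + m - 2)
        = algebraMap ℝ S⟦X⟧ ((Fintype.card κ + m) / 2 - 1) * 2 := by
      rw [← map_ofNat (algebraMap ℝ S⟦X⟧) 2, ← map_mul]; congr 1; ring
    rw [this]; ring
  rw [e] at h1 h2
  obtain ⟨h3, h4⟩ := dvd_and_coeff_of_dvd h0 h1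
  refine ⟨h3, h4.trans (h2.trans ?_)⟩
  have e2 : coeff 0 (2 * f) = algebraMap ℝ S 2 * coeff 0 f := by
    rw [coeff_zero_mul, coeff_zero_two, map_ofNat (algebraMap ℝ S) 2]
  have e3 : coeff 0 (f ^ 2) = coeff 0 f ^ 2 := by rw [pow_two, coeff_zero_mul, pow_two]
  rw [e2, e3, ← mul_assoc, ← map_mul]
  congr 4
  ring

end AgreeTo

end FormalSeries

/-! ### Solving the linearized equations -/

section Linear

variable {S κ : Type*} [CommRing S] [Algebra ℝ S] [Fintype κ] [DecidableEq κ]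

/-- The linear map giving the change of the coefficient of order `k` of the modified tangential
equations; `n` is the weighted dimension, `σ` the weighted trace of the change of the coefficient of
order `k + 1`. -/
def linTan (n : ℝ) (k : ℕ) (G D : S) (σ : S) : S :=
  algebraMap ℝ S ((k + 1) * ((k + 1) - n / 2)) * D
    - algebraMap ℝ S ((k + 1) * (1 + 2 / n * k) / 2) * σ * G

/-- The linear map giving the change of the coefficient of order `k` of the modified scalar
equation. -/
def linScal (n : ℝ) (k : ℕ) (f δ : S) (σ : S) : S :=
  algebraMap ℝ S (2 * (k + 1) * ((k + 1) - n / 2)) * f * δ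
    - algebraMap ℝ S ((k + 1) * (1 + 2 / n * k) / 2) * σ * f ^ 2

/-- The weighted trace of a pair, for the tangential part. -/
def trPair (m : ℝ) (gi : Matrix κ κ S) (fi : S) (D : Matrix κ κ S) (δ : S) : S :=
  ∑ a, ∑ b, gi a b * D a b + 2 * algebraMap ℝ S m * fi * δ

/-- The weighted trace of a pair of equations. -/
def trEqn (m : ℝ) (gi : Matrix κ κ S) (fi : S) (O : Matrix κ κ S) (w : S) : S :=
  ∑ a, ∑ b, gi a b * O a b + algebraMap ℝ S m * fi ^ 2 * w

variable {g gi : Matrix κ κ S} {f fi : S}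

omit [Algebra ℝ S] in
lemma sum_inv_mul (hg : g.IsSymm) (h : g * gi = 1) : ∑ a, ∑ b, gi a b * g a b = Fintype.card κ := by
  have : ∑ k, ∑ l, gi k l * g k l = (gi * g).trace := by
    simp only [Matrix.trace, Matrix.diag_apply, Matrix.mul_apply]
    exact Finset.sum_congr rfl fun i _ => Finset.sum_congr rfl fun j _ => by rw [hg.apply j i]
  rw [this, mul_eq_one_comm.mp h, Matrix.trace_one]

/-- The weighted trace of the linearized equations is a nonzero multiple of the weighted trace `σ` of
the unknown, at the critical order too. -/
lemma trEqn_lin (hg : g.IsSymm) (h : g * gi = 1) (hf : f * fi = 1) {n m : ℝ}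
    (hn : n = Fintype.card κ + m) (hn0 : n ≠ 0) (k : ℕ) (D : Matrix κ κ S) (δ σ : S)
    (hσ : σ = trPair m gi fi D δ) :
    trEqn m gi fi (Matrix.of fun i j => linTan n k (g i j) (D i j) σ) (linScal n k f δ σ)
      = algebraMap ℝ S ((k + 1) * (1 - n)) * σ := by
  have e1 : ∑ a, ∑ b, gi a b * linTan n k (g a b) (D a b) σ
      = algebraMap ℝ S ((k + 1) * ((k + 1) - n / 2)) * ∑ a, ∑ b, gi a b * D a b
        - algebraMap ℝ S ((k + 1) * (1 + 2 / n * k) / 2) * σ * ∑ a, ∑ b, gi a b * g a b := by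
    simp only [linTan, Finset.mul_sum, ← Finset.sum_sub_distrib]
    exact Finset.sum_congr rfl fun a _ => Finset.sum_congr rfl fun b _ => by ring
  have e2 : algebraMap ℝ S ((k + 1) * (1 - n)) = algebraMap ℝ S ((k + 1) * ((k + 1) - n / 2))
      - algebraMap ℝ S ((k + 1) * (1 + 2 / n * k) / 2) * (Fintype.card κ + algebraMap ℝ S m) := by
    have : (Fintype.card κ + algebraMap ℝ S m : S) = algebraMap ℝ S n := by
      rw [hn, map_add, map_natCast]
    rw [this, ← map_mul, ← map_sub]; congr 1; field_simp; ring
  have e3 : algebraMap ℝ S (2 * (k + 1) * ((k + 1) - n / 2))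
      = 2 * algebraMap ℝ S ((k + 1) * ((k + 1) - n / 2)) := by
    rw [← map_ofNat (algebraMap ℝ S) 2, ← map_mul]; congr 1; ring
  simp only [trEqn, Matrix.of_apply, e1, sum_inv_mul hg h, e2]
  rw [linScal, e3]
  generalize algebraMap ℝ S ((k + 1) * ((k + 1) - n / 2)) = a at *
  generalize algebraMap ℝ S ((k + 1) * (1 + 2 / n * k) / 2) = β at *
  have e4 : fi ^ 2 * f = fi := by linear_combination fi * hf
  have e5 : fi ^ 2 * f ^ 2 = 1 := by linear_combination (1 + f * fi) * hf
  have hσ' := hσ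
  rw [trPair] at hσ'
  linear_combination algebraMap ℝ S m * 2 * a * δ * e4 - algebraMap ℝ S m * β * σ * e5 - a * hσ'

/-- The linearized equations have only the zero solution away from the critical order. -/
lemma linear_injective (hg : g.IsSymm) (h : g * gi = 1) (hf : f * fi = 1) {n m : ℝ}
    (hn : n = Fintype.card κ + m) (hn0 : n ≠ 0) (hn1 : n ≠ 1) {k : ℕ} (hk : n ≠ 2 * (k + 1))
    (D : Matrix κ κ S) (δ : S)
    (hD : ∀ i j, linTan n k (g i j) (D i j) (trPair m gi fi D δ) = 0)
    (hδ : linScal n k f δ (trPair m gi fi D δ) = 0) : (∀ i j, D i j = 0) ∧ δ = 0 := by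
  have hcancel : ∀ (r : ℝ) (x : S), r ≠ 0 → algebraMap ℝ S r * x = 0 → x = 0 := by
    intro r x hr hx
    rw [← Algebra.smul_def] at hx
    simpa [smul_smul, inv_mul_cancel₀ hr] using congrArg (r⁻¹ • ·) hx
  have h1 := trEqn_lin hg h hf hn hn0 k D δ _ rfl
  have hk1 : ((k : ℝ) + 1) ≠ 0 := by positivity
  have hσ : trPair m gi fi D δ = 0 := by
    refine hcancel _ _ (mul_ne_zero hk1 (sub_ne_zero.2 hn1.symm)) (h1.symm.trans ?_)
    simp [trEqn, hD, hδ]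
  have ha : ((k : ℝ) + 1) - n / 2 ≠ 0 := fun h0 => hk (by linarith)
  constructor
  · intro i j
    refine hcancel _ _ (mul_ne_zero hk1 ha) ?_
    simpa [linTan, hσ] using hD i j
  · have h2 : algebraMap ℝ S (2 * (k + 1) * ((k + 1) - n / 2)) * (f * δ) = 0 := by
      have := hδ
      rw [linScal, hσ] at this
      linear_combination this
    have h3 := hcancel _ _ (mul_ne_zero (mul_ne_zero two_ne_zero hk1) ha) h2
    linear_combination fi * h3 - δ * hf

/-- The weighted trace of the solution of the linearized equations with right hand side
`-(O, w)`. -/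
def solTrace (n m : ℝ) (k : ℕ) (gi : Matrix κ κ S) (fi : S) (O : Matrix κ κ S) (w : S) : S :=
  algebraMap ℝ S (1 / ((k + 1) * (n - 1))) * trEqn m gi fi O w

/-- The tensor part of the solution of the linearized equations with right hand side `-(O, w)`; at
the critical order `k + 1 = n / 2` only the weighted trace of the equations is solved. -/
def solTan (n m : ℝ) (k : ℕ) (g gi : Matrix κ κ S) (fi : S) (O : Matrix κ κ S) (w : S) :
    Matrix κ κ S :=
  if n = 2 * (k + 1) then algebraMap ℝ S (1 / n) • solTrace n m k gi fi O w • g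
  else algebraMap ℝ S (1 / ((k + 1) - n / 2)) •
    (algebraMap ℝ S ((1 + 2 / n * k) / 2) • solTrace n m k gi fi O w • g
      - algebraMap ℝ S (1 / (k + 1)) • O)

/-- The scalar part of the solution of the linearized equations with right hand side `-(O, w)`; at
the critical order `k + 1 = n / 2` only the weighted trace of the equations is solved. -/
def solScal (n m : ℝ) (k : ℕ) (gi : Matrix κ κ S) (f fi : S) (O : Matrix κ κ S) (w : S) : S :=
  if n = 2 * (k + 1) then algebraMap ℝ S (1 / (2 * n)) * solTrace n m k gi fi O w * f
  else algebraMap ℝ S (1 / (2 * ((k + 1) - n / 2))) *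
    (algebraMap ℝ S ((1 + 2 / n * k) / 2) * solTrace n m k gi fi O w * f
      - algebraMap ℝ S (1 / (k + 1)) * w * fi)

lemma trPair_sol (hg : g.IsSymm) (h : g * gi = 1) (hf : f * fi = 1) {n m : ℝ}
    (hn : n = Fintype.card κ + m) (hn0 : n ≠ 0) (hn1 : n ≠ 1) (k : ℕ)
    (O : Matrix κ κ S) (w : S) :
    trPair m gi fi (solTan n m k g gi fi O w) (solScal n m k gi f fi O w)
      = solTrace n m k gi fi O w := by
  have hk1 : ((k : ℝ) + 1) ≠ 0 := by positivity
  have hcard : (Fintype.card κ + algebraMap ℝ S m : S) = algebraMap ℝ S n := by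
    rw [hn, map_add, map_natCast]
  have hn1' : n - 1 ≠ 0 := sub_ne_zero.2 hn1
  have e1 : ∀ (p q r : S), ∑ a, ∑ b, gi a b * (r * (p * g a b - q * O a b))
      = r * (p * (∑ a, ∑ b, gi a b * g a b) - q * ∑ a, ∑ b, gi a b * O a b) := by
    intro p q r
    simp only [Finset.mul_sum, ← Finset.sum_sub_distrib]
    exact Finset.sum_congr rfl fun a _ => Finset.sum_congr rfl fun b _ => by ring
  by_cases hk : n = 2 * (k + 1)
  · have h2 : algebraMap ℝ S (1 / n) = 2 * algebraMap ℝ S (1 / (2 * n)) := by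
      rw [← map_ofNat (algebraMap ℝ S) 2, ← map_mul]; congr 1; field_simp
    have h3 : algebraMap ℝ S (1 / n) * algebraMap ℝ S n = 1 := by
      rw [← map_mul, one_div_mul_cancel hn0, map_one]
    have := e1 (solTrace n m k gi fi O w) 0 (algebraMap ℝ S (1 / n))
    simp only [trPair, solTan, solScal, if_pos hk, Matrix.smul_apply, smul_eq_mul]
    simp only [zero_mul, sub_zero] at this
    rw [this, sum_inv_mul hg h]
    rw [← hcard] at h3
    linear_combination solTrace n m k gi fi O w * h3
      + 2 * algebraMap ℝ S m * algebraMap ℝ S (1 / (2 * n)) * solTrace n m k gi fi O w * hf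
      - algebraMap ℝ S m * solTrace n m k gi fi O w * h2
  · have ha : ((k : ℝ) + 1) - n / 2 ≠ 0 := fun h0 => hk (by linarith)
    have h2 : algebraMap ℝ S (1 / ((k + 1) - n / 2))
        = 2 * algebraMap ℝ S (1 / (2 * ((k + 1) - n / 2))) := by
      rw [← map_ofNat (algebraMap ℝ S) 2, ← map_mul]; congr 1; field_simp
    simp only [trPair, solTan, solScal, if_neg hk, Matrix.smul_apply, Matrix.sub_apply, smul_eq_mul]
    have := e1 (algebraMap ℝ S ((1 + 2 / n * k) / 2) * solTrace n m k gi fi O w)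
      (algebraMap ℝ S (1 / (k + 1))) (algebraMap ℝ S (1 / ((k + 1) - n / 2)))
    simp only [mul_assoc] at this ⊢
    rw [this, sum_inv_mul hg h]
    have hω : trEqn m gi fi O w = algebraMap ℝ S ((k + 1) * (n - 1)) * solTrace n m k gi fi O w := by
      rw [solTrace, ← mul_assoc, ← map_mul, mul_one_div_cancel (mul_ne_zero hk1 hn1'), map_one,
        one_mul]
    rw [trEqn] at hω
    have h4 : algebraMap ℝ S (1 / ((k + 1) - n / 2)) * (algebraMap ℝ S ((1 + 2 / n * k) / 2)
        * algebraMap ℝ S n - algebraMap ℝ S (1 / (k + 1)) * algebraMap ℝ S ((k + 1) * (n - 1))) = 1 := by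
      simp only [← map_mul, ← map_sub]
      rw [← map_one (algebraMap ℝ S)]; congr 1
      rw [show (1 + 2 / n * k) / 2 * n - 1 / ((k : ℝ) + 1) * ((k + 1) * (n - 1))
        = (k + 1) - n / 2 by field_simp; ring]
      exact one_div_mul_cancel ha
    rw [← hcard] at h4
    generalize solTrace n m k gi fi O w = σ at *
    generalize algebraMap ℝ S (1 / ((k + 1) - n / 2)) = a at *
    generalize algebraMap ℝ S (1 / (2 * ((k + 1) - n / 2))) = a' at *
    generalize algebraMap ℝ S ((1 + 2 / n * k) / 2) = β at *
    generalize algebraMap ℝ S (1 / (k + 1)) = r at *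
    linear_combination σ * h4 - a * r * hω + 2 * algebraMap ℝ S m * a' * β * σ * hf
      - algebraMap ℝ S m * (β * σ - r * w * fi ^ 2) * h2

/-- Away from the critical order, `solTan` and `solScal` solve the linearized equations. -/
lemma lin_sol (hg : g.IsSymm) (h : g * gi = 1) (hf : f * fi = 1) {n m : ℝ}
    (hn : n = Fintype.card κ + m) (hn0 : n ≠ 0) (hn1 : n ≠ 1) {k : ℕ} (hk : n ≠ 2 * (k + 1))
    (O : Matrix κ κ S) (w : S) :
    (∀ i j, O i j + linTan n k (g i j) (solTan n m k g gi fi O w i j)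
      (trPair m gi fi (solTan n m k g gi fi O w) (solScal n m k gi f fi O w)) = 0) ∧
    w + linScal n k f (solScal n m k gi f fi O w)
      (trPair m gi fi (solTan n m k g gi fi O w) (solScal n m k gi f fi O w)) = 0 := by
  rw [trPair_sol hg h hf hn hn0 hn1]
  have hk1 : ((k : ℝ) + 1) ≠ 0 := by positivity
  have ha : ((k : ℝ) + 1) - n / 2 ≠ 0 := fun h0 => hk (by linarith)
  have h1 : algebraMap ℝ S ((k + 1) * ((k + 1) - n / 2)) * algebraMap ℝ S (1 / ((k + 1) - n / 2))
      = algebraMap ℝ S (k + 1) := by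
    rw [← map_mul]; congr 1
    generalize ((k : ℝ) + 1) - n / 2 = a at ha ⊢
    field_simp
  have h2 : algebraMap ℝ S (2 * (k + 1) * ((k + 1) - n / 2))
      * algebraMap ℝ S (1 / (2 * ((k + 1) - n / 2))) = algebraMap ℝ S (k + 1) := by
    rw [← map_mul]; congr 1
    generalize ((k : ℝ) + 1) - n / 2 = a at ha ⊢
    field_simp
  have h3 : algebraMap ℝ S (k + 1) * algebraMap ℝ S (1 / (k + 1)) = 1 := by
    rw [← map_mul, mul_one_div_cancel hk1, map_one]
  have h4 : algebraMap ℝ S ((k + 1) * (1 + 2 / n * k) / 2)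
      = algebraMap ℝ S (k + 1) * algebraMap ℝ S ((1 + 2 / n * k) / 2) := by
    rw [← map_mul]; congr 1; ring
  constructor
  · intro i j
    simp only [linTan, solTan, if_neg hk, Matrix.smul_apply, Matrix.sub_apply, smul_eq_mul]
    linear_combination (algebraMap ℝ S ((1 + 2 / n * k) / 2) * solTrace n m k gi fi O w * g i j
      - algebraMap ℝ S (1 / (k + 1)) * O i j) * h1 - O i j * h3
      - solTrace n m k gi fi O w * g i j * h4
  · simp only [linScal, solScal, if_neg hk]
    linear_combination f * (algebraMap ℝ S ((1 + 2 / n * k) / 2) * solTrace n m k gi fi O w * f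
      - algebraMap ℝ S (1 / (k + 1)) * w * fi) * h2 - w * f * fi * h3
      - solTrace n m k gi fi O w * f ^ 2 * h4 - w * hf

omit [DecidableEq κ] in
lemma trEqn_add (gi : Matrix κ κ S) (fi : S) (m : ℝ) (O O' : Matrix κ κ S) (w w' : S) :
    trEqn m gi fi (O + O') (w + w') = trEqn m gi fi O w + trEqn m gi fi O' w' := by
  simp only [trEqn, Matrix.add_apply, mul_add, Finset.sum_add_distrib]
  ring

/-- At every order, `solTan` and `solScal` solve the weighted trace of the linearized equations. -/
lemma trEqn_lin_sol (hg : g.IsSymm) (h : g * gi = 1) (hf : f * fi = 1) {n m : ℝ}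
    (hn : n = Fintype.card κ + m) (hn0 : n ≠ 0) (hn1 : n ≠ 1) (k : ℕ)
    (O : Matrix κ κ S) (w : S) :
    trEqn m gi fi (Matrix.of fun i j => O i j + linTan n k (g i j) (solTan n m k g gi fi O w i j)
      (trPair m gi fi (solTan n m k g gi fi O w) (solScal n m k gi f fi O w)))
      (w + linScal n k f (solScal n m k gi f fi O w)
      (trPair m gi fi (solTan n m k g gi fi O w) (solScal n m k gi f fi O w))) = 0 := by
  have hk1 : ((k : ℝ) + 1) ≠ 0 := by positivity
  have hn1' : n - 1 ≠ 0 := sub_ne_zero.2 hn1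
  have h1 := trEqn_lin hg h hf hn hn0 k (solTan n m k g gi fi O w) (solScal n m k gi f fi O w) _ rfl
  have h2 := trEqn_add gi fi m O (Matrix.of fun i j => linTan n k (g i j)
    (solTan n m k g gi fi O w i j)
      (trPair m gi fi (solTan n m k g gi fi O w) (solScal n m k gi f fi O w))) w
    (linScal n k f (solScal n m k gi f fi O w)
      (trPair m gi fi (solTan n m k g gi fi O w) (solScal n m k gi f fi O w)))
  rw [h1] at h2
  refine (Eq.trans ?_ h2).trans ?_
  · rfl
  · rw [trPair_sol hg h hf hn hn0 hn1, solTrace, ← mul_assoc, ← map_mul]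
    rw [show ((k : ℝ) + 1) * (1 - n) * (1 / ((k + 1) * (n - 1))) = -1 by field_simp; ring]
    simp

omit [DecidableEq κ] in
lemma solTan_isSymm (hg : g.IsSymm) (n m : ℝ) (k : ℕ) (gi : Matrix κ κ S) (fi : S)
    {O : Matrix κ κ S} (hO : O.IsSymm) (w : S) : (solTan n m k g gi fi O w).IsSymm := by
  rw [solTan]
  split_ifs
  · exact (hg.smul _).smul _
  · exact (((hg.smul _).smul _).sub (hO.smul _)).smul _

end Linear

/-! ### Vanishing of the remaining components -/

section Vanishing

open PowerSeries

variable {S κ : Type*} [CommRing S] [Algebra ℝ S] [Fintype κ] [DecidableEq κ]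
  {D : κ → Derivation ℝ S S} {g gi E M0 : Matrix κ κ S⟦X⟧} {f fi F M B : S⟦X⟧} {A : κ → S⟦X⟧}

/-- The Bianchi identities `h1` and `h2` propagate the modified equations to the components
`A = P_i∞` and `B = P_∞∞`. Here `E` and `F` are the tangential components and the scalar, `M0` and `M`
their modifications. -/
lemma dvd_of_bianchi (hg : g.IsSymm) (h : g * gi = 1) (hf : f * fi = 1) {n m : ℝ}
    (hn : n = Fintype.card κ + m) (hn0 : n ≠ 0) (hn1 : n ≠ 1) {N : ℕ}
    (hN : ∀ s < N, n ≠ 2 * (s + 1)) (τ : S⟦X⟧)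
    (hE : ∀ i j, X ^ N ∣ M0 i j) (hM : X ^ N ∣ M)
    (htr : trEqn m (gi.map (coeff 0)) (coeff 0 fi) (M0.map (coeff N)) (coeff N M) = 0)
    (hEM : ∀ i j, E i j = M0 i j - algebraMap ℝ S⟦X⟧ (2 / n) * X * B * g i j)
    (hFM : F = -M + algebraMap ℝ S⟦X⟧ (2 / n) * X * B * f ^ 2)
    (h1 : ∀ j, 2 * ((Fintype.card κ : S⟦X⟧) + algebraMap ℝ S⟦X⟧ m - 2) * A j
      - 4 * X * psδ S (A j) + 2 * X * psD (D j) B - 2 * X * τ * A j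
      + divForm (fun i => psD (D i)) gi (chr (fun i => psD (D i)) g gi) E j
      + 2 * algebraMap ℝ S⟦X⟧ m * fi * ∑ a, grad (fun i => psD (D i)) gi f a * E a j
      + algebraMap ℝ S⟦X⟧ m * fi ^ 2 * psD (D j) F = 0)
    (h2 : 2 * ((Fintype.card κ : S⟦X⟧) + algebraMap ℝ S⟦X⟧ m - 2) * B
      - 2 * X * psδ S B - 2 * X * τ * B
      + ∑ a, ∑ b, gi a b * (2 * psD (D a) (A b)
          - 2 * ∑ l, chr (fun i => psD (D i)) g gi l a b * A l)
      + 2 * algebraMap ℝ S⟦X⟧ m * fi * ∑ a, grad (fun i => psD (D i)) gi f a * A a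
      - ∑ a, ∑ b, gi a b * psδ S (E a b)
      + algebraMap ℝ S⟦X⟧ m * fi ^ 2 * psδ S F = 0) :
    (∀ j, X ^ N ∣ A j) ∧ X ^ N ∣ B := by
  have hcancel : ∀ (r : ℝ) (x : S), r ≠ 0 → algebraMap ℝ S r * x = 0 → x = 0 := by
    intro r x hr hx
    rw [← Algebra.smul_def] at hx
    simpa [smul_smul, inv_mul_cancel₀ hr] using congrArg (r⁻¹ • ·) hx
  suffices hs : ∀ s ≤ N, (∀ j, X ^ s ∣ A j) ∧ X ^ s ∣ B from hs N le_rfl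
  intro s
  induction s with
  | zero => simp
  | succ s ih =>
    intro hsN
    obtain ⟨ihA, ihB⟩ := ih (by omega)
    have up : ∀ {x : S⟦X⟧}, X ^ s ∣ x → coeff s x = 0 → X ^ (s + 1) ∣ x := by
      intro x hx h0
      rw [X_pow_dvd_iff] at hx ⊢
      intro k hk
      rcases Nat.lt_succ_iff_lt_or_eq.1 hk with hk | rfl
      · exact hx k hk
      · exact h0
    have c0 : ∀ {x : S⟦X⟧}, X ^ (s + 1) ∣ x → coeff s x = 0 := fun hx =>
      X_pow_dvd_iff.1 hx s (Nat.lt_succ_self s)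
    have hXB : X ^ (s + 1) ∣ X * B := by rw [pow_succ']; exact mul_dvd_mul_left X ihB
    have hMs : X ^ (s + 1) ∣ M := (pow_dvd_pow X hsN).trans hM
    have hEs : ∀ i j, X ^ (s + 1) ∣ E i j := fun i j => by
      rw [hEM, mul_assoc _ X B]
      exact dvd_sub ((pow_dvd_pow X hsN).trans (hE i j)) ((hXB.mul_left _).mul_right _)
    have hFs : X ^ (s + 1) ∣ F := by
      rw [hFM, mul_assoc _ X B]
      exact dvd_add (hMs.neg_right) ((hXB.mul_left _).mul_right _)
    have hcoef : (2 : S⟦X⟧) * ((Fintype.card κ : S⟦X⟧) + algebraMap ℝ S⟦X⟧ m - 2)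
        = algebraMap ℝ S⟦X⟧ (2 * (n - 2)) := by
      rw [hn, map_mul, map_sub, map_add, map_natCast, map_ofNat]
    have calg : ∀ (r : ℝ) (x : S⟦X⟧), coeff s (algebraMap ℝ S⟦X⟧ r * x)
        = algebraMap ℝ S r * coeff s x := fun r x => by
      rw [← Algebra.smul_def, ← Algebra.smul_def]; simp
    -- the coefficient of order `s` of `h1` is `2 (n - 2 (s + 1))` times that of `A`
    have hA : ∀ j, X ^ (s + 1) ∣ A j := by
      intro j
      refine up (ihA j) ?_
      have d1 : X ^ (s + 1) ∣ 2 * X * psD (D j) B := by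
        rw [mul_assoc, pow_succ']
        exact (mul_dvd_mul_left X (X_pow_dvd_psD _ ihB)).mul_left _
      have d2 : X ^ (s + 1) ∣ 2 * X * τ * A j := by
        rw [show 2 * X * τ * A j = 2 * τ * (X * A j) by ring, pow_succ']
        exact (mul_dvd_mul_left X (ihA j)).mul_left _
      have d3 : X ^ (s + 1) ∣ divForm (fun i => psD (D i)) gi (chr (fun i => psD (D i)) g gi) E j :=
        Finset.dvd_sum fun a _ => Finset.dvd_sum fun b _ => Dvd.dvd.mul_left
          (dvd_sub (dvd_sub ((X_pow_dvd_psD _ (hEs b j)).mul_left _) (X_pow_dvd_psD _ (hEs a b)))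
            (Dvd.dvd.mul_left (Finset.dvd_sum fun l _ => (hEs l j).mul_left _) _)) _
      have d4 : X ^ (s + 1) ∣ 2 * algebraMap ℝ S⟦X⟧ m * fi
          * ∑ a, grad (fun i => psD (D i)) gi f a * E a j :=
        Dvd.dvd.mul_left (Finset.dvd_sum fun a _ => (hEs a j).mul_left _) _
      have d5 : X ^ (s + 1) ∣ algebraMap ℝ S⟦X⟧ m * fi ^ 2 * psD (D j) F :=
        (X_pow_dvd_psD _ hFs).mul_left _
      have := congrArg (coeff s) (h1 j)
      rw [map_add, map_add, map_add, map_sub, map_add, map_sub, c0 d1, c0 d2, c0 d3, c0 d4, c0 d5,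
        hcoef, calg, show (4 : S⟦X⟧) * X * psδ S (A j)
          = algebraMap ℝ S⟦X⟧ 4 * (X * psδ S (A j)) by rw [map_ofNat]; ring, calg,
        AgreeTo.coeff_X_mul_psδ, map_zero] at this
      refine hcancel (2 * (n - 2) - 4 * s) _ (fun h0 => hN s (by omega) (by linarith)) ?_
      rw [map_sub, map_mul (algebraMap ℝ S) 4, map_natCast]
      linear_combination this
    -- `E` and `F` differ from `M0` and `M` by multiples of `X * B`, so the coefficient of order `s` of
    -- `h2` is `2 (n - 1)` times that of `B`
    refine ⟨hA, up ihB ?_⟩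
    have d2 : X ^ (s + 1) ∣ 2 * X * τ * B := by
      rw [show 2 * X * τ * B = 2 * τ * (X * B) by ring]
      exact hXB.mul_left _
    have d3 : X ^ (s + 1) ∣ ∑ a, ∑ b, gi a b * (2 * psD (D a) (A b)
          - 2 * ∑ l, chr (fun i => psD (D i)) g gi l a b * A l) :=
      Finset.dvd_sum fun a _ => Finset.dvd_sum fun b _ => Dvd.dvd.mul_left
        (dvd_sub ((X_pow_dvd_psD _ (hA b)).mul_left _)
          (Dvd.dvd.mul_left (Finset.dvd_sum fun l _ => (hA l).mul_left _) _)) _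
    have d4 : X ^ (s + 1) ∣ 2 * algebraMap ℝ S⟦X⟧ m * fi
        * ∑ a, grad (fun i => psD (D i)) gi f a * A a :=
      Dvd.dvd.mul_left (Finset.dvd_sum fun a _ => (hA a).mul_left _) _
    have cE : ∀ a b, coeff s (gi a b * psδ S (E a b)) = (s + 1) * (coeff 0 (gi a b)
        * (coeff (s + 1) (M0 a b) - algebraMap ℝ S (2 / n) * coeff s B * coeff 0 (g a b))) := by
      intro a b
      rw [coeff_mul_of_dvd _ (X_pow_dvd_psδ (hEs a b)), coeff_psδ, hEM, map_sub,
        show algebraMap ℝ S⟦X⟧ (2 / n) * X * B * g a b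
          = X * (algebraMap ℝ S⟦X⟧ (2 / n) * (g a b * B)) by ring, coeff_succ_X_mul, calg,
        coeff_mul_of_dvd _ ihB]
      ring
    have cF : coeff s (algebraMap ℝ S⟦X⟧ m * fi ^ 2 * psδ S F) = (s + 1) * (algebraMap ℝ S m
        * coeff 0 fi ^ 2 * (-coeff (s + 1) M + algebraMap ℝ S (2 / n) * coeff s B
          * coeff 0 f ^ 2)) := by
      rw [coeff_mul_of_dvd _ (X_pow_dvd_psδ hFs), coeff_psδ, hFM, map_add,
        show algebraMap ℝ S⟦X⟧ (2 / n) * X * B * f ^ 2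
          = X * (algebraMap ℝ S⟦X⟧ (2 / n) * (f ^ 2 * B)) by ring, coeff_succ_X_mul, calg,
        coeff_mul_of_dvd _ ihB, pow_two, pow_two, AgreeTo.coeff_zero_mul, AgreeTo.coeff_zero_mul,
        AgreeTo.coeff_zero_mul, AgreeTo.coeff_zero_algebraMap, map_neg]
      ring
    have htr' : trEqn m (gi.map (coeff 0)) (coeff 0 fi) (M0.map (coeff (s + 1)))
        (coeff (s + 1) M) = 0 := by
      rcases Nat.lt_or_ge (s + 1) N with hlt | hge
      · have z : ∀ a b, coeff (s + 1) (M0 a b) = 0 := fun a b => X_pow_dvd_iff.1 (hE a b) _ hlt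
        simp [trEqn, z, X_pow_dvd_iff.1 hM _ hlt]
      · obtain rfl : s + 1 = N := by omega
        exact htr
    have := congrArg (coeff s) h2
    have hg0 : (g.map (coeff 0)).IsSymm := hg.map _
    have hgi0 : g.map (coeff 0) * gi.map (coeff 0) = 1 := by
      have : (g * gi).map (constantCoeff (R := S)) = 1 := by
        rw [h]; exact Matrix.map_one _ (map_zero _) (map_one _)
      rw [Matrix.map_mul] at this
      simpa only [coeff_zero_eq_constantCoeff] using this
    have hs0 := sum_inv_mul hg0 hgi0
    simp only [Matrix.map_apply] at hs0
    have hf0 : coeff 0 f * coeff 0 fi = 1 := by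
      rw [← AgreeTo.coeff_zero_mul, hf]; simp
    rw [map_add, map_sub, map_add, map_add, map_sub, map_sub, c0 d2, c0 d3, c0 d4, cF, map_sum] at this
    simp only [map_sum, cE] at this
    have hsum : ∑ a, ∑ b, ((s : S) + 1) * (coeff 0 (gi a b)
        * (coeff (s + 1) (M0 a b) - algebraMap ℝ S (2 / n) * coeff s B * coeff 0 (g a b)))
        = (s + 1) * (∑ a, ∑ b, coeff 0 (gi a b) * coeff (s + 1) (M0 a b)
          - algebraMap ℝ S (2 / n) * coeff s B * Fintype.card κ) := by
      rw [← hs0]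
      simp only [Finset.mul_sum, ← Finset.sum_sub_distrib]
      exact Finset.sum_congr rfl fun a _ => Finset.sum_congr rfl fun b _ => by ring
    rw [hsum, hcoef, calg, show (2 : S⟦X⟧) * X * psδ S B
          = algebraMap ℝ S⟦X⟧ 2 * (X * psδ S B) by rw [map_ofNat]; ring, calg,
        AgreeTo.coeff_X_mul_psδ, map_zero] at this
    simp only [trEqn, Matrix.map_apply] at htr'
    have hc : algebraMap ℝ S (2 * (n - 1)) = algebraMap ℝ S (2 * (n - 2))
        - algebraMap ℝ S 2 * s + (s + 1) * (algebraMap ℝ S (2 / n) * (Fintype.card κ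
          + algebraMap ℝ S m)) := by
      have : (Fintype.card κ + algebraMap ℝ S m : S) = algebraMap ℝ S n := by
        rw [hn, map_add, map_natCast]
      rw [this, ← map_mul, ← map_natCast (algebraMap ℝ S) s, ← map_one (algebraMap ℝ S), ← map_mul,
        ← map_add, ← map_mul, ← map_sub, ← map_add]
      congr 1
      field_simp
      ring
    refine hcancel (2 * (n - 1)) _ (mul_ne_zero two_ne_zero (sub_ne_zero.2 hn1)) ?_
    rw [hc]
    have e5 : coeff 0 fi ^ 2 * coeff 0 f ^ 2 = 1 := by
      linear_combination (1 + coeff 0 f * coeff 0 fi) * hf0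
    linear_combination this + (s + 1) * htr'
      - (s + 1) * algebraMap ℝ S m * algebraMap ℝ S (2 / n) * coeff s B * e5

end Vanishing

/-! ### The ring of smooth functions on an open set -/

section SmoothFunctions

open TopologicalSpace

variable {V V' ι : Type*} [NormedAddCommGroup V] [NormedSpace ℝ V] [NormedAddCommGroup V']
  [NormedSpace ℝ V']

open scoped Classical in
/-- The extension by zero of a function on `U`. -/
def extZero (U : Opens V) (F : U → ℝ) (y : V) : ℝ := if h : y ∈ U then F ⟨y, h⟩ else 0

lemma extZero_of_mem {U : Opens V} (F : U → ℝ) {y : V} (hy : y ∈ U) :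
    extZero U F y = F ⟨y, hy⟩ := dif_pos hy

/-- The algebra of smooth functions on the open set `U`. -/
def smoothFun (U : Opens V) : Subalgebra ℝ (U → ℝ) where
  carrier := {F | ContDiffOn ℝ ∞ (extZero U F) U}
  mul_mem' {F G} hF hG := by
    refine (ContDiffOn.mul hF hG).congr fun y hy => ?_
    simp [extZero_of_mem _ (show y ∈ U from hy)]
  add_mem' {F G} hF hG := by
    refine (ContDiffOn.add hF hG).congr fun y hy => ?_
    simp [extZero_of_mem _ (show y ∈ U from hy)]
  algebraMap_mem' r := by
    refine (contDiffOn_const (c := r)).congr fun y hy => ?_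
    rw [extZero_of_mem _ (show y ∈ U from hy)]
    rfl

namespace smoothFun

variable {U : Opens V} {U' : Opens V'}

/-- A smooth function on `U`, extended by zero. -/
def val (F : smoothFun U) : V → ℝ := extZero U F

lemma contDiffOn_val (F : smoothFun U) : ContDiffOn ℝ ∞ (val F) U := F.2

/-- The element of `smoothFun U` given by a function that is smooth on `U`. -/
def mk (F : V → ℝ) (hF : ContDiffOn ℝ ∞ F U) : smoothFun U :=
  ⟨fun y => F y, hF.congr fun _ hy => extZero_of_mem _ hy⟩

lemma ext_val {F G : smoothFun U} (h : ∀ y ∈ U, val F y = val G y) : F = G := by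
  refine Subtype.ext (funext fun y => ?_)
  have := h y y.2
  rwa [val, val, extZero_of_mem _ y.2, extZero_of_mem _ y.2] at this

/-- Evaluation at a point of `U`. -/
def eval (y : V) (hy : y ∈ U) : smoothFun U →ₐ[ℝ] ℝ :=
  (Pi.evalAlgHom ℝ (fun _ : U => ℝ) ⟨y, hy⟩).comp (smoothFun U).val

lemma eval_apply {y : V} (hy : y ∈ U) (F : smoothFun U) : eval y hy F = val F y :=
  (extZero_of_mem _ hy).symm

lemma eval_mk {F : V → ℝ} (hF : ContDiffOn ℝ ∞ F U) {y : V} (hy : y ∈ U) :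
    eval y hy (mk F hF) = F y := rfl

lemma ext_eval {F G : smoothFun U} (h : ∀ y (hy : y ∈ U), eval y hy F = eval y hy G) : F = G :=
  ext_val fun y hy => by rw [← eval_apply hy, ← eval_apply hy, h]

lemma isUnit_iff {F : smoothFun U} : IsUnit F ↔ ∀ y (hy : y ∈ U), eval y hy F ≠ 0 := by
  refine ⟨fun h y hy => (h.map (eval y hy)).ne_zero, fun h => ?_⟩
  have h1 : ContDiffOn ℝ ∞ (fun y => (val F y)⁻¹) U :=
    (contDiffOn_val F).inv fun y hy => by rw [← eval_apply hy]; exact h y hy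
  refine IsUnit.of_mul_eq_one (mk _ h1) (ext_eval fun y hy => ?_)
  rw [map_mul, map_one, eval_mk, eval_apply hy]
  exact mul_inv_cancel₀ (by rw [← eval_apply hy]; exact h y hy)

section Derivations

lemma pd_congr {b : Module.Basis ι ℝ V} {F G : V → ℝ} (h : ∀ y ∈ U, F y = G y) {y : V}
    (hy : y ∈ U) (i : ι) : pd b i F y = pd b i G y := by
  have : F =ᶠ[𝓝 y] G := Filter.eventually_of_mem (U.isOpen.mem_nhds hy) h
  rw [pd, pd, this.fderiv_eq]

lemma contDiffOn_pd (b : Module.Basis ι ℝ V) (i : ι) {F : V → ℝ} (hF : ContDiffOn ℝ ∞ F U) :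
    ContDiffOn ℝ ∞ (pd b i F) U :=
  (hF.fderiv_of_isOpen U.isOpen (m := ∞) le_rfl).clm_apply contDiffOn_const

lemma differentiableAt_val (F : smoothFun U) {y : V} (hy : y ∈ U) :
    DifferentiableAt ℝ (val F) y :=
  ((contDiffOn_val F).differentiableOn (by simp)).differentiableAt (U.isOpen.mem_nhds hy)

/-- The partial derivative `∂_i` on smooth functions. -/
def der (U : Opens V) (b : Module.Basis ι ℝ V) (i : ι) :
    Derivation ℝ (smoothFun U) (smoothFun U) :=
  Derivation.mk'
    { toFun := fun F => mk (pd b i (val F)) (contDiffOn_pd b i (contDiffOn_val F))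
      map_add' := fun F G => ext_eval fun y hy => by
        rw [map_add, eval_mk, eval_mk, eval_mk]
        have : pd b i (val (F + G)) y = pd b i (fun z => val F z + val G z) y :=
          pd_congr (fun z hz => by rw [← eval_apply hz, ← eval_apply hz, ← eval_apply hz, map_add]) hy i
        rw [this, pd, fderiv_fun_add (differentiableAt_val F hy) (differentiableAt_val G hy)]
        rfl
      map_smul' := fun c F => ext_eval fun y hy => by
        rw [map_smul, eval_mk, eval_mk]
        have : pd b i (val (c • F)) y = pd b i (fun z => c • val F z) y :=
          pd_congr (fun z hz => by rw [← eval_apply hz, ← eval_apply hz, map_smul]) hy i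
        rw [this, pd, fderiv_fun_const_smul (differentiableAt_val F hy)]
        rfl }
    (fun F G => ext_eval fun y hy => by
      simp only [LinearMap.coe_mk, AddHom.coe_mk, smul_eq_mul, map_add, map_mul, eval_mk]
      have : pd b i (val (F * G)) y = pd b i (fun z => val F z * val G z) y :=
        pd_congr (fun z hz => by rw [← eval_apply hz, ← eval_apply hz, ← eval_apply hz, map_mul]) hy i
      rw [this, pd, fderiv_fun_mul (differentiableAt_val F hy) (differentiableAt_val G hy), eval_apply hy,
        eval_apply hy]
      rfl)

lemma eval_der (b : Module.Basis ι ℝ V) (i : ι) (F : smoothFun U) {y : V} (hy : y ∈ U) :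
    eval y hy (der U b i F) = pd b i (val F) y := rfl

lemma eval_der_of_eqOn (b : Module.Basis ι ℝ V) (i : ι) {F : smoothFun U} {G : V → ℝ}
    (h : ∀ y (hy : y ∈ U), eval y hy F = G y) {y : V} (hy : y ∈ U) :
    eval y hy (der U b i F) = pd b i G y := by
  rw [eval_der]
  exact pd_congr (fun z hz => by rw [← eval_apply hz, h]) hy i

lemma der_comm (b : Module.Basis ι ℝ V) (i j : ι) (F : smoothFun U) :
    der U b i (der U b j F) = der U b j (der U b i F) := by
  have key : ∀ i j y (hy : y ∈ U), eval y hy (der U b i (der U b j F))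
      = fderiv ℝ (fderiv ℝ (val F)) y (b i) (b j) := by
    intro i j y hy
    rw [eval_der_of_eqOn b i (G := pd b j (val F)) (fun z hz => eval_der b j F hz) hy]
    have h1 : DifferentiableAt ℝ (fderiv ℝ (val F)) y :=
      (((contDiffOn_val F).fderiv_of_isOpen U.isOpen (m := ∞) le_rfl).differentiableOn
        (by simp)).differentiableAt (U.isOpen.mem_nhds hy)
    unfold pd
    rw [fderiv_clm_apply h1 (differentiableAt_const _)]
    simp
  refine ext_eval fun y hy => ?_
  rw [key, key]
  have h2 : ContDiffAt ℝ ∞ (val F) y := (contDiffOn_val F).contDiffAt (U.isOpen.mem_nhds hy)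
  exact (h2.isSymmSndFDerivAt (by
    rw [minSmoothness_of_isRCLikeNormedField]; exact WithTop.coe_le_coe.2 (le_top : (2 : ℕ∞) ≤ ⊤))).eq _ _

end Derivations

section Pullback

/-- The pullback of smooth functions by a smooth map. -/
def pullback (φ : V' → V) (hφ : ContDiffOn ℝ ∞ φ U') (hm : ∀ y ∈ U', φ y ∈ U) :
    smoothFun U →ₐ[ℝ] smoothFun U' where
  toFun F := mk (fun y => val F (φ y)) ((contDiffOn_val F).comp hφ hm)
  map_one' := ext_eval fun y hy => by
    rw [eval_mk, ← eval_apply (hm y hy), map_one, map_one]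
  map_mul' F G := ext_eval fun y hy => by
    simp only [map_mul, eval_mk, ← eval_apply (hm y hy)]
  map_zero' := ext_eval fun y hy => by
    rw [eval_mk, ← eval_apply (hm y hy), map_zero, map_zero]
  map_add' F G := ext_eval fun y hy => by
    simp only [map_add, eval_mk, ← eval_apply (hm y hy)]
  commutes' r := ext_eval fun y hy => by
    rw [eval_mk, ← eval_apply (hm y hy), AlgHom.commutes, AlgHom.commutes]

lemma eval_pullback {φ : V' → V} (hφ : ContDiffOn ℝ ∞ φ U') (hm : ∀ y ∈ U', φ y ∈ U)
    (F : smoothFun U) {y : V'} (hy : y ∈ U') :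
    eval y hy (pullback φ hφ hm F) = eval (φ y) (hm y hy) F := by
  rw [eval_apply (hm y hy)]; rfl

variable [Fintype ι]

/-- The entry `∂φ^a / ∂y^i` of the Jacobian matrix. -/
def jacobian {ι' : Type*} (b : Module.Basis ι ℝ V) (b' : Module.Basis ι' ℝ V') (φ : V' → V)
    (hφ : ContDiffOn ℝ ∞ φ U') : Matrix ι ι' (smoothFun U') :=
  haveI := b.finiteDimensional_of_finite
  Matrix.of fun a i => mk (fun y => b.repr (fderiv ℝ φ y (b' i)) a)
    ((LinearMap.toContinuousLinearMap (b.coord a)).contDiff.comp_contDiffOn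
      ((hφ.fderiv_of_isOpen U'.isOpen (m := ∞) le_rfl).clm_apply contDiffOn_const))

lemma eval_jacobian {ι' : Type*} (b : Module.Basis ι ℝ V) (b' : Module.Basis ι' ℝ V') {φ : V' → V}
    (hφ : ContDiffOn ℝ ∞ φ U') {y : V'} (hy : y ∈ U') (a : ι) (i : ι') :
    eval y hy (jacobian b b' φ hφ a i) = b.repr (fderiv ℝ φ y (b' i)) a := rfl

lemma der_pullback {ι' : Type*} (b : Module.Basis ι ℝ V) (b' : Module.Basis ι' ℝ V') {φ : V' → V}
    (hφ : ContDiffOn ℝ ∞ φ U') (hm : ∀ y ∈ U', φ y ∈ U) (F : smoothFun U) (i : ι') :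
    der U' b' i (pullback φ hφ hm F)
      = ∑ a, jacobian b b' φ hφ a i * pullback φ hφ hm (der U b a F) := by
  refine ext_eval fun y hy => ?_
  rw [eval_der_of_eqOn b' i (G := fun z => val F (φ z))
    (fun z hz => by rw [eval_pullback, eval_apply]) hy]
  have h1 : DifferentiableAt ℝ φ y :=
    (hφ.differentiableOn (by simp)).differentiableAt (U'.isOpen.mem_nhds hy)
  have h2 : pd b' i (fun z => val F (φ z)) y = fderiv ℝ (val F) (φ y) (fderiv ℝ φ y (b' i)) := by
    rw [pd, show (fun z => val F (φ z)) = val F ∘ φ from rfl,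
      fderiv_comp y (differentiableAt_val F (hm y hy)) h1]
    rfl
  rw [h2]
  conv_lhs => rw [← b.sum_repr (fderiv ℝ φ y (b' i))]
  simp only [map_sum, map_smul, map_mul, eval_pullback, eval_der, eval_jacobian, smul_eq_mul]
  rfl

end Pullback

section Frozen

variable [Fintype ι] [DecidableEq ι] {b : Module.Basis ι ℝ V} {H Hi : Matrix ι ι (smoothFun U)}
  {G : V → Matrix ι ι ℝ} {f : smoothFun U} {u : V → ℝ}

/-- The matrix function `G` represents the matrix `H` on `U`. -/
def Represents (H : Matrix ι ι (smoothFun U)) (G : V → Matrix ι ι ℝ) : Prop :=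
  ∀ y (hy : y ∈ U), H.map (eval y hy) = G y

lemma Represents.apply (h : Represents H G) {y : V} (hy : y ∈ U) (i j : ι) :
    eval y hy (H i j) = G y i j := congrFun (congrFun (h y hy) i) j

lemma Represents.inv (h : Represents H G) (hi : H * Hi = 1) {y : V} (hy : y ∈ U) :
    (G y)⁻¹ = Hi.map (eval y hy) := by
  refine Matrix.inv_eq_right_inv ?_
  rw [← h y hy, ← Matrix.map_mul, hi, Matrix.map_one _ (map_zero _) (map_one _)]

lemma Represents.chr (h : Represents H G) (hi : H * Hi = 1) (k i j : ι) {y : V} (hy : y ∈ U) :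
    eval y hy (chr (der U b) H Hi k i j) = christoffel b G k i j y := by
  have hd : ∀ l i j, eval y hy (der U b l (H i j)) = pd b l (fun z => G z i j) y := fun l i j =>
    eval_der_of_eqOn b l (fun z hz => h.apply hz i j) hy
  simp only [WeightedAmbient.chr, christoffel, map_mul, map_sum, map_sub, map_add, hd,
    h.inv hi hy, Matrix.map_apply, AlgHom.commutes]
  rfl

lemma Represents.ric (h : Represents H G) (hi : H * Hi = 1) (i j : ι) {y : V} (hy : y ∈ U) :
    eval y hy (ric (der U b) (WeightedAmbient.chr (der U b) H Hi) i j) = ricciCoord b G i j y := by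
  have hd : ∀ l k i j, eval y hy (der U b l (WeightedAmbient.chr (der U b) H Hi k i j))
      = pd b l (christoffel b G k i j) y := fun l k i j =>
    eval_der_of_eqOn b l (fun z hz => h.chr hi k i j hz) hy
  simp only [WeightedAmbient.ric, ricciCoord, map_add, map_sum, map_sub, map_mul, hd, h.chr hi]

lemma Represents.hess (h : Represents H G) (hi : H * Hi = 1)
    (hu : ∀ y (hy : y ∈ U), eval y hy f = u y) (i j : ι) {y : V} (hy : y ∈ U) :
    eval y hy (hess (der U b) (WeightedAmbient.chr (der U b) H Hi) f i j)
      = hessCoord b G u i j y := by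
  have hd : ∀ z (hz : z ∈ U) l, eval z hz (der U b l f) = pd b l u z := fun z hz l =>
    eval_der_of_eqOn b l hu hz
  have hdd : ∀ l l', eval y hy (der U b l (der U b l' f)) = pd b l (pd b l' u) y := fun l l' =>
    eval_der_of_eqOn b l (fun z hz => hd z hz l') hy
  simp only [WeightedAmbient.hess, hessCoord, map_sub, map_sum, map_mul, hd, hdd, h.chr hi]

lemma Represents.lap (h : Represents H G) (hi : H * Hi = 1)
    (hu : ∀ y (hy : y ∈ U), eval y hy f = u y) {y : V} (hy : y ∈ U) :
    eval y hy (lap (der U b) H Hi f) = laplacianCoord b G u y := by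
  simp only [WeightedAmbient.lap, laplacianCoord, map_sum, map_mul, h.hess hi hu, h.inv hi hy,
    Matrix.map_apply]

lemma Represents.gradSq (h : Represents H G) (hi : H * Hi = 1)
    (hu : ∀ y (hy : y ∈ U), eval y hy f = u y) {y : V} (hy : y ∈ U) :
    eval y hy (gradSq (der U b) Hi f) = gradSqCoord b G u y := by
  have hd : ∀ l, eval y hy (der U b l f) = pd b l u y := fun l => eval_der_of_eqOn b l hu hy
  simp only [WeightedAmbient.gradSq, gradSqCoord, map_sum, map_mul, hd, h.inv hi hy,
    Matrix.map_apply]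

lemma Represents.beRic (h : Represents H G) (hi : H * Hi = 1)
    (hu : ∀ y (hy : y ∈ U), eval y hy f = u y) {fi : smoothFun U} (hf : f * fi = 1) (m : ℝ)
    (i j : ι) {y : V} (hy : y ∈ U) :
    eval y hy (beRic (der U b) H Hi f fi m i j)
      = ricciCoord b G i j y - m / u y * hessCoord b G u i j y := by
  have hfi : eval y hy fi = (u y)⁻¹ := by
    have := congrArg (eval y hy) hf
    rw [map_mul, hu, map_one] at this
    exact eq_inv_of_mul_eq_one_right this
  simp only [WeightedAmbient.beRic, map_sub, map_mul, h.ric hi, h.hess hi hu, hfi,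
    AlgHom.commutes, div_eq_mul_inv]
  rfl

lemma Represents.wF (h : Represents H G) (hi : H * Hi = 1)
    (hu : ∀ y (hy : y ∈ U), eval y hy f = u y) (m μ : ℝ) {y : V} (hy : y ∈ U) :
    eval y hy (wF (der U b) H Hi f m μ)
      = u y * laplacianCoord b G u y + (m - 1) * (gradSqCoord b G u y - μ) := by
  simp only [WeightedAmbient.wF, map_add, map_sub, map_mul, h.lap hi hu, h.gradSq hi hu, hu,
    AlgHom.commutes]
  rfl

end Frozen

end smoothFun

end SmoothFunctions

/-! ### Taylor series -/

section Taylor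

open PowerSeries

variable {R S S' κ : Type*} [CommRing R] [Algebra ℝ R] [CommRing S] [Algebra ℝ S]
  [CommRing S'] [Algebra ℝ S']

/-- The coefficients `r (δ^k F) / k!`. -/
def taylorFun (r : R →ₐ[ℝ] S) (δ : Derivation ℝ R R) (F : R) : S⟦X⟧ :=
  PowerSeries.mk fun k => ((k.factorial : ℝ)⁻¹) • r (δ^[k] F)

lemma coeff_taylorFun (r : R →ₐ[ℝ] S) (δ : Derivation ℝ R R) (F : R) (k : ℕ) :
    coeff k (taylorFun r δ F) = ((k.factorial : ℝ)⁻¹) • r (δ^[k] F) := coeff_mk _ _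

lemma psδ_taylorFun (r : R →ₐ[ℝ] S) (δ : Derivation ℝ R R) (F : R) :
    psδ S (taylorFun r δ F) = taylorFun r δ (δ F) := by
  ext k
  rw [coeff_psδ, coeff_taylorFun, coeff_taylorFun, ← Function.iterate_succ_apply, smul_mul_assoc,
    mul_comm _ ((k : S) + 1), show ((k : S) + 1) = algebraMap ℝ S (k + 1) by simp,
    ← Algebra.smul_def, smul_smul, Nat.factorial_succ]
  congr 1
  push_cast
  field_simp

lemma taylorFun_add (r : R →ₐ[ℝ] S) (δ : Derivation ℝ R R) (F G : R) :
    taylorFun r δ (F + G) = taylorFun r δ F + taylorFun r δ G := by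
  ext k
  rw [map_add, coeff_taylorFun, coeff_taylorFun, coeff_taylorFun, iterate_map_add, map_add, smul_add]

lemma eq_of_psδ_eq {p q : S⟦X⟧} {n : ℕ} (h : coeff n (psδ S p) = coeff n (psδ S q)) :
    coeff (n + 1) p = coeff (n + 1) q := by
  rw [coeff_psδ, coeff_psδ, show ((n : S) + 1) = algebraMap ℝ S (n + 1) by simp, mul_comm,
    mul_comm (coeff _ q), ← Algebra.smul_def, ← Algebra.smul_def] at h
  have h0 : ((n : ℝ) + 1) ≠ 0 := by positivity
  simpa [smul_smul, inv_mul_cancel₀ h0] using congrArg (((n : ℝ) + 1)⁻¹ • ·) h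

lemma taylorFun_mul (r : R →ₐ[ℝ] S) (δ : Derivation ℝ R R) (F G : R) :
    taylorFun r δ (F * G) = taylorFun r δ F * taylorFun r δ G := by
  ext n
  induction n generalizing F G with
  | zero => simp [coeff_taylorFun, AgreeTo.coeff_zero_mul, -coeff_zero_eq_constantCoeff]
  | succ n ih =>
    refine eq_of_psδ_eq ?_
    rw [psδ_taylorFun, Derivation.leibniz, Derivation.leibniz, smul_eq_mul, smul_eq_mul, smul_eq_mul,
      smul_eq_mul, taylorFun_add, map_add, map_add, ih, ih, psδ_taylorFun, psδ_taylorFun]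

lemma taylorFun_algebraMap (r : R →ₐ[ℝ] S) (δ : Derivation ℝ R R) (c : ℝ) :
    taylorFun r δ (algebraMap ℝ R c) = algebraMap ℝ S⟦X⟧ c := by
  ext n
  cases n with
  | zero => simp [coeff_taylorFun, AgreeTo.coeff_zero_algebraMap, -coeff_zero_eq_constantCoeff]
  | succ n =>
    refine eq_of_psδ_eq ?_
    rw [psδ_taylorFun, Derivation.map_algebraMap, Derivation.map_algebraMap, coeff_taylorFun,
      iterate_map_zero, map_zero, smul_zero, map_zero]

/-- The Taylor series in the direction of the derivation `δ` of the elements of `R`, along the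
restriction homomorphism `r`. -/
def taylor (r : R →ₐ[ℝ] S) (δ : Derivation ℝ R R) : R →ₐ[ℝ] S⟦X⟧ where
  toFun := taylorFun r δ
  map_one' := by simpa using taylorFun_algebraMap r δ 1
  map_mul' := taylorFun_mul r δ
  map_zero' := by simpa using taylorFun_algebraMap r δ 0
  map_add' := taylorFun_add r δ
  commutes' := taylorFun_algebraMap r δ

variable (r : R →ₐ[ℝ] S) (δ : Derivation ℝ R R)

lemma coeff_taylor (F : R) (k : ℕ) :
    coeff k (taylor r δ F) = ((k.factorial : ℝ)⁻¹) • r (δ^[k] F) := coeff_taylorFun r δ F k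

lemma coeff_zero_taylor (F : R) : coeff 0 (taylor r δ F) = r F := by
  rw [coeff_taylor]; simp

lemma psδ_taylor (F : R) : psδ S (taylor r δ F) = taylor r δ (δ F) := psδ_taylorFun r δ F

lemma taylor_eq_X {F : R} (h0 : r F = 0) (h1 : δ F = 1) : taylor r δ F = X := by
  ext n
  cases n with
  | zero => rw [coeff_zero_taylor, h0]; simp
  | succ n => exact eq_of_psδ_eq (by rw [psδ_taylor, h1, map_one, psδ_X])

lemma taylor_der {D : Derivation ℝ R R} {d : Derivation ℝ S S} (h : ∀ F, r (D F) = d (r F))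
    (hc : ∀ F, D (δ F) = δ (D F)) (F : R) : taylor r δ (D F) = psD d (taylor r δ F) := by
  ext n
  have e : ∀ F, δ^[n] (D F) = D (δ^[n] F) := fun F =>
    ((show Function.Commute (D : R → R) δ from hc).iterate_right n F).symm
  rw [coeff_psD, coeff_taylor, coeff_taylor, e, h, Derivation.map_smul]

lemma isCoordChange_taylor [Fintype κ] [DecidableEq κ] {D : κ → Derivation ℝ R R}
    {d : κ → Derivation ℝ S S} (h : ∀ i F, r (D i F) = d i (r F))
    (hc : ∀ i F, D i (δ F) = δ (D i F)) (hd : ∀ i j x, d i (d j x) = d j (d i x)) :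
    IsCoordChange (taylor r δ) D (fun i => psD (d i)) 1 1 where
  comm i j x := by
    ext n
    simp [hd i j]
  chain i F := by
    rw [← taylor_der r δ (h i) (hc i)]
    simp [Matrix.one_apply]
  jac i j a := by
    simp only [Matrix.one_apply]
    split_ifs <;> simp
  inv := Matrix.one_mul 1

end Taylor

section Asymptotics

open TopologicalSpace smoothFun PowerSeries

variable {V ι : Type*} [NormedAddCommGroup V] [NormedSpace ℝ V] {U : Opens V}

lemma hasDerivAt_line (b : Module.Basis ι ℝ V) (i : ι) (F : smoothFun U) {p : V} {s : ℝ}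
    (hs : p + s • b i ∈ U) :
    HasDerivAt (fun s : ℝ => val F (p + s • b i)) (val (der U b i F) (p + s • b i)) s := by
  have h1 : HasDerivAt (fun s : ℝ => p + s • b i) (b i) s := by
    simpa using ((hasDerivAt_id s).smul_const (b i)).const_add p
  have h2 := (differentiableAt_val F hs).hasFDerivAt.comp_hasDerivAt s h1
  rw [← eval_apply hs, eval_der]
  exact h2

lemma eventually_line_mem {p : V} (hp : p ∈ U) (v : V) : ∀ᶠ s : ℝ in 𝓝 0, p + s • v ∈ U := by
  have : Continuous fun s : ℝ => p + s • v := by fun_prop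
  have h0 : (U : Set V) ∈ 𝓝 (p + (0 : ℝ) • v) := by simpa using U.isOpen.mem_nhds hp
  exact this.continuousAt.eventually h0

/-- If the Taylor coefficients of order less than `k` vanish, then the function is `O(s^k)`. -/
lemma isBigO_of_taylor (b : Module.Basis ι ℝ V) (i : ι) {p : V} (hp : p ∈ U) {k : ℕ} :
    ∀ F : smoothFun U, X ^ k ∣ taylor (eval p hp) (der U b i) F →
      (fun s : ℝ => val F (p + s • b i)) =O[𝓝 0] fun s => s ^ k := by
  induction k with
  | zero =>
    intro F _
    simp only [pow_zero]
    exact (hasDerivAt_line b i F (s := 0) (by simpa using hp)).continuousAt.isBigO_one ℝ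
  | succ k ih =>
    intro F hF
    have h0 : val F (p + (0 : ℝ) • b i) = 0 := by
      have := X_pow_dvd_iff.1 hF 0 (Nat.succ_pos k)
      rw [coeff_zero_taylor, eval_apply] at this
      simpa using this
    obtain ⟨C, hC⟩ := (ih (der U b i F) (by rw [← psδ_taylor]; exact X_pow_dvd_psδ hF)).bound
    obtain ⟨ε, hε, hball⟩ := Metric.eventually_nhds_iff_ball.1
      (hC.and (eventually_line_mem hp (b i)))
    refine Asymptotics.IsBigO.of_bound C ?_
    filter_upwards [Metric.ball_mem_nhds (0 : ℝ) hε] with s hs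
    have hsub : ∀ x ∈ Metric.closedBall (0 : ℝ) ‖s‖, x ∈ Metric.ball (0 : ℝ) ε := by
      intro x hx
      rw [mem_closedBall_zero_iff] at hx
      rw [mem_ball_zero_iff] at hs ⊢
      exact hx.trans_lt hs
    have hC0 : 0 ≤ C ∨ s = 0 := by
      by_cases hs0 : s = 0
      · exact Or.inr hs0
      · left
        have h1 := (norm_nonneg _).trans (hball s hs).1
        have h2 : 0 < ‖s ^ k‖ := norm_pos_iff.2 (pow_ne_zero k hs0)
        exact nonneg_of_mul_nonneg_left h1 h2
    rcases hC0 with hC0 | rfl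
    · have key := (convex_closedBall (0 : ℝ) ‖s‖).norm_image_sub_le_of_norm_hasDerivWithin_le
        (f := fun s : ℝ => val F (p + s • b i))
        (f' := fun s : ℝ => val (der U b i F) (p + s • b i)) (C := C * ‖s‖ ^ k) (x := 0) (y := s)
        (fun x hx => (hasDerivAt_line b i F (hball x (hsub x hx)).2).hasDerivWithinAt)
        (fun x hx => ((hball x (hsub x hx)).1).trans (by
          rw [norm_pow]
          rw [mem_closedBall_zero_iff] at hx
          gcongr))
        (by simp) (by simp)
      rw [h0, sub_zero, sub_zero] at key
      rw [norm_pow, pow_succ, ← mul_assoc]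
      exact key
    · simp only [h0]; simp

/-- The Taylor coefficients of a function that is `O(s^k)` vanish up to order `k`. -/
lemma taylor_of_isBigO (b : Module.Basis ι ℝ V) [Finite ι] (i : ι) {p : V} (hp : p ∈ U) {k : ℕ}
    (F : smoothFun U) (hF : (fun s : ℝ => val F (p + s • b i)) =O[𝓝 0] fun s => s ^ k) :
    X ^ k ∣ taylor (eval p hp) (der U b i) F := by
  have := b.finiteDimensional_of_finite
  have hℓs : ContDiffOn ℝ ∞ (fun z => LinearMap.toContinuousLinearMap (b.coord i) (z - p)) U := by
    fun_prop
  set ℓ : smoothFun U := mk _ hℓs with hℓ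
  have hX : taylor (eval p hp) (der U b i) ℓ = X := by
    refine taylor_eq_X _ _ (by rw [hℓ, eval_mk]; simp) (ext_eval fun y hy => ?_)
    rw [eval_der_of_eqOn b i (G := fun z => LinearMap.toContinuousLinearMap (b.coord i) (z - p))
      (fun y hy => rfl) hy, pd, map_one]
    have : HasFDerivAt (fun z => LinearMap.toContinuousLinearMap (b.coord i) (z - p))
        (LinearMap.toContinuousLinearMap (b.coord i)) y :=
      (LinearMap.toContinuousLinearMap (b.coord i)).hasFDerivAt.comp y
        ((hasFDerivAt_id y).sub_const p)
    rw [this.fderiv]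
    simp
  rw [X_pow_dvd_iff]
  intro j hj
  induction j using Nat.strong_induction_on with
  | _ j ih =>
    set c := coeff j (taylor (eval p hp) (der U b i) F)
    set G := F - algebraMap ℝ _ c * ℓ ^ j with hG
    have h1 : X ^ (j + 1) ∣ taylor (eval p hp) (der U b i) G := by
      rw [X_pow_dvd_iff]
      intro l hl
      rw [hG, map_sub, map_mul, map_pow, hX, AlgHom.commutes, map_sub,
        show algebraMap ℝ ℝ⟦X⟧ c = C c from rfl, coeff_C_mul_X_pow]
      rcases Nat.lt_succ_iff_lt_or_eq.1 hl with hl | rfl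
      · rw [ih l hl (hl.trans hj), if_neg hl.ne, sub_zero]
      · rw [if_pos rfl, sub_self]
    have h2 := isBigO_of_taylor b i hp G h1
    have h3 : (fun s : ℝ => c * s ^ j) =O[𝓝 0] fun s => s ^ (j + 1) := by
      have h4 : (fun s : ℝ => val F (p + s • b i)) =O[𝓝 0] fun s => s ^ (j + 1) :=
        hF.trans (Asymptotics.IsBigO.of_bound 1 (by
          filter_upwards [Metric.ball_mem_nhds (0 : ℝ) one_pos] with s hs
          rw [norm_pow, norm_pow, one_mul]
          exact pow_le_pow_of_le_one (norm_nonneg _) (mem_ball_zero_iff.1 hs).le hj))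
      refine (h4.sub h2).congr' ?_ Filter.EventuallyEq.rfl
      filter_upwards [eventually_line_mem hp (b i)] with s hs
      rw [← eval_apply hs, ← eval_apply hs, hG, map_sub, map_mul, map_pow, AlgHom.commutes, hℓ,
        eval_mk]
      simp
    by_contra hc
    have h5 : (fun s : ℝ => s ^ j) =O[𝓝 0] fun s => s ^ (j + 1) := by
      rwa [Asymptotics.isBigO_const_mul_left_iff hc] at h3
    have h6 : (fun s : ℝ => s ^ (j + 1)) =o[𝓝 0] fun s => s ^ j :=
      Asymptotics.isLittleO_pow_pow (Nat.lt_succ_self j)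
    have h7 := h5.trans_isLittleO h6
    have h8 := (h7.mono (nhdsWithin_le_nhds (s := {0}ᶜ))).def (c := 1 / 2) (by norm_num)
    obtain ⟨s, hs, hs0⟩ := (h8.and self_mem_nhdsWithin).exists
    have h9 : 0 < ‖s ^ j‖ := norm_pos_iff.2 (pow_ne_zero j hs0)
    linarith

end Asymptotics

/-! ### Formal expansion of an ambient metric in normal form -/

section Formal

open PowerSeries

variable {R S κ : Type*} [CommRing R] [Algebra ℝ R] [CommRing S] [Algebra ℝ S] [Fintype κ]
  [DecidableEq κ] {D : Unit ⊕ (κ ⊕ Unit) → Derivation ℝ R R} {t ti ρ : R} {g gi : Matrix κ κ R}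
  {f fi : R} {T : R →ₐ[ℝ] S⟦X⟧} {d : κ → Derivation ℝ S S}

omit [DecidableEq κ] in
lemma pullTensor_one [DecidableEq κ] (T : R →ₐ[ℝ] S⟦X⟧) (G : Matrix κ κ R) :
    pullTensor T 1 G = G.map T := by simp [pullTensor]

lemma pullInv_one (T : R →ₐ[ℝ] S⟦X⟧) (G : Matrix κ κ R) : pullInv T 1 G = G.map T := by
  simp [pullInv]

/-- A homomorphism to formal power series that is compatible with the derivations. -/
structure IsExpansion (T : R →ₐ[ℝ] S⟦X⟧) (D : Unit ⊕ (κ ⊕ Unit) → Derivation ℝ R R) (ρ : R)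
    (d : κ → Derivation ℝ S S) : Prop where
  coord : IsCoordChange T (fun i => D (.inr (.inl i))) (fun i => psD (d i)) 1 1
  rad : ∀ x, psδ S (T x) = T (D (.inr (.inr ())) x)
  map_ρ : T ρ = X

namespace IsExpansion

lemma psδ_one_apply (i j : κ) : psδ S ((1 : Matrix κ κ S⟦X⟧) i j) = 0 := by
  rw [Matrix.one_apply]; split_ifs <;> simp

lemma tan (hT : IsExpansion T D ρ d) (x : R) (i : κ) :
    psD (d i) (T x) = T (D (.inr (.inl i)) x) := by
  rw [hT.coord.chain]
  simp [Matrix.one_apply]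

lemma modTan (hT : IsExpansion T D ρ d) (hg : g.IsSymm) (hgi : g * gi = 1) (f fi : R) (m c : ℝ)
    (i j : κ) :
    modTan (fun i => psD (d i)) (psδ S) X (g.map T) (gi.map T) (T f) (T fi) m c i j
      = T (modTan (fun i => D (.inr (.inl i))) (D (.inr (.inr ()))) ρ g gi f fi m c i j) := by
  have := hT.coord.modTan_pull hT.rad psδ_one_apply hg hgi ρ f fi m c i j
  rwa [pullTensor_one, pullInv_one, hT.map_ρ, pullTensor_one] at this

lemma modScal (hT : IsExpansion T D ρ d) (hg : g.IsSymm) (hgi : g * gi = 1) (f fi : R) (m μ c : ℝ) :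
    modScal (fun i => psD (d i)) (psδ S) X (g.map T) (gi.map T) (T f) (T fi) m μ c
      = T (modScal (fun i => D (.inr (.inl i))) (D (.inr (.inr ()))) ρ g gi f fi m μ c) := by
  have := hT.coord.modScal_pull hT.rad psδ_one_apply hg hgi ρ f fi m μ c
  rwa [pullTensor_one, pullInv_one, hT.map_ρ] at this

lemma chr (hT : IsExpansion T D ρ d) (g gi : Matrix κ κ R) (k i j : κ) :
    chr (fun i => psD (d i)) (g.map T) (gi.map T) k i j
      = T (chr (fun i => D (.inr (.inl i))) g gi k i j) := by
  simp only [WeightedAmbient.chr, Matrix.map_apply, hT.tan, map_mul, map_sum, map_add, map_sub,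
    AlgHom.commutes]

lemma grad (hT : IsExpansion T D ρ d) (gi : Matrix κ κ R) (f : R) (a : κ) :
    grad (fun i => psD (d i)) (gi.map T) (T f) a = T (grad (fun i => D (.inr (.inl i))) gi f a) := by
  simp only [WeightedAmbient.grad, Matrix.map_apply, hT.tan, map_mul, map_sum]

/-- A solution of the modified equations to order `N` is a solution of the Ricci equations and the
scalar equation to order `N`. -/
theorem dvd_ambRic (hT : IsExpansion T D ρ d) (h : IsNormalFrame D t ti ρ g gi f fi) {n m : ℝ}
    (μ : ℝ) (hn : n = Fintype.card κ + m) (hn0 : n ≠ 0) (hn1 : n ≠ 1) {N : ℕ}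
    (hN : ∀ s < N, n ≠ 2 * (s + 1))
    (hE : ∀ i j, X ^ N ∣ WeightedAmbient.modTan (fun i => psD (d i)) (psδ S) X (g.map T) (gi.map T)
      (T f) (T fi) m (2 / n) i j)
    (hM : X ^ N ∣ WeightedAmbient.modScal (fun i => psD (d i)) (psδ S) X (g.map T) (gi.map T)
      (T f) (T fi) m μ (2 / n))
    (htr : trEqn m ((gi.map T).map (coeff 0)) (coeff 0 (T fi))
      ((Matrix.of (WeightedAmbient.modTan (fun i => psD (d i)) (psδ S) X (g.map T) (gi.map T)
        (T f) (T fi) m (2 / n))).map (coeff N))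
      (coeff N (WeightedAmbient.modScal (fun i => psD (d i)) (psδ S) X (g.map T) (gi.map T)
        (T f) (T fi) m μ (2 / n))) = 0) :
    (∀ I J, X ^ N ∣ T (ambRic D t ti ρ g gi f fi m I J)) ∧
    X ^ N ∣ T (wF D (ambMat t ρ g) (ambInv ti ρ gi) (t * f) m μ) ∧
    algebraMap ℝ S m * coeff 0 (T fi) ^ 2
        * coeff N (T (wF D (ambMat t ρ g) (ambInv ti ρ gi) (t * f) m μ))
      - ∑ a, ∑ b, coeff 0 (T (gi a b))
        * coeff N (T (ambRic D t ti ρ g gi f fi m (.inr (.inl a)) (.inr (.inl b)))) = 0 := by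
  set P := ambRic D t ti ρ g gi f fi m with hP
  set W := wF D (ambMat t ρ g) (ambInv ti ρ gi) (t * f) m μ with hW
  have hgT : (g.map T).IsSymm := h.hg.map _
  have hgiT : g.map T * gi.map T = 1 := by
    rw [← Matrix.map_mul, h.hgi, Matrix.map_one _ (map_zero _) (map_one _)]
  have hfT : T f * T fi = 1 := by rw [← map_mul, h.hf, map_one]
  have hBT : T (P (.inr (.inr ())) (.inr (.inr ())))
      = T (radRic (D (.inr (.inr ()))) g gi f fi m) := by rw [hP, h.ambRic_rad]
  have hEM : ∀ i j, (Matrix.of fun i j => T (P (.inr (.inl i)) (.inr (.inl j)))) i j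
      = Matrix.of (WeightedAmbient.modTan (fun i => psD (d i)) (psδ S) X (g.map T) (gi.map T)
        (T f) (T fi) m (2 / n)) i j
        - algebraMap ℝ S⟦X⟧ (2 / n) * X * T (P (.inr (.inr ())) (.inr (.inr ()))) * g.map T i j := by
    intro i j
    rw [Matrix.of_apply, Matrix.of_apply, hT.modTan h.hg h.hgi, hBT, hP, h.ambRic_tan, Matrix.map_apply,
      WeightedAmbient.modTan, map_add, map_mul, map_mul, map_mul, AlgHom.commutes, hT.map_ρ]
    ring
  have hFM : T W = -(WeightedAmbient.modScal (fun i => psD (d i)) (psδ S) X (g.map T) (gi.map T)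
        (T f) (T fi) m μ (2 / n))
        + algebraMap ℝ S⟦X⟧ (2 / n) * X * T (P (.inr (.inr ())) (.inr (.inr ()))) * T f ^ 2 := by
    rw [hT.modScal h.hg h.hgi, hBT, hW, h.wF_amb, WeightedAmbient.modScal, map_add, map_neg, map_mul,
      map_mul, map_mul, AlgHom.commutes, hT.map_ρ, map_pow]
    ring
  have h1 := fun j => congrArg T (h.bianchi_tan m μ j)
  have h2 := congrArg T (h.bianchi_rad m μ)
  simp only [← hP, ← hW, divForm, wTrace, Matrix.of_apply, map_add, map_sub, map_mul, map_sum, map_pow,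
    AlgHom.commutes, map_ofNat, map_natCast, ← hT.rad, ← hT.tan, ← hT.chr, ← hT.grad, hT.map_ρ,
    map_zero] at h1 h2
  obtain ⟨hA, hB⟩ := dvd_of_bianchi (D := d) (A := fun j => T (P (.inr (.inl j)) (.inr (.inr ()))))
    (B := T (P (.inr (.inr ())) (.inr (.inr ())))) (F := T W)
    hgT hgiT hfT hn hn0 hn1 hN
    (∑ k, ∑ l, T (gi k l) * psδ S (T (g k l))
      + 2 * algebraMap ℝ S⟦X⟧ m * T fi * psδ S (T f)) hE hM htr hEM hFM h1 h2
  have hXB : X ^ (N + 1) ∣ X * T (P (.inr (.inr ())) (.inr (.inr ()))) := by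
    rw [pow_succ']; exact mul_dvd_mul_left X hB
  have hXB' : X ^ N ∣ X * T (P (.inr (.inr ())) (.inr (.inr ()))) := hB.mul_left X
  have htan : ∀ i j, X ^ N ∣ T (P (.inr (.inl i)) (.inr (.inl j))) := fun i j => by
    have := hEM i j
    rw [Matrix.of_apply, mul_assoc _ X] at this
    rw [this]
    exact dvd_sub (hE i j) ((hXB'.mul_left _).mul_right _)
  refine ⟨?_, ?_, ?_⟩
  · rintro (_ | i | _) (_ | j | _)
    · rw [hP, h.ambRic_zero]; simp
    · rw [hP, h.ambRic_zero]; simp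
    · rw [hP, h.ambRic_zero]; simp
    · rw [hP, h.ambRic_zero']; simp
    · exact htan i j
    · exact hA i
    · rw [hP, h.ambRic_zero']; simp
    · rw [hP, h.ambRic_symm]; exact hA j
    · exact hB
  · rw [hFM, mul_assoc _ X]
    exact dvd_add hM.neg_right ((hXB'.mul_left _).mul_right _)
  · have c0 : ∀ x y : S⟦X⟧, coeff N (x * X * T (P (.inr (.inr ())) (.inr (.inr ()))) * y) = 0 :=
      fun x y => X_pow_dvd_iff.1 (by
        rw [mul_assoc x]; exact (hXB.mul_left _).mul_right _) N (Nat.lt_succ_self N)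
    have e1 : ∀ a b, coeff N (T (P (.inr (.inl a)) (.inr (.inl b))))
        = coeff N (WeightedAmbient.modTan (fun i => psD (d i)) (psδ S) X (g.map T) (gi.map T)
        (T f) (T fi) m (2 / n) a b) := by
      intro a b
      have := congrArg (coeff N) (hEM a b)
      rwa [Matrix.of_apply, map_sub, c0, sub_zero] at this
    simp only [e1]
    rw [hFM, map_add, c0, map_neg]
    simp only [trEqn, Matrix.map_apply, Matrix.of_apply] at htr
    linear_combination -htr

end IsExpansion

end Formal

/-! ### Normal frames on open sets of coordinates -/

section LocalFrame

open TopologicalSpace smoothFun PowerSeries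

variable {d : ℕ} {U : Opens (BaseVec d)} {Ω : Opens (AmbVec d)}

lemma ambBasis_zero : ambBasis d (.inl ()) = (1, 0, 0) := by
  simp [ambBasis, Module.Basis.prod_apply]
  rfl

lemma ambBasis_tan (i : Fin d) : ambBasis d (.inr (.inl i)) = (0, baseBasis d i, 0) := by
  simp [ambBasis, Module.Basis.prod_apply]

lemma ambBasis_rad : ambBasis d (.inr (.inr ())) = (0, 0, 1) := by
  simp [ambBasis, Module.Basis.prod_apply]

/-- The coordinate `t`. -/
def coordT (Ω : Opens (AmbVec d)) : smoothFun Ω := mk (fun z => z.1) (by fun_prop)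

/-- The coordinate `ρ`. -/
def coordR (Ω : Opens (AmbVec d)) : smoothFun Ω := mk (fun z => z.2.2) (by fun_prop)

lemma der_coordT (I : AmbIdx d) :
    der Ω (ambBasis d) I (coordT Ω) = algebraMap ℝ _ (ambBasis d I).1 := by
  refine ext_eval fun z hz => ?_
  rw [eval_der_of_eqOn _ I (G := fun z => z.1) (fun y hy => rfl) hz, pd,
    (hasFDerivAt_fst (p := z)).fderiv, AlgHom.commutes]
  rfl

lemma der_coordR (I : AmbIdx d) :
    der Ω (ambBasis d) I (coordR Ω) = algebraMap ℝ _ (ambBasis d I).2.2 := by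
  refine ext_eval fun z hz => ?_
  have h : HasFDerivAt (fun z : AmbVec d => z.2.2) ((ContinuousLinearMap.snd ℝ (BaseVec d) ℝ).comp
      (ContinuousLinearMap.snd ℝ ℝ (BaseVec d × ℝ))) z :=
    ((ContinuousLinearMap.snd ℝ (BaseVec d) ℝ).comp
      (ContinuousLinearMap.snd ℝ ℝ (BaseVec d × ℝ))).hasFDerivAt
  rw [eval_der_of_eqOn _ I (G := fun z => z.2.2) (fun y hy => rfl) hz, pd, h.fderiv,
    AlgHom.commutes]
  rfl

lemma contDiffOn_init (t : ℝ) : ContDiffOn ℝ ∞ (fun y : BaseVec d => ((t, y, 0) : AmbVec d)) U := by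
  fun_prop

/-- The restriction of functions of `(t, y, ρ)` to `ρ = 0` and a fixed `t`. -/
def restr (t : ℝ) (h : ∀ y ∈ U, ((t, y, 0) : AmbVec d) ∈ Ω) : smoothFun Ω →ₐ[ℝ] smoothFun U :=
  pullback (fun y => (t, y, 0)) (contDiffOn_init t) h

lemma restr_der (t : ℝ) (h : ∀ y ∈ U, ((t, y, 0) : AmbVec d) ∈ Ω) (i : Fin d) (F : smoothFun Ω) :
    restr t h (der Ω (ambBasis d) (.inr (.inl i)) F) = der U (baseBasis d) i (restr t h F) := by
  rw [restr, der_pullback (ambBasis d)]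
  have e : ∀ a, jacobian (ambBasis d) (baseBasis d) _ (contDiffOn_init (U := U) t) a i
      = if .inr (.inl i) = a then 1 else 0 := by
    intro a
    refine ext_eval fun y hy => ?_
    have hd : HasFDerivAt (fun y : BaseVec d => ((t, y, 0) : AmbVec d))
        ((0 : BaseVec d →L[ℝ] ℝ).prod ((ContinuousLinearMap.id ℝ (BaseVec d)).prod 0)) y :=
      (hasFDerivAt_const t y).prodMk ((hasFDerivAt_id y).prodMk (hasFDerivAt_const (0 : ℝ) y))
    rw [eval_jacobian, hd.fderiv]
    have : ((0 : BaseVec d →L[ℝ] ℝ).prod ((ContinuousLinearMap.id ℝ (BaseVec d)).prod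
        (0 : BaseVec d →L[ℝ] ℝ))) (baseBasis d i) = ambBasis d (.inr (.inl i)) := by
      rw [ambBasis_tan]; rfl
    rw [this, Module.Basis.repr_self, Finsupp.single_apply]
    split_ifs <;> simp
  simp only [e, ite_mul, one_mul, zero_mul, Finset.sum_ite_eq, Finset.mem_univ, if_true]

/-- The expansion in `ρ`, for a fixed `t`. -/
def ambTaylor (t : ℝ) (h : ∀ y ∈ U, ((t, y, 0) : AmbVec d) ∈ Ω) :
    smoothFun Ω →ₐ[ℝ] (smoothFun U)⟦X⟧ :=
  taylor (restr t h) (der Ω (ambBasis d) (.inr (.inr ())))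

variable {t : ℝ} (h : ∀ y ∈ U, ((t, y, 0) : AmbVec d) ∈ Ω)

lemma isExpansion_ambTaylor :
    IsExpansion (ambTaylor t h) (der Ω (ambBasis d)) (coordR Ω) (der U (baseBasis d)) where
  coord := isCoordChange_taylor _ _ (restr_der t h) (fun i F => der_comm _ _ _ F)
    (fun i j F => der_comm _ _ _ F)
  rad F := psδ_taylor _ _ F
  map_ρ := taylor_eq_X _ _ (ext_eval fun y hy => by rw [restr, eval_pullback]; rfl) (by
    rw [der_coordR, ambBasis_rad, map_one])

lemma coeff_zero_ambTaylor (F : smoothFun Ω) : coeff 0 (ambTaylor t h F) = restr t h F :=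
  coeff_zero_taylor _ _ F

lemma eval_coeff_ambTaylor {y : BaseVec d} (hy : y ∈ U) (F : smoothFun Ω) (k : ℕ) :
    eval y hy (coeff k (ambTaylor t h F))
      = coeff k (taylor (eval _ (h y hy)) (der Ω (ambBasis d) (.inr (.inr ()))) F) := by
  rw [ambTaylor, coeff_taylor, coeff_taylor, map_smul, restr, eval_pullback]

lemma isBigO_iff_ambTaylor {y : BaseVec d} (hy : y ∈ U) (F : smoothFun Ω) (k : ℕ) :
    ((fun ρ : ℝ => val F (t, y, ρ)) =O[𝓝 0] fun ρ => ρ ^ k)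
      ↔ ∀ j < k, eval y hy (coeff j (ambTaylor t h F)) = 0 := by
  have e : ∀ s : ℝ, ((t, y, 0) : AmbVec d) + s • ambBasis d (.inr (.inr ())) = (t, y, s) := by
    intro s
    simp [ambBasis_rad]
  have e2 : (fun ρ : ℝ => val F (t, y, ρ))
      = fun s => val F ((t, y, 0) + s • ambBasis d (.inr (.inr ()))) := by
    funext s; rw [e]
  simp only [eval_coeff_ambTaylor, e2, ← X_pow_dvd_iff]
  exact ⟨taylor_of_isBigO _ _ (h y hy) F, isBigO_of_taylor _ _ (h y hy) F⟩

/-- Solutions of the modified equations that agree to order `k` agree at a point to the next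
order. -/
theorem eval_coeff_succ_eq {y : BaseVec d} (hy : y ∈ U) {k : ℕ} {n m μ : ℝ} (hn : n = d + m)
    (hn0 : n ≠ 0) (hn1 : n ≠ 1) (hk : n ≠ 2 * (k + 1))
    {g g' gi gi' : Matrix (Fin d) (Fin d) (smoothFun U)⟦X⟧} {f f' fi fi' : (smoothFun U)⟦X⟧}
    (hA : AgreeTo k g g' gi gi' f f' fi fi') (hg : g.IsSymm)
    (h1 : ∀ i j, eval y hy (coeff k (modTan (fun i => psD (der U (baseBasis d) i)) (psδ _) X
      g gi f fi m (2 / n) i j)) = 0)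
    (h1' : ∀ i j, eval y hy (coeff k (modTan (fun i => psD (der U (baseBasis d) i)) (psδ _) X
      g' gi' f' fi' m (2 / n) i j)) = 0)
    (h2 : eval y hy (coeff k (modScal (fun i => psD (der U (baseBasis d) i)) (psδ _) X
      g gi f fi m μ (2 / n))) = 0)
    (h2' : eval y hy (coeff k (modScal (fun i => psD (der U (baseBasis d) i)) (psδ _) X
      g' gi' f' fi' m μ (2 / n))) = 0) :
    (∀ i j, eval y hy (coeff (k + 1) (g' i j - g i j)) = 0) ∧
      eval y hy (coeff (k + 1) (f' - f)) = 0 := by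
  set e := eval y hy
  have hcard : (Fintype.card (Fin d) : ℝ) = d := by simp
  have c0 : ∀ a b : (smoothFun U)⟦X⟧, coeff 0 (a * b) = coeff 0 a * coeff 0 b :=
    AgreeTo.coeff_zero_mul
  have hgi0 : (Matrix.of fun i j => e (coeff 0 (g i j)))
      * (Matrix.of fun i j => e (coeff 0 (gi i j))) = 1 := by
    ext i j
    have := congrArg (fun x => e (coeff 0 x)) (congrFun (congrFun hA.hgi i) j)
    simp only [Matrix.mul_apply, map_sum, c0, map_mul] at this
    rw [Matrix.mul_apply]
    simp only [Matrix.of_apply]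
    rw [this, Matrix.one_apply, Matrix.one_apply]
    split_ifs <;> simp
  have hf0 : e (coeff 0 f) * e (coeff 0 fi) = 1 := by
    have := congrArg (fun x => e (coeff 0 x)) hA.hf
    simp only [c0, map_mul] at this
    rw [this]; simp
  have htr : e (coeffTrace k g g' gi f f' fi m)
      = trPair m (Matrix.of fun i j => e (coeff 0 (gi i j))) (e (coeff 0 fi))
        (Matrix.of fun i j => e (coeff (k + 1) (g' i j - g i j))) (e (coeff (k + 1) (f' - f))) := by
    simp only [coeffTrace, trPair, map_add, map_sum, map_mul, map_ofNat, AlgHom.commutes,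
      Matrix.of_apply]
  refine linear_injective (g := Matrix.of fun i j => e (coeff 0 (g i j)))
    (Matrix.IsSymm.ext fun i j => by simp [hg.apply]) hgi0 hf0 (n := n) (m := m) (by rw [hn, hcard])
    hn0 hn1 hk (Matrix.of fun i j => e (coeff (k + 1) (g' i j - g i j)))
    (e (coeff (k + 1) (f' - f))) (fun i j => ?_) ?_
  · have := congrArg e (AgreeTo.coeff_modTan (D := der U (baseBasis d)) hA m (2 / n) i j).2
    rw [map_sub e, h1, h1', map_sub e, map_mul e, map_mul e, map_mul e, htr, AlgHom.commutes,
      AlgHom.commutes, hcard, ← hn] at this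
    rw [linTan, Matrix.of_apply, Matrix.of_apply]
    linear_combination -this
  · have := congrArg e (AgreeTo.coeff_modScal (D := der U (baseBasis d)) hA m μ (2 / n)).2
    rw [map_sub e, h2, h2', map_sub e, map_mul e, map_mul e, map_mul e, map_mul e, htr, AlgHom.commutes,
      AlgHom.commutes, hcard, ← hn, map_pow] at this
    rw [linScal]
    linear_combination -this

end LocalFrame

/-! ### Component matrices in charts -/

section ChartMatrix

variable {V H : Type*} [NormedAddCommGroup V] [NormedSpace ℝ V] [FiniteDimensional ℝ V]
  [TopologicalSpace H] (I : ModelWithCorners ℝ V H) [I.Boundaryless] {N : Type*}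
  [TopologicalSpace N] [ChartedSpace H N] [IsManifold I ∞ N]
  {ι : Type*} [Fintype ι] [DecidableEq ι] (b : Module.Basis ι ℝ V)

/-- The value of a two-tensor at `p` on two vectors of the model space. -/
def pairAt (h : TwoTensor I N) (p : N) (v w : V) : ℝ :=
  h p (show TangentSpace I p from v) (show TangentSpace I p from w)

/-- The derivative of the inverse of the preferred chart at `p`. -/
def symmDeriv (p : N) (y : V) : V →L[ℝ] V := mfderiv 𝓘(ℝ, V) I (extChartAt I p).symm y

lemma chartMatrix_eq (h : TwoTensor I N) (p : N) (y : V) (i j : ι) :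
    chartMatrix I b h p y i j
      = pairAt I h ((extChartAt I p).symm y) (symmDeriv I p y (b i)) (symmDeriv I p y (b j)) := rfl

lemma pairAt_add_left (h : TwoTensor I N) (p : N) (v v' w : V) :
    pairAt I h p (v + v') w = pairAt I h p v w + pairAt I h p v' w := by
  simp only [pairAt]
  exact congrArg (fun L : TangentSpace I p →L[ℝ] ℝ => L (show TangentSpace I p from w))
    (map_add (h p) (show TangentSpace I p from v) (show TangentSpace I p from v'))

lemma pairAt_smul_left (h : TwoTensor I N) (p : N) (c : ℝ) (v w : V) :
    pairAt I h p (c • v) w = c * pairAt I h p v w := by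
  simp only [pairAt]
  exact congrArg (fun L : TangentSpace I p →L[ℝ] ℝ => L (show TangentSpace I p from w))
    (map_smul (h p) c (show TangentSpace I p from v))

lemma pairAt_add_right (h : TwoTensor I N) (p : N) (v w w' : V) :
    pairAt I h p v (w + w') = pairAt I h p v w + pairAt I h p v w' :=
  map_add (h p _) _ _

lemma pairAt_smul_right (h : TwoTensor I N) (p : N) (c : ℝ) (v w : V) :
    pairAt I h p v (c • w) = c * pairAt I h p v w :=
  map_smul (h p _) c _

/-- The value of a two-tensor at `p`, as a bilinear map on the model space. -/
def bilinAt (h : TwoTensor I N) (p : N) : V →ₗ[ℝ] V →ₗ[ℝ] ℝ :=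
  LinearMap.mk₂ ℝ (pairAt I h p) (pairAt_add_left I h p) (pairAt_smul_left I h p)
    (pairAt_add_right I h p) (pairAt_smul_right I h p)

lemma pairAt_expand (h : TwoTensor I N) (p : N) (v w : V) :
    pairAt I h p v w = ∑ i, ∑ j, b.repr v i * b.repr w j * pairAt I h p (b i) (b j) := by
  have := LinearMap.sum_repr_mul_repr_mul b b (B := bilinAt I h p) v w
  rw [show pairAt I h p v w = bilinAt I h p v w from rfl, ← this]
  simp [Finsupp.sum_fintype, mul_assoc, bilinAt]

lemma mdifferentiableAt_symm (p : N) {y : V} (hy : y ∈ (extChartAt I p).target) :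
    MDifferentiableAt 𝓘(ℝ, V) I (extChartAt I p).symm y := by
  have : IsManifold I 1 N := IsManifold.of_le (n := ∞) (by exact_mod_cast le_top)
  have := mdifferentiableWithinAt_extChartAt_symm (I := I) hy
  rwa [I.range_eq_univ, mdifferentiableWithinAt_univ] at this

lemma symmDeriv_self (p : N) : symmDeriv I p (extChartAt I p p) = ContinuousLinearMap.id ℝ V := by
  have : IsManifold I 1 N := IsManifold.of_le (n := ∞) (by exact_mod_cast le_top)
  have := mfderivWithin_range_extChartAt_symm (I := I) (x := p)
  rw [I.range_eq_univ, mfderivWithin_univ] at this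
  exact this

lemma pairAt_congr (h : TwoTensor I N) {p q : N} (hpq : p = q) {v v' w w' : V} (hv : v = v')
    (hw : w = w') : pairAt I h p v w = pairAt I h q v' w' := by
  subst hpq hv hw; rfl

lemma chartMatrix_self (h : TwoTensor I N) (p : N) (i j : ι) :
    chartMatrix I b h p (extChartAt I p p) i j = pairAt I h p (b i) (b j) := by
  rw [chartMatrix_eq]
  exact pairAt_congr I h (extChartAt_to_inv p) (by rw [symmDeriv_self]; rfl)
    (by rw [symmDeriv_self]; rfl)

/-- The transition map from the chart at `p` to the chart at `q`. -/
def trans (p q : N) (y : V) : V := extChartAt I q ((extChartAt I p).symm y)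

lemma contDiffAt_trans (p q : N) {y : V} (hy : y ∈ (extChartAt I p).target)
    (hq : (extChartAt I p).symm y ∈ (extChartAt I q).source) : ContDiffAt ℝ ∞ (trans I p q) y := by
  have h1 : ContMDiffAt 𝓘(ℝ, V) I ∞ (extChartAt I p).symm y :=
    (contMDiffOn_extChartAt_symm p).contMDiffAt ((isOpen_extChartAt_target p).mem_nhds hy)
  have h2 : ContMDiffAt I 𝓘(ℝ, V) ∞ (extChartAt I q) ((extChartAt I p).symm y) :=
    contMDiffAt_extChartAt' (by rwa [extChartAt_source] at hq)
  exact (h2.comp y h1).contDiffAt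

lemma symm_trans (p q : N) {y : V}
    (hq : (extChartAt I p).symm y ∈ (extChartAt I q).source) :
    (extChartAt I q).symm (trans I p q y) = (extChartAt I p).symm y :=
  (extChartAt I q).left_inv hq

lemma trans_mem_target (p q : N) {y : V}
    (hq : (extChartAt I p).symm y ∈ (extChartAt I q).source) :
    trans I p q y ∈ (extChartAt I q).target := (extChartAt I q).map_source hq

lemma trans_trans (p q : N) {y : V} (hy : y ∈ (extChartAt I p).target)
    (hq : (extChartAt I p).symm y ∈ (extChartAt I q).source) :
    trans I q p (trans I p q y) = y := by
  rw [trans, symm_trans I p q hq, (extChartAt I p).right_inv hy]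

lemma eventually_symm_mem (p : N) {y : V} (hy : y ∈ (extChartAt I p).target) {O : Set N}
    (hO : IsOpen O) (hq : (extChartAt I p).symm y ∈ O) :
    ∀ᶠ z in 𝓝 y, z ∈ (extChartAt I p).target ∧ (extChartAt I p).symm z ∈ O :=
  ((isOpen_extChartAt_target p).eventually_mem hy).and
    ((continuousAt_extChartAt_symm'' hy).eventually (hO.mem_nhds hq))

lemma symmDeriv_trans (p q : N) {y : V} (hy : y ∈ (extChartAt I p).target)
    (hq : (extChartAt I p).symm y ∈ (extChartAt I q).source) (v : V) :
    symmDeriv I p y v = symmDeriv I q (trans I p q y) (fderiv ℝ (trans I p q) y v) := by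
  have h1 : (extChartAt I p).symm =ᶠ[𝓝 y] (extChartAt I q).symm ∘ trans I p q := by
    filter_upwards [eventually_symm_mem I p hy (isOpen_extChartAt_source q) hq] with z hz
    exact (symm_trans I p q hz.2).symm
  have h2 : MDifferentiableAt 𝓘(ℝ, V) 𝓘(ℝ, V) (trans I p q) y :=
    ((contDiffAt_trans I p q hy hq).differentiableAt (by simp)).mdifferentiableAt
  have h3 := mfderiv_comp y (mdifferentiableAt_symm I q (trans_mem_target I p q hq)) h2
  have h4 := h1.mfderiv_eq (I := 𝓘(ℝ, V)) (I' := I)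
  rw [h3, mfderiv_eq_fderiv] at h4
  exact congrFun (congrArg DFunLike.coe h4) v

/-- The matrix of the derivative of the transition map. -/
def transJac (p q : N) (y : V) : Matrix ι ι ℝ :=
  Matrix.of fun a i => b.repr (fderiv ℝ (trans I p q) y (b i)) a

lemma chartMatrix_trans (h : TwoTensor I N) (p q : N) {y : V} (hy : y ∈ (extChartAt I p).target)
    (hq : (extChartAt I p).symm y ∈ (extChartAt I q).source) :
    chartMatrix I b h p y = (transJac I b p q y).transpose * chartMatrix I b h q (trans I p q y)
      * transJac I b p q y := by
  set y' := trans I p q y with hy'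
  set hh : TwoTensor I N := h
  have key : ∀ v w, pairAt I h ((extChartAt I p).symm y) (symmDeriv I p y v) (symmDeriv I p y w)
      = ((bilinAt I h ((extChartAt I q).symm y')).compl₁₂ (symmDeriv I q y').toLinearMap
          (symmDeriv I q y').toLinearMap)
        (fderiv ℝ (trans I p q) y v) (fderiv ℝ (trans I p q) y w) := fun v w =>
    pairAt_congr I h (symm_trans I p q hq).symm (symmDeriv_trans I p q hy hq v)
      (symmDeriv_trans I p q hy hq w)
  ext i j
  rw [chartMatrix_eq, key, ← LinearMap.sum_repr_mul_repr_mul b b]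
  simp only [Finsupp.sum_fintype, zero_mul, zero_smul, implies_true, Finset.sum_const_zero,
    Matrix.mul_apply, Finset.sum_mul, smul_eq_mul, mul_zero]
  rw [Finset.sum_comm]
  refine Finset.sum_congr rfl fun a _ => Finset.sum_congr rfl fun c _ => ?_
  rw [Matrix.transpose_apply, transJac, Matrix.of_apply, Matrix.of_apply, chartMatrix_eq]
  simp only [LinearMap.compl₁₂_apply, ContinuousLinearMap.coe_coe]
  rw [show bilinAt I h ((extChartAt I q).symm y') (symmDeriv I q y' (b c)) (symmDeriv I q y' (b a))
    = pairAt I h ((extChartAt I q).symm y') (symmDeriv I q y' (b c)) (symmDeriv I q y' (b a)) from rfl]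
  ring

lemma transJac_mul (p q : N) {y : V} (hy : y ∈ (extChartAt I p).target)
    (hq : (extChartAt I p).symm y ∈ (extChartAt I q).source) :
    transJac I b p q y * transJac I b q p (trans I p q y) = 1 := by
  have hy2 := trans_mem_target I p q hq
  have hq2 : (extChartAt I q).symm (trans I p q y) ∈ (extChartAt I p).source := by
    rw [symm_trans I p q hq]; exact (extChartAt I p).map_target hy
  have d1 := (contDiffAt_trans I p q hy hq).differentiableAt (by simp)
  have d2 := (contDiffAt_trans I q p hy2 hq2).differentiableAt (by simp)
  have e1 : trans I p q ∘ trans I q p =ᶠ[𝓝 (trans I p q y)] id := by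
    filter_upwards [eventually_symm_mem I q hy2 (isOpen_extChartAt_source p) hq2] with z hz
    exact trans_trans I q p hz.1 hz.2
  have e2 : trans I q p (trans I p q y) = y := trans_trans I p q hy hq
  have e3 := e1.fderiv_eq (𝕜 := ℝ)
  rw [fderiv_comp _ (by rwa [e2]) d2, fderiv_id, e2] at e3
  ext i j
  have e4 := congrArg (fun L => b.repr (L (b j)) i) e3
  simp only [ContinuousLinearMap.comp_apply, ContinuousLinearMap.id_apply,
    Module.Basis.repr_self] at e4
  rw [Matrix.mul_apply, Matrix.one_apply]
  conv_lhs at e4 => rw [← b.sum_repr (fderiv ℝ (trans I q p) (trans I p q y) (b j))]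
  simp only [map_sum, map_smul, Finsupp.coe_finsetSum, Finset.sum_apply, Finsupp.smul_apply,
    smul_eq_mul, Finsupp.single_apply] at e4
  simp only [transJac, Matrix.of_apply]
  rw [← show (if j = i then (1 : ℝ) else 0) = if i = j then 1 else 0 by simp only [eq_comm], ← e4]
  exact Finset.sum_congr rfl fun a _ => mul_comm _ _

/-- A two-tensor as a section of the bundle of bilinear forms. -/
abbrev tensorSection (h : TwoTensor I N) (p : N) :
    Bundle.TotalSpace (V →L[ℝ] V →L[ℝ] ℝ)
      (fun p : N => TangentSpace I p →L[ℝ] TangentSpace I p →L[ℝ] ℝ) :=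
  Bundle.TotalSpace.mk' (V →L[ℝ] V →L[ℝ] ℝ)
    (E := fun p : N => TangentSpace I p →L[ℝ] TangentSpace I p →L[ℝ] ℝ) p (h p)

lemma trivialization_tensorSection (h : TwoTensor I N) (p₀ p : N)
    (hp : p ∈ (extChartAt I p₀).source) (v w : V) :
    ((trivializationAt (V →L[ℝ] V →L[ℝ] ℝ)
      (fun p : N => TangentSpace I p →L[ℝ] TangentSpace I p →L[ℝ] ℝ) p₀) (tensorSection I h p)).2 v w
      = pairAt I h p (symmDeriv I p₀ (extChartAt I p₀ p) v)
          (symmDeriv I p₀ (extChartAt I p₀ p) w) := by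
  have : IsManifold I 1 N := IsManifold.of_le (n := ∞) (by exact_mod_cast le_top)
  have hp' : p ∈ (chartAt H p₀).source := by rwa [extChartAt_source] at hp
  have hb : p ∈ (trivializationAt V (TangentSpace I) p₀).baseSet := by simpa using hp'
  rw [hom_trivializationAt_apply]
  have e := inCoordinates_apply_eq₂ (𝕜 := ℝ) (F₁ := V) (E₁ := fun p : N => TangentSpace I p)
    (F₂ := V) (E₂ := fun p : N => TangentSpace I p) (F₃ := ℝ) (E₃ := fun _ : N => ℝ) (x₀ := p₀) (x := p)
    (ϕ := h p) (v := v) (w := w) hb hb (by simp)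
  have hs : ∀ v, (trivializationAt V (TangentSpace I) p₀).symm p v
      = symmDeriv I p₀ (extChartAt I p₀ p) v := by
    intro v
    have := TangentBundle.symmL_trivializationAt (I := I) hp'
    rw [I.range_eq_univ, mfderivWithin_univ] at this
    exact (Bundle.Trivialization.symmL_apply _ hb _).symm.trans
      (congrFun (congrArg DFunLike.coe this) v)
  refine e.trans ?_
  rw [hs, hs]
  simp
  rfl

set_option synthInstance.maxHeartbeats 200000 in
/-- The bundle section given by a two-tensor is smooth on the intersection of an open set with the
domain of a chart if and only if the components in the chart are smooth. -/
lemma contMDiffOn_tensor_iff (h : TwoTensor I N) (p₀ : N) (O : Set N) :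
    ContMDiffOn I (I.prod 𝓘(ℝ, V →L[ℝ] V →L[ℝ] ℝ)) ∞ (tensorSection I h)
      (O ∩ (extChartAt I p₀).source) ↔
    ∀ i j, ContDiffOn ℝ ∞ (fun y => chartMatrix I b h p₀ y i j)
      {y | y ∈ (extChartAt I p₀).target ∧ (extChartAt I p₀).symm y ∈ O} := by
  set e := trivializationAt (V →L[ℝ] V →L[ℝ] ℝ)
      (fun p : N => TangentSpace I p →L[ℝ] TangentSpace I p →L[ℝ] ℝ) p₀ with he
  have hmaps : Set.MapsTo (tensorSection I h) (O ∩ (extChartAt I p₀).source) e.source := by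
    intro p hp
    have : p ∈ (chartAt H p₀).source := by simpa [extChartAt_source] using hp.2
    rw [he, Bundle.Trivialization.mem_source]
    simpa using this
  have : MemTrivializationAtlas e := inferInstanceAs (MemTrivializationAtlas (trivializationAt
    (V →L[ℝ] V →L[ℝ] ℝ)
      (fun p : N => TangentSpace I p →L[ℝ] TangentSpace I p →L[ℝ] ℝ) p₀))
  rw [Bundle.Trivialization.contMDiffOn_iff (e := e) hmaps]
  have h1 : ContMDiffOn I I ∞ (fun p => (tensorSection I h p).proj)
      (O ∩ (extChartAt I p₀).source) := contMDiffOn_id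
  rw [and_iff_right h1]
  set Y := {y | y ∈ (extChartAt I p₀).target ∧ (extChartAt I p₀).symm y ∈ O} with hY
  set Φ : N → V →L[ℝ] V →L[ℝ] ℝ := fun p => (e (tensorSection I h p)).2 with hΦ
  have h2 : ContMDiffOn I 𝓘(ℝ, V →L[ℝ] V →L[ℝ] ℝ) ∞ Φ (O ∩ (extChartAt I p₀).source)
      ↔ ContDiffOn ℝ ∞ (Φ ∘ (extChartAt I p₀).symm) Y := by
    rw [← contMDiffOn_iff_contDiffOn]
    constructor
    · intro hc
      exact hc.comp ((contMDiffOn_extChartAt_symm p₀).mono fun y hy => hy.1)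
        fun y hy => ⟨hy.2, (extChartAt I p₀).map_target hy.1⟩
    · intro hc
      have h0 : ContMDiffOn I 𝓘(ℝ, V) ∞ (extChartAt I p₀) (O ∩ (extChartAt I p₀).source) :=
        contMDiffOn_extChartAt.mono fun p hp => by simpa [extChartAt_source] using hp.2
      have := hc.comp h0 fun p hp => ⟨(extChartAt I p₀).map_source hp.2, by
          rw [(extChartAt I p₀).left_inv hp.2]; exact hp.1⟩
      exact this.congr fun p hp => by
        simp only [Function.comp_apply, (extChartAt I p₀).left_inv hp.2]
  rw [show ContMDiffOn I 𝓘(ℝ, V →L[ℝ] V →L[ℝ] ℝ) ∞ (fun x => (e (tensorSection I h x)).2)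
    (O ∩ (extChartAt I p₀).source) ↔ _ from h2, contDiffOn_clm_apply]
  have h3 : ∀ y ∈ Y, ∀ v w, Φ ((extChartAt I p₀).symm y) v w
      = pairAt I h ((extChartAt I p₀).symm y) (symmDeriv I p₀ y v) (symmDeriv I p₀ y w) := by
    intro y hy v w
    rw [hΦ]
    refine (trivialization_tensorSection I h p₀ _ ((extChartAt I p₀).map_target hy.1) v w).trans ?_
    rw [(extChartAt I p₀).right_inv hy.1]
  constructor
  · intro hc i j
    exact (contDiffOn_clm_apply.1 (hc (b i)) (b j)).congr fun y hy => (h3 y hy _ _).symm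
  · intro hc v
    refine contDiffOn_clm_apply.2 fun w => ?_
    have : ContDiffOn ℝ ∞ (fun y => ∑ i, ∑ j, b.repr v i * b.repr w j
        * chartMatrix I b h p₀ y i j) Y :=
      ContDiffOn.sum fun i _ => ContDiffOn.sum fun j _ => contDiffOn_const.mul (hc i j)
    refine this.congr fun y hy => (h3 y hy v w).trans ?_
    have e5 := LinearMap.sum_repr_mul_repr_mul b b
      (B := (bilinAt I h ((extChartAt I p₀).symm y)).compl₁₂ (symmDeriv I p₀ y).toLinearMap
          (symmDeriv I p₀ y).toLinearMap) v w
    refine Eq.trans ?_ (e5.symm.trans ?_)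
    · rfl
    · simp only [Finsupp.sum_fintype, zero_mul, zero_smul, implies_true, Finset.sum_const_zero,
        smul_eq_mul, mul_zero]
      refine Finset.sum_congr rfl fun a _ => Finset.sum_congr rfl fun c _ => ?_
      rw [mul_assoc]; rfl

end ChartMatrix

/-! ### Charts of the ambient manifold -/

section AmbientCharts

variable {d : ℕ} {M : Type*} [TopologicalSpace M] [ChartedSpace (BaseVec d) M]
  [IsManifold (𝓡 d) ∞ M]

lemma mem_target_amb (t ρ : ℝ) (x : M) (z : AmbVec d) :
    z ∈ (extChartAt (ambI d) ((t, x, ρ) : ℝ × M × ℝ)).target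
      ↔ z.2.1 ∈ (extChartAt (𝓡 d) x).target := by
  simp only [extChartAt_prod, PartialEquiv.prod_target, Set.mem_prod, extChartAt_model_space_eq_id,
    PartialEquiv.refl_target, Set.mem_univ, true_and, and_true]

lemma mem_source_amb (t ρ : ℝ) (x : M) (p : ℝ × M × ℝ) :
    p ∈ (extChartAt (ambI d) ((t, x, ρ) : ℝ × M × ℝ)).source
      ↔ p.2.1 ∈ (extChartAt (𝓡 d) x).source := by
  simp only [extChartAt_prod, PartialEquiv.prod_source, Set.mem_prod, extChartAt_model_space_eq_id,
    PartialEquiv.refl_source, Set.mem_univ, true_and, and_true]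

lemma symmDeriv_amb (t ρ : ℝ) (x : M) {y : BaseVec d} (hy : y ∈ (extChartAt (𝓡 d) x).target)
    (t' ρ' a c : ℝ) (v : BaseVec d) :
    symmDeriv (ambI d) ((t, x, ρ) : ℝ × M × ℝ) (t', y, ρ') (a, v, c)
      = (a, symmDeriv (𝓡 d) x y v, c) := by
  have h1 : MDifferentiableAt (𝓡 d) (𝓡 d) (extChartAt (𝓡 d) x).symm y :=
    mdifferentiableAt_symm (𝓡 d) x hy
  have h2 : MDifferentiableAt ((𝓡 d).prod 𝓘(ℝ, ℝ)) ((𝓡 d).prod 𝓘(ℝ, ℝ))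
      (Prod.map (extChartAt (𝓡 d) x).symm (id : ℝ → ℝ)) (y, ρ') :=
    MDifferentiableAt.prodMap h1 mdifferentiableAt_id
  have h3 := mfderiv_prodMap (p := ((t', y, ρ') : AmbVec d)) (I := 𝓘(ℝ, ℝ))
    (I' := (𝓡 d).prod 𝓘(ℝ, ℝ)) (J := 𝓘(ℝ, ℝ)) (J' := (𝓡 d).prod 𝓘(ℝ, ℝ)) (f := (id : ℝ → ℝ))
    (g := Prod.map (extChartAt (𝓡 d) x).symm (id : ℝ → ℝ)) mdifferentiableAt_id h2
  have h4 := mfderiv_prodMap (p := ((y, ρ') : BaseVec d × ℝ)) (I := (𝓡 d)) (I' := 𝓘(ℝ, ℝ))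
    (J := 𝓡 d) (J' := 𝓘(ℝ, ℝ)) (f := (extChartAt (𝓡 d) x).symm) (g := (id : ℝ → ℝ)) h1
    mdifferentiableAt_id
  rw [h4] at h3
  simp only [mfderiv_id] at h3
  have h5 : (extChartAt (ambI d) ((t, x, ρ) : ℝ × M × ℝ)).symm
      = Prod.map (id : ℝ → ℝ) (Prod.map (extChartAt (𝓡 d) x).symm (id : ℝ → ℝ)) := rfl
  unfold symmDeriv
  rw [h5]
  have h6 := congrFun (congrArg DFunLike.coe h3) (a, v, c)
  have h7 : 𝓘(ℝ, AmbVec d) = 𝓘(ℝ, ℝ).prod ((𝓡 d).prod 𝓘(ℝ, ℝ)) := by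
    rw [modelWithCornersSelf_prod, modelWithCornersSelf_prod]
  rw [h7, ← chartedSpaceSelf_prod, ← chartedSpaceSelf_prod]
  exact h6

/-- A form whose signature adds up to the dimension has no kernel. -/
lemma HasSignature.nondegenerate {W : Type*} [AddCommGroup W] [Module ℝ W] [TopologicalSpace W]
    [FiniteDimensional ℝ W] {B : W →L[ℝ] W →L[ℝ] ℝ} {q₁ q₂ : ℕ} (h : HasSignature B q₁ q₂)
    (hq : q₁ + q₂ = Module.finrank ℝ W) {v : W} (hv : ∀ w, B v w = 0) : v = 0 := by
  obtain ⟨hs, h1, h2⟩ := h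
  have h3 := QuadraticForm.sigPos_add_sigNeg_add_radical (Q := LinearMap.BilinMap.toQuadraticMap
    (LinearMap.mk₂ ℝ (fun v w => B v w) (by simp) (by simp) (by simp) (by simp)))
  rw [h1, h2, hq] at h3
  have h4 := Submodule.finrank_eq_zero.1 (Nat.add_eq_left.1 h3)
  rw [← Submodule.mem_bot ℝ, ← h4, QuadraticMap.mem_radical_iff']
  have hv' : ∀ w, B w v = 0 := fun w => by rw [hs, hv]
  simp [hv, hv']

lemma symmDeriv_surjective {V H : Type*} [NormedAddCommGroup V] [NormedSpace ℝ V]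
    [FiniteDimensional ℝ V] [TopologicalSpace H] (I : ModelWithCorners ℝ V H) [I.Boundaryless]
    {N : Type*} [TopologicalSpace N] [ChartedSpace H N] [IsManifold I ∞ N] (p : N) {y : V}
    (hy : y ∈ (extChartAt I p).target) : Function.Surjective (symmDeriv I p y) := by
  intro v
  have h := symmDeriv_trans I ((extChartAt I p).symm y) p (mem_extChartAt_target _)
    (by rw [extChartAt_to_inv]; exact (extChartAt I p).map_target hy) v
  rw [symmDeriv_self] at h
  have e : trans I ((extChartAt I p).symm y) p
      (extChartAt I ((extChartAt I p).symm y) ((extChartAt I p).symm y)) = y := by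
    rw [trans, extChartAt_to_inv, (extChartAt I p).right_inv hy]
  rw [e] at h
  exact ⟨_, h.symm⟩

end AmbientCharts

/-! ### Ambient metrics in normal form in the charts of the ambient manifold -/

section AmbientChart

open TopologicalSpace smoothFun

variable {d : ℕ} {M : Type*} [TopologicalSpace M] [ChartedSpace (BaseVec d) M]
  [IsManifold (𝓡 d) ∞ M] {S : SmoothMetricMeasureSpace d M} {A : MetricMeasureStructure d M}

/-- The part of the domain where the density does not vanish. -/
def MetricMeasureStructure.regular (A : MetricMeasureStructure d M) : Set (ℝ × M × ℝ) :=
  A.space ∩ A.f ⁻¹' {0}ᶜ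

/-- The metric has the normal form `2 ρ dt² + 2 t dρ dt` modulo tangential terms. -/
def IsReduced (A : MetricMeasureStructure d M) : Prop :=
  ∀ t x ρ, (t, x, ρ) ∈ A.space → ∀ (a : ℝ) (v : BaseVec d) (c a' : ℝ) (v' : BaseVec d) (c' : ℝ),
    pairAt (ambI d) A.g (t, x, ρ) (a, v, c) (a', v', c')
      = 2 * ρ * (a * a') + t * (a * c' + a' * c)
        + pairAt (ambI d) A.g (t, x, ρ) (0, v, 0) (0, v', 0)

lemma IsPreAmbient.isOpen_regular (hA : IsPreAmbient S A) : IsOpen A.regular :=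
  hA.contMDiffOn_f.continuousOn.isOpen_inter_preimage hA.isOpen_space isOpen_compl_singleton

lemma IsPreAmbient.zero_mem_regular (hA : IsPreAmbient S A) {t : ℝ} (ht : 0 < t) (x : M) :
    (t, x, 0) ∈ A.regular :=
  ⟨hA.mem_zero t ht x, by
    rw [Set.mem_preimage, hA.initial_f t ht x]; exact (mul_pos ht (S.f_pos x)).ne'⟩

/-- The target of the preferred chart at `x`. -/
def baseOpen (x : M) : Opens (BaseVec d) :=
  ⟨(extChartAt (𝓡 d) x).target, isOpen_extChartAt_target x⟩

lemma self_mem_baseOpen (x : M) : extChartAt (𝓡 d) x x ∈ baseOpen x := mem_extChartAt_target x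

/-- The regular points, in the chart of the ambient manifold given by the preferred chart
at `x`. -/
def ambOpen (hA : IsPreAmbient S A) (x : M) : Opens (AmbVec d) :=
  ⟨(extChartAt (ambI d) ((1, x, 0) : ℝ × M × ℝ)).target
      ∩ (extChartAt (ambI d) ((1, x, 0) : ℝ × M × ℝ)).symm ⁻¹' A.regular,
    (continuousOn_extChartAt_symm _).isOpen_inter_preimage (isOpen_extChartAt_target _)
      hA.isOpen_regular⟩

lemma mem_ambOpen (hA : IsPreAmbient S A) {x : M} {t ρ : ℝ} {y : BaseVec d} :
    (t, y, ρ) ∈ ambOpen hA x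
      ↔ y ∈ baseOpen x ∧ (t, (extChartAt (𝓡 d) x).symm y, ρ) ∈ A.regular := by
  refine Iff.trans ?_ (and_congr (mem_target_amb 1 0 x (t, y, ρ)) Iff.rfl)
  rfl

lemma ambOpen_pos (hA : IsPreAmbient S A) {x : M} {z : AmbVec d} (hz : z ∈ ambOpen hA x) :
    0 < z.1 := hA.pos_of_mem _ hz.2.1

lemma init_mem_ambOpen (hA : IsPreAmbient S A) {x : M} {t : ℝ} (ht : 0 < t) :
    ∀ y ∈ baseOpen x, ((t, y, 0) : AmbVec d) ∈ ambOpen hA x := fun _ hy =>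
  (mem_ambOpen hA).2 ⟨hy, hA.zero_mem_regular ht _⟩

lemma self_mem_ambOpen (hA : IsPreAmbient S A) {x : M} {t ρ : ℝ} (h : (t, x, ρ) ∈ A.regular) :
    ((t, extChartAt (𝓡 d) x x, ρ) : AmbVec d) ∈ ambOpen hA x :=
  (mem_ambOpen hA).2 ⟨self_mem_baseOpen x, by rwa [extChartAt_to_inv]⟩

/-- The components of the ambient metric in the chart given by the preferred chart at `x`. -/
def locG (hA : IsPreAmbient S A) (x : M) : Matrix (AmbIdx d) (AmbIdx d) (smoothFun (ambOpen hA x)) :=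
  Matrix.of fun I J => mk (fun z => chartMatrix (ambI d) (ambBasis d) A.g (1, x, 0) z I J)
    ((contMDiffOn_tensor_iff (ambI d) (ambBasis d) A.g (1, x, 0) A.regular).1
      (hA.contMDiffOn_g.mono fun _ hp => hp.1.1) I J)

lemma eval_locG (hA : IsPreAmbient S A) {x : M} {z : AmbVec d} (hz : z ∈ ambOpen hA x)
    (I J : AmbIdx d) :
    eval z hz (locG hA x I J) = chartMatrix (ambI d) (ambBasis d) A.g (1, x, 0) z I J := rfl

/-- The ambient density in the chart given by the preferred chart at `x`. -/
def locF (hA : IsPreAmbient S A) (x : M) : smoothFun (ambOpen hA x) :=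
  mk (chartFun (ambI d) A.f (1, x, 0)) (by
    have h := hA.contMDiffOn_f.comp (contMDiffOn_extChartAt_symm ((1, x, 0) : ℝ × M × ℝ)
      (I := ambI d) (n := ∞) |>.mono (fun z (hz : z ∈ ambOpen hA x) => hz.1))
      (fun z hz => hz.2.1)
    exact h.contDiffOn)

/-- The tangential part of an ambient two-tensor, in the preferred chart at `x`. -/
lemma chartMatrix_amb (h : TwoTensor (ambI d) (ℝ × M × ℝ)) {x : M} {t ρ : ℝ} {y : BaseVec d}
    (hy : y ∈ baseOpen x) (I J : AmbIdx d) :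
    chartMatrix (ambI d) (ambBasis d) h (1, x, 0) (t, y, ρ) I J
      = pairAt (ambI d) h (t, (extChartAt (𝓡 d) x).symm y, ρ)
        ((ambBasis d I).1, symmDeriv (𝓡 d) x y (ambBasis d I).2.1, (ambBasis d I).2.2)
        ((ambBasis d J).1, symmDeriv (𝓡 d) x y (ambBasis d J).2.1, (ambBasis d J).2.2) := by
  rw [chartMatrix_eq]
  exact pairAt_congr _ h rfl (symmDeriv_amb 1 0 x hy t ρ _ _ _) (symmDeriv_amb 1 0 x hy t ρ _ _ _)

/-- The inverse of the function `t`. -/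
def locTi (hA : IsPreAmbient S A) (x : M) : smoothFun (ambOpen hA x) :=
  mk (fun z => z.1⁻¹) (ContDiffOn.inv (by fun_prop) fun _ hz => (ambOpen_pos hA hz).ne')

lemma coordT_mul_locTi (hA : IsPreAmbient S A) (x : M) :
    coordT (ambOpen hA x) * locTi hA x = 1 :=
  ext_eval fun z hz => by
    rw [map_mul, map_one]
    exact mul_inv_cancel₀ (ambOpen_pos hA hz).ne'

/-- The family `g_ρ` of metrics, in the preferred chart at `x`. -/
def locg (hA : IsPreAmbient S A) (x : M) : Matrix (Fin d) (Fin d) (smoothFun (ambOpen hA x)) :=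
  Matrix.of fun i j => locTi hA x * locTi hA x * locG hA x (.inr (.inl i)) (.inr (.inl j))

/-- The family `f_ρ` of densities, in the preferred chart at `x`. -/
def locf (hA : IsPreAmbient S A) (x : M) : smoothFun (ambOpen hA x) := locTi hA x * locF hA x

lemma eval_locg (hA : IsPreAmbient S A) {x : M} {t ρ : ℝ} {y : BaseVec d}
    (hz : (t, y, ρ) ∈ ambOpen hA x) (i j : Fin d) :
    eval _ hz (locg hA x i j)
      = t⁻¹ * t⁻¹ * pairAt (ambI d) A.g (t, (extChartAt (𝓡 d) x).symm y, ρ)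
        (0, symmDeriv (𝓡 d) x y (baseBasis d i), 0)
        (0, symmDeriv (𝓡 d) x y (baseBasis d j), 0) := by
  have : eval _ hz (locg hA x i j) = t⁻¹ * t⁻¹ * chartMatrix (ambI d) (ambBasis d) A.g (1, x, 0)
    (t, y, ρ) (.inr (.inl i)) (.inr (.inl j)) := rfl
  rw [this, chartMatrix_amb _ ((mem_ambOpen hA).1 hz).1, ambBasis_tan, ambBasis_tan]

lemma eval_locf (hA : IsPreAmbient S A) {x : M} {t ρ : ℝ} {y : BaseVec d}
    (hz : (t, y, ρ) ∈ ambOpen hA x) :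
    eval _ hz (locf hA x) = t⁻¹ * A.f (t, (extChartAt (𝓡 d) x).symm y, ρ) := rfl

lemma pairAt_amb_zero_left (h : TwoTensor (ambI d) (ℝ × M × ℝ)) (p : ℝ × M × ℝ) (w : AmbVec d) :
    pairAt (ambI d) h p (0, 0, 0) w = 0 := by
  have := pairAt_smul_left (ambI d) h p 0 (0, 0, 0) w
  rwa [zero_smul, zero_mul] at this

lemma pairAt_amb_zero_right (h : TwoTensor (ambI d) (ℝ × M × ℝ)) (p : ℝ × M × ℝ) (w : AmbVec d) :
    pairAt (ambI d) h p w (0, 0, 0) = 0 := by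
  have := pairAt_smul_right (ambI d) h p 0 w (0, 0, 0)
  rwa [zero_smul, zero_mul] at this

lemma IsReduced.locG_eq (hA : IsPreAmbient S A) (hR : IsReduced A) (x : M) :
    locG hA x = ambMat (coordT _) (coordR _) (locg hA x) := by
  refine Matrix.ext fun I J => ext_eval fun z hz => ?_
  obtain ⟨t, y, ρ⟩ := z
  obtain ⟨hy, hp⟩ := (mem_ambOpen hA).1 hz
  have ht : t ≠ 0 := (ambOpen_pos hA hz).ne'
  have hT : eval _ hz (coordT _) = t := rfl
  have hR' : eval _ hz (coordR _) = ρ := rfl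
  have b0 : ∀ u : Unit, ambBasis d (.inl u) = (1, 0, 0) := fun _ => ambBasis_zero
  have b1 : ∀ u : Unit, ambBasis d (.inr (.inr u)) = (0, 0, 1) := fun _ => ambBasis_rad
  rw [eval_locG, chartMatrix_amb _ hy, hR _ _ _ hp.1]
  rcases I with ⟨⟩ | i | ⟨⟩ <;> rcases J with ⟨⟩ | j | ⟨⟩ <;>
    simp only [b0, ambBasis_tan, b1, map_zero, pairAt_amb_zero_left,
      pairAt_amb_zero_right, ambMat, Matrix.of_apply, map_mul, map_add, hT, hR', eval_locg] <;>
    field_simp <;> ring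

lemma IsPreAmbient.pairAt_dilation (hA : IsPreAmbient S A) {s t ρ : ℝ} {x : M} (hs : 0 < s)
    (h : (t, x, ρ) ∈ A.space) (a : ℝ) (v : BaseVec d) (c a' : ℝ) (v' : BaseVec d) (c' : ℝ) :
    pairAt (ambI d) A.g (s * t, x, ρ) (s * a, v, c) (s * a', v', c')
      = s ^ 2 * pairAt (ambI d) A.g (t, x, ρ) (a, v, c) (a', v', c') :=
  hA.homogeneous_g s hs t x ρ h a v c a' v' c'

lemma val_locg_eq (hA : IsPreAmbient S A) {x : M} {t t' ρ : ℝ} {y : BaseVec d}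
    (hz : (t, y, ρ) ∈ ambOpen hA x) (hz' : (t', y, ρ) ∈ ambOpen hA x) (i j : Fin d) :
    val (locg hA x i j) (t', y, ρ) = val (locg hA x i j) (t, y, ρ) := by
  have ht := ambOpen_pos hA hz
  have ht' := ambOpen_pos hA hz'
  rw [← eval_apply hz, ← eval_apply hz', eval_locg, eval_locg]
  have := hA.pairAt_dilation (div_pos ht' ht) ((mem_ambOpen hA).1 hz).2.1 0
    (symmDeriv (𝓡 d) x y (baseBasis d i)) 0 0 (symmDeriv (𝓡 d) x y (baseBasis d j)) 0
  dsimp only at ht ht'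
  rw [div_mul_cancel₀ _ ht.ne', mul_zero] at this
  rw [this]
  field_simp

lemma val_locf_eq (hA : IsPreAmbient S A) {x : M} {t t' ρ : ℝ} {y : BaseVec d}
    (hz : (t, y, ρ) ∈ ambOpen hA x) (hz' : (t', y, ρ) ∈ ambOpen hA x) :
    val (locf hA x) (t', y, ρ) = val (locf hA x) (t, y, ρ) := by
  have ht := ambOpen_pos hA hz
  have ht' := ambOpen_pos hA hz'
  rw [← eval_apply hz, ← eval_apply hz', eval_locf, eval_locf]
  have := hA.homogeneous_f (t' / t) (div_pos ht' ht) t _ ρ ((mem_ambOpen hA).1 hz).2.1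
  dsimp only at ht ht'
  rw [div_mul_cancel₀ _ ht.ne'] at this
  rw [this]
  field_simp

lemma der_zero_eq_zero {Ω : Opens (AmbVec d)} {F : smoothFun Ω}
    (h : ∀ t t' y ρ, (t, y, ρ) ∈ Ω → (t', y, ρ) ∈ Ω → val F (t', y, ρ) = val F (t, y, ρ)) :
    der Ω (ambBasis d) (.inl ()) F = 0 := by
  refine ext_eval fun z hz => ?_
  obtain ⟨t, y, ρ⟩ := z
  have h1 := hasDerivAt_line (ambBasis d) (.inl ()) F (p := (t, y, ρ)) (s := 0) (by simpa using hz)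
  have h2 : (fun s : ℝ => val F ((t, y, ρ) + s • ambBasis d (.inl ()))) =ᶠ[𝓝 0]
      fun _ => val F (t, y, ρ) := by
    filter_upwards [eventually_line_mem hz (ambBasis d (.inl ()))] with s hs
    have e : ((t, y, ρ) : AmbVec d) + s • ambBasis d (.inl ()) = (t + s, y, ρ) := by
      simp [ambBasis_zero]
    rw [e] at hs ⊢
    exact h _ _ _ _ hz hs
  have h3 := h1.unique (h2.hasDerivAt_iff.2 (hasDerivAt_const (0 : ℝ) _))
  rw [zero_smul, add_zero] at h3
  rw [eval_apply hz, h3, map_zero]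

lemma IsPreAmbient.nondegenerate (hA : IsPreAmbient S A) {p : ℝ × M × ℝ}
    (hp : p ∈ A.space) {v : AmbVec d} (h : ∀ w, pairAt (ambI d) A.g p v w = 0) : v = 0 := by
  have : FiniteDimensional ℝ (TangentSpace (ambI d) p) :=
    inferInstanceAs (FiniteDimensional ℝ (AmbVec d))
  have hd : d + 1 + 1 = Module.finrank ℝ (AmbVec d) := by simp; ring
  exact (hA.signature_g p hp).nondegenerate hd h

lemma isUnit_det_locg (hA : IsPreAmbient S A) (hR : IsReduced A) (x : M) :
    IsUnit (locg hA x).det := by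
  rw [isUnit_iff]
  rintro ⟨t, y, ρ⟩ hz
  rw [AlgHom.map_det]
  intro h0
  obtain ⟨w, hw0, hw⟩ := Matrix.exists_vecMul_eq_zero_iff.2 h0
  obtain ⟨hy, hp⟩ := (mem_ambOpen hA).1 hz
  have ht : t ≠ 0 := (ambOpen_pos hA hz).ne'
  set p := (t, (extChartAt (𝓡 d) x).symm y, ρ) with hpdef
  set L := symmDeriv (𝓡 d) x y with hL
  set u : BaseVec d := ∑ i, w i • baseBasis d i with hu
  have hbij : ∀ v : BaseVec d, ∃ v', L v' = v := symmDeriv_surjective (𝓡 d) x hy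
  -- a tangential vector orthogonal to all tangential vectors is orthogonal to everything
  have key : ((0, L u, 0) : AmbVec d) = 0 := by
    refine hA.nondegenerate hp.1 fun W => ?_
    obtain ⟨a, v, c⟩ := W
    obtain ⟨v', rfl⟩ := hbij v
    rw [hR _ _ _ hp.1]
    set B : BaseVec d →ₗ[ℝ] BaseVec d →ₗ[ℝ] ℝ := (bilinAt (ambI d) A.g p).compl₁₂
      (LinearMap.inr ℝ ℝ (BaseVec d × ℝ) ∘ₗ LinearMap.inl ℝ (BaseVec d) ℝ ∘ₗ L.toLinearMap)
      (LinearMap.inr ℝ ℝ (BaseVec d × ℝ) ∘ₗ LinearMap.inl ℝ (BaseVec d) ℝ ∘ₗ L.toLinearMap)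
    have hB : ∀ i j, B (baseBasis d i) (baseBasis d j)
        = t * t * (locg hA x).map (eval _ hz) i j := fun i j => by
      rw [Matrix.map_apply, eval_locg]
      field_simp
      rfl
    have hB0 : B u = 0 := (baseBasis d).ext fun j => by
      rw [hu, map_sum, LinearMap.sum_apply]
      simp only [map_smul, LinearMap.smul_apply, hB, smul_eq_mul, LinearMap.zero_apply]
      have := congrFun hw j
      rw [Matrix.vecMul, dotProduct, Pi.zero_apply] at this
      calc _ = t * t * ∑ i, w i * (locg hA x).map (eval _ hz) i j := by
            rw [Finset.mul_sum]; exact Finset.sum_congr rfl fun i _ => by ring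
        _ = 0 := mul_eq_zero_of_right _ this
    have : pairAt (ambI d) A.g p (0, L u, 0) (0, L v', 0) = B u v' := rfl
    rw [this, hB0]
    simp
  have hLu : L u = 0 := (Prod.mk.inj (Prod.mk.inj key).2).1
  have hu0 : u = 0 := (L : BaseVec d →ₗ[ℝ] BaseVec d).injective_iff_surjective.2 hbij
    (hLu.trans (map_zero _).symm)
  exact hw0 (funext (Fintype.linearIndependent_iff.1 (baseBasis d).linearIndependent w
    (hu.symm.trans hu0)))

/-- The inverse of the family `g_ρ`. -/
def locgi (hA : IsPreAmbient S A) (x : M) : Matrix (Fin d) (Fin d) (smoothFun (ambOpen hA x)) :=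
  (locg hA x)⁻¹

/-- The inverse of the family `f_ρ`. -/
def locfi (hA : IsPreAmbient S A) (x : M) : smoothFun (ambOpen hA x) := Ring.inverse (locf hA x)

lemma isUnit_locf (hA : IsPreAmbient S A) (x : M) : IsUnit (locf hA x) := by
  rw [isUnit_iff]
  rintro ⟨t, y, ρ⟩ hz
  rw [eval_locf]
  exact mul_ne_zero (inv_ne_zero (ambOpen_pos hA hz).ne') ((mem_ambOpen hA).1 hz).2.2

lemma locg_isSymm (hA : IsPreAmbient S A) (x : M) : (locg hA x).IsSymm :=
  Matrix.IsSymm.ext fun i j => ext_eval fun z hz => by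
    obtain ⟨t, y, ρ⟩ := z
    rw [eval_locg, eval_locg]
    congr 1
    exact (hA.signature_g _ ((mem_ambOpen hA).1 hz).2.1).1 _ _

theorem isNormalFrame (hA : IsPreAmbient S A) (hR : IsReduced A) (x : M) :
    IsNormalFrame (der (ambOpen hA x) (ambBasis d)) (coordT _) (locTi hA x) (coordR _)
      (locg hA x) (locgi hA x) (locf hA x) (locfi hA x) where
  comm := der_comm _
  d0_t := by rw [der_coordT, ambBasis_zero, map_one]
  di_t i := by
    rw [der_coordT]
    rcases i with i | _
    · rw [ambBasis_tan, map_zero]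
    · rw [ambBasis_rad, map_zero]
  d0_ρ := by rw [der_coordR, ambBasis_zero, map_zero]
  di_ρ i := by rw [der_coordR, ambBasis_tan, map_zero]
  dr_ρ := by rw [der_coordR, ambBasis_rad, map_one]
  d0_g i j := der_zero_eq_zero fun _ _ _ _ h h' => val_locg_eq hA h h' i j
  d0_f := der_zero_eq_zero fun _ _ _ _ h h' => val_locf_eq hA h h'
  ht := coordT_mul_locTi hA x
  hg := locg_isSymm hA x
  hgi := Matrix.mul_nonsing_inv _ (isUnit_det_locg hA hR x)
  hf := Ring.mul_inverse_cancel _ (isUnit_locf hA x)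

lemma represents_ambMat (hA : IsPreAmbient S A) (hR : IsReduced A) (x : M) :
    Represents (ambMat (coordT _) (coordR _) (locg hA x))
      (chartMatrix (ambI d) (ambBasis d) A.g (1, x, 0)) := fun z hz => by
  rw [← hR.locG_eq hA x]; rfl

lemma coordT_mul_locf (hA : IsPreAmbient S A) (x : M) :
    coordT _ * locf hA x = locF hA x := by
  rw [locf, ← mul_assoc, coordT_mul_locTi, one_mul]

theorem ambRicci_eq (hA : IsPreAmbient S A) (hR : IsReduced A) {t ρ : ℝ} {x : M}
    (h : (t, x, ρ) ∈ A.regular) (I J : AmbIdx d) :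
    ambRicci S A (t, x, ρ) I J = val (ambRic (der (ambOpen hA x) (ambBasis d)) (coordT _)
      (locTi hA x) (coordR _) (locg hA x) (locgi hA x) (locf hA x) (locfi hA x) S.m I J)
      (t, extChartAt (𝓡 d) x x, ρ) := by
  have hF := isNormalFrame hA hR x
  rw [← eval_apply (self_mem_ambOpen hA h), ambRic,
    (represents_ambMat hA hR x).beRic (ambMat_mul_ambInv hF.ht hF.hgi)
    (u := chartFun (ambI d) A.f (1, x, 0)) (fun z hz => by rw [coordT_mul_locf]; rfl)
    (by linear_combination (locf hA x * locfi hA x) * hF.ht + hF.hf)]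
  have e : chartFun (ambI d) A.f (1, x, 0) (t, extChartAt (𝓡 d) x x, ρ) = A.f (t, x, ρ) :=
    congrArg A.f (extChartAt_to_inv (I := ambI d) ((t, x, ρ) : ℝ × M × ℝ))
  rw [e]
  rfl

theorem ambF_eq (hA : IsPreAmbient S A) (hR : IsReduced A) {t ρ : ℝ} {x : M}
    (h : (t, x, ρ) ∈ A.regular) :
    ambF S A (t, x, ρ) = val (wF (der (ambOpen hA x) (ambBasis d))
      (ambMat (coordT _) (coordR _) (locg hA x)) (ambInv (locTi hA x) (coordR _) (locgi hA x))
      (coordT _ * locf hA x) S.m S.μ) (t, extChartAt (𝓡 d) x x, ρ) := by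
  have hF := isNormalFrame hA hR x
  rw [← eval_apply (self_mem_ambOpen hA h),
    (represents_ambMat hA hR x).wF (ambMat_mul_ambInv hF.ht hF.hgi)
    (u := chartFun (ambI d) A.f (1, x, 0)) (fun z hz => by rw [coordT_mul_locf]; rfl)]
  have e : chartFun (ambI d) A.f (1, x, 0) (t, extChartAt (𝓡 d) x x, ρ) = A.f (t, x, ρ) :=
    congrArg A.f (extChartAt_to_inv (I := ambI d) ((t, x, ρ) : ℝ × M × ℝ))
  rw [e]
  rfl

end AmbientChart

/-! ### Straight and normal metrics have the normal form -/

section NormalForm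

open TopologicalSpace

lemma pd_eq_of_christoffel_eq_zero {V ι : Type*} [NormedAddCommGroup V] [NormedSpace ℝ V]
    [Fintype ι] [DecidableEq ι] (b : Module.Basis ι ℝ V) (G : V → Matrix ι ι ℝ) {y : V}
    (hG : IsUnit (G y).det) {i : ι} (h : ∀ k, christoffel b G k i i y = 0) (l : ι) :
    2 * pd b i (fun z => G z i l) y = pd b l (fun z => G z i i) y := by
  set v : ι → ℝ := fun l => pd b i (fun z => G z i l) y + pd b i (fun z => G z i l) y
    - pd b l (fun z => G z i i) y with hv
  have h1 : (G y)⁻¹.mulVec v = 0 := funext fun k => by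
    have := h k
    rw [christoffel] at this
    simpa [Matrix.mulVec, dotProduct] using this
  have h2 : v = 0 := by
    have := congrArg (G y).mulVec h1
    rwa [Matrix.mulVec_mulVec, Matrix.mul_nonsing_inv _ hG, Matrix.one_mulVec,
      Matrix.mulVec_zero] at this
  have := congrFun h2 l
  simp only [hv, Pi.zero_apply] at this
  linarith

/-- If a curve is a coordinate line in the preferred chart at each of its points, with velocity `v`
and without acceleration, the geodesic equation is algebraic. -/
lemma IsGeodesicOn.christoffel_eq_zero {V H : Type*} [NormedAddCommGroup V] [NormedSpace ℝ V]
    [TopologicalSpace H] {I : ModelWithCorners ℝ V H} {N : Type*} [TopologicalSpace N]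
    [ChartedSpace H N] {ι : Type*} [Fintype ι] [DecidableEq ι] {b : Module.Basis ι ℝ V}
    {h : TwoTensor I N} {γ : ℝ → N} {J : Set ℝ} (hγ : IsGeodesicOn I b h γ J) {s c : ℝ} (hs : s ∈ J)
    {i : ι} (hc : c ≠ 0) (hv : ∀ r, HasDerivAt (fun r => extChartAt I (γ s) (γ r)) (c • b i) r)
    (k : ι) : christoffel b (chartMatrix I b h (γ s)) k i i (extChartAt I (γ s) (γ s)) = 0 := by
  have h1 : deriv (fun r => extChartAt I (γ s) (γ r)) = fun _ => c • b i :=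
    funext fun r => (hv r).deriv
  have := hγ.2 s hs k
  rw [h1] at this
  simp only [deriv_const, map_zero, map_smul, Module.Basis.repr_self, Finsupp.smul_single, smul_eq_mul,
    mul_one, Finsupp.single_apply, mul_ite, mul_zero, ite_mul, zero_mul, Finsupp.zero_apply, zero_add,
    Finset.sum_ite_eq, Finset.mem_univ, if_true] at this
  simpa [hc] using this

variable {d : ℕ} {M : Type*} [TopologicalSpace M] [ChartedSpace (BaseVec d) M]
  [IsManifold (𝓡 d) ∞ M] {S : SmoothMetricMeasureSpace d M} {A : MetricMeasureStructure d M}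

lemma isUnit_det_chartMatrix (hA : IsPreAmbient S A) {p : ℝ × M × ℝ} (hp : p ∈ A.space) :
    IsUnit (chartMatrix (ambI d) (ambBasis d) A.g p (extChartAt (ambI d) p p)).det := by
  rw [isUnit_iff_ne_zero]
  intro h0
  obtain ⟨w, hw0, hw⟩ := Matrix.exists_vecMul_eq_zero_iff.2 h0
  set u : AmbVec d := ∑ I, w I • ambBasis d I with hu
  have hB0 : bilinAt (ambI d) A.g p u = 0 := (ambBasis d).ext fun J => by
    rw [hu, map_sum, LinearMap.sum_apply]
    simp only [map_smul, LinearMap.smul_apply, smul_eq_mul, LinearMap.zero_apply]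
    have := congrFun hw J
    rw [Matrix.vecMul, dotProduct, Pi.zero_apply] at this
    rw [← this]
    refine Finset.sum_congr rfl fun I _ => ?_
    rw [chartMatrix_self]
    rfl
  have hu0 : u = 0 := hA.nondegenerate hp fun w => congrArg (fun L => L w) hB0
  exact hw0 (funext (Fintype.linearIndependent_iff.1 (ambBasis d).linearIndependent w
    (hu.symm.trans hu0)))

/-- A component of the ambient metric in a chart. -/
def entry (A : MetricMeasureStructure d M) (x : M) (I J : AmbIdx d) (z : AmbVec d) : ℝ :=
  chartMatrix (ambI d) (ambBasis d) A.g (1, x, 0) z I J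

lemma entry_self (t ρ : ℝ) (x : M) (I J : AmbIdx d) :
    entry A x I J (t, extChartAt (𝓡 d) x x, ρ)
      = pairAt (ambI d) A.g (t, x, ρ) (ambBasis d I) (ambBasis d J) :=
  chartMatrix_self (ambI d) (ambBasis d) A.g (t, x, ρ) I J

lemma differentiableAt_entry (hA : IsPreAmbient S A) {t ρ : ℝ} {x : M} (h : (t, x, ρ) ∈ A.space)
    (I J : AmbIdx d) :
    DifferentiableAt ℝ (entry A x I J) (t, extChartAt (𝓡 d) x x, ρ) := by
  have h1 := (contMDiffOn_tensor_iff (ambI d) (ambBasis d) A.g (1, x, 0) A.space).1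
      (hA.contMDiffOn_g.mono fun _ hp => hp.1) I J
  refine (h1.differentiableOn (by simp)).differentiableAt (IsOpen.mem_nhds ?_ ?_)
  · exact (continuousOn_extChartAt_symm _).isOpen_inter_preimage (isOpen_extChartAt_target _)
      hA.isOpen_space
  · refine ⟨(mem_target_amb 1 0 x _).2 (mem_extChartAt_target x), ?_⟩
    have : (extChartAt (ambI d) ((1, x, 0) : ℝ × M × ℝ)).symm (t, extChartAt (𝓡 d) x x, ρ)
        = (t, x, ρ) := extChartAt_to_inv (I := ambI d) ((t, x, ρ) : ℝ × M × ℝ)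
    rwa [this]

lemma hasDerivAt_entry_rad (hA : IsPreAmbient S A) {t ρ : ℝ} {x : M} (h : (t, x, ρ) ∈ A.space)
    (I J : AmbIdx d) :
    HasDerivAt (fun r => pairAt (ambI d) A.g (t, x, r) (ambBasis d I) (ambBasis d J))
      (pd (ambBasis d) (.inr (.inr ())) (entry A x I J) (t, extChartAt (𝓡 d) x x, ρ)) ρ := by
  have h1 : HasDerivAt (fun r : ℝ => ((t, extChartAt (𝓡 d) x x, r) : AmbVec d))
      (ambBasis d (.inr (.inr ()))) ρ := by
    rw [ambBasis_rad]
    exact (hasDerivAt_const _ _).prodMk ((hasDerivAt_const _ _).prodMk (hasDerivAt_id _))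
  have := (differentiableAt_entry hA h I J).hasFDerivAt.comp_hasDerivAt ρ h1
  refine this.congr_of_eventuallyEq (Filter.Eventually.of_forall fun r => ?_)
  exact (entry_self t r x I J).symm

lemma hasDerivAt_entry_zero (hA : IsPreAmbient S A) {t ρ : ℝ} {x : M} (h : (t, x, ρ) ∈ A.space)
    (I J : AmbIdx d) :
    HasDerivAt (fun r => pairAt (ambI d) A.g (r, x, ρ) (ambBasis d I) (ambBasis d J))
      (pd (ambBasis d) (.inl ()) (entry A x I J) (t, extChartAt (𝓡 d) x x, ρ)) t := by
  have h1 : HasDerivAt (fun r : ℝ => ((r, extChartAt (𝓡 d) x x, ρ) : AmbVec d))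
      (ambBasis d (.inl ())) t := by
    rw [ambBasis_zero]
    exact (hasDerivAt_id _).prodMk ((hasDerivAt_const _ _).prodMk (hasDerivAt_const _ _))
  have := (differentiableAt_entry hA h I J).hasFDerivAt.comp_hasDerivAt t h1
  refine this.congr_of_eventuallyEq (Filter.Eventually.of_forall fun r => ?_)
  exact (entry_self r ρ x I J).symm

/-- The geodesic equation along the curves `ρ ↦ (t, x, ρ)`. -/
lemma IsNormal.pd_entry (hA : IsPreAmbient S A) (hN : IsNormal S A) {t ρ : ℝ} {x : M}
    (h : (t, x, ρ) ∈ A.space) (l : AmbIdx d) :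
    2 * pd (ambBasis d) (.inr (.inr ())) (entry A x (.inr (.inr ())) l)
        (t, extChartAt (𝓡 d) x x, ρ)
      = pd (ambBasis d) l (entry A x (.inr (.inr ())) (.inr (.inr ())))
        (t, extChartAt (𝓡 d) x x, ρ) := by
  refine pd_eq_of_christoffel_eq_zero (ambBasis d)
    (chartMatrix (ambI d) (ambBasis d) A.g (t, x, ρ)) (isUnit_det_chartMatrix hA h) (fun k => ?_) l
  refine (hN.geodesic t (hA.pos_of_mem _ h) x).christoffel_eq_zero (s := ρ) (c := 1) h one_ne_zero
    (fun r => ?_) k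
  rw [one_smul, ambBasis_rad]
  have : HasDerivAt (fun r : ℝ => ((t, extChartAt (𝓡 d) x x, r) : AmbVec d)) (0, 0, 1) r :=
    (hasDerivAt_const _ _).prodMk ((hasDerivAt_const _ _).prodMk (hasDerivAt_id _))
  exact this

/-- The geodesic equation along the dilation orbits. -/
lemma IsStraight.pd_entry (hA : IsPreAmbient S A) (hS : IsStraight A) {t ρ : ℝ} {x : M}
    (h : (t, x, ρ) ∈ A.space) (l : AmbIdx d) :
    2 * pd (ambBasis d) (.inl ()) (entry A x (.inl ()) l) (t, extChartAt (𝓡 d) x x, ρ)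
      = pd (ambBasis d) l (entry A x (.inl ()) (.inl ())) (t, extChartAt (𝓡 d) x x, ρ) := by
  refine pd_eq_of_christoffel_eq_zero (ambBasis d)
    (chartMatrix (ambI d) (ambBasis d) A.g (t, x, ρ)) (isUnit_det_chartMatrix hA h) (fun k => ?_) l
  have := (hS t x ρ h).christoffel_eq_zero (s := 1) (i := .inl ()) (c := t) (Set.mem_Ioi.2 one_pos)
    (hA.pos_of_mem _ h).ne' (fun r => ?_) k
  · rw [one_mul] at this
    exact this
  · have e : t • ambBasis d (.inl ()) = (t, 0, 0) := by rw [ambBasis_zero]; simp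
    rw [e]
    have h1 : HasDerivAt (fun r : ℝ => r * t) t r := by simpa using (hasDerivAt_id r).mul_const t
    have : HasDerivAt (fun r : ℝ => ((r * t, extChartAt (𝓡 d) x x, ρ) : AmbVec d)) (t, 0, 0) r :=
      h1.prodMk ((hasDerivAt_const _ _).prodMk (hasDerivAt_const _ _))
    exact this

/-- Components in the directions `∂_t` and `∂_ρ` do not depend on the chart of `M`. -/
lemma pd_entry_eq_zero {F : ℝ → ℝ} (hA : IsPreAmbient S A) {I J : AmbIdx d}
    (hI : (ambBasis d I).2.1 = 0) (hJ : (ambBasis d J).2.1 = 0)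
    (hF : ∀ t x ρ, (t, x, ρ) ∈ A.space →
      pairAt (ambI d) A.g (t, x, ρ) (ambBasis d I) (ambBasis d J) = F ρ)
    {t ρ : ℝ} {x : M} (h : (t, x, ρ) ∈ A.space) (l : AmbIdx d) (hl : (ambBasis d l).2.2 = 0)  :
    pd (ambBasis d) l (entry A x I J) (t, extChartAt (𝓡 d) x x, ρ) = 0 := by
  have h1 : HasDerivAt (fun s : ℝ => ((t, extChartAt (𝓡 d) x x, ρ) : AmbVec d) + s • ambBasis d l)
      (ambBasis d l) 0 := by
    simpa using ((hasDerivAt_id (0 : ℝ)).smul_const (ambBasis d l)).const_add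
      ((t, extChartAt (𝓡 d) x x, ρ) : AmbVec d)
  have h2 := HasFDerivAt.comp_hasDerivAt (0 : ℝ) (by
    rw [zero_smul, add_zero]; exact (differentiableAt_entry hA h I J).hasFDerivAt) h1
  have hopen : IsOpen {z : AmbVec d | z ∈ (extChartAt (ambI d) ((1, x, 0) : ℝ × M × ℝ)).target
      ∧ (extChartAt (ambI d) ((1, x, 0) : ℝ × M × ℝ)).symm z ∈ A.space} :=
    (continuousOn_extChartAt_symm _).isOpen_inter_preimage (isOpen_extChartAt_target _)
      hA.isOpen_space
  have hmem : ((t, extChartAt (𝓡 d) x x, ρ) : AmbVec d) + (0 : ℝ) • ambBasis d l ∈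
      {z : AmbVec d | z ∈ (extChartAt (ambI d) ((1, x, 0) : ℝ × M × ℝ)).target
      ∧ (extChartAt (ambI d) ((1, x, 0) : ℝ × M × ℝ)).symm z ∈ A.space} := by
    rw [zero_smul, add_zero]
    refine ⟨(mem_target_amb 1 0 x _).2 (mem_extChartAt_target x), ?_⟩
    have : (extChartAt (ambI d) ((1, x, 0) : ℝ × M × ℝ)).symm (t, extChartAt (𝓡 d) x x, ρ)
        = (t, x, ρ) := extChartAt_to_inv (I := ambI d) ((t, x, ρ) : ℝ × M × ℝ)
    rwa [this]
  refine h2.unique ((hasDerivAt_const (0 : ℝ) (F ρ)).congr_of_eventuallyEq ?_)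
  filter_upwards [h1.continuousAt.eventually (hopen.mem_nhds hmem)] with s hs
  obtain ⟨hs1, hs2⟩ := hs
  have e : ((t, extChartAt (𝓡 d) x x, ρ) : AmbVec d) + s • ambBasis d l
      = (t + s * (ambBasis d l).1, extChartAt (𝓡 d) x x + s • (ambBasis d l).2.1, ρ) := by
    simp [Prod.ext_iff, hl]
  rw [mem_target_amb] at hs1
  rw [e] at hs1 hs2
  have hs3 : (t + s * (ambBasis d l).1,
    (extChartAt (𝓡 d) x).symm (extChartAt (𝓡 d) x x + s • (ambBasis d l).2.1), ρ) ∈ A.space := hs2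
  rw [Function.comp_apply, e, entry, chartMatrix_amb _ hs1, ← hF _ _ _ hs3, hI, hJ, map_zero]
  have e1 : ((ambBasis d I).1, (0 : BaseVec d), (ambBasis d I).2.2) = ambBasis d I := by rw [← hI]
  have e2 : ((ambBasis d J).1, (0 : BaseVec d), (ambBasis d J).2.2) = ambBasis d J := by rw [← hJ]
  rw [e1, e2]

/-- A function on the lines `ρ ↦ (t, x, ρ)` with a constant derivative. -/
lemma IsNormal.eq_of_hasDerivAt (hA : IsPreAmbient S A) (hN : IsNormal S A) {t ρ : ℝ} {x : M}
    (h : (t, x, ρ) ∈ A.space) {u : ℝ → ℝ} {c : ℝ}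
    (hu : ∀ r, (t, x, r) ∈ A.space → HasDerivAt u c r) : u ρ = u 0 + c * ρ := by
  obtain ⟨h1, h2, h3⟩ := hN.interval t (hA.pos_of_mem _ h) x
  have hd : ∀ r, (t, x, r) ∈ A.space → HasDerivAt (fun r => u r - c * r) 0 r := fun r hr => by
    exact ((hu r hr).sub ((hasDerivAt_id r).const_mul c)).congr_deriv (by simp)
  have := h1.is_const_of_deriv_eq_zero h2.isPreconnected
    (fun r hr => (hd r hr).differentiableAt.differentiableWithinAt)
    (fun r hr => (hd r hr).deriv) (x := ρ) (y := 0) h h3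
  linarith

lemma IsPreAmbient.pairAt_symm (hA : IsPreAmbient S A) {p : ℝ × M × ℝ} (h : p ∈ A.space)
    (v w : AmbVec d) : pairAt (ambI d) A.g p v w = pairAt (ambI d) A.g p w v :=
  (hA.signature_g _ h).1 v w

lemma IsPreAmbient.mem_of_pos (hA : IsPreAmbient S A) {t r ρ : ℝ} {x : M}
    (h : (t, x, ρ) ∈ A.space) (hr : 0 < r) : (r, x, ρ) ∈ A.space := by
  have ht : 0 < t := hA.pos_of_mem _ h
  have := hA.dilation_mem (r / t) (div_pos hr ht) t x ρ h
  rwa [div_mul_cancel₀ _ ht.ne'] at this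

section

variable (hA : IsPreAmbient S A) (hN : IsNormal S A)
include hA hN

lemma IsNormal.pairAt_init {t : ℝ} (ht : 0 < t) (x : M) (a : ℝ) (v : BaseVec d) (c a' : ℝ)
    (v' : BaseVec d) (c' : ℝ) : pairAt (ambI d) A.g (t, x, 0) (a, v, c) (a', v', c')
      = t ^ 2 * pairAt (𝓡 d) (fun x => S.g.inner x) x v v' + t * (a * c' + a' * c) :=
  hN.initial t ht x a v c a' v' c'

/-- `g_∞∞ = 0`. -/
lemma IsNormal.pairAt_rad_rad {t ρ : ℝ} {x : M} (h : (t, x, ρ) ∈ A.space) :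
    pairAt (ambI d) A.g (t, x, ρ) (ambBasis d (.inr (.inr ()))) (ambBasis d (.inr (.inr ()))) = 0 := by
  have := hN.eq_of_hasDerivAt hA h (c := 0) (u := fun r => pairAt (ambI d) A.g (t, x, r)
    (ambBasis d (.inr (.inr ()))) (ambBasis d (.inr (.inr ())))) (fun r hr => by
      have h1 := hasDerivAt_entry_rad hA hr (.inr (.inr ())) (.inr (.inr ()))
      have h2 := hN.pd_entry hA hr (.inr (.inr ()))
      have h3 : pd (ambBasis d) (.inr (.inr ())) (entry A x (.inr (.inr ())) (.inr (.inr ())))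
        (t, extChartAt (𝓡 d) x x, r) = 0 := by linarith
      rwa [h3] at h1)
  rw [this, ambBasis_rad, hN.pairAt_init hA (hA.pos_of_mem _ h)]
  have := pairAt_smul_left (𝓡 d) (fun x => S.g.inner x) x 0 0 0
  rw [zero_smul, zero_mul] at this
  rw [this]
  ring

/-- `g_∞0 = t` and `g_∞i = 0`. -/
lemma IsNormal.pairAt_rad {t ρ : ℝ} {x : M} (h : (t, x, ρ) ∈ A.space) (w : AmbVec d) :
    pairAt (ambI d) A.g (t, x, ρ) (0, 0, 1) w = t * w.1 := by
  have key : ∀ l, (ambBasis d l).2.2 = 0 → pairAt (ambI d) A.g (t, x, ρ)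
      (ambBasis d (.inr (.inr ()))) (ambBasis d l) = t * (ambBasis d l).1 := by
    intro l hl
    have := hN.eq_of_hasDerivAt hA h (c := 0) (u := fun r => pairAt (ambI d) A.g (t, x, r)
      (ambBasis d (.inr (.inr ()))) (ambBasis d l)) (fun r hr => by
        have h1 := hasDerivAt_entry_rad hA hr (.inr (.inr ())) l
        have h2 := hN.pd_entry hA hr l
        rw [pd_entry_eq_zero (F := fun _ => 0) hA (by rw [ambBasis_rad]) (by rw [ambBasis_rad])
          (fun t x ρ h => hN.pairAt_rad_rad hA h) hr l hl] at h2
        rwa [show pd (ambBasis d) (.inr (.inr ())) (entry A x (.inr (.inr ())) l)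
          (t, extChartAt (𝓡 d) x x, r) = 0 by linarith] at h1)
    rw [this, ambBasis_rad]
    have := hN.pairAt_init hA (hA.pos_of_mem _ h) x 0 0 1 (ambBasis d l).1 (ambBasis d l).2.1
      (ambBasis d l).2.2
    rw [show pairAt (ambI d) A.g (t, x, 0) (0, 0, 1) (ambBasis d l) = _ from this]
    have := pairAt_smul_left (𝓡 d) (fun x => S.g.inner x) x 0 0 (ambBasis d l).2.1
    rw [zero_smul, zero_mul] at this
    rw [this]
    ring
  have : bilinAt (ambI d) A.g (t, x, ρ) (0, 0, 1)
      = t • LinearMap.fst ℝ ℝ (BaseVec d × ℝ) := (ambBasis d).ext fun l => by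
    rw [← ambBasis_rad]
    rcases l with ⟨⟩ | i | ⟨⟩
    · exact key _ (by rw [ambBasis_zero])
    · exact key _ (by rw [ambBasis_tan])
    · refine (hN.pairAt_rad_rad hA h).trans ?_
      rw [ambBasis_rad]; simp
  exact congrArg (fun L => L w) this

/-- `g_00 = 2 ρ`. -/
lemma IsNormal.pairAt_zero_zero (hS : IsStraight A) {t ρ : ℝ} {x : M} (h : (t, x, ρ) ∈ A.space) :
    pairAt (ambI d) A.g (t, x, ρ) (ambBasis d (.inl ())) (ambBasis d (.inl ())) = 2 * ρ := by
  have ht : 0 < t := hA.pos_of_mem _ h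
  have := hN.eq_of_hasDerivAt hA h (c := 2) (u := fun r => pairAt (ambI d) A.g (t, x, r)
    (ambBasis d (.inl ())) (ambBasis d (.inl ()))) (fun r hr => by
      have h1 := hasDerivAt_entry_rad hA hr (.inl ()) (.inl ())
      have h2 := hS.pd_entry hA hr (.inr (.inr ()))
      have h3 := hasDerivAt_entry_zero hA hr (.inl ()) (.inr (.inr ()))
      have h4 : HasDerivAt (fun s : ℝ => s) 1 t := hasDerivAt_id t
      have h5 := h3.unique (h4.congr_of_eventuallyEq (by
        filter_upwards [lt_mem_nhds ht] with s hs
        have hs' := hA.mem_of_pos hr hs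
        rw [hA.pairAt_symm hs', ambBasis_rad, hN.pairAt_rad hA hs', ambBasis_zero, mul_one]))
      rwa [← h2, h5, mul_one] at h1)
  rw [this, ambBasis_zero, hN.pairAt_init hA ht]
  have := pairAt_smul_left (𝓡 d) (fun x => S.g.inner x) x 0 0 0
  rw [zero_smul, zero_mul] at this
  rw [this]
  ring

/-- `g_0i = 0`. -/
lemma IsNormal.pairAt_zero_tan (hS : IsStraight A) {t ρ : ℝ} {x : M} (h : (t, x, ρ) ∈ A.space)
    (i : Fin d) :
    pairAt (ambI d) A.g (t, x, ρ) (ambBasis d (.inl ())) (ambBasis d (.inr (.inl i))) = 0 := by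
  have ht : 0 < t := hA.pos_of_mem _ h
  have h2 := hS.pd_entry hA h (.inr (.inl i))
  rw [pd_entry_eq_zero (F := fun ρ => 2 * ρ) hA (by rw [ambBasis_zero]) (by rw [ambBasis_zero])
    (fun t x ρ h => hN.pairAt_zero_zero hA hS h) h _ (by rw [ambBasis_tan])] at h2
  have h3 := hasDerivAt_entry_zero hA h (.inl ()) (.inr (.inl i))
  set c := pairAt (ambI d) A.g (t, x, ρ) (ambBasis d (.inl ())) (ambBasis d (.inr (.inl i)))
    with hc
  have h4 : HasDerivAt (fun s : ℝ => s * (c / t)) (1 * (c / t)) t :=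
    (hasDerivAt_id t).mul_const _
  have h5 := h3.unique (h4.congr_of_eventuallyEq (by
    filter_upwards [lt_mem_nhds ht] with s hs
    have := hA.pairAt_dilation (div_pos hs ht) h 1 0 0 0 (baseBasis d i) 0
    rw [div_mul_cancel₀ _ ht.ne', mul_zero, mul_one, ← ambBasis_tan, ← ambBasis_zero, ← hc] at this
    have e : ((s / t, 0, 0) : AmbVec d) = (s / t) • ambBasis d (.inl ()) := by
      rw [ambBasis_zero]; simp
    rw [e, pairAt_smul_left] at this
    field_simp at this ⊢
    linarith))
  have : 1 * (c / t) = 0 := by rw [← h5]; linarith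
  rw [one_mul] at this
  simpa [ht.ne'] using this

/-- A straight and normal ambient metric has the normal form `2 ρ dt² + 2 t dρ dt + t² g_ρ`. -/
theorem IsNormal.isReduced (hS : IsStraight A) : IsReduced A := by
  intro t x ρ h
  have key : ∀ w : AmbVec d, pairAt (ambI d) A.g (t, x, ρ) (1, 0, 0) w
      = 2 * ρ * w.1 + t * w.2.2 := by
    intro w
    have : bilinAt (ambI d) A.g (t, x, ρ) (1, 0, 0) = (2 * ρ) • LinearMap.fst ℝ ℝ (BaseVec d × ℝ)
        + t • LinearMap.snd ℝ (BaseVec d) ℝ ∘ₗ LinearMap.snd ℝ ℝ (BaseVec d × ℝ) :=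
      (ambBasis d).ext fun l => by
        rw [← ambBasis_zero]
        rcases l with ⟨⟩ | i | ⟨⟩
        · refine (hN.pairAt_zero_zero hA hS h).trans ?_
          rw [ambBasis_zero]; simp
        · refine (hN.pairAt_zero_tan hA hS h i).trans ?_
          rw [ambBasis_tan]; simp
        · refine (hA.pairAt_symm h _ _).trans ?_
          rw [ambBasis_rad, hN.pairAt_rad hA h, ambBasis_zero]; simp
    exact congrArg (fun L => L w) this
  have exp : ∀ (a : ℝ) (v : BaseVec d) (c : ℝ) (w : AmbVec d),
      pairAt (ambI d) A.g (t, x, ρ) (a, v, c) w = a * (2 * ρ * w.1 + t * w.2.2)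
        + pairAt (ambI d) A.g (t, x, ρ) (0, v, 0) w + c * (t * w.1) := by
    intro a v c w
    have e : ((a, v, c) : AmbVec d) = a • (1, 0, 0) + (0, v, 0) + c • (0, 0, 1) := by
      simp
    rw [e, pairAt_add_left, pairAt_add_left, pairAt_smul_left, pairAt_smul_left, key,
      hN.pairAt_rad hA h]
  intro a v c a' v' c'
  rw [exp, hA.pairAt_symm h _ (a', v', c'), exp, hA.pairAt_symm h _ (0, v, 0)]
  ring

end

end NormalForm

/-! ### Uniqueness to high order -/

section Uniqueness

open TopologicalSpace smoothFun PowerSeries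

/-- Where the equations hold to some order, so do the modified equations. -/
lemma IsExpansion.dvd_map_mod {R R' R'' κ : Type*} [CommRing R] [Algebra ℝ R] [CommRing R']
    [Algebra ℝ R'] [CommRing R''] [Fintype κ] [DecidableEq κ]
    {D : Unit ⊕ (κ ⊕ Unit) → Derivation ℝ R R} {t ti ρ : R} {g gi : Matrix κ κ R}
    {f fi : R} {T : R →ₐ[ℝ] R'⟦X⟧} {D' : κ → Derivation ℝ R' R'} (hT : IsExpansion T D ρ D')
    (h : IsNormalFrame D t ti ρ g gi f fi) (e : R' →+* R'') {m : ℝ} (μ c : ℝ) {K : ℕ}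
    (hP : ∀ I J, X ^ K ∣ PowerSeries.map e (T (ambRic D t ti ρ g gi f fi m I J)))
    (hW : X ^ K ∣ PowerSeries.map e (T (wF D (ambMat t ρ g) (ambInv ti ρ gi) (t * f) m μ))) :
    (∀ i j, X ^ K ∣ PowerSeries.map e (WeightedAmbient.modTan (fun i => psD (D' i)) (psδ R') X (g.map T) (gi.map T)
        (T f) (T fi) m c i j)) ∧
      X ^ K ∣ PowerSeries.map e (WeightedAmbient.modScal (fun i => psD (D' i)) (psδ R') X (g.map T) (gi.map T)
        (T f) (T fi) m μ c) := by
  have hB := hP (.inr (.inr ())) (.inr (.inr ()))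
  rw [h.ambRic_rad] at hB
  rw [h.wF_amb] at hW
  refine ⟨fun i j => ?_, ?_⟩
  · have h2 := hP (.inr (.inl i)) (.inr (.inl j))
    rw [h.ambRic_tan] at h2
    rw [hT.modTan h.hg h.hgi, WeightedAmbient.modTan]
    simp only [map_add, map_mul]
    exact dvd_add h2 ((hB.mul_left _).mul_right _)
  · rw [hT.modScal h.hg h.hgi, WeightedAmbient.modScal]
    simp only [map_add, map_mul, map_neg]
    exact dvd_add hW.neg_right ((hB.mul_left _).mul_right _)

variable {d : ℕ}

section Restrict

variable {U : Opens (BaseVec d)} {Ω Ω' Ω₁ Ω₂ : Opens (AmbVec d)}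

/-- The restriction to a smaller open set. -/
def restrict (h : Ω' ≤ Ω) : smoothFun Ω →ₐ[ℝ] smoothFun Ω' :=
  pullback id contDiffOn_id fun _ hy => h hy

lemma eval_restrict (h : Ω' ≤ Ω) (F : smoothFun Ω) {z : AmbVec d} (hz : z ∈ Ω') :
    eval z hz (restrict h F) = eval z (h hz) F := eval_pullback _ _ _ _

lemma restrict_der (h : Ω' ≤ Ω) (I : AmbIdx d) (F : smoothFun Ω) :
    der Ω' (ambBasis d) I (restrict h F) = restrict h (der Ω (ambBasis d) I F) :=
  ext_eval fun z hz => by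
    rw [eval_der_of_eqOn _ _ (G := val F)
      (fun y hy => by rw [eval_restrict, eval_apply]) hz, eval_restrict, eval_der]

lemma ambTaylor_restrict (hle : Ω' ≤ Ω) {t : ℝ} (h : ∀ y ∈ U, ((t, y, 0) : AmbVec d) ∈ Ω)
    (h' : ∀ y ∈ U, ((t, y, 0) : AmbVec d) ∈ Ω') (F : smoothFun Ω) :
    ambTaylor t h' (restrict hle F) = ambTaylor t h F := by
  have h1 : ∀ G : smoothFun Ω, restr t h' (restrict hle G) = restr t h G := fun G =>
    ext_eval fun y hy => by
      rw [restr, restr, eval_pullback, eval_pullback, eval_restrict]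
  ext k : 1
  rw [ambTaylor, ambTaylor, coeff_taylor, coeff_taylor]
  have h2 : ∀ k, (der Ω' (ambBasis d) (.inr (.inr ())))^[k] (restrict hle F)
      = restrict hle ((der Ω (ambBasis d) (.inr (.inr ())))^[k] F) := fun k => by
    induction k with
    | zero => rfl
    | succ k ih => rw [Function.iterate_succ_apply', Function.iterate_succ_apply', ih, restrict_der]
  rw [h2, h1]

lemma eventually_rad_mem {t ρ : ℝ} {y : BaseVec d} (h : (t, y, ρ) ∈ Ω) :
    ∀ᶠ r in 𝓝 ρ, (t, y, r) ∈ Ω :=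
  (Continuous.prodMk_right t |>.comp (Continuous.prodMk_right y)).continuousAt.eventually
    (Ω.isOpen.mem_nhds h)

lemma isBigO_sub_iff {t : ℝ} (h₁ : ∀ y ∈ U, ((t, y, 0) : AmbVec d) ∈ Ω₁)
    (h₂ : ∀ y ∈ U, ((t, y, 0) : AmbVec d) ∈ Ω₂) (F₁ : smoothFun Ω₁) (F₂ : smoothFun Ω₂)
    {y : BaseVec d} (hy : y ∈ U) (k : ℕ) :
    ((fun ρ : ℝ => val F₂ (t, y, ρ) - val F₁ (t, y, ρ)) =O[𝓝 0] fun ρ => ρ ^ k)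
      ↔ ∀ j < k, eval y hy (coeff j (ambTaylor t h₂ F₂ - ambTaylor t h₁ F₁)) = 0 := by
  have h' : ∀ y ∈ U, ((t, y, 0) : AmbVec d) ∈ Ω₁ ⊓ Ω₂ := fun y hy => ⟨h₁ y hy, h₂ y hy⟩
  rw [← ambTaylor_restrict inf_le_left h₁ h', ← ambTaylor_restrict inf_le_right h₂ h', ← map_sub,
    ← isBigO_iff_ambTaylor]
  refine Asymptotics.isBigO_congr ?_ Filter.EventuallyEq.rfl
  filter_upwards [eventually_rad_mem (h' y hy)] with r hr
  rw [← eval_apply hr, map_sub, eval_restrict, eval_restrict, eval_apply, eval_apply]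

end Restrict

variable {M : Type*} [TopologicalSpace M] [ChartedSpace (BaseVec d) M]
  [IsManifold (𝓡 d) ∞ M] {S : SmoothMetricMeasureSpace d M} {A : MetricMeasureStructure d M}

lemma eventually_mem_regular (hA : IsPreAmbient S A) {t : ℝ} (ht : 0 < t) (x : M) :
    ∀ᶠ ρ in 𝓝 (0 : ℝ), (t, x, ρ) ∈ A.regular :=
  (Continuous.prodMk_right t |>.comp (Continuous.prodMk_right x)).continuousAt.eventually
    (hA.isOpen_regular.mem_nhds (hA.zero_mem_regular ht x))

/-- The expansion in `ρ` of functions on the chart of the ambient manifold at `x`. -/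
abbrev radExpand (hA : IsPreAmbient S A) {t : ℝ} (ht : 0 < t) (x : M) :
    smoothFun (ambOpen hA x) →ₐ[ℝ] (smoothFun (baseOpen (d := d) x))⟦X⟧ :=
  ambTaylor t (init_mem_ambOpen hA (x := x) ht)

/-- The order of vanishing of a function of `ρ` is read off from the expansion of the function of the
chart coordinates that represents it. -/
lemma isOrder_iff (hA : IsPreAmbient S A) {t : ℝ} (ht : 0 < t) (x : M)
    (F : smoothFun (ambOpen hA x)) {u : ℝ → ℝ}
    (hu : ∀ ρ, (t, x, ρ) ∈ A.regular → u ρ = val F (t, extChartAt (𝓡 d) x x, ρ)) (k : ℕ) :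
    (u =O[𝓝 0] fun ρ => ρ ^ k) ↔
      ∀ j < k, eval (U := baseOpen (d := d) x) (extChartAt (𝓡 d) x x) (self_mem_baseOpen x) (coeff j (radExpand hA ht x F)) = 0 := by
  rw [← isBigO_iff_ambTaylor]
  refine Asymptotics.isBigO_congr ?_ Filter.EventuallyEq.rfl
  filter_upwards [eventually_mem_regular hA ht x] with ρ hρ using hu ρ hρ

/-- The modified equations hold to the order to which the ambient equations hold. -/
lemma eval_coeff_mod_eq_zero (hA : IsPreAmbient S A) (hR : IsReduced A) {t : ℝ} (ht : 0 < t) (x : M)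
    {K : ℕ} (hK : PairIsOrder (ambRicci S A) (ambF S A) K) (c : ℝ) {k : ℕ} (hk : k < K) :
    (∀ i j, eval (U := baseOpen (d := d) x) (extChartAt (𝓡 d) x x) (self_mem_baseOpen x) (coeff k
      (modTan (fun i => psD (der (baseOpen x) (baseBasis d) i)) (psδ (smoothFun (baseOpen x))) X
        ((locg hA x).map (radExpand hA ht x)) ((locgi hA x).map (radExpand hA ht x))
        (radExpand hA ht x (locf hA x)) (radExpand hA ht x (locfi hA x)) S.m c i j)) = 0) ∧
    eval (U := baseOpen (d := d) x) (extChartAt (𝓡 d) x x) (self_mem_baseOpen x) (coeff k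
      (modScal (fun i => psD (der (baseOpen x) (baseBasis d) i)) (psδ (smoothFun (baseOpen x))) X
        ((locg hA x).map (radExpand hA ht x)) ((locgi hA x).map (radExpand hA ht x))
        (radExpand hA ht x (locf hA x)) (radExpand hA ht x (locfi hA x)) S.m S.μ c)) = 0 := by
  have hF := isNormalFrame hA hR x
  have hT := isExpansion_ambTaylor (init_mem_ambOpen hA (x := x) ht)
  set e := eval (extChartAt (𝓡 d) x x) (self_mem_baseOpen x)
  have hP : ∀ I J, X ^ K ∣ PowerSeries.map (e : _ →+* ℝ) (radExpand hA ht x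
      (ambRic (der (ambOpen hA x) (ambBasis d)) (coordT _)
      (locTi hA x) (coordR _) (locg hA x) (locgi hA x) (locf hA x) (locfi hA x) S.m I J)) := by
    intro I J
    rw [X_pow_dvd_iff]
    exact (isOrder_iff hA ht x _ (fun ρ hρ => ambRicci_eq hA hR hρ I J) K).1 (hK.1 I J t ht x)
  have hW : X ^ K ∣ PowerSeries.map (e : _ →+* ℝ) (radExpand hA ht x
      (wF (der (ambOpen hA x) (ambBasis d))
      (ambMat (coordT _) (coordR _) (locg hA x)) (ambInv (locTi hA x) (coordR _) (locgi hA x))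
      (coordT _ * locf hA x) S.m S.μ)) := by
    rw [X_pow_dvd_iff]
    exact (isOrder_iff hA ht x _ (fun ρ hρ => ambF_eq hA hR hρ) K).1 (hK.2 t ht x)
  obtain ⟨h1, h2⟩ := hT.dvd_map_mod hF (e : _ →+* ℝ) S.μ c hP hW
  exact ⟨fun i j => X_pow_dvd_iff.1 (h1 i j) k hk, X_pow_dvd_iff.1 h2 k hk⟩

/-- The tangential parts of the metrics and the densities of two ambient spaces agree to
order `k`. -/
def AgreesTo (A₁ A₂ : MetricMeasureStructure d M) (t : ℝ) (k : ℕ) : Prop := ∀ q : M,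
  (∀ v w : BaseVec d, (fun ρ : ℝ => pairAt (ambI d) A₂.g (t, q, ρ) (0, v, 0) (0, w, 0)
      - pairAt (ambI d) A₁.g (t, q, ρ) (0, v, 0) (0, w, 0)) =O[𝓝 0] fun ρ => ρ ^ k) ∧
  (fun ρ : ℝ => A₂.f (t, q, ρ) - A₁.f (t, q, ρ)) =O[𝓝 0] fun ρ => ρ ^ k

section

variable {A₁ A₂ : MetricMeasureStructure d M} (hA₁ : IsPreAmbient S A₁) (hA₂ : IsPreAmbient S A₂)
  {t : ℝ} (ht : 0 < t)

include hA₁ hA₂ ht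

lemma isBigO_locg_iff (x : M) {y : BaseVec d} (hy : y ∈ baseOpen x) (i j : Fin d) (k : ℕ) :
    ((fun ρ : ℝ => pairAt (ambI d) A₂.g (t, (extChartAt (𝓡 d) x).symm y, ρ)
          (0, symmDeriv (𝓡 d) x y (baseBasis d i), 0) (0, symmDeriv (𝓡 d) x y (baseBasis d j), 0)
        - pairAt (ambI d) A₁.g (t, (extChartAt (𝓡 d) x).symm y, ρ)
          (0, symmDeriv (𝓡 d) x y (baseBasis d i), 0) (0, symmDeriv (𝓡 d) x y (baseBasis d j), 0))
      =O[𝓝 0] fun ρ => ρ ^ k) ↔ ∀ l < k, eval y hy (coeff l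
        (radExpand hA₂ ht x (locg hA₂ x i j) - radExpand hA₁ ht x (locg hA₁ x i j))) = 0 := by
  rw [← isBigO_sub_iff]
  have hc : t⁻¹ * t⁻¹ ≠ 0 := by positivity
  rw [← Asymptotics.isBigO_const_mul_left_iff hc]
  refine Asymptotics.isBigO_congr ?_ Filter.EventuallyEq.rfl
  filter_upwards [eventually_rad_mem (init_mem_ambOpen hA₁ ht y hy),
    eventually_rad_mem (init_mem_ambOpen hA₂ ht y hy)] with ρ h1 h2
  rw [← eval_apply h1, ← eval_apply h2, eval_locg, eval_locg]
  ring

lemma isBigO_locf_iff (x : M) {y : BaseVec d} (hy : y ∈ baseOpen x) (k : ℕ) :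
    ((fun ρ : ℝ => A₂.f (t, (extChartAt (𝓡 d) x).symm y, ρ)
        - A₁.f (t, (extChartAt (𝓡 d) x).symm y, ρ)) =O[𝓝 0] fun ρ => ρ ^ k)
      ↔ ∀ l < k, eval y hy (coeff l
        (radExpand hA₂ ht x (locf hA₂ x) - radExpand hA₁ ht x (locf hA₁ x))) = 0 := by
  rw [← isBigO_sub_iff]
  have hc : t⁻¹ ≠ 0 := by positivity
  rw [← Asymptotics.isBigO_const_mul_left_iff hc]
  refine Asymptotics.isBigO_congr ?_ Filter.EventuallyEq.rfl
  filter_upwards [eventually_rad_mem (init_mem_ambOpen hA₁ ht y hy),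
    eventually_rad_mem (init_mem_ambOpen hA₂ ht y hy)] with ρ h1 h2
  rw [← eval_apply h1, ← eval_apply h2, eval_locf, eval_locf]
  ring

/-- Bilinear functions of the tangent vectors need to be estimated on a basis only. -/
lemma agreesTo_of_coeff {k : ℕ} (h : ∀ x, ∀ l < k, (∀ i j, eval (U := baseOpen (d := d) x) (extChartAt (𝓡 d) x x) (self_mem_baseOpen x) (coeff l
        (radExpand hA₂ ht x (locg hA₂ x i j) - radExpand hA₁ ht x (locg hA₁ x i j))) = 0) ∧
      eval (U := baseOpen (d := d) x) (extChartAt (𝓡 d) x x) (self_mem_baseOpen x) (coeff l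
        (radExpand hA₂ ht x (locf hA₂ x) - radExpand hA₁ ht x (locf hA₁ x))) = 0) :
    AgreesTo A₁ A₂ t k := by
  intro q
  have e := extChartAt_to_inv (I := 𝓡 d) q
  refine ⟨fun v w => ?_, ?_⟩
  · have key : ∀ i j, (fun ρ : ℝ => pairAt (ambI d) A₂.g (t, q, ρ) (0, baseBasis d i, 0)
        (0, baseBasis d j, 0) - pairAt (ambI d) A₁.g (t, q, ρ) (0, baseBasis d i, 0)
        (0, baseBasis d j, 0)) =O[𝓝 0] fun ρ => ρ ^ k := by
      intro i j
      have := (isBigO_locg_iff hA₁ hA₂ ht q (self_mem_baseOpen q) i j k).2 fun l hl => (h q l hl).1 i j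
      rwa [e, symmDeriv_self] at this
    have hexp : ∀ (A : MetricMeasureStructure d M) (ρ : ℝ),
        pairAt (ambI d) A.g (t, q, ρ) (0, v, 0) (0, w, 0)
          = ∑ i, ∑ j, (baseBasis d).repr v i * (baseBasis d).repr w j
            * pairAt (ambI d) A.g (t, q, ρ) (0, baseBasis d i, 0) (0, baseBasis d j, 0) := by
      intro A ρ
      set L : BaseVec d →ₗ[ℝ] AmbVec d :=
        LinearMap.inr ℝ ℝ (BaseVec d × ℝ) ∘ₗ LinearMap.inl ℝ (BaseVec d) ℝ
      have := LinearMap.sum_repr_mul_repr_mul (baseBasis d) (baseBasis d)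
        (B := (bilinAt (ambI d) A.g (t, q, ρ)).compl₁₂ L L) v w
      refine this.symm.trans ?_
      rw [Finsupp.sum_fintype _ _ (by simp)]
      refine Finset.sum_congr rfl fun i _ => ?_
      rw [Finsupp.sum_fintype _ _ (by simp)]
      exact Finset.sum_congr rfl fun j _ => (mul_assoc _ _ _).symm
    have : (fun ρ : ℝ => pairAt (ambI d) A₂.g (t, q, ρ) (0, v, 0) (0, w, 0)
      - pairAt (ambI d) A₁.g (t, q, ρ) (0, v, 0) (0, w, 0)) = fun ρ => ∑ i, ∑ j,
        (baseBasis d).repr v i * (baseBasis d).repr w j *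
        (pairAt (ambI d) A₂.g (t, q, ρ) (0, baseBasis d i, 0) (0, baseBasis d j, 0)
        - pairAt (ambI d) A₁.g (t, q, ρ) (0, baseBasis d i, 0) (0, baseBasis d j, 0)) := by
      funext ρ
      rw [hexp A₂, hexp A₁]
      simp only [← Finset.sum_sub_distrib, mul_sub]
    rw [this]
    exact Asymptotics.IsBigO.fun_sum fun i _ => Asymptotics.IsBigO.fun_sum fun j _ =>
      (key i j).const_mul_left _
  · have := (isBigO_locf_iff hA₁ hA₂ ht q (self_mem_baseOpen q) k).2 fun l hl => (h q l hl).2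
    rwa [e] at this

lemma agreesTo_one : AgreesTo A₁ A₂ t 1 := by
  refine agreesTo_of_coeff hA₁ hA₂ ht fun x l hl => ?_
  obtain rfl : l = 0 := by omega
  simp only [map_sub, coeff_zero_ambTaylor, restr, eval_pullback, eval_locg, eval_locf]
  refine ⟨fun i j => ?_, ?_⟩
  · have h1 := hA₁.initial_g t ht ((extChartAt (𝓡 d) x).symm (extChartAt (𝓡 d) x x)) 0
      (symmDeriv (𝓡 d) x (extChartAt (𝓡 d) x x) (baseBasis d i)) 0
      (symmDeriv (𝓡 d) x (extChartAt (𝓡 d) x x) (baseBasis d j))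
    have h2 := hA₂.initial_g t ht ((extChartAt (𝓡 d) x).symm (extChartAt (𝓡 d) x x)) 0
      (symmDeriv (𝓡 d) x (extChartAt (𝓡 d) x x) (baseBasis d i)) 0
      (symmDeriv (𝓡 d) x (extChartAt (𝓡 d) x x) (baseBasis d j))
    rw [sub_eq_zero]
    exact congrArg (t⁻¹ * t⁻¹ * ·) (h2.trans h1.symm)
  · rw [hA₁.initial_f t ht, hA₂.initial_f t ht, sub_self]

variable (hR₁ : IsReduced A₁) (hR₂ : IsReduced A₂) {K : ℕ}
  (hK₁ : PairIsOrder (ambRicci S A₁) (ambF S A₁) K)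
  (hK₂ : PairIsOrder (ambRicci S A₂) (ambF S A₂) K)

include hR₁ hR₂ hK₁ hK₂ in
/-- Two solutions that agree to some order agree to the next order. -/
lemma AgreesTo.succ (hd : 3 ≤ d) {k : ℕ} (hk : k < K) (hn : (d : ℝ) + S.m ≠ 2 * (k + 1))
    (h : AgreesTo A₁ A₂ t (k + 1)) : AgreesTo A₁ A₂ t (k + 2) := by
  refine agreesTo_of_coeff hA₁ hA₂ ht fun x => ?_
  have hag : AgreeTo k ((locg hA₁ x).map (radExpand hA₁ ht x)) ((locg hA₂ x).map (radExpand hA₂ ht x))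
      ((locgi hA₁ x).map (radExpand hA₁ ht x)) ((locgi hA₂ x).map (radExpand hA₂ ht x))
      (radExpand hA₁ ht x (locf hA₁ x)) (radExpand hA₂ ht x (locf hA₂ x))
      (radExpand hA₁ ht x (locfi hA₁ x)) (radExpand hA₂ ht x (locfi hA₂ x)) := by
    refine ⟨?_, ?_, ?_, ?_, fun i j => ?_, ?_⟩
    · rw [← Matrix.map_mul, (isNormalFrame hA₁ hR₁ x).hgi, Matrix.map_one _ (map_zero _) (map_one _)]
    · rw [← Matrix.map_mul, (isNormalFrame hA₂ hR₂ x).hgi, Matrix.map_one _ (map_zero _) (map_one _)]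
    · rw [← map_mul, (isNormalFrame hA₁ hR₁ x).hf, map_one]
    · rw [← map_mul, (isNormalFrame hA₂ hR₂ x).hf, map_one]
    · exact X_pow_dvd_iff.2 fun l hl => ext_eval fun y hy => by
        rw [map_zero]
        exact (isBigO_locg_iff hA₁ hA₂ ht x hy i j (k + 1)).1 ((h _).1 _ _) l hl
    · exact X_pow_dvd_iff.2 fun l hl => ext_eval fun y hy => by
        rw [map_zero]
        exact (isBigO_locf_iff hA₁ hA₂ ht x hy (k + 1)).1 (h _).2 l hl
  have hd' : (3 : ℝ) ≤ d := by exact_mod_cast hd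
  have hm := S.m_nonneg
  have h1 := eval_coeff_mod_eq_zero hA₁ hR₁ ht x hK₁ (2 / (d + S.m)) hk
  have h2 := eval_coeff_mod_eq_zero hA₂ hR₂ ht x hK₂ (2 / (d + S.m)) hk
  have key := eval_coeff_succ_eq (self_mem_baseOpen x) (n := d + S.m) rfl (by linarith)
    (by intro h; linarith) hn hag
    ((locg_isSymm hA₁ x).map _) h1.1 h2.1 h1.2 h2.2
  intro l hl
  rcases Nat.lt_succ_iff_lt_or_eq.1 hl with hl | rfl
  · exact ⟨fun i j => by
      have := X_pow_dvd_iff.1 (hag.hg i j) l hl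
      simp only [Matrix.map_apply] at this
      rw [this, map_zero], by
      rw [X_pow_dvd_iff.1 hag.hff l hl, map_zero]⟩
  · exact key

include hR₁ hR₂ hK₁ hK₂ in
/-- The critical order is excluded by `hn`, so agreement is improved one order at a time, from the
initial agreement at `ρ = 0`. -/
lemma agreesTo_of_order (hd : 3 ≤ d) (hn : ∀ k < K, (d : ℝ) + S.m ≠ 2 * (k + 1)) :
    ∀ k ≤ K, AgreesTo A₁ A₂ t (k + 1) := by
  intro k hk
  induction k with
  | zero => exact agreesTo_one hA₁ hA₂ ht
  | succ k ih =>
    exact (ih (by omega)).succ hA₁ hA₂ ht hR₁ hR₂ hK₁ hK₂ hd (by omega) (hn k (by omega))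

end

/-- In normal form, all components of the difference of the metrics are as small as the tangential
ones. -/
lemma pairIsOrder_of_agreesTo {A₁ A₂ : MetricMeasureStructure d M} (hA₁ : IsPreAmbient S A₁)
    (hA₂ : IsPreAmbient S A₂) (hR₁ : IsReduced A₁) (hR₂ : IsReduced A₂) {k : ℕ}
    (h : ∀ t > 0, AgreesTo A₁ A₂ t k) :
    PairIsOrder (componentsAt (ambI d) (ambBasis d) (fun p => A₁.g p - A₂.g p))
      (fun p => -2 * (A₁.f p - A₂.f p)) k := by
  refine ⟨fun I J t ht x => ?_, fun t ht x => ?_⟩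
  · refine Asymptotics.IsBigO.congr' (((h t ht x).1 (ambBasis d I).2.1 (ambBasis d J).2.1).neg_left)
      ?_ Filter.EventuallyEq.rfl
    filter_upwards [eventually_mem_regular hA₁ ht x, eventually_mem_regular hA₂ ht x] with ρ h1 h2
    have e : componentsAt (ambI d) (ambBasis d) (fun p => A₁.g p - A₂.g p) (t, x, ρ) I J
        = pairAt (ambI d) A₁.g (t, x, ρ) (ambBasis d I) (ambBasis d J)
          - pairAt (ambI d) A₂.g (t, x, ρ) (ambBasis d I) (ambBasis d J) := rfl
    have e1 := hR₁ t x ρ h1.1 (ambBasis d I).1 (ambBasis d I).2.1 (ambBasis d I).2.2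
      (ambBasis d J).1 (ambBasis d J).2.1 (ambBasis d J).2.2
    have e2 := hR₂ t x ρ h2.1 (ambBasis d I).1 (ambBasis d I).2.1 (ambBasis d I).2.2
      (ambBasis d J).1 (ambBasis d J).2.1 (ambBasis d J).2.2
    simp only [Prod.mk.eta] at e1 e2
    rw [e, e1, e2]
    ring
  · refine ((h t ht x).2.const_mul_left 2).congr_left fun ρ => ?_
    ring

lemma PairIsOrder.isOrderPlus {T : ℝ × M × ℝ → AmbIdx d → AmbIdx d → ℝ} {h : ℝ × M × ℝ → ℝ}
    {n k : ℕ} (hT : PairIsOrder T h (n + 1)) : PairIsOrderPlus S k T h n := by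
  have hle : (fun ρ : ℝ => ρ ^ (n + 1)) =O[𝓝 0] fun ρ : ℝ => ρ ^ n := by
    simpa [pow_succ] using (Asymptotics.isBigO_refl (fun ρ : ℝ => ρ ^ n) (𝓝 0)).mul
      ((continuous_id.tendsto (0 : ℝ)).isBigO_one ℝ)
  refine ⟨⟨fun I J t ht x => (hT.1 I J t ht x).trans hle, fun t ht x => (hT.2 t ht x).trans hle⟩,
    hT.1 _ _, fun i => hT.1 _ _, fun t ht x => ?_⟩
  have h1 := (hT.2 t ht x).const_mul_left (S.m * (S.f x ^ k)⁻¹)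
  have h2 : (fun ρ : ℝ => ∑ i, ∑ j,
      (Matrix.of (componentsAt (𝓡 d) (baseBasis d) S.g.inner x))⁻¹ i j
        * T (t, x, ρ) (idxM i) (idxM j)) =O[𝓝 0] fun ρ => ρ ^ (n + 1) :=
    Asymptotics.IsBigO.fun_sum fun i _ => Asymptotics.IsBigO.fun_sum fun j _ =>
      (hT.1 (idxM i) (idxM j) t ht x).const_mul_left _
  exact h1.sub h2

/-- Straight and normal weighted ambient spaces are unique to the expected order. -/
theorem uniqueness (hd : 3 ≤ d) {A₁ A₂ : MetricMeasureStructure d M}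
    (h₁ : IsWeightedAmbient S A₁) (hS₁ : IsStraight A₁) (hN₁ : IsNormal S A₁)
    (h₂ : IsWeightedAmbient S A₂) (hS₂ : IsStraight A₂) (hN₂ : IsNormal S A₂) :
    ((¬ ∃ n : ℕ, (d : ℝ) + S.m = 2 * n) → ∀ k : ℕ,
      PairIsOrder (componentsAt (ambI d) (ambBasis d) (fun p => A₁.g p - A₂.g p))
        (fun p => -2 * (A₁.f p - A₂.f p)) k) ∧
    (∀ n : ℕ, (d : ℝ) + S.m = 2 * n →
      PairIsOrderPlus S 1 (componentsAt (ambI d) (ambBasis d) (fun p => A₁.g p - A₂.g p))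
        (fun p => -2 * (A₁.f p - A₂.f p)) (n - 1)) := by
  have hA₁ := h₁.toIsPreAmbient
  have hA₂ := h₂.toIsPreAmbient
  have hR₁ := hN₁.isReduced hA₁ hS₁
  have hR₂ := hN₂.isReduced hA₂ hS₂
  refine ⟨fun hn k => ?_, fun n hn => ?_⟩
  · rcases k with _ | k
    · refine pairIsOrder_of_agreesTo hA₁ hA₂ hR₁ hR₂ fun t ht q => ?_
      have h1 := agreesTo_one hA₁ hA₂ ht q
      have hle : (fun ρ : ℝ => ρ ^ 1) =O[𝓝 0] fun ρ : ℝ => ρ ^ 0 := by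
        simpa using (continuous_id.tendsto (0 : ℝ)).isBigO_one ℝ
      exact ⟨fun v w => (h1.1 v w).trans hle, h1.2.trans hle⟩
    · exact pairIsOrder_of_agreesTo hA₁ hA₂ hR₁ hR₂ fun t ht =>
        agreesTo_of_order hA₁ hA₂ ht hR₁ hR₂ (h₁.order_of_not_even hn k)
          (h₂.order_of_not_even hn k) hd
          (fun k _ h => hn ⟨k + 1, by rw [h]; push_cast; ring⟩) k le_rfl
  -- `d + m = 2 n`: the orders `k + 1 < n` are not critical, so the metrics agree to order `n`
  · refine (pairIsOrder_of_agreesTo hA₁ hA₂ hR₁ hR₂ fun t ht =>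
        agreesTo_of_order hA₁ hA₂ ht hR₁ hR₂ (h₁.order_of_even n hn).1
          (h₂.order_of_even n hn).1 hd
          (fun k hk h => ?_) (n - 1) le_rfl).isOrderPlus
    rw [hn] at h
    have : (n : ℝ) = k + 1 := by linarith
    have : n = k + 1 := by exact_mod_cast this
    omega

end Uniqueness

/-! ### The formal solution -/

section FormalSolution

open PowerSeries

variable {S S' κ : Type*} [CommRing S] [Algebra ℝ S] [CommRing S'] [Algebra ℝ S'] [Fintype κ]
  [DecidableEq κ]

/-- The initial data of the formal problem: an invertible symmetric matrix and an invertible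
function, in a ring with commuting derivations. -/
structure IsInitial (D : κ → Derivation ℝ S S) (g gi : Matrix κ κ S) (f fi : S) : Prop where
  comm : ∀ i j x, D i (D j x) = D j (D i x)
  hg : g.IsSymm
  hgi : g * gi = 1
  hf : f * fi = 1

/-- The coefficient of order `k` of the modified tensor equation, for a pair of series. -/
def coeffTan (D : κ → Derivation ℝ S S) (m : ℝ) (p : Matrix κ κ S⟦X⟧ × S⟦X⟧) (k : ℕ) :
    Matrix κ κ S :=
  (Matrix.of (modTan (fun i => psD (D i)) (psδ S) X p.1 p.1⁻¹ p.2 (Ring.inverse p.2) m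
    (2 / (Fintype.card κ + m)))).map (coeff k)

/-- The coefficient of order `k` of the modified scalar equation, for a pair of series. -/
def coeffScal (D : κ → Derivation ℝ S S) (m μ : ℝ) (p : Matrix κ κ S⟦X⟧ × S⟦X⟧) (k : ℕ) : S :=
  coeff k (modScal (fun i => psD (D i)) (psδ S) X p.1 p.1⁻¹ p.2 (Ring.inverse p.2) m μ
    (2 / (Fintype.card κ + m)))

/-- The approximate solution of order `k`, a pair of polynomials of degree `k`. -/
def stage (D : κ → Derivation ℝ S S) (m μ : ℝ) (g gi : Matrix κ κ S) (f fi : S) :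
    ℕ → Matrix κ κ S⟦X⟧ × S⟦X⟧
  | 0 => (g.map (C (R := S)), C f)
  | k + 1 =>
    ((stage D m μ g gi f fi k).1 + Matrix.of fun i j => X ^ (k + 1) * C (solTan (Fintype.card κ + m) m k
        g gi fi (coeffTan D m (stage D m μ g gi f fi k) k)
        (coeffScal D m μ (stage D m μ g gi f fi k) k) i j),
      (stage D m μ g gi f fi k).2 + X ^ (k + 1) * C (solScal (Fintype.card κ + m) m k gi f fi
        (coeffTan D m (stage D m μ g gi f fi k) k)
        (coeffScal D m μ (stage D m μ g gi f fi k) k)))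

/-- The formal solution. -/
def formal (D : κ → Derivation ℝ S S) (m μ : ℝ) (g gi : Matrix κ κ S) (f fi : S) :
    Matrix κ κ S⟦X⟧ × S⟦X⟧ :=
  (Matrix.of fun i j => PowerSeries.mk fun k => coeff k ((stage D m μ g gi f fi k).1 i j),
    PowerSeries.mk fun k => coeff k (stage D m μ g gi f fi k).2)

variable {D : κ → Derivation ℝ S S} {m μ : ℝ} {g gi : Matrix κ κ S} {f fi : S}

lemma stage_succ_fst (k : ℕ) (i j : κ) :
    (stage D m μ g gi f fi (k + 1)).1 i j = (stage D m μ g gi f fi k).1 i j + X ^ (k + 1)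
      * C (solTan (Fintype.card κ + m) m k g gi fi (coeffTan D m (stage D m μ g gi f fi k) k)
        (coeffScal D m μ (stage D m μ g gi f fi k) k) i j) := rfl

lemma stage_succ_snd (k : ℕ) :
    (stage D m μ g gi f fi (k + 1)).2 = (stage D m μ g gi f fi k).2 + X ^ (k + 1)
      * C (solScal (Fintype.card κ + m) m k gi f fi (coeffTan D m (stage D m μ g gi f fi k) k)
        (coeffScal D m μ (stage D m μ g gi f fi k) k)) := rfl

lemma coeff_stage_of_le {j k l : ℕ} (hj : j ≤ k) (hk : k ≤ l) :
    (∀ a b, coeff j ((stage D m μ g gi f fi l).1 a b) = coeff j ((stage D m μ g gi f fi k).1 a b)) ∧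
      coeff j (stage D m μ g gi f fi l).2 = coeff j (stage D m μ g gi f fi k).2 := by
  induction l, hk using Nat.le_induction with
  | base => exact ⟨fun _ _ => rfl, rfl⟩
  | succ l hl ih =>
    have h0 : ∀ x : S⟦X⟧, coeff j (X ^ (l + 1) * x) = 0 := fun x =>
      X_pow_dvd_iff.1 (Dvd.intro _ rfl) j (by omega)
    exact ⟨fun a b => by rw [stage_succ_fst, map_add, h0, add_zero, ih.1],
      by rw [stage_succ_snd, map_add, h0, add_zero, ih.2]⟩

lemma coeff_formal {j k : ℕ} (hj : j ≤ k) :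
    (∀ a b, coeff j ((formal D m μ g gi f fi).1 a b) = coeff j ((stage D m μ g gi f fi k).1 a b)) ∧
      coeff j (formal D m μ g gi f fi).2 = coeff j (stage D m μ g gi f fi k).2 := by
  have h := coeff_stage_of_le (D := D) (m := m) (μ := μ) (g := g) (gi := gi) (f := f) (fi := fi)
    le_rfl hj
  exact ⟨fun a b => by rw [h.1]; simp [formal], by rw [h.2]; simp [formal]⟩

lemma coeff_zero_stage (k : ℕ) :
    (stage D m μ g gi f fi k).1.map (coeff 0) = g ∧ coeff 0 (stage D m μ g gi f fi k).2 = f := by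
  have h := coeff_stage_of_le (D := D) (m := m) (μ := μ) (g := g) (gi := gi) (f := f) (fi := fi)
    (le_refl 0) (Nat.zero_le k)
  refine ⟨Matrix.ext fun a b => ?_, ?_⟩
  · rw [Matrix.map_apply, h.1]; simp [stage]
  · rw [h.2]; simp [stage]

lemma coeff_zero_formal :
    (formal D m μ g gi f fi).1.map (coeff 0) = g ∧ coeff 0 (formal D m μ g gi f fi).2 = f := by
  have h := coeff_formal (D := D) (m := m) (μ := μ) (g := g) (gi := gi) (f := f) (fi := fi)
    (le_refl 0)
  have h' := coeff_zero_stage (D := D) (m := m) (μ := μ) (g := g) (gi := gi) (f := f) (fi := fi) 0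
  exact ⟨Matrix.ext fun a b => (h.1 a b).trans (congrFun (congrFun h'.1 a) b), h.2.trans h'.2⟩

/-- A pair of series with invertible symmetric initial values. -/
lemma mul_inv_of_coeff_zero {p : Matrix κ κ S⟦X⟧ × S⟦X⟧} (h : IsInitial D g gi f fi)
    (h1 : p.1.map (coeff 0) = g) (h2 : coeff 0 p.2 = f) :
    p.1 * p.1⁻¹ = 1 ∧ p.2 * Ring.inverse p.2 = 1 := by
  refine ⟨Matrix.mul_nonsing_inv _ ?_, Ring.mul_inverse_cancel _ ?_⟩
  · rw [PowerSeries.isUnit_iff_constantCoeff, RingHom.map_det]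
    have : (constantCoeff (R := S)).mapMatrix p.1 = g := by
      rw [← h1]; ext; simp
    rw [this]
    exact Matrix.isUnit_det_of_right_inverse h.hgi
  · rw [PowerSeries.isUnit_iff_constantCoeff, ← coeff_zero_eq_constantCoeff_apply, h2]
    exact IsUnit.of_mul_eq_one _ h.hf

lemma coeff_zero_inv {p : Matrix κ κ S⟦X⟧ × S⟦X⟧} {pi : Matrix κ κ S⟦X⟧} {qi : S⟦X⟧}
    (h : IsInitial D g gi f fi)
    (h1 : p.1.map (coeff 0) = g) (h2 : coeff 0 p.2 = f) (hp : p.1 * pi = 1) (hq : p.2 * qi = 1) :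
    pi.map (coeff 0) = gi ∧ coeff 0 qi = fi := by
  have e1 : g * pi.map (coeff 0) = 1 := by
    have := congrArg (constantCoeff (R := S)).mapMatrix hp
    rw [map_mul, map_one] at this
    rw [← this, ← h1]
    congr 1 <;> ext <;> simp
  have e2 : f * coeff 0 qi = 1 := by
    have := congrArg (coeff 0) hq
    rwa [AgreeTo.coeff_zero_mul, h2, coeff_zero_one] at this
  have e3 : gi * g = 1 := mul_eq_one_comm.mp h.hgi
  refine ⟨?_, ?_⟩
  · rw [← Matrix.one_mul (pi.map (coeff 0)), ← e3, Matrix.mul_assoc, e1, Matrix.mul_one]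
  · linear_combination fi * e2 - coeff 0 qi * h.hf

lemma modTan_symm {R : Type*} [CommRing R] [Algebra ℝ R] {D : κ → Derivation ℝ R R}
    (hD : ∀ i j x, D i (D j x) = D j (D i x)) (δ : Derivation ℝ R R)
    (ρ : R) {g gi : Matrix κ κ R} (hg : g.IsSymm) (hgi : g * gi = 1) (f fi : R) (m c : ℝ) (i j : κ) :
    modTan D δ ρ g gi f fi m c i j = modTan D δ ρ g gi f fi m c j i := by
  have h1 : ∑ k, ∑ l, δ (g i k) * gi k l * δ (g l j) = ∑ k, ∑ l, δ (g j k) * gi k l * δ (g l i) := by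
    rw [Finset.sum_comm]
    refine Finset.sum_congr rfl fun k _ => Finset.sum_congr rfl fun l _ => ?_
    rw [hg.apply i l, hg.apply k j, (isSymm_inv hg hgi).apply l k]
    ring
  simp only [modTan, tanRic, beRic]
  rw [h1, hg.apply i j, ric_symm hD hg hgi i j, hess_symm hD hg f i j]

lemma stage_isSymm (h : IsInitial D g gi f fi) (k : ℕ) : (stage D m μ g gi f fi k).1.IsSymm := by
  induction k with
  | zero => exact h.hg.map _
  | succ k ih =>
    have h0 := coeff_zero_stage (D := D) (m := m) (μ := μ) (g := g) (gi := gi) (f := f) (fi := fi) k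
    have hO : (coeffTan D m (stage D m μ g gi f fi k) k).IsSymm := Matrix.IsSymm.ext fun i j => by
      simp only [coeffTan, Matrix.map_apply, Matrix.of_apply]
      rw [modTan_symm (fun i j x => ?_) _ _ ih (mul_inv_of_coeff_zero h h0.1 h0.2).1]
      ext n
      simp [h.comm i j]
    refine Matrix.IsSymm.ext fun i j => ?_
    rw [stage_succ_fst, stage_succ_fst, ih.apply, (solTan_isSymm h.hg _ _ _ _ _ hO _).apply]

lemma formal_isSymm (h : IsInitial D g gi f fi) : (formal D m μ g gi f fi).1.IsSymm :=
  Matrix.IsSymm.ext fun i j => by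
    simp only [formal, Matrix.of_apply]
    congr 1
    funext k
    rw [(stage_isSymm h k).apply]

lemma agreeTo_stage_succ (h : IsInitial D g gi f fi) (k : ℕ) :
    AgreeTo k (stage D m μ g gi f fi k).1 (stage D m μ g gi f fi (k + 1)).1
      (stage D m μ g gi f fi k).1⁻¹ (stage D m μ g gi f fi (k + 1)).1⁻¹
      (stage D m μ g gi f fi k).2 (stage D m μ g gi f fi (k + 1)).2
      (Ring.inverse (stage D m μ g gi f fi k).2) (Ring.inverse (stage D m μ g gi f fi (k + 1)).2) := by
  have h0 := fun k =>
    coeff_zero_stage (D := D) (m := m) (μ := μ) (g := g) (gi := gi) (f := f) (fi := fi) k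
  have h1 := fun k => mul_inv_of_coeff_zero h (h0 k).1 (h0 k).2
  exact ⟨(h1 k).1, (h1 _).1, (h1 k).2, (h1 _).2,
    fun i j => by rw [stage_succ_fst, add_sub_cancel_left]; exact Dvd.intro _ rfl,
    by rw [stage_succ_snd, add_sub_cancel_left]; exact Dvd.intro _ rfl⟩

/-- The coefficient of order `k` of the equations for the approximate solution of order `k + 1`. -/
lemma coeff_stage_succ (h : IsInitial D g gi f fi) (hn0 : (Fintype.card κ + m : ℝ) ≠ 0)
    (hn1 : (Fintype.card κ + m : ℝ) ≠ 1) (k : ℕ) :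
    ((Fintype.card κ + m : ℝ) ≠ 2 * (k + 1) →
      (∀ i j, coeffTan D m (stage D m μ g gi f fi (k + 1)) k i j = 0) ∧
      coeffScal D m μ (stage D m μ g gi f fi (k + 1)) k = 0) ∧
    trEqn m gi fi (coeffTan D m (stage D m μ g gi f fi (k + 1)) k)
      (coeffScal D m μ (stage D m μ g gi f fi (k + 1)) k) = 0 := by
  have h0 := coeff_zero_stage (D := D) (m := m) (μ := μ) (g := g) (gi := gi) (f := f) (fi := fi) k
  have hA := agreeTo_stage_succ (m := m) (μ := μ) h k
  have hi := coeff_zero_inv h h0.1 h0.2 hA.hgi hA.hf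
  set p := stage D m μ g gi f fi k with hp
  set O := coeffTan D m p k with hO
  set w := coeffScal D m μ p k with hw
  have e1 : ∀ i j, coeff (k + 1) ((stage D m μ g gi f fi (k + 1)).1 i j - p.1 i j)
      = solTan (Fintype.card κ + m) m k g gi fi O w i j := fun i j => by
    rw [stage_succ_fst, add_sub_cancel_left, coeff_X_pow_mul', if_pos le_rfl, Nat.sub_self,
      coeff_zero_C]
  have e2 : coeff (k + 1) ((stage D m μ g gi f fi (k + 1)).2 - p.2)
      = solScal (Fintype.card κ + m) m k gi f fi O w := by
    rw [stage_succ_snd, add_sub_cancel_left, coeff_X_pow_mul', if_pos le_rfl, Nat.sub_self,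
      coeff_zero_C]
  have e0 : ∀ i j, coeff 0 (p.1 i j) = g i j := fun i j => congrFun (congrFun h0.1 i) j
  have ei : ∀ i j, coeff 0 (p.1⁻¹ i j) = gi i j := fun i j => congrFun (congrFun hi.1 i) j
  have htr : coeffTrace k p.1 (stage D m μ g gi f fi (k + 1)).1 p.1⁻¹ p.2
      (stage D m μ g gi f fi (k + 1)).2 (Ring.inverse p.2) m
      = trPair m gi fi (solTan (Fintype.card κ + m) m k g gi fi O w)
        (solScal (Fintype.card κ + m) m k gi f fi O w) := by
    simp only [coeffTrace, trPair, e1, e2, ei, hi.2]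
  have hT : ∀ i j, coeffTan D m (stage D m μ g gi f fi (k + 1)) k i j
      = O i j + linTan (Fintype.card κ + m) k (g i j)
        (solTan (Fintype.card κ + m) m k g gi fi O w i j)
        (trPair m gi fi (solTan (Fintype.card κ + m) m k g gi fi O w)
          (solScal (Fintype.card κ + m) m k gi f fi O w)) := fun i j => by
    have := (hA.coeff_modTan (D := D) m (2 / (Fintype.card κ + m)) i j).2
    rw [htr, e1, e0, sub_eq_iff_eq_add'] at this
    exact this
  have hS : coeffScal D m μ (stage D m μ g gi f fi (k + 1)) k
      = w + linScal (Fintype.card κ + m) k f (solScal (Fintype.card κ + m) m k gi f fi O w)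
        (trPair m gi fi (solTan (Fintype.card κ + m) m k g gi fi O w)
          (solScal (Fintype.card κ + m) m k gi f fi O w)) := by
    have := (hA.coeff_modScal (D := D) m μ (2 / (Fintype.card κ + m))).2
    rw [htr, e2, h0.2, sub_eq_iff_eq_add'] at this
    exact this
  refine ⟨fun hk => ?_, ?_⟩
  · have := lin_sol h.hg h.hgi h.hf rfl hn0 hn1 hk O w
    exact ⟨fun i j => (hT i j).trans (this.1 i j), hS.trans this.2⟩
  · rw [show coeffTan D m (stage D m μ g gi f fi (k + 1)) k = Matrix.of _ from
      Matrix.ext fun i j => hT i j, hS]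
    exact trEqn_lin_sol h.hg h.hgi h.hf rfl hn0 hn1 k O w

/-- The formal solution solves the modified equations below the critical order, and their weighted
trace at the critical order. -/
theorem formal_solves (h : IsInitial D g gi f fi) {n : ℝ} (hn : n = Fintype.card κ + m) (hn0 : n ≠ 0)
    (hn1 : n ≠ 1) {N : ℕ} (hN : ∀ s < N, n ≠ 2 * (s + 1))
    {G Gi : Matrix κ κ S⟦X⟧} {F Fi : S⟦X⟧} (hG : G = (formal D m μ g gi f fi).1)
    (hF : F = (formal D m μ g gi f fi).2) (hGi : G * Gi = 1) (hFi : F * Fi = 1) :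
    (∀ i j, X ^ N ∣ modTan (fun i => psD (D i)) (psδ S) X G Gi F Fi m (2 / n) i j) ∧
    X ^ N ∣ modScal (fun i => psD (D i)) (psδ S) X G Gi F Fi m μ (2 / n) ∧
    trEqn m (Gi.map (coeff 0)) (coeff 0 Fi)
      ((Matrix.of (modTan (fun i => psD (D i)) (psδ S) X G Gi F Fi m (2 / n))).map (coeff N))
      (coeff N (modScal (fun i => psD (D i)) (psδ S) X G Gi F Fi m μ (2 / n))) = 0 := by
  subst hn
  have hc0 := coeff_zero_formal (D := D) (m := m) (μ := μ) (g := g) (gi := gi) (f := f) (fi := fi)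
  have hA : ∀ k, AgreeTo (k + 1) (stage D m μ g gi f fi (k + 1)).1 G
      (stage D m μ g gi f fi (k + 1)).1⁻¹ Gi (stage D m μ g gi f fi (k + 1)).2 F
      (Ring.inverse (stage D m μ g gi f fi (k + 1)).2) Fi := by
    intro k
    have h0 := coeff_zero_stage (D := D) (m := m) (μ := μ) (g := g) (gi := gi) (f := f) (fi := fi)
      (k + 1)
    have h1 := mul_inv_of_coeff_zero h h0.1 h0.2
    refine ⟨h1.1, hGi, h1.2, hFi, fun i j => ?_, ?_⟩
    · rw [X_pow_dvd_iff]
      intro l hl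
      rw [map_sub, hG, (coeff_formal (Nat.lt_succ_iff.1 hl)).1, sub_self]
    · rw [X_pow_dvd_iff]
      intro l hl
      rw [map_sub, hF, (coeff_formal (Nat.lt_succ_iff.1 hl)).2, sub_self]
  have eT : ∀ k i j, coeff k (modTan (fun i => psD (D i)) (psδ S) X G Gi F Fi m
      (2 / (Fintype.card κ + m)) i j) = coeffTan D m (stage D m μ g gi f fi (k + 1)) k i j := by
    intro k i j
    have := X_pow_dvd_iff.1 ((hA k).coeff_modTan (D := D) m (2 / (Fintype.card κ + m)) i j).1 k
      (Nat.lt_succ_self k)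
    rw [map_sub, sub_eq_zero] at this
    exact this
  have eS : ∀ k, coeff k (modScal (fun i => psD (D i)) (psδ S) X G Gi F Fi m μ
      (2 / (Fintype.card κ + m))) = coeffScal D m μ (stage D m μ g gi f fi (k + 1)) k := by
    intro k
    have := X_pow_dvd_iff.1 ((hA k).coeff_modScal (D := D) m μ (2 / (Fintype.card κ + m))).1 k
      (Nat.lt_succ_self k)
    rw [map_sub, sub_eq_zero] at this
    exact this
  have key := coeff_stage_succ (μ := μ) h hn0 hn1
  have hi := coeff_zero_inv (p := (G, F)) h (by rw [hG]; exact hc0.1) (by rw [hF]; exact hc0.2) hGi hFi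
  refine ⟨fun i j => X_pow_dvd_iff.2 fun k hk => ?_, X_pow_dvd_iff.2 fun k hk => ?_, ?_⟩
  · rw [eT, ((key k).1 (hN k hk)).1]
  · rw [eS, ((key k).1 (hN k hk)).2]
  · rw [hi.1, hi.2, eS, show (Matrix.of (modTan (fun i => psD (D i)) (psδ S) X G Gi F Fi m
      (2 / (Fintype.card κ + m)))).map (coeff N) = coeffTan D m (stage D m μ g gi f fi (N + 1)) N from
      Matrix.ext fun i j => eT N i j]
    exact (key N).2

/-! ### The formal solution is natural under changes of coordinates -/

variable {π : S →ₐ[ℝ] S'} {D' : κ → Derivation ℝ S' S'} {J Ji : Matrix κ κ S'}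

lemma IsCoordChange.series (h : IsCoordChange π D D' J Ji) :
    IsCoordChange (mapAlgHom π) (fun i => psD (D i)) (fun i => psD (D' i)) (J.map (C (R := S')))
      (Ji.map (C (R := S'))) where
  comm i j x := by ext n; simp [h.comm i j]
  chain i x := by
    ext n
    simp [mapAlgHom_apply, h.chain, coeff_C_mul]
  jac i j a := by
    ext n
    simp only [coeff_psD, Matrix.map_apply, coeff_C]
    split_ifs <;> simp [h.jac i j a]
  inv := by rw [← Matrix.map_mul, h.inv, Matrix.map_one _ (map_zero _) (map_one _)]

lemma coeff_pullTensor (J : Matrix κ κ S') (T : Matrix κ κ S⟦X⟧) (k : ℕ) (i j : κ) :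
    coeff k (pullTensor (mapAlgHom π) (J.map (C (R := S'))) T i j)
      = pullTensor π J (T.map (coeff k)) i j := by
  simp only [pullTensor_apply, map_sum, Matrix.map_apply, mapAlgHom_apply, mul_assoc, coeff_C_mul]
  rfl

omit [DecidableEq κ] in
lemma pullTensor_smul (J : Matrix κ κ S') (a : S) (T : Matrix κ κ S) :
    pullTensor π J (a • T) = π a • pullTensor π J T := by
  have : (a • T).map π = π a • T.map π := by ext; simp
  rw [pullTensor, pullTensor, this, Matrix.mul_smul, Matrix.smul_mul]

omit [DecidableEq κ] in
lemma pullTensor_sub (J : Matrix κ κ S') (T T' : Matrix κ κ S) :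
    pullTensor π J (T - T') = pullTensor π J T - pullTensor π J T' := by
  have : (T - T').map π = T.map π - T'.map π := by ext; simp
  rw [pullTensor, pullTensor, pullTensor, this, Matrix.mul_sub, Matrix.sub_mul]

lemma IsCoordChange.solTrace_pull (h : IsCoordChange π D D' J Ji) (n m : ℝ) (k : ℕ)
    (gi : Matrix κ κ S) (fi : S) (O : Matrix κ κ S) (w : S) :
    solTrace n m k (pullInv π Ji gi) (π fi) (pullTensor π J O) (π w)
      = π (solTrace n m k gi fi O w) := by
  simp only [solTrace, trEqn, h.contract_pull, map_mul, map_add, map_pow, AlgHom.commutes]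

lemma IsCoordChange.solTan_pull (h : IsCoordChange π D D' J Ji) (n m : ℝ) (k : ℕ)
    (g gi : Matrix κ κ S) (fi : S) (O : Matrix κ κ S) (w : S) :
    solTan n m k (pullTensor π J g) (pullInv π Ji gi) (π fi) (pullTensor π J O) (π w)
      = pullTensor π J (solTan n m k g gi fi O w) := by
  simp only [solTan, h.solTrace_pull]
  split_ifs <;> simp only [pullTensor_smul, pullTensor_sub, AlgHom.commutes]

lemma IsCoordChange.solScal_pull (h : IsCoordChange π D D' J Ji) (n m : ℝ) (k : ℕ)
    (gi : Matrix κ κ S) (f fi : S) (O : Matrix κ κ S) (w : S) :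
    solScal n m k (pullInv π Ji gi) (π f) (π fi) (pullTensor π J O) (π w)
      = π (solScal n m k gi f fi O w) := by
  simp only [solScal, h.solTrace_pull]
  split_ifs <;> simp only [map_mul, map_sub, AlgHom.commutes]

lemma inverse_eq_of_mul {R : Type*} [CommRing R] {a b : R} (h : a * b = 1) : Ring.inverse a = b := by
  have := Ring.inverse_mul_cancel a (IsUnit.of_mul_eq_one _ h)
  linear_combination b * this - Ring.inverse a * h

/-- The pullback of a pair of series. -/
def pullPair (π : S →ₐ[ℝ] S') (J : Matrix κ κ S') (p : Matrix κ κ S⟦X⟧ × S⟦X⟧) :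
    Matrix κ κ S'⟦X⟧ × S'⟦X⟧ :=
  (pullTensor (mapAlgHom π) (J.map (C (R := S'))) p.1, mapAlgHom π p.2)

lemma IsCoordChange.coeffTan_pull (h : IsCoordChange π D D' J Ji) {p : Matrix κ κ S⟦X⟧ × S⟦X⟧}
    (hs : p.1.IsSymm) (h1 : p.1 * p.1⁻¹ = 1) (h2 : p.2 * Ring.inverse p.2 = 1) (m μ : ℝ) (k : ℕ) :
    coeffTan D' m (pullPair π J p) k = pullTensor π J (coeffTan D m p k) ∧
      coeffScal D' m μ (pullPair π J p) k = π (coeffScal D m μ p k) := by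
  have hc := h.series
  have e1 : (pullPair π J p).1⁻¹ = pullInv (mapAlgHom π) (Ji.map (C (R := S'))) p.1⁻¹ :=
    Matrix.inv_eq_right_inv (hc.pull_mul_pullInv h1)
  have e2 : Ring.inverse (pullPair π J p).2 = mapAlgHom π (Ring.inverse p.2) :=
    inverse_eq_of_mul (by rw [pullPair, ← map_mul, h2, map_one])
  have hX : mapAlgHom π (X : S⟦X⟧) = X := by simp [mapAlgHom_apply]
  have hδ : ∀ x, psδ S' (mapAlgHom π x) = mapAlgHom π (psδ S x) := fun x => by
    ext n
    simp [mapAlgHom_apply]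
  have hJ : ∀ i j, psδ S' (J.map (C (R := S')) i j) = 0 := fun i j => by
    ext n
    simp [coeff_C]
  refine ⟨Matrix.ext fun i j => ?_, ?_⟩
  · rw [coeffTan, Matrix.map_apply, Matrix.of_apply, e1, e2, ← hX]
    simp only [pullPair]
    rw [hc.modTan_pull hδ hJ hs h1, coeff_pullTensor]
    rfl
  · rw [coeffScal, e1, e2, ← hX]
    simp only [pullPair]
    rw [hc.modScal_pull hδ hJ hs h1]
    rfl

lemma IsCoordChange.stage_pull (h : IsCoordChange π D D' J Ji) (hi : IsInitial D g gi f fi) (k : ℕ) :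
    stage D' m μ (pullTensor π J g) (pullInv π Ji gi) (π f) (π fi) k
      = pullPair π J (stage D m μ g gi f fi k) := by
  have hpt : ∀ (j : ℕ) (T : Matrix κ κ S) (a b : κ),
      pullTensor (mapAlgHom π) (J.map (C (R := S'))) (Matrix.of fun a b => X ^ j * C (T a b)) a b
        = X ^ j * C (pullTensor π J T a b) := by
    intro j T a b
    simp only [pullTensor_apply, Matrix.of_apply, Matrix.map_apply, map_mul, map_pow, map_sum,
      mapAlgHom_apply, map_X, map_C, Finset.mul_sum]
    exact Finset.sum_congr rfl fun a _ => Finset.sum_congr rfl fun b _ => by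
      simp only [AlgHom.coe_toRingHom, RingHom.coe_coe]; ring
  induction k with
  | zero =>
    refine Prod.ext (Matrix.ext fun a b => ?_) ?_
    · have := hpt 0 g a b
      simp only [pow_zero, one_mul] at this
      exact this.symm
    · simp only [stage, pullPair, mapAlgHom_apply, map_C]
      rfl
  | succ k ih =>
    have h0 := coeff_zero_stage (D := D) (m := m) (μ := μ) (g := g) (gi := gi) (f := f) (fi := fi) k
    have h1 := mul_inv_of_coeff_zero hi h0.1 h0.2
    obtain ⟨e1, e2⟩ := h.coeffTan_pull (stage_isSymm (m := m) (μ := μ) hi k) h1.1 h1.2 m μ k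
    refine Prod.ext (Matrix.ext fun a b => ?_) ?_
    · rw [stage_succ_fst, ih, e1, e2, h.solTan_pull, ← hpt]
      simp only [pullPair]
      rw [← Matrix.add_apply]
      rw [stage]
      simp only [pullTensor, Matrix.mul_add, Matrix.add_mul, Matrix.map_add _ (map_add _)]
    · rw [stage_succ_snd, ih, e1, e2, h.solScal_pull]
      simp only [pullPair, stage_succ_snd, map_add, map_mul, map_pow, mapAlgHom_apply, map_X, map_C]
      rfl

/-- The coefficients of the formal solution are tensors. -/
theorem IsCoordChange.formal_pull (h : IsCoordChange π D D' J Ji) (hi : IsInitial D g gi f fi)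
    (k : ℕ) :
    (formal D' m μ (pullTensor π J g) (pullInv π Ji gi) (π f) (π fi)).1.map (coeff k)
      = pullTensor π J ((formal D m μ g gi f fi).1.map (coeff k)) ∧
    coeff k (formal D' m μ (pullTensor π J g) (pullInv π Ji gi) (π f) (π fi)).2
      = π (coeff k (formal D m μ g gi f fi).2) := by
  have h1 := coeff_formal (D := D) (m := m) (μ := μ) (g := g) (gi := gi) (f := f) (fi := fi)
    (le_refl k)
  have h2 := coeff_formal (D := D') (m := m) (μ := μ) (g := pullTensor π J g)
    (gi := pullInv π Ji gi) (f := π f) (fi := π fi) (le_refl k)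
  rw [h.stage_pull hi k] at h2
  have e : (formal D m μ g gi f fi).1.map (coeff k) = (stage D m μ g gi f fi k).1.map (coeff k) :=
    Matrix.ext fun a b => h1.1 a b
  refine ⟨Matrix.ext fun a b => ?_, ?_⟩
  · rw [Matrix.map_apply, h2.1, e]
    exact coeff_pullTensor J _ k a b
  · rw [h2.2, h1.2]
    simp [pullPair, mapAlgHom_apply]

end FormalSolution

/-! ### The coefficients of the formal solution on the manifold -/

section Coefficients

open TopologicalSpace smoothFun PowerSeries

section Jacobian

variable {V ι : Type*} [NormedAddCommGroup V] [NormedSpace ℝ V] [FiniteDimensional ℝ V] [Fintype ι]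
  [DecidableEq ι] {U U' : Opens V} (b : Module.Basis ι ℝ V) {φ : V → V}

lemma jacobian_eq_der (hφ : ContDiffOn ℝ ∞ φ U') (a i : ι) :
    jacobian b b φ hφ a i = der U' b i (mk (fun y => b.coord a (φ y))
      ((LinearMap.toContinuousLinearMap (b.coord a)).contDiff.comp_contDiffOn hφ)) := by
  refine ext_eval fun y hy => ?_
  rw [eval_der_of_eqOn b i (G := fun y => b.coord a (φ y)) (fun _ _ => rfl) hy, eval_jacobian, pd]
  have h1 : DifferentiableAt ℝ φ y :=
    (hφ.differentiableOn (by simp)).differentiableAt (U'.isOpen.mem_nhds hy)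
  have h2 : HasFDerivAt (fun y => b.coord a (φ y))
      ((LinearMap.toContinuousLinearMap (b.coord a)).comp (fderiv ℝ φ y)) y :=
    (LinearMap.toContinuousLinearMap (b.coord a)).hasFDerivAt.comp y h1.hasFDerivAt
  rw [h2.fderiv]
  rfl

/-- The matrix of the derivative of `φ`. -/
def jacAt (φ : V → V) (y : V) : Matrix ι ι ℝ :=
  Matrix.of fun a i => b.repr (fderiv ℝ φ y (b i)) a

lemma isUnit_det_jacobian (hφ : ContDiffOn ℝ ∞ φ U') (h : ∀ y ∈ U', (jacAt b φ y).det ≠ 0) :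
    IsUnit (jacobian b b φ hφ).det := by
  rw [isUnit_iff]
  intro y hy
  rw [AlgHom.map_det]
  have e : (eval y hy).mapMatrix (jacobian b b φ hφ) = jacAt b φ y := rfl
  rw [e]
  exact h y hy

/-- The pullback of functions by a local diffeomorphism is a change of coordinates. -/
lemma isCoordChange_pullback (hφ : ContDiffOn ℝ ∞ φ U') (hm : ∀ y ∈ U', φ y ∈ U)
    (hJ : IsUnit (jacobian b b φ hφ).det) :
    IsCoordChange (pullback φ hφ hm) (der U b) (der U' b) (jacobian b b φ hφ)
      (jacobian b b φ hφ)⁻¹ where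
  comm := der_comm b
  chain i x := der_pullback b b hφ hm x i
  jac i j a := by rw [jacobian_eq_der, jacobian_eq_der, der_comm]
  inv := Matrix.mul_nonsing_inv _ hJ

lemma map_eval_pullTensor (hφ : ContDiffOn ℝ ∞ φ U') (hm : ∀ y ∈ U', φ y ∈ U)
    (T : Matrix ι ι (smoothFun U)) {y : V} (hy : y ∈ U') :
    (pullTensor (pullback φ hφ hm) (jacobian b b φ hφ) T).map (eval y hy)
      = (jacAt b φ y).transpose * T.map (eval (φ y) (hm y hy)) * jacAt b φ y := by
  have e : (jacobian b b φ hφ).map (eval y hy) = jacAt b φ y := rfl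
  rw [pullTensor, map_mul_alg, map_mul_alg, Matrix.transpose_map, e]
  congr 2
  ext i j
  simp only [Matrix.map_apply, eval_pullback]

end Jacobian

variable {d : ℕ} {M : Type*} [TopologicalSpace M] [ChartedSpace (BaseVec d) M]
  [IsManifold (𝓡 d) ∞ M] (S : SmoothMetricMeasureSpace d M)

/-- The metric in the preferred chart at `x`. -/
def baseG (x : M) : Matrix (Fin d) (Fin d) (smoothFun (baseOpen (d := d) x)) :=
  Matrix.of fun i j => mk (fun y => chartMatrix (𝓡 d) (baseBasis d) S.g.inner x y i j)
    (((contMDiffOn_tensor_iff (𝓡 d) (baseBasis d) S.g.inner x Set.univ).1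
      S.g.contMDiff.contMDiffOn i j).mono fun _ hy => ⟨hy, trivial⟩)

/-- The density in the preferred chart at `x`. -/
def baseF (x : M) : smoothFun (baseOpen (d := d) x) :=
  mk (chartFun (𝓡 d) S.f x)
    (S.contMDiff_f.comp_contMDiffOn (contMDiffOn_extChartAt_symm x)).contDiffOn

lemma map_eval_baseG (x : M) {y : BaseVec d} (hy : y ∈ baseOpen x) :
    (baseG S x).map (eval y hy) = chartMatrix (𝓡 d) (baseBasis d) S.g.inner x y := rfl

lemma eval_baseF (x : M) {y : BaseVec d} (hy : y ∈ baseOpen x) :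
    eval y hy (baseF S x) = S.f ((extChartAt (𝓡 d) x).symm y) := rfl

lemma chartMatrix_det_ne_zero (h : TwoTensor (𝓡 d) M) {x : M} {y : BaseVec d} (hy : y ∈ baseOpen x)
    (hp : ∀ v : BaseVec d, v ≠ 0 → 0 < pairAt (𝓡 d) h ((extChartAt (𝓡 d) x).symm y) v v) :
    (chartMatrix (𝓡 d) (baseBasis d) h x y).det ≠ 0 := by
  intro h0
  obtain ⟨w, hw0, hw⟩ := Matrix.exists_vecMul_eq_zero_iff.2 h0
  set L := symmDeriv (𝓡 d) x y with hL
  set u : BaseVec d := ∑ i, w i • baseBasis d i with hu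
  have hinj : Function.Injective L :=
    (L : BaseVec d →ₗ[ℝ] BaseVec d).injective_iff_surjective.2 (symmDeriv_surjective (𝓡 d) x hy)
  have hu0 : u ≠ 0 := fun h => hw0 (funext (Fintype.linearIndependent_iff.1
    (baseBasis d).linearIndependent w h))
  have hpos := hp (L u) (fun h => hu0 (hinj (h.trans (map_zero L).symm)))
  set B := (bilinAt (𝓡 d) h ((extChartAt (𝓡 d) x).symm y)).compl₁₂ L.toLinearMap L.toLinearMap
  have hB : ∀ i j, B (baseBasis d i) (baseBasis d j)
      = chartMatrix (𝓡 d) (baseBasis d) h x y i j := fun i j => rfl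
  have hB0 : B u = 0 := (baseBasis d).ext fun j => by
    rw [hu, map_sum, LinearMap.sum_apply]
    simp only [map_smul, LinearMap.smul_apply, hB, smul_eq_mul, LinearMap.zero_apply]
    exact congrFun hw j
  have : pairAt (𝓡 d) h ((extChartAt (𝓡 d) x).symm y) (L u) (L u) = B u u := rfl
  rw [this, hB0] at hpos
  simp at hpos

lemma isUnit_det_baseG (x : M) : IsUnit (baseG S x).det := by
  rw [isUnit_iff]
  intro y hy
  rw [AlgHom.map_det]
  exact chartMatrix_det_ne_zero S.g.inner hy fun v hv => S.g.pos _ v hv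

lemma isUnit_baseF (x : M) : IsUnit (baseF S x) :=
  isUnit_iff.2 fun _ _ => (S.f_pos _).ne'

lemma isInitial_base (x : M) :
    IsInitial (der (baseOpen x) (baseBasis d)) (baseG S x) (baseG S x)⁻¹ (baseF S x)
      (Ring.inverse (baseF S x)) where
  comm := der_comm _
  hg := Matrix.IsSymm.ext fun _ _ => ext_eval fun _ _ => S.g.symm _ _ _
  hgi := Matrix.mul_nonsing_inv _ (isUnit_det_baseG S x)
  hf := Ring.mul_inverse_cancel _ (isUnit_baseF S x)

/-- The formal solution in the preferred chart at `x`. -/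
def baseFormal (x : M) : Matrix (Fin d) (Fin d) (smoothFun (baseOpen (d := d) x))⟦X⟧
    × (smoothFun (baseOpen (d := d) x))⟦X⟧ :=
  formal (der (baseOpen x) (baseBasis d)) S.m S.μ (baseG S x) (baseG S x)⁻¹ (baseF S x)
      (Ring.inverse (baseF S x))

/-- The formal solution with pulled back initial values is the pullback of the formal solution. -/
lemma coeff_formal_pull_base {U : Opens (BaseVec d)} {p : M} {φ : BaseVec d → BaseVec d}
    (hφ : ContDiffOn ℝ ∞ φ U) (hm : ∀ y ∈ U, φ y ∈ baseOpen p)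
    (hJ : IsUnit (jacobian (baseBasis d) (baseBasis d) φ hφ).det)
    {g : Matrix (Fin d) (Fin d) (smoothFun U)} {f : smoothFun U}
    (hg : pullTensor (pullback φ hφ hm) (jacobian (baseBasis d) (baseBasis d) φ hφ) (baseG S p) = g)
    (hf : pullback φ hφ hm (baseF S p) = f) (k : ℕ) :
    (formal (der U (baseBasis d)) S.m S.μ g g⁻¹ f (Ring.inverse f)).1.map (coeff k)
      = pullTensor (pullback φ hφ hm) (jacobian (baseBasis d) (baseBasis d) φ hφ)
        ((baseFormal S p).1.map (coeff k)) ∧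
    coeff k (formal (der U (baseBasis d)) S.m S.μ g g⁻¹ f (Ring.inverse f)).2
      = pullback φ hφ hm (coeff k (baseFormal S p).2) := by
  have h := isCoordChange_pullback (baseBasis d) hφ hm hJ
  have hi := isInitial_base S p
  have e1 : g⁻¹ = pullInv (pullback φ hφ hm) (jacobian (baseBasis d) (baseBasis d) φ hφ)⁻¹
      (baseG S p)⁻¹ := by
    rw [← hg]
    exact Matrix.inv_eq_right_inv (h.pull_mul_pullInv hi.hgi)
  have e2 : Ring.inverse f = pullback φ hφ hm (Ring.inverse (baseF S p)) := by
    rw [← hf]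
    exact inverse_eq_of_mul (by rw [← map_mul, hi.hf, map_one])
  rw [e1, e2, ← hg, ← hf]
  exact h.formal_pull hi k

/-- The coefficients of the formal solutions in two charts are related by the transition map. -/
theorem eval_coeff_baseFormal_trans (p q : M) {y : BaseVec d} (hy : y ∈ baseOpen p)
    (hq : (extChartAt (𝓡 d) p).symm y ∈ (extChartAt (𝓡 d) q).source) (k : ℕ) :
    ((baseFormal S p).1.map (coeff k)).map (eval y hy)
      = (transJac (𝓡 d) (baseBasis d) p q y).transpose
        * ((baseFormal S q).1.map (coeff k)).map
          (eval (U := baseOpen q) (trans (𝓡 d) p q y) (trans_mem_target (𝓡 d) p q hq))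
        * transJac (𝓡 d) (baseBasis d) p q y ∧
    eval y hy (coeff k (baseFormal S p).2)
      = eval (U := baseOpen q) (trans (𝓡 d) p q y) (trans_mem_target (𝓡 d) p q hq)
        (coeff k (baseFormal S q).2) := by
  let U : Opens (BaseVec d) := ⟨{z | z ∈ (extChartAt (𝓡 d) p).target ∧
      (extChartAt (𝓡 d) p).symm z ∈ (extChartAt (𝓡 d) q).source},
    (continuousOn_extChartAt_symm p).isOpen_inter_preimage (isOpen_extChartAt_target p)
      (isOpen_extChartAt_source q)⟩
  have hyU : y ∈ U := ⟨hy, hq⟩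
  have hφ : ContDiffOn ℝ ∞ (trans (𝓡 d) p q) U := fun z hz =>
    (contDiffAt_trans (𝓡 d) p q hz.1 hz.2).contDiffWithinAt
  have hm : ∀ z ∈ U, trans (𝓡 d) p q z ∈ baseOpen q := fun z hz =>
    trans_mem_target (𝓡 d) p q hz.2
  have hid : ContDiffOn ℝ ∞ (id : BaseVec d → BaseVec d) U := contDiffOn_id
  have hmid : ∀ z ∈ U, id z ∈ baseOpen p := fun z hz => hz.1
  have hjac : ∀ z, jacAt (baseBasis d) (trans (𝓡 d) p q) z = transJac (𝓡 d) (baseBasis d) p q z :=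
    fun z => rfl
  have hJ : IsUnit (jacobian (baseBasis d) (baseBasis d) (trans (𝓡 d) p q) hφ).det :=
    isUnit_det_jacobian (baseBasis d) hφ fun z hz => (Matrix.isUnit_det_of_right_inverse
      (transJac_mul (𝓡 d) (baseBasis d) p q hz.1 hz.2)).ne_zero
  have hone : ∀ z : BaseVec d, jacAt (baseBasis d) id z = 1 := by
    intro z
    ext a i
    rw [jacAt, Matrix.of_apply, fderiv_id, ContinuousLinearMap.id_apply, Module.Basis.repr_self,
      Finsupp.single_apply, Matrix.one_apply]
    simp only [eq_comm]
  have hJid : IsUnit (jacobian (baseBasis d) (baseBasis d) id hid).det :=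
    isUnit_det_jacobian (baseBasis d) hid fun z _ => by
      rw [hone, Matrix.det_one]
      exact one_ne_zero
  have hg : pullTensor (pullback (trans (𝓡 d) p q) hφ hm)
      (jacobian (baseBasis d) (baseBasis d) (trans (𝓡 d) p q) hφ) (baseG S q)
      = pullTensor (pullback id hid hmid) (jacobian (baseBasis d) (baseBasis d) id hid)
        (baseG S p) := by
    refine Matrix.ext fun i j => ext_eval fun z hz => ?_
    have h1 := map_eval_pullTensor (baseBasis d) hφ hm (baseG S q) hz
    have h2 := map_eval_pullTensor (baseBasis d) hid hmid (baseG S p) hz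
    rw [hjac] at h1
    rw [hone z, Matrix.transpose_one, Matrix.one_mul, Matrix.mul_one] at h2
    have h3 := chartMatrix_trans (𝓡 d) (baseBasis d) S.g.inner p q hz.1 hz.2
    rw [← map_eval_baseG S q (trans_mem_target (𝓡 d) p q hz.2),
      ← map_eval_baseG S p (y := z) hz.1] at h3
    exact congrFun (congrFun (h1.trans (h3.symm.trans h2.symm)) i) j
  have hf : pullback (trans (𝓡 d) p q) hφ hm (baseF S q) = pullback id hid hmid (baseF S p) :=
    ext_eval fun z hz => by
      rw [eval_pullback, eval_pullback, eval_baseF, eval_baseF, symm_trans (𝓡 d) p q hz.2]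
      rfl
  have k1 := coeff_formal_pull_base S hφ hm hJ hg hf k
  have k2 := coeff_formal_pull_base S hid hmid hJid rfl rfl k
  refine ⟨?_, ?_⟩
  · have h1 := map_eval_pullTensor (baseBasis d) hφ hm ((baseFormal S q).1.map (coeff k)) hyU
    have h2 := map_eval_pullTensor (baseBasis d) hid hmid ((baseFormal S p).1.map (coeff k)) hyU
    rw [hone y, Matrix.transpose_one, Matrix.one_mul, Matrix.mul_one] at h2
    rw [hjac] at h1
    rw [← k2.1, k1.1] at h2
    exact h2.symm.trans h1
  · have h1 := congrArg (eval y hyU) (k1.2.symm.trans k2.2)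
    rw [eval_pullback, eval_pullback] at h1
    exact h1.symm

/-- The bilinear form with the given components. -/
def bilinOfMatrix (B : Matrix (Fin d) (Fin d) ℝ) : BaseVec d →L[ℝ] BaseVec d →L[ℝ] ℝ :=
  LinearMap.toContinuousLinearMap
    (LinearMap.toContinuousLinearMap.toLinearMap ∘ₗ Matrix.toLinearMap₂ (baseBasis d) (baseBasis d) B)

lemma bilinOfMatrix_basis (B : Matrix (Fin d) (Fin d) ℝ) (i j : Fin d) :
    bilinOfMatrix B (baseBasis d i) (baseBasis d j) = B i j :=
  Matrix.toLinearMap₂_apply_basis _ _ _ _ _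

/-- The coefficient of order `k` of the formal solution, a tensor on the manifold. -/
def coefG (k : ℕ) : TwoTensor (𝓡 d) M := fun x =>
  bilinOfMatrix (((baseFormal S x).1.map (coeff k)).map (eval _ (self_mem_baseOpen x)))

/-- The coefficient of order `k` of the formal solution, a function on the manifold. -/
def coefF (k : ℕ) (x : M) : ℝ :=
  eval (U := baseOpen (d := d) x) _ (self_mem_baseOpen x) (coeff k (baseFormal S x).2)

/-- In every chart, the components of `coefG` are the coefficients of the formal solution in that
chart. -/
theorem chartMatrix_coefG (p : M) {y : BaseVec d} (hy : y ∈ baseOpen p) (k : ℕ) :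
    chartMatrix (𝓡 d) (baseBasis d) (coefG S k) p y
      = ((baseFormal S p).1.map (coeff k)).map (eval y hy) := by
  have hq := mem_extChartAt_source (I := 𝓡 d) ((extChartAt (𝓡 d) p).symm y)
  rw [chartMatrix_trans (𝓡 d) (baseBasis d) _ p _ hy hq, (eval_coeff_baseFormal_trans S p _ hy hq k).1]
  congr 2
  ext i j
  refine (chartMatrix_self (𝓡 d) (baseBasis d) (coefG S k) _ i j).trans ?_
  exact bilinOfMatrix_basis _ _ _

theorem coefF_symm (p : M) {y : BaseVec d} (hy : y ∈ baseOpen p) (k : ℕ) :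
    coefF S k ((extChartAt (𝓡 d) p).symm y) = eval y hy (coeff k (baseFormal S p).2) := by
  have hq := mem_extChartAt_source (I := 𝓡 d) ((extChartAt (𝓡 d) p).symm y)
  exact ((eval_coeff_baseFormal_trans S p _ hy hq k).2).symm

end Coefficients

/-! ### Borel summation -/

section Borel

open Filter

/-- A cutoff function on the line. -/
def cutoff : ContDiffBump (0 : ℝ) := ⟨1 / 2, 1, by norm_num, by norm_num⟩

/-- The function `ρ ^ k`, cut off at the scale `1 / l k`. -/
def borelCoeff (l : ℕ → ℝ) (k : ℕ) (ρ : ℝ) : ℝ := ρ ^ k * cutoff (l k * ρ)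

variable {l : ℕ → ℝ}

lemma cutoff_nonneg (s : ℝ) : 0 ≤ cutoff s := cutoff.nonneg

lemma cutoff_le_one (s : ℝ) : cutoff s ≤ 1 := cutoff.le_one

lemma cutoff_eq_zero {s : ℝ} (h : 1 ≤ |s|) : cutoff s = 0 :=
  cutoff.zero_of_le_dist (by simpa [cutoff] using h)

lemma cutoff_eq_one {s : ℝ} (h : |s| ≤ 1 / 2) : cutoff s = 1 :=
  cutoff.one_of_mem_closedBall (by simpa [cutoff] using h)

lemma borelCoeff_zero (k : ℕ) : borelCoeff l k 0 = if k = 0 then 1 else 0 := by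
  rw [borelCoeff, mul_zero, cutoff_eq_one (by norm_num), mul_one]
  split_ifs with h <;> simp [h]

lemma borelCoeff_eq_zero (hl : ∀ k : ℕ, (k + 1 : ℝ) ≤ l k) {ρ : ℝ} {k : ℕ}
    (hk : k ∉ Finset.range (⌈|ρ|⁻¹⌉₊ + 1)) : borelCoeff l k ρ = 0 := by
  rw [Finset.mem_range, not_lt] at hk
  rcases eq_or_ne ρ 0 with rfl | hρ
  · rw [borelCoeff_zero, if_neg (by omega)]
  · have h0 : 0 < |ρ| := abs_pos.2 hρ
    have h1 : |ρ|⁻¹ ≤ l k := by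
      have : (⌈|ρ|⁻¹⌉₊ : ℝ) + 1 ≤ k := by exact_mod_cast hk
      linarith [Nat.le_ceil |ρ|⁻¹, hl k]
    rw [borelCoeff, cutoff_eq_zero, mul_zero]
    rw [abs_mul, abs_of_pos (lt_of_lt_of_le (inv_pos.2 h0) h1)]
    calc (1 : ℝ) = |ρ|⁻¹ * |ρ| := (inv_mul_cancel₀ h0.ne').symm
      _ ≤ _ := mul_le_mul_of_nonneg_right h1 h0.le

lemma abs_borelCoeff_le (ρ : ℝ) (k : ℕ) : |borelCoeff l k ρ| ≤ |ρ| ^ k := by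
  rw [borelCoeff, abs_mul, abs_pow, abs_of_nonneg (cutoff_nonneg _)]
  exact mul_le_of_le_one_right (by positivity) (cutoff_le_one _)

lemma abs_borelCoeff_le_div {ρ : ℝ} (hρ : |ρ| ≤ 1) {N k : ℕ} (hk : N < k) (hl : 0 < l k) :
    |borelCoeff l k ρ| ≤ |ρ| ^ N * (l k)⁻¹ := by
  rw [borelCoeff, abs_mul, abs_pow, abs_of_nonneg (cutoff_nonneg _)]
  rcases le_or_gt 1 |l k * ρ| with h | h
  · rw [cutoff_eq_zero h, mul_zero]
    positivity
  · have h1 : |ρ| ≤ (l k)⁻¹ := by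
      rw [abs_mul, abs_of_pos hl, mul_comm] at h
      rw [← one_div, le_div_iff₀ hl]
      exact h.le
    calc |ρ| ^ k * cutoff (l k * ρ) ≤ |ρ| ^ k :=
          mul_le_of_le_one_right (by positivity) (cutoff_le_one _)
      _ ≤ |ρ| ^ (N + 1) := pow_le_pow_of_le_one (abs_nonneg _) hρ hk
      _ = |ρ| ^ N * |ρ| := pow_succ _ _
      _ ≤ _ := by gcongr

variable {W : Type*} [NormedAddCommGroup W] [NormedSpace ℝ W]

lemma borel_tsum_eq (hl : ∀ k : ℕ, (k + 1 : ℝ) ≤ l k) (ρ : ℝ) (e : ℕ → W) :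
    ∑' k, borelCoeff l k ρ • e k
      = ∑ k ∈ Finset.range (⌈|ρ|⁻¹⌉₊ + 1), borelCoeff l k ρ • e k :=
  tsum_eq_sum fun k hk => by rw [borelCoeff_eq_zero hl hk, zero_smul]

lemma borel_summable (hl : ∀ k : ℕ, (k + 1 : ℝ) ≤ l k) (ρ : ℝ) (e : ℕ → W) :
    Summable fun k => borelCoeff l k ρ • e k :=
  summable_of_ne_finset_zero (s := Finset.range (⌈|ρ|⁻¹⌉₊ + 1))
    fun k hk => by rw [borelCoeff_eq_zero hl hk, zero_smul]

/-- The Borel sum has the given asymptotic expansion. -/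
theorem borel_expansion (hl : ∀ k : ℕ, (k + 1 : ℝ) ≤ l k) {e : ℕ → W}
    (he : ∀ᶠ k in atTop, 2 ^ k * ‖e k‖ ≤ l k) (N : ℕ) :
    (fun ρ : ℝ => ∑ k ∈ Finset.range (⌈|ρ|⁻¹⌉₊ + 1), borelCoeff l k ρ • e k
      - ∑ k ∈ Finset.range N, ρ ^ k • e k) =O[𝓝 0] fun ρ => ρ ^ N := by
  have hl0 : ∀ k, 0 < l k := fun k => lt_of_lt_of_le (by positivity) (hl k)
  obtain ⟨K, hK⟩ := eventually_atTop.1 he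
  set a : ℕ → ℝ := fun k => (if k < max K (N + 1) then ‖e k‖ else 0) + (1 / 2) ^ k with ha
  have hsum : Summable a := by
    refine Summable.add ?_ (summable_geometric_of_lt_one (by norm_num) (by norm_num))
    exact summable_of_ne_finset_zero (s := Finset.range (max K (N + 1))) fun k hk => by
      rw [if_neg (by simpa using hk)]
  have hsum' : Summable fun k => a (k + N) := (summable_nat_add_iff N).2 hsum
  have hev : ∀ k, ∀ᶠ ρ in 𝓝 (0 : ℝ), cutoff (l k * ρ) = 1 := fun k => by
    have : Tendsto (fun ρ : ℝ => |l k * ρ|) (𝓝 0) (𝓝 0) := by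
      have : Continuous fun ρ : ℝ => |l k * ρ| := by fun_prop
      simpa using this.tendsto 0
    filter_upwards [this.eventually (ge_mem_nhds (show (0 : ℝ) < 1 / 2 by norm_num))] with ρ hρ
    exact cutoff_eq_one hρ
  have hev1 : ∀ᶠ ρ in 𝓝 (0 : ℝ), |ρ| ≤ 1 := by
    have : Tendsto (fun ρ : ℝ => |ρ|) (𝓝 0) (𝓝 0) := by
      simpa using (continuous_abs (G := ℝ)).tendsto 0
    exact this.eventually (ge_mem_nhds (by norm_num))
  refine Asymptotics.IsBigO.of_bound (∑' k, a (k + N)) ?_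
  filter_upwards [hev1, (eventually_all_finset (Finset.range N)).2 fun k _ => hev k] with ρ hρ hN
  have h1 : ∑ k ∈ Finset.range N, ρ ^ k • e k = ∑ k ∈ Finset.range N, borelCoeff l k ρ • e k :=
    Finset.sum_congr rfl fun k hk => by rw [borelCoeff, hN k hk, mul_one]
  rw [← borel_tsum_eq hl, h1, ← (borel_summable hl ρ e).sum_add_tsum_nat_add N, add_sub_cancel_left,
    norm_pow, Real.norm_eq_abs]
  refine tsum_of_norm_bounded (hsum'.hasSum.mul_right (|ρ| ^ N)) fun k => ?_
  rw [norm_smul, Real.norm_eq_abs, ha]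
  by_cases hk : k + N < max K (N + 1)
  · simp only [if_pos hk]
    calc |borelCoeff l (k + N) ρ| * ‖e (k + N)‖ ≤ |ρ| ^ N * ‖e (k + N)‖ := by
          gcongr
          exact (abs_borelCoeff_le ρ _).trans
            (pow_le_pow_of_le_one (abs_nonneg _) hρ (Nat.le_add_left _ _))
      _ ≤ _ := by
          rw [mul_comm]
          gcongr
          exact le_add_of_nonneg_right (by positivity)
  · simp only [if_neg hk, zero_add]
    have hk' : K ≤ k + N ∧ N < k + N := by omega
    calc |borelCoeff l (k + N) ρ| * ‖e (k + N)‖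
        ≤ |ρ| ^ N * (l (k + N))⁻¹ * ‖e (k + N)‖ := by
          gcongr
          exact abs_borelCoeff_le_div hρ hk'.2 (hl0 _)
      _ = |ρ| ^ N * ((l (k + N))⁻¹ * ‖e (k + N)‖) := mul_assoc _ _ _
      _ ≤ |ρ| ^ N * (1 / 2) ^ (k + N) := by
          gcongr
          rw [one_div, inv_pow, inv_mul_le_iff₀ (hl0 _), ← div_eq_mul_inv,
            le_div_iff₀ (by positivity), mul_comm]
          exact hK _ hk'.1
      _ = _ := mul_comm _ _

variable {V : Type*} [NormedAddCommGroup V] [NormedSpace ℝ V] [FiniteDimensional ℝ V]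
  [CompleteSpace W]

/-- For compactly supported coefficients, the Borel sum is smooth if the cutoff scales are small
enough. -/
lemma borel_contDiff_of_hasCompactSupport (E : ℕ → V → W) (hE : ∀ k, ContDiff ℝ ∞ (E k))
    (hc : ∀ k, HasCompactSupport (E k)) :
    ∃ Λ : ℕ → ℝ, (∀ k y, 2 ^ k * ‖E k y‖ ≤ Λ k) ∧ ∀ l : ℕ → ℝ, (∀ᶠ k in atTop, Λ k ≤ l k) →
      ContDiff ℝ ∞ fun z : V × ℝ => ∑' k, borelCoeff l k z.2 • E k z.1 := by
  set w : ℕ → V × ℝ → W := fun k z => (z.2 ^ k * cutoff z.2) • E k z.1 with hw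
  have hws : ∀ k, ContDiff ℝ ∞ (w k) := fun k =>
    (((contDiff_snd.pow k).mul ((cutoff.contDiff (n := ⊤)).comp contDiff_snd)).smul
      ((hE k).comp contDiff_fst))
  have hwc : ∀ k, HasCompactSupport (w k) := fun k => by
    refine HasCompactSupport.intro ((hc k).isCompact.prod (isCompact_closedBall (0 : ℝ) 1)) ?_
    rintro ⟨y, s⟩ hz
    rw [Set.mem_prod, not_and_or] at hz
    rcases hz with hz | hz
    · simp only [hw, image_eq_zero_of_notMem_tsupport hz, smul_zero]
    · rw [hw]
      dsimp only
      rw [cutoff_eq_zero, mul_zero, zero_smul]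
      simp only [Metric.mem_closedBall, dist_zero_right, Real.norm_eq_abs, not_le] at hz
      exact hz.le
  have hb : ∀ k n : ℕ, ∃ C, ∀ z, ‖iteratedFDeriv ℝ n (w k) z‖ ≤ C := fun k n =>
    ((hws k).continuous_iteratedFDeriv (m := n) (by exact_mod_cast le_top)).bounded_above_of_compact_support
      ((hwc k).iteratedFDeriv n)
  have hb0 : ∀ k : ℕ, ∃ C, ∀ y, ‖E k y‖ ≤ C := fun k =>
    (hE k).continuous.bounded_above_of_compact_support (hc k)
  choose C hC using hb
  choose C0 hC0 using hb0
  have hCn : ∀ k n, 0 ≤ C k n := fun k n => (norm_nonneg _).trans (hC k n 0)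
  have hC0n : ∀ k, 0 ≤ C0 k := fun k => (norm_nonneg _).trans (hC0 k 0)
  have hSn : ∀ k, 0 ≤ ∑ n ∈ Finset.range k, C k n := fun k => Finset.sum_nonneg fun n _ => hCn k n
  refine ⟨fun k => 1 + 2 ^ k * (C0 k + ∑ n ∈ Finset.range k, C k n), fun k y => ?_, fun l hl => ?_⟩
  · have : (2 : ℝ) ^ k * ‖E k y‖ ≤ 2 ^ k * (C0 k + ∑ n ∈ Finset.range k, C k n) := by
      gcongr
      exact (hC0 k y).trans (le_add_of_nonneg_right (hSn k))
    linarith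
  refine contDiff_tsum_of_eventually (N := ⊤) (v := fun _ k => (1 / 2 : ℝ) ^ k) (fun k => ?_)
    (fun n _ => summable_geometric_of_lt_one (by norm_num) (by norm_num)) fun n _ => ?_
  · exact ((contDiff_snd.pow k).mul ((cutoff.contDiff (n := ⊤)).comp
      (contDiff_const.mul contDiff_snd))).smul ((hE k).comp contDiff_fst)
  · rw [Nat.cofinite_eq_atTop]
    filter_upwards [hl, eventually_gt_atTop n] with k hk hkn z
    have hl1 : 1 ≤ l k := by
      have : (0 : ℝ) ≤ 2 ^ k * (C0 k + ∑ n ∈ Finset.range k, C k n) :=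
        mul_nonneg (by positivity) (add_nonneg (hC0n k) (hSn k))
      linarith
    have hl0 : 0 < l k := by linarith
    -- the `k`-th term is a rescaling of the function `w k`
    set L : V × ℝ →L[ℝ] V × ℝ :=
      (ContinuousLinearMap.id ℝ V).prodMap (l k • ContinuousLinearMap.id ℝ ℝ) with hL
    have hLn : ‖L‖ ≤ l k := L.opNorm_le_bound hl0.le fun z => by
      have e : L z = (z.1, l k * z.2) := rfl
      rw [e, Prod.norm_mk, norm_mul, Real.norm_eq_abs (l k), abs_of_pos hl0]
      refine max_le ?_ (mul_le_mul_of_nonneg_left (norm_snd_le z) hl0.le)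
      calc ‖z.1‖ ≤ 1 * ‖z‖ := by rw [one_mul]; exact norm_fst_le z
        _ ≤ _ := by gcongr
    have hf : (fun z : V × ℝ => borelCoeff l k z.2 • E k z.1)
        = fun z => ((l k) ^ k)⁻¹ • (w k ∘ L) z := by
      funext z
      have e : L z = (z.1, l k * z.2) := rfl
      simp only [Function.comp_apply, e, hw, borelCoeff, smul_smul]
      congr 1
      field_simp
      ring
    rw [hf]
    have hcd : ContDiff ℝ n (w k ∘ L) := ((hws k).comp L.contDiff).of_le (by exact_mod_cast le_top)
    rw [iteratedFDeriv_const_smul_apply' hcd.contDiffAt, norm_smul, norm_inv, norm_pow, Real.norm_eq_abs, abs_of_pos hl0,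
      L.iteratedFDeriv_comp_right (hws k) z (by exact_mod_cast le_top)]
    have h1 : ‖(iteratedFDeriv ℝ n (w k) (L z)).compContinuousLinearMap fun _ => L‖
        ≤ C k n * l k ^ n := by
      refine (ContinuousMultilinearMap.norm_compContinuousLinearMap_le _ _).trans ?_
      rw [Finset.prod_const, Finset.card_univ, Fintype.card_fin]
      exact mul_le_mul (hC k n _) (pow_le_pow_left₀ (norm_nonneg _) hLn n) (by positivity) (hCn k n)
    have h2 : C k n ≤ l k * (1 / 2) ^ k := by
      rw [one_div, inv_pow, ← div_eq_mul_inv, le_div_iff₀ (by positivity), mul_comm]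
      have : C k n ≤ C0 k + ∑ n ∈ Finset.range k, C k n :=
        (Finset.single_le_sum (fun n _ => hCn k n) (Finset.mem_range.2 hkn)).trans
          (le_add_of_nonneg_left (hC0n k))
      have := mul_le_mul_of_nonneg_left this (show (0 : ℝ) ≤ 2 ^ k by positivity)
      linarith
    have h3 : l k ^ (n + 1) ≤ l k ^ k := pow_le_pow_right₀ hl1 hkn
    calc (l k ^ k)⁻¹ * ‖(iteratedFDeriv ℝ n (w k) (L z)).compContinuousLinearMap fun _ => L‖
        ≤ (l k ^ k)⁻¹ * (l k * (1 / 2) ^ k * l k ^ n) := by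
          gcongr
          exact h1.trans (by gcongr)
      _ = (l k ^ k)⁻¹ * l k ^ (n + 1) * (1 / 2) ^ k := by ring
      _ ≤ 1 * (1 / 2) ^ k := by
          gcongr
          rw [inv_mul_le_iff₀ (by positivity), mul_one]
          exact h3
      _ = _ := one_mul _

/-- Near each point, the Borel sum of smooth functions is smooth if the cutoff scales are small
enough. -/
theorem exists_borel_contDiffOn (E : ℕ → V → W) {U : Set V} (hU : IsOpen U)
    (hE : ∀ k, ContDiffOn ℝ ∞ (E k) U) {y₀ : V} (hy₀ : y₀ ∈ U) :
    ∃ O : Set V, IsOpen O ∧ y₀ ∈ O ∧ O ⊆ U ∧ ∃ Λ : ℕ → ℝ,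
      (∀ k, ∀ y ∈ O, 2 ^ k * ‖E k y‖ ≤ Λ k) ∧ ∀ l : ℕ → ℝ, (∀ k : ℕ, (k + 1 : ℝ) ≤ l k) →
      (∀ᶠ k in atTop, Λ k ≤ l k) →
      ContDiffOn ℝ ∞ (fun z : V × ℝ =>
        ∑ k ∈ Finset.range (⌈|z.2|⁻¹⌉₊ + 1), borelCoeff l k z.2 • E k z.1) (O ×ˢ Set.univ) := by
  obtain ⟨ε, hε, hεU⟩ := Metric.isOpen_iff.1 hU y₀ hy₀
  let θ : ContDiffBump y₀ := ⟨ε / 4, ε / 2, by positivity, by linarith⟩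
  have hsupp : tsupport θ ⊆ U := by
    rw [θ.tsupport_eq]
    exact (Metric.closedBall_subset_ball (by change ε / 2 < ε; linarith)).trans hεU
  have hsm : ∀ k, ContDiff ℝ ∞ fun y => θ y • E k y := fun k => by
    rw [contDiff_iff_contDiffAt]
    intro y
    by_cases hy : y ∈ tsupport θ
    · exact θ.contDiff.contDiffAt.smul ((hE k).contDiffAt (hU.mem_nhds (hsupp hy)))
    · have : (fun y => θ y • E k y) =ᶠ[𝓝 y] fun _ => 0 := by
        filter_upwards [(isClosed_tsupport θ).isOpen_compl.mem_nhds hy] with z hz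
        rw [image_eq_zero_of_notMem_tsupport hz, zero_smul]
      exact contDiffAt_const.congr_of_eventuallyEq this
  obtain ⟨Λ, hΛ0, hΛ⟩ := borel_contDiff_of_hasCompactSupport (fun k y => θ y • E k y) hsm
    fun k => θ.hasCompactSupport.smul_right
  have hone : ∀ y ∈ Metric.ball y₀ (ε / 4), θ y = 1 := fun y hy =>
    θ.one_of_mem_closedBall (Metric.ball_subset_closedBall hy)
  refine ⟨Metric.ball y₀ (ε / 4), Metric.isOpen_ball, Metric.mem_ball_self (by positivity),
    (Metric.ball_subset_ball (by linarith)).trans hεU, Λ, fun k y hy => ?_, fun l hl hl' => ?_⟩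
  · have := hΛ0 k y
    rwa [hone y hy, one_smul] at this
  · refine (hΛ l hl').contDiffOn.congr fun z hz => ?_
    rw [borel_tsum_eq hl]
    simp only [hone z.1 hz.1, one_smul]

/-- Countably many conditions on the cutoff scales can be satisfied simultaneously. -/
lemma exists_eventually_ge {ι : Type*} {s : Set ι} (hs : s.Countable) (Λ : ι → ℕ → ℝ) :
    ∃ l : ℕ → ℝ, (∀ k : ℕ, (k + 1 : ℝ) ≤ l k) ∧ ∀ i ∈ s, ∀ᶠ k in atTop, Λ i k ≤ l k := by
  rcases s.eq_empty_or_nonempty with rfl | hne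
  · exact ⟨fun k => k + 1, fun _ => le_rfl, fun i hi => hi.elim⟩
  obtain ⟨e, rfl⟩ := hs.exists_eq_range hne
  have hn : ∀ k, 0 ≤ ∑ j ∈ Finset.range (k + 1), |Λ (e j) k| := fun k =>
    Finset.sum_nonneg fun _ _ => abs_nonneg _
  refine ⟨fun k => k + 1 + ∑ j ∈ Finset.range (k + 1), |Λ (e j) k|,
    fun k => le_add_of_nonneg_right (hn k), ?_⟩
  rintro _ ⟨j, rfl⟩
  filter_upwards [eventually_ge_atTop j] with k hk
  have := Finset.single_le_sum (f := fun j => |Λ (e j) k|) (fun _ _ => abs_nonneg _)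
    (Finset.mem_range.2 (Nat.lt_succ_of_le hk))
  have h2 := le_abs_self (Λ (e j) k)
  have h3 : (0 : ℝ) ≤ k := k.cast_nonneg
  linarith

end Borel

/-! ### The ambient space of a family of metrics and densities -/

section AmbientSpace

open TopologicalSpace smoothFun

variable {d : ℕ}

/-- The bilinear form `2 ρ dt² + 2 t dρ dt + t² B`. -/
def ambForm (t ρ : ℝ) (B : BaseVec d →L[ℝ] BaseVec d →L[ℝ] ℝ) : AmbVec d →L[ℝ] AmbVec d →L[ℝ] ℝ :=
  LinearMap.toContinuousLinearMap (LinearMap.toContinuousLinearMap.toLinearMap ∘ₗ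
    LinearMap.mk₂ ℝ (fun v w : AmbVec d => 2 * ρ * (v.1 * w.1) + t * (v.1 * w.2.2 + w.1 * v.2.2)
        + t ^ 2 * B v.2.1 w.2.1)
      (fun v v' w => by simp only [Prod.fst_add, Prod.snd_add, map_add, add_apply]; ring)
      (fun c v w => by simp only [Prod.smul_fst, Prod.smul_snd, map_smul, smul_apply, smul_eq_mul]; ring)
      (fun v w w' => by simp only [Prod.fst_add, Prod.snd_add, map_add]; ring)
      (fun c v w => by simp only [Prod.smul_fst, Prod.smul_snd, map_smul, smul_eq_mul]; ring))

lemma ambForm_apply (t ρ : ℝ) (B : BaseVec d →L[ℝ] BaseVec d →L[ℝ] ℝ) (a : ℝ) (v : BaseVec d) (c : ℝ)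
    (a' : ℝ) (v' : BaseVec d) (c' : ℝ) : ambForm t ρ B (a, v, c) (a', v', c')
      = 2 * ρ * (a * a') + t * (a * c' + a' * c) + t ^ 2 * B v v' := rfl

/-- The form `2 ρ dt² + 2 t dρ dt + t² B` is positive on the vectors `(a, v, κ a)` with
`2 ρ + 2 t κ = 1`, and negative on the vectors `(a, 0, κ a)` with `2 ρ + 2 t κ = -1`. -/
lemma hasSignature_ambForm {t ρ : ℝ} (ht : 0 < t) {B : BaseVec d →L[ℝ] BaseVec d →L[ℝ] ℝ}
    (hs : ∀ v w, B v w = B w v) (hp : ∀ v, v ≠ 0 → 0 < B v v) :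
    HasSignature (ambForm t ρ B) (d + 1) 1 := by
  refine ⟨?_, ?_⟩
  · rintro ⟨a, v, c⟩ ⟨a', v', c'⟩
    rw [ambForm_apply, ambForm_apply, hs v v']
    ring
  set Q := LinearMap.BilinMap.toQuadraticMap (LinearMap.mk₂ ℝ (fun v w => ambForm t ρ B v w)
    (by simp) (by simp) (by simp) (by simp)) with hQ
  have hQa : ∀ v, Q v = ambForm t ρ B v v := fun v => rfl
  have hB0 : ∀ v, 0 ≤ B v v := fun v => by
    rcases eq_or_ne v 0 with rfl | hv
    · simp
    · exact (hp v hv).le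
  let L₁ : ℝ × BaseVec d →ₗ[ℝ] AmbVec d :=
    (LinearMap.fst ℝ ℝ (BaseVec d)).prod ((LinearMap.snd ℝ ℝ (BaseVec d)).prod
      (((1 - 2 * ρ) / (2 * t)) • LinearMap.fst ℝ ℝ (BaseVec d)))
  let L₂ : ℝ →ₗ[ℝ] AmbVec d :=
    LinearMap.id.prod (LinearMap.prod 0 (((-1 - 2 * ρ) / (2 * t)) • LinearMap.id))
  have hL₁ : ∀ a v, L₁ (a, v) = (a, v, (1 - 2 * ρ) / (2 * t) * a) := fun _ _ => rfl
  have hL₂ : ∀ a, L₂ a = (a, 0, (-1 - 2 * ρ) / (2 * t) * a) := fun _ => rfl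
  have i₁ : Function.Injective L₁ := fun z w h => by
    have := Prod.mk.inj h
    exact Prod.ext this.1 (Prod.mk.inj this.2).1
  have i₂ : Function.Injective L₂ := fun z w h => (Prod.mk.inj h).1
  have h₁ : d + 1 ≤ sigPos Q := by
    have hV : (Q.restrict (LinearMap.range L₁)).PosDef := by
      rintro ⟨_, ⟨⟨a, v⟩, rfl⟩⟩ h0
      have e : Q (L₁ (a, v)) = a ^ 2 + t ^ 2 * B v v := by
        rw [hQa, hL₁, ambForm_apply]
        field_simp
        ring
      rw [QuadraticMap.restrict_apply]
      change 0 < Q (L₁ (a, v))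
      rw [e]
      rcases eq_or_ne v 0 with rfl | hv
      · have ha : a ≠ 0 := by
          rintro rfl
          exact h0 (Subtype.ext (map_zero L₁))
        have := hB0 0
        positivity
      · have := hp v hv
        positivity
    have := le_sigPos_of_posDef Q hV
    rw [LinearMap.finrank_range_of_inj i₁] at this
    simpa [add_comm] using this
  have h₂ : 1 ≤ sigNeg Q := by
    have hV : ((-Q).restrict (LinearMap.range L₂)).PosDef := by
      rintro ⟨_, ⟨a, rfl⟩⟩ h0
      have e : (-Q) (L₂ a) = a ^ 2 := by
        rw [neg_apply, hQa, hL₂, ambForm_apply, map_zero]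
        field_simp
        ring
      rw [QuadraticMap.restrict_apply]
      change 0 < (-Q) (L₂ a)
      rw [e]
      have ha : a ≠ 0 := by
        rintro rfl
        exact h0 (Subtype.ext (map_zero L₂))
      positivity
    have := le_sigNeg_of_negDef Q hV
    rw [LinearMap.finrank_range_of_inj i₂] at this
    simpa using this
  have h₃ := QuadraticForm.sigPos_add_sigNeg_add_radical (Q := Q)
  have h₄ : Module.finrank ℝ (AmbVec d) = d + 2 := by simp; ring
  rw [h₄] at h₃
  change sigPos Q = d + 1 ∧ sigNeg Q = 1
  omega

variable {M : Type*} [TopologicalSpace M] [ChartedSpace (BaseVec d) M]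
  [IsManifold (𝓡 d) ∞ M]

/-- A smooth one-parameter family of symmetric two-tensors and of functions with the initial
values `g` and `f`. Smoothness is required near each point, in some chart. -/
structure IsFamily (S : SmoothMetricMeasureSpace d M) (G : ℝ → TwoTensor (𝓡 d) M)
    (F : ℝ → M → ℝ) : Prop where
  init_g : ∀ x v w, G 0 x v w = S.g.inner x v w
  init_f : ∀ x, F 0 x = S.f x
  symm : ∀ ρ x v w, G ρ x v w = G ρ x w v
  smooth : ∀ x : M, ∃ p : M, ∃ O : Set (BaseVec d), IsOpen O ∧ O ⊆ (extChartAt (𝓡 d) p).target ∧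
    x ∈ (extChartAt (𝓡 d) p).source ∧ extChartAt (𝓡 d) p x ∈ O ∧
    (∀ i j, ContDiffOn ℝ ∞
      (fun z : BaseVec d × ℝ => chartMatrix (𝓡 d) (baseBasis d) (G z.2) p z.1 i j)
      (O ×ˢ Set.univ)) ∧
    ContDiffOn ℝ ∞ (fun z : BaseVec d × ℝ => F z.2 ((extChartAt (𝓡 d) p).symm z.1)) (O ×ˢ Set.univ)

/-- The points where `g_ρ` is a metric and `f_ρ` is positive. -/
def goodSet (G : ℝ → TwoTensor (𝓡 d) M) (F : ℝ → M → ℝ) : Set (M × ℝ) :=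
  {q | (∀ v : BaseVec d, v ≠ 0 → 0 < pairAt (𝓡 d) (G q.2) q.1 v v) ∧ 0 < F q.2 q.1}

/-- The ambient space of a family: it consists of the points `(t, x, ρ)` such that `g_r` is a metric
and `f_r` is positive at `x` for all `r` between `0` and `ρ`. -/
def ambientSpace (G : ℝ → TwoTensor (𝓡 d) M) (F : ℝ → M → ℝ) : MetricMeasureStructure d M where
  space := {p | 0 < p.1 ∧ ∀ s ∈ Set.Icc (0 : ℝ) 1, (p.2.1, s * p.2.2) ∈ goodSet G F}
  g := fun p => ambForm p.1 p.2.2 (G p.2.2 p.2.1)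
  f := fun p => p.1 * F p.2.2 p.2.1

lemma pairAt_ambientSpace (G : ℝ → TwoTensor (𝓡 d) M) (F : ℝ → M → ℝ) (t ρ : ℝ) (x : M) (a : ℝ)
    (v : BaseVec d) (c a' : ℝ) (v' : BaseVec d) (c' : ℝ) :
    pairAt (ambI d) (ambientSpace G F).g (t, x, ρ) (a, v, c) (a', v', c')
      = 2 * ρ * (a * a') + t * (a * c' + a' * c) + t ^ 2 * pairAt (𝓡 d) (G ρ) x v v' :=
  ambForm_apply _ _ _ _ _ _ _ _ _

variable {S : SmoothMetricMeasureSpace d M} {G : ℝ → TwoTensor (𝓡 d) M} {F : ℝ → M → ℝ}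

lemma goodSet_of_mem {t ρ : ℝ} {x : M} (h : (t, x, ρ) ∈ (ambientSpace G F).space) :
    (x, ρ) ∈ goodSet G F := by
  simpa using h.2 1 ⟨zero_le_one, le_rfl⟩

lemma isReduced_ambientSpace : IsReduced (ambientSpace G F) := fun t x ρ _ a v c a' v' c' => by
  rw [pairAt_ambientSpace, pairAt_ambientSpace]
  ring

namespace IsFamily

variable (h : IsFamily S G F)

include h

lemma zero_mem_goodSet (x : M) : (x, 0) ∈ goodSet G F := by
  refine ⟨fun v hv => ?_, ?_⟩
  · rw [pairAt, h.init_g]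
    exact S.g.pos x v hv
  · rw [h.init_f]
    exact S.f_pos x

lemma isOpen_goodSet : IsOpen (goodSet G F) := by
  rw [isOpen_iff_eventually]
  rintro ⟨x₀, ρ₀⟩ ⟨hg, hf⟩
  obtain ⟨p, O, hO, hOt, hx, hxO, hsg, hsf⟩ := h.smooth x₀
  have hφ : ContinuousAt (fun q : M × ℝ => (extChartAt (𝓡 d) p q.1, q.2)) (x₀, ρ₀) :=
    (ContinuousAt.comp (f := Prod.fst) (x := (x₀, ρ₀)) (continuousAt_extChartAt' hx)
      continuousAt_fst).prodMk continuousAt_snd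
  have hOn : O ×ˢ Set.univ ∈ 𝓝 (extChartAt (𝓡 d) p x₀, ρ₀) :=
    (hO.prod isOpen_univ).mem_nhds ⟨hxO, trivial⟩
  have hnear : ∀ᶠ q : M × ℝ in 𝓝 (x₀, ρ₀), q.1 ∈ (extChartAt (𝓡 d) p).source
      ∧ extChartAt (𝓡 d) p q.1 ∈ O :=
    ((continuousAt_fst (p := (x₀, ρ₀))).eventually ((isOpen_extChartAt_source p).mem_nhds hx)).and
      ((hφ.eventually hOn).mono fun q hq => hq.1)
  have hsymm : ∀ q : M × ℝ, q.1 ∈ (extChartAt (𝓡 d) p).source →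
      (extChartAt (𝓡 d) p).symm (extChartAt (𝓡 d) p q.1) = q.1 := fun q hq =>
    (extChartAt (𝓡 d) p).left_inv hq
  -- positivity of the density
  have e1 : ∀ᶠ q : M × ℝ in 𝓝 (x₀, ρ₀), 0 < F q.2 q.1 := by
    have hc := ContinuousAt.comp (f := fun q : M × ℝ => (extChartAt (𝓡 d) p q.1, q.2))
      (hsf.contDiffAt hOn).continuousAt hφ
    have := hc.eventually (lt_mem_nhds (a := 0) (by
      simp only [Function.comp_apply, hsymm (x₀, ρ₀) hx]; exact hf))
    filter_upwards [this, hnear] with q hq hn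
    simpa only [Function.comp_apply, hsymm q hn.1] using hq
  -- positivity of the metric on the unit sphere
  set m : BaseVec d × ℝ → BaseVec d → ℝ := fun z v => ∑ i, ∑ j, (baseBasis d).repr v i
    * (baseBasis d).repr v j * chartMatrix (𝓡 d) (baseBasis d) (G z.2) p z.1 i j with hm
  have hmG : ∀ z : BaseVec d × ℝ, ∀ v, m z v = pairAt (𝓡 d) (G z.2)
      ((extChartAt (𝓡 d) p).symm z.1) (symmDeriv (𝓡 d) p z.1 v) (symmDeriv (𝓡 d) p z.1 v) := by
    intro z v
    have := LinearMap.sum_repr_mul_repr_mul (baseBasis d) (baseBasis d)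
      (B := (bilinAt (𝓡 d) (G z.2) ((extChartAt (𝓡 d) p).symm z.1)).compl₁₂
        (symmDeriv (𝓡 d) p z.1).toLinearMap (symmDeriv (𝓡 d) p z.1).toLinearMap) v v
    refine Eq.trans ?_ this
    rw [Finsupp.sum_fintype _ _ (by simp), hm]
    refine Finset.sum_congr rfl fun i _ => ?_
    rw [Finsupp.sum_fintype _ _ (by simp)]
    exact Finset.sum_congr rfl fun j _ => mul_assoc _ _ _
  have hmc : ∀ v, ContinuousAt (fun w : (M × ℝ) × BaseVec d =>
      m (extChartAt (𝓡 d) p w.1.1, w.1.2) w.2) ((x₀, ρ₀), v) := by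
    intro v
    refine tendsto_finsetSum _ fun i _ => tendsto_finsetSum _ fun j _ => ?_
    have hr : ∀ i, Continuous fun v : BaseVec d => (baseBasis d).repr v i := fun i =>
      (LinearMap.toContinuousLinearMap ((baseBasis d).coord i)).continuous
    refine Filter.Tendsto.mul (Filter.Tendsto.mul ?_ ?_) ?_
    · exact ((hr i).comp continuous_snd).continuousAt
    · exact ((hr j).comp continuous_snd).continuousAt
    · have h1 := ContinuousAt.comp (f := fun q : M × ℝ => (extChartAt (𝓡 d) p q.1, q.2))
        ((hsg i j).contDiffAt hOn).continuousAt hφ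
      exact ContinuousAt.comp (f := fun w : (M × ℝ) × BaseVec d => w.1) (x := ((x₀, ρ₀), v)) h1
        continuousAt_fst
  have hbij : ∀ q : M × ℝ, q.1 ∈ (extChartAt (𝓡 d) p).source →
      Function.Bijective (symmDeriv (𝓡 d) p (extChartAt (𝓡 d) p q.1)) := fun q hq => by
    have := symmDeriv_surjective (𝓡 d) p ((extChartAt (𝓡 d) p).map_source hq)
    exact ⟨((symmDeriv (𝓡 d) p (extChartAt (𝓡 d) p q.1)) : BaseVec d →ₗ[ℝ] BaseVec d)
      |>.injective_iff_surjective.2 this, this⟩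
  have e2 : ∀ᶠ q : M × ℝ in 𝓝 (x₀, ρ₀), ∀ v ∈ Metric.sphere (0 : BaseVec d) 1,
      0 < m (extChartAt (𝓡 d) p q.1, q.2) v := by
    refine IsCompact.eventually_forall_of_forall_eventually (isCompact_sphere _ _) fun v hv => ?_
    refine (hmc v).eventually (lt_mem_nhds (a := 0) ?_)
    dsimp only
    rw [hmG]
    dsimp only
    rw [hsymm (x₀, ρ₀) hx]
    refine hg _ fun h0 => ?_
    have := (hbij (x₀, ρ₀) hx).1 (h0.trans (map_zero _).symm)
    rw [this] at hv
    simp at hv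
  filter_upwards [e1, e2, hnear] with q h1 h2 h3
  refine ⟨fun v hv => ?_, h1⟩
  obtain ⟨u, rfl⟩ := (hbij q h3.1).2 v
  have hu : u ≠ 0 := by rintro rfl; exact hv (map_zero _)
  have h4 := h2 (‖u‖⁻¹ • u) (by simp [norm_smul, hu])
  rw [hmG, map_smul, pairAt_smul_left, pairAt_smul_right] at h4
  dsimp only at h4
  rw [hsymm q h3.1] at h4
  have h5 : 0 < ‖u‖⁻¹ := inv_pos.2 (norm_pos_iff.2 hu)
  exact (pos_iff_pos_of_mul_pos (by rwa [← mul_assoc] at h4)).1 (mul_pos h5 h5)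

lemma isOpen_space : IsOpen (ambientSpace G F).space := by
  have h1 : IsOpen {p : ℝ × M × ℝ | 0 < p.1} := isOpen_lt continuous_const continuous_fst
  refine h1.inter (t := {p : ℝ × M × ℝ | ∀ s ∈ Set.Icc (0 : ℝ) 1, (p.2.1, s * p.2.2) ∈ goodSet G F})
    (isOpen_iff_eventually.2 fun p hp => ?_)
  refine IsCompact.eventually_forall_of_forall_eventually isCompact_Icc fun s hs => ?_
  have hc : Continuous fun z : (ℝ × M × ℝ) × ℝ => (z.1.2.1, z.2 * z.1.2.2) := by fun_prop
  exact hc.continuousAt.eventually (h.isOpen_goodSet.mem_nhds (hp s hs))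

lemma contMDiff_ambientSpace :
    ContMDiff (ambI d) ((ambI d).prod 𝓘(ℝ, AmbVec d →L[ℝ] AmbVec d →L[ℝ] ℝ)) ∞
      (tensorSection (ambI d) (ambientSpace G F).g) ∧
    ContMDiff (ambI d) 𝓘(ℝ, ℝ) ∞ (ambientSpace G F).f := by
  have key : ∀ q : ℝ × M × ℝ,
      ContMDiffAt (ambI d) ((ambI d).prod 𝓘(ℝ, AmbVec d →L[ℝ] AmbVec d →L[ℝ] ℝ)) ∞
        (tensorSection (ambI d) (ambientSpace G F).g) q ∧
      ContMDiffAt (ambI d) 𝓘(ℝ, ℝ) ∞ (ambientSpace G F).f q := by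
    rintro ⟨t, x, ρ⟩
    obtain ⟨p, O, hO, hOt, hx, hxO, hsg, hsf⟩ := h.smooth x
    set e := extChartAt (ambI d) ((1, p, 0) : ℝ × M × ℝ) with he
    have hsrc : ((t, x, ρ) : ℝ × M × ℝ) ∈ e.source := (mem_source_amb 1 0 p _).2 hx
    set Ω : Set (AmbVec d) := {z | z.2.1 ∈ O} with hΩ
    have hΩo : IsOpen Ω := hO.preimage (by fun_prop)
    set N : Set (ℝ × M × ℝ) := e.source ∩ e ⁻¹' Ω with hN
    have hNo : IsOpen N := (continuousOn_extChartAt _).isOpen_inter_preimage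
      (isOpen_extChartAt_source _) hΩo
    have hqN : ((t, x, ρ) : ℝ × M × ℝ) ∈ N := ⟨hsrc, hxO⟩
    have hNs : N ∩ e.source = N := Set.inter_eq_left.2 fun _ hz => hz.1
    have hmap : ∀ z : AmbVec d, z ∈ e.target → e.symm z ∈ N → z.2.1 ∈ O := fun z hz hzN => by
      have := hzN.2
      rwa [Set.mem_preimage, e.right_inv hz] at this
    have h21 : ContDiff ℝ ∞ fun z : AmbVec d => (z.2.1, z.2.2) := by fun_prop
    refine ⟨?_, ?_⟩
    · have h1 : ContMDiffOn (ambI d) ((ambI d).prod 𝓘(ℝ, AmbVec d →L[ℝ] AmbVec d →L[ℝ] ℝ)) ∞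
          (tensorSection (ambI d) (ambientSpace G F).g) (N ∩ e.source) := by
        refine (contMDiffOn_tensor_iff (ambI d) (ambBasis d) (ambientSpace G F).g (1, p, 0) N).2
          fun I J => ?_
        have hterm : ContDiffOn ℝ ∞ (fun z : AmbVec d => ∑ i, ∑ j,
            (baseBasis d).repr (ambBasis d I).2.1 i * (baseBasis d).repr (ambBasis d J).2.1 j
              * chartMatrix (𝓡 d) (baseBasis d) (G z.2.2) p z.2.1 i j)
            {z | z ∈ e.target ∧ e.symm z ∈ N} :=
          ContDiffOn.sum fun i _ => ContDiffOn.sum fun j _ => contDiffOn_const.mul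
            ((hsg i j).comp h21.contDiffOn fun z hz => ⟨hmap z hz.1 hz.2, trivial⟩)
        have hall : ContDiffOn ℝ ∞ (fun z : AmbVec d =>
            2 * z.2.2 * ((ambBasis d I).1 * (ambBasis d J).1)
            + z.1 * ((ambBasis d I).1 * (ambBasis d J).2.2 + (ambBasis d J).1 * (ambBasis d I).2.2)
            + z.1 ^ 2 * ∑ i, ∑ j,
            (baseBasis d).repr (ambBasis d I).2.1 i * (baseBasis d).repr (ambBasis d J).2.1 j
              * chartMatrix (𝓡 d) (baseBasis d) (G z.2.2) p z.2.1 i j)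
            {z | z ∈ e.target ∧ e.symm z ∈ N} := by
          refine ContDiffOn.add ?_ (ContDiffOn.mul ?_ hterm)
          · exact ContDiff.contDiffOn (by fun_prop)
          · exact ContDiff.contDiffOn (by fun_prop)
        refine hall.congr ?_
        rintro ⟨t', y, ρ'⟩ hz
        have hy : y ∈ baseOpen p := (mem_target_amb 1 0 p _).1 hz.1
        rw [chartMatrix_amb _ hy, pairAt_ambientSpace]
        congr 2
        have := LinearMap.sum_repr_mul_repr_mul (baseBasis d) (baseBasis d)
          (B := (bilinAt (𝓡 d) (G ρ') ((extChartAt (𝓡 d) p).symm y)).compl₁₂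
            (symmDeriv (𝓡 d) p y).toLinearMap (symmDeriv (𝓡 d) p y).toLinearMap)
            (ambBasis d I).2.1 (ambBasis d J).2.1
        refine this.symm.trans ?_
        rw [Finsupp.sum_fintype _ _ (by simp)]
        refine Finset.sum_congr rfl fun i _ => ?_
        rw [Finsupp.sum_fintype _ _ (by simp)]
        exact Finset.sum_congr rfl fun j _ => (mul_assoc _ _ _).symm
      rw [hNs] at h1
      exact h1.contMDiffAt (hNo.mem_nhds hqN)
    · have h1 : ContDiffOn ℝ ∞ (fun z : AmbVec d => z.1 * F z.2.2 ((extChartAt (𝓡 d) p).symm z.2.1))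
          Ω := ContDiffOn.mul (ContDiff.contDiffOn (by fun_prop))
            (hsf.comp h21.contDiffOn fun z hz => ⟨hz, trivial⟩)
      have h0 : ContMDiffOn (ambI d) 𝓘(ℝ, AmbVec d) ∞ e N := fun z hz =>
        (contMDiffAt_extChartAt' (by rw [← extChartAt_source (ambI d)]; exact hz.1)).contMDiffWithinAt
      have h2 := h1.contMDiffOn.comp h0 (fun z hz => hz.2)
      refine (h2.congr ?_).contMDiffAt (hNo.mem_nhds hqN)
      rintro ⟨t', x', ρ'⟩ hz
      have hx' : x' ∈ (extChartAt (𝓡 d) p).source := (mem_source_amb 1 0 p _).1 hz.1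
      change t' * F ρ' x' = t' * F ρ' ((extChartAt (𝓡 d) p).symm (extChartAt (𝓡 d) p x'))
      rw [(extChartAt (𝓡 d) p).left_inv hx']
  exact ⟨fun q => (key q).1, fun q => (key q).2⟩

theorem isPreAmbient : IsPreAmbient S (ambientSpace G F) where
  isOpen_space := h.isOpen_space
  pos_of_mem p hp := hp.1
  mem_zero t ht x := ⟨ht, fun s _ => by simpa using h.zero_mem_goodSet x⟩
  dilation_mem s hs t x ρ hp := ⟨mul_pos hs hp.1, hp.2⟩
  contMDiffOn_g := h.contMDiff_ambientSpace.1.contMDiffOn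
  signature_g p hp := by
    obtain ⟨t, x, ρ⟩ := p
    exact hasSignature_ambForm hp.1 (h.symm ρ x) (goodSet_of_mem hp).1
  contMDiffOn_f := h.contMDiff_ambientSpace.2.contMDiffOn
  homogeneous_g s hs t x ρ hp a v c a' v' c' := by
    have e1 := pairAt_ambientSpace G F (s * t) ρ x (s * a) v c (s * a') v' c'
    have e2 := pairAt_ambientSpace G F t ρ x a v c a' v' c'
    refine e1.trans ?_
    rw [show evalAt (ambientSpace G F).g t x ρ a v c a' v' c' = _ from e2]
    ring
  homogeneous_f s hs t x ρ hp := mul_assoc _ _ _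
  initial_g t ht x a v a' v' := by
    refine (pairAt_ambientSpace G F t 0 x a v 0 a' v' 0).trans ?_
    have e : pairAt (𝓡 d) (G 0) x v v' = S.g.inner x v v' := h.init_g x v v'
    rw [e]
    ring
  initial_f t ht x := by
    change t * F 0 x = _
    rw [h.init_f]

lemma mem_regular {p : ℝ × M × ℝ} (hp : p ∈ (ambientSpace G F).space) :
    p ∈ (ambientSpace G F).regular :=
  ⟨hp, (mul_pos hp.1 (goodSet_of_mem (t := p.1) (x := p.2.1) (ρ := p.2.2) hp).2).ne'⟩

omit h in
lemma mem_of_mem_segment {t r ρ : ℝ} {x : M} (hp : (t, x, ρ) ∈ (ambientSpace G F).space) {s : ℝ}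
    (hs : s ∈ Set.Icc (0 : ℝ) 1) (hr : r = s * ρ) : (t, x, r) ∈ (ambientSpace G F).space :=
  ⟨hp.1, fun s' hs' => by
    have := hp.2 (s' * s) ⟨mul_nonneg hs'.1 hs.1, mul_le_one₀ hs'.2 hs.1 hs.2⟩
    rwa [mul_assoc, ← hr] at this⟩

omit h in
lemma ordConnected (t : ℝ) (x : M) : Set.OrdConnected {ρ : ℝ | (t, x, ρ) ∈ (ambientSpace G F).space} := by
  refine Set.ordConnected_iff.2 fun r₁ h₁ r₂ h₂ _ r hr => ?_
  -- the set is star-shaped about `0`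
  rcases le_or_gt 0 r with h0 | h0
  · rcases h0.eq_or_lt with rfl | h0
    · exact mem_of_mem_segment h₁ ⟨le_rfl, zero_le_one⟩ (zero_mul _).symm
    · have : 0 < r₂ := h0.trans_le hr.2
      exact mem_of_mem_segment h₂ (s := r / r₂) ⟨by positivity, (div_le_one this).2 hr.2⟩
        (div_mul_cancel₀ _ this.ne').symm
  · have : r₁ < 0 := hr.1.trans_lt h0
    exact mem_of_mem_segment h₁ (s := r / r₁)
      ⟨div_nonneg_of_nonpos h0.le this.le, (div_le_one_of_neg this).2 hr.1⟩
      (div_mul_cancel₀ _ this.ne).symm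

/-- The Christoffel symbols responsible for the coordinate lines being geodesics vanish. -/
lemma christoffel_eq_zero {t ρ : ℝ} {x : M} (hp : (t, x, ρ) ∈ (ambientSpace G F).space)
    (k : AmbIdx d) {I : AmbIdx d} (hI : I = .inl () ∨ I = .inr (.inr ())) :
    christoffel (ambBasis d) (chartMatrix (ambI d) (ambBasis d) (ambientSpace G F).g (t, x, ρ)) k I I
      (extChartAt (ambI d) (t, x, ρ) (t, x, ρ)) = 0 := by
  have hA := h.isPreAmbient
  have hF := isNormalFrame hA isReduced_ambientSpace x
  have e := (represents_ambMat hA isReduced_ambientSpace x).chr (b := ambBasis d) (ambMat_mul_ambInv hF.ht hF.hgi) k I I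
    (self_mem_ambOpen hA (h.mem_regular hp))
  rw [chr_ambMat hF] at e
  refine Eq.trans e.symm ?_
  rcases hI with rfl | rfl <;> rcases k with _ | k | _ <;> exact map_zero _

end IsFamily

/-- A coordinate line traversed with constant speed is a geodesic if the corresponding Christoffel
symbols vanish. -/
lemma isGeodesicOn_of_christoffel {V H : Type*} [NormedAddCommGroup V] [NormedSpace ℝ V]
    [TopologicalSpace H] {I : ModelWithCorners ℝ V H} {N : Type*} [TopologicalSpace N]
    [ChartedSpace H N] {ι : Type*} [Fintype ι] [DecidableEq ι] {b : Module.Basis ι ℝ V}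
    {h : TwoTensor I N} {γ : ℝ → N} {J : Set ℝ} {i : ι} {c : ℝ}
    (hγ : ContMDiffOn 𝓘(ℝ, ℝ) I ∞ γ J)
    (hv : ∀ s r, HasDerivAt (fun r => extChartAt I (γ s) (γ r)) (c • b i) r)
    (hc : ∀ s ∈ J, ∀ k,
      christoffel b (chartMatrix I b h (γ s)) k i i (extChartAt I (γ s) (γ s)) = 0) :
    IsGeodesicOn I b h γ J := by
  refine ⟨hγ, fun s hs k => ?_⟩
  have h1 : deriv (fun r => extChartAt I (γ s) (γ r)) = fun _ => c • b i :=
    funext fun r => (hv s r).deriv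
  rw [h1]
  simp only [deriv_const, map_zero, map_smul, Module.Basis.repr_self, Finsupp.smul_single, smul_eq_mul,
    mul_one, Finsupp.single_apply, mul_ite, mul_zero, ite_mul, zero_mul, Finsupp.zero_apply, zero_add,
    Finset.sum_ite_eq, Finset.mem_univ, if_true, hc s hs k]

namespace IsFamily

variable (h : IsFamily S G F)

include h

theorem isNormal : IsNormal S (ambientSpace G F) where
  interval t ht x := by
    refine ⟨?_, ordConnected t x, h.isPreAmbient.mem_zero t ht x⟩
    exact h.isOpen_space.preimage (by fun_prop : Continuous fun ρ : ℝ => ((t, x, ρ) : ℝ × M × ℝ))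
  geodesic t ht x := by
    refine isGeodesicOn_of_christoffel (i := .inr (.inr ())) (c := 1) ?_ (fun s r => ?_)
      fun ρ hρ k => h.christoffel_eq_zero hρ k (.inr rfl)
    · exact (contMDiff_const.prodMk (contMDiff_const.prodMk contMDiff_id)).contMDiffOn
    · rw [one_smul, ambBasis_rad]
      have : HasDerivAt (fun r : ℝ => ((t, extChartAt (𝓡 d) x x, r) : AmbVec d)) (0, 0, 1) r :=
        (hasDerivAt_const _ _).prodMk ((hasDerivAt_const _ _).prodMk (hasDerivAt_id _))
      exact this
  initial t ht x a v c a' v' c' := by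
    refine (pairAt_ambientSpace G F t 0 x a v c a' v' c').trans ?_
    have e : pairAt (𝓡 d) (G 0) x v v' = S.g.inner x v v' := h.init_g x v v'
    rw [e]
    ring

theorem isStraight : IsStraight (ambientSpace G F) := by
  intro t x ρ hp
  refine isGeodesicOn_of_christoffel (i := .inl ()) (c := t) ?_ (fun s r => ?_)
    fun s hs k => h.christoffel_eq_zero (h.isPreAmbient.dilation_mem s hs t x ρ hp) k (.inl rfl)
  · have : ContMDiff 𝓘(ℝ, ℝ) 𝓘(ℝ, ℝ) ∞ fun s : ℝ => s * t :=
      (contDiff_id.mul contDiff_const).contMDiff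
    exact (this.prodMk (contMDiff_const.prodMk contMDiff_const)).contMDiffOn
  · have e : t • ambBasis d (.inl ()) = (t, 0, 0) := by rw [ambBasis_zero]; simp
    rw [e]
    have h1 : HasDerivAt (fun r : ℝ => r * t) t r := by simpa using (hasDerivAt_id r).mul_const t
    have : HasDerivAt (fun r : ℝ => ((r * t, extChartAt (𝓡 d) x x, ρ) : AmbVec d)) (t, 0, 0) r :=
      h1.prodMk ((hasDerivAt_const _ _).prodMk (hasDerivAt_const _ _))
    exact this

theorem hasStraightNormalForm : HasStraightNormalForm S (ambientSpace G F) :=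
  ⟨G, F, h.init_g, h.init_f, fun t x ρ hp => ⟨h.symm ρ x, (goodSet_of_mem hp).1,
    fun a v c a' v' c' => pairAt_ambientSpace G F t ρ x a v c a' v' c', rfl⟩⟩

end IsFamily

end AmbientSpace

/-! ### Existence -/

section Existence

open TopologicalSpace smoothFun PowerSeries

section Expansion

variable {d : ℕ} {U : Opens (BaseVec d)} {Ω : Opens (AmbVec d)} {t : ℝ}
  (h : ∀ y ∈ U, ((t, y, 0) : AmbVec d) ∈ Ω)

/-- The Taylor coefficients of a function are determined by any asymptotic expansion. -/
lemma eval_coeff_of_expansion {y : BaseVec d} (hy : y ∈ U) (F : smoothFun Ω) {c : ℕ → ℝ}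
    (hc : ∀ N, (fun ρ : ℝ => val F (t, y, ρ) - ∑ k ∈ Finset.range N, ρ ^ k * c k)
      =O[𝓝 0] fun ρ => ρ ^ N) (k : ℕ) :
    eval y hy (coeff k (ambTaylor t h F)) = c k := by
  set G : smoothFun Ω := F - ∑ j ∈ Finset.range (k + 1), coordR Ω ^ j * algebraMap ℝ _ (c j) with hG
  have h1 : (fun ρ : ℝ => val G (t, y, ρ)) =O[𝓝 0] fun ρ => ρ ^ (k + 1) := by
    refine Asymptotics.IsBigO.congr' (hc (k + 1)) ?_ Filter.EventuallyEq.rfl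
    filter_upwards [eventually_rad_mem (h y hy)] with r hr
    rw [← eval_apply hr, ← eval_apply hr, hG, map_sub, map_sum]
    congr 1
  have h2 := (isBigO_iff_ambTaylor h hy G (k + 1)).1 h1 k (Nat.lt_succ_self k)
  have h3 : coeff k (ambTaylor t h (∑ j ∈ Finset.range (k + 1), coordR Ω ^ j
      * algebraMap ℝ (smoothFun Ω) (c j))) = algebraMap ℝ (smoothFun U) (c k) := by
    simp only [map_sum, map_mul, map_pow, AlgHom.commutes, (isExpansion_ambTaylor h).map_ρ]
    rw [Finset.sum_eq_single k]
    · rw [coeff_X_pow_mul', if_pos le_rfl, Nat.sub_self, PowerSeries.algebraMap_apply, coeff_zero_C]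
    · intro j hj hjk
      have : j ≤ k := Nat.lt_succ_iff.1 (Finset.mem_range.1 hj)
      rw [coeff_X_pow_mul', if_pos this, PowerSeries.algebraMap_apply, coeff_C, if_neg (by omega)]
    · simp
  rw [hG, map_sub, map_sub, h3, map_sub, AlgHom.commutes, sub_eq_zero] at h2
  exact h2

end Expansion

variable {d : ℕ} {M : Type*} [TopologicalSpace M] [ChartedSpace (BaseVec d) M]
  [IsManifold (𝓡 d) ∞ M] (S : SmoothMetricMeasureSpace d M)

/-- The coefficients of the formal solution in a chart, as vectors. -/
def coefVec (p : M) (k : ℕ) (y : BaseVec d) : (Fin d → Fin d → ℝ) × ℝ :=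
  (fun i j => val (coeff k ((baseFormal S p).1 i j)) y, val (coeff k (baseFormal S p).2) y)

/-- Cutoff scales `1 / l k` that serve near every point of the manifold: the Borel sum of the formal
solution is smooth there, and it has the right expansion. By the lower bound on `l k`, the terms
with `k > 1 / |ρ|` vanish, so that the sum is finite; for `ρ = 0`, where `|ρ|⁻¹ = 0` in Lean, it is
the term `k = 0`. -/
def IsGoodScale (l : ℕ → ℝ) : Prop :=
  (∀ k : ℕ, (k + 1 : ℝ) ≤ l k) ∧ ∀ x : M, ∃ p : M, ∃ O : Set (BaseVec d), IsOpen O ∧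
    O ⊆ (extChartAt (𝓡 d) p).target ∧ x ∈ (extChartAt (𝓡 d) p).source ∧ extChartAt (𝓡 d) p x ∈ O ∧
    (∀ y ∈ O, ∀ᶠ k in Filter.atTop, 2 ^ k * ‖coefVec S p k y‖ ≤ l k) ∧
    ContDiffOn ℝ ∞ (fun z : BaseVec d × ℝ => ∑ k ∈ Finset.range (⌈|z.2|⁻¹⌉₊ + 1),
      borelCoeff l k z.2 • coefVec S p k z.1) (O ×ˢ Set.univ)

/-- Countably many of the neighborhoods provided by the local Borel lemma cover the manifold. -/
lemma exists_isGoodScale [SecondCountableTopology M] : ∃ l : ℕ → ℝ, IsGoodScale S l := by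
  have hsm : ∀ p k, ContDiffOn ℝ ∞ (coefVec S p k) (baseOpen (d := d) p) := fun p k =>
    (contDiffOn_pi.2 fun i => contDiffOn_pi.2 fun j => contDiffOn_val _).prodMk (contDiffOn_val _)
  choose O hO hxO hOt Λ hΛ hs using fun p : M =>
    exists_borel_contDiffOn (coefVec S p) (isOpen_extChartAt_target p) (hsm p) (self_mem_baseOpen p)
  have hN : ∀ p : M, (extChartAt (𝓡 d) p).source ∩ extChartAt (𝓡 d) p ⁻¹' O p ∈ 𝓝 p := fun p =>
    ((continuousOn_extChartAt p).isOpen_inter_preimage (isOpen_extChartAt_source p) (hO p)).mem_nhds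
      ⟨mem_extChartAt_source p, hxO p⟩
  obtain ⟨s, hsc, hcov⟩ := TopologicalSpace.countable_cover_nhds hN
  obtain ⟨l, hl, hl'⟩ := exists_eventually_ge hsc Λ
  refine ⟨l, hl, fun x => ?_⟩
  have hx : x ∈ ⋃ p ∈ s, (extChartAt (𝓡 d) p).source ∩ extChartAt (𝓡 d) p ⁻¹' O p := by
    rw [hcov]; trivial
  obtain ⟨p, hp, hxp⟩ := Set.mem_iUnion₂.1 hx
  exact ⟨p, O p, hO p, hOt p, hxp.1, hxp.2, fun y hy =>
    (hl' p hp).mono fun k hk => (hΛ p k y hy).trans hk, hs p l hl (hl' p hp)⟩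

/-- The Borel sum of the tensors of the formal solution. -/
def borelG (l : ℕ → ℝ) (ρ : ℝ) : TwoTensor (𝓡 d) M := fun x =>
  (∑ k ∈ Finset.range (⌈|ρ|⁻¹⌉₊ + 1), borelCoeff l k ρ • bilinOfMatrix
    (((baseFormal S x).1.map (coeff k)).map (eval _ (self_mem_baseOpen x))) :
    BaseVec d →L[ℝ] BaseVec d →L[ℝ] ℝ)

/-- The Borel sum of the functions of the formal solution. -/
def borelF (l : ℕ → ℝ) (ρ : ℝ) (x : M) : ℝ :=
  ∑ k ∈ Finset.range (⌈|ρ|⁻¹⌉₊ + 1), borelCoeff l k ρ * coefF S k x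

variable {S} {l : ℕ → ℝ}

lemma pairAt_borelG (ρ : ℝ) (x : M) (v w : BaseVec d) :
    pairAt (𝓡 d) (borelG S l ρ) x v w = ∑ k ∈ Finset.range (⌈|ρ|⁻¹⌉₊ + 1),
      borelCoeff l k ρ * pairAt (𝓡 d) (coefG S k) x v w := by
  have : pairAt (𝓡 d) (borelG S l ρ) x v w = (∑ k ∈ Finset.range (⌈|ρ|⁻¹⌉₊ + 1),
    borelCoeff l k ρ • bilinOfMatrix
    (((baseFormal S x).1.map (coeff k)).map (eval _ (self_mem_baseOpen x))) :
    BaseVec d →L[ℝ] BaseVec d →L[ℝ] ℝ) v w := rfl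
  rw [this, sum_apply, sum_apply]
  rfl

lemma pairAt_coefG_symm (k : ℕ) (x : M) (v w : BaseVec d) :
    pairAt (𝓡 d) (coefG S k) x v w = pairAt (𝓡 d) (coefG S k) x w v := by
  rw [pairAt_expand (𝓡 d) (baseBasis d), pairAt_expand (𝓡 d) (baseBasis d) _ x w v, Finset.sum_comm]
  refine Finset.sum_congr rfl fun i _ => Finset.sum_congr rfl fun j _ => ?_
  have e : ∀ i j, pairAt (𝓡 d) (coefG S k) x (baseBasis d i) (baseBasis d j)
      = eval (U := baseOpen (d := d) x) _ (self_mem_baseOpen x) (coeff k ((baseFormal S x).1 i j)) :=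
    fun i j => bilinOfMatrix_basis _ i j
  have h : (baseFormal S x).1 i j = (baseFormal S x).1 j i :=
    ((formal_isSymm (isInitial_base S x)).apply i j).symm
  rw [e, e, h]
  ring

lemma pairAt_coefG_zero (x : M) (v w : BaseVec d) :
    pairAt (𝓡 d) (coefG S 0) x v w = S.g.inner x v w := by
  have h0 : pairAt (𝓡 d) S.g.inner x v w = S.g.inner x v w := rfl
  rw [← h0, pairAt_expand (𝓡 d) (baseBasis d), pairAt_expand (𝓡 d) (baseBasis d) S.g.inner]
  refine Finset.sum_congr rfl fun i _ => Finset.sum_congr rfl fun j _ => ?_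
  congr 1
  rw [← chartMatrix_self (𝓡 d) (baseBasis d) (coefG S 0), chartMatrix_coefG S x (self_mem_baseOpen x),
    ← chartMatrix_self (𝓡 d) (baseBasis d) S.g.inner, baseFormal, coeff_zero_formal.1]
  rfl

lemma coefF_zero (x : M) : coefF S 0 x = S.f x := by
  rw [coefF, baseFormal, coeff_zero_formal.2, eval_baseF, extChartAt_to_inv]

lemma chartMatrix_borelG (ρ : ℝ) (p : M) {y : BaseVec d} (hy : y ∈ baseOpen p) (i j : Fin d) :
    chartMatrix (𝓡 d) (baseBasis d) (borelG S l ρ) p y i j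
      = ∑ k ∈ Finset.range (⌈|ρ|⁻¹⌉₊ + 1), borelCoeff l k ρ * (coefVec S p k y).1 i j := by
  rw [chartMatrix_eq, pairAt_borelG]
  refine Finset.sum_congr rfl fun k _ => ?_
  congr 1
  rw [← chartMatrix_eq, chartMatrix_coefG S p hy]
  exact eval_apply hy _

lemma borelF_symm (ρ : ℝ) (p : M) {y : BaseVec d} (hy : y ∈ baseOpen p) :
    borelF S l ρ ((extChartAt (𝓡 d) p).symm y)
      = ∑ k ∈ Finset.range (⌈|ρ|⁻¹⌉₊ + 1), borelCoeff l k ρ * (coefVec S p k y).2 :=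
  Finset.sum_congr rfl fun k _ => by rw [coefF_symm S p hy, eval_apply]; rfl

lemma sum_borelCoeff_zero (a : ℕ → ℝ) :
    ∑ k ∈ Finset.range (⌈|(0 : ℝ)|⁻¹⌉₊ + 1), borelCoeff l k 0 * a k = a 0 := by
  simp [borelCoeff_zero]

lemma IsGoodScale.isFamily (hl : IsGoodScale S l) : IsFamily S (borelG S l) (borelF S l) where
  init_g x v w := by
    refine (pairAt_borelG 0 x v w).trans ?_
    rw [sum_borelCoeff_zero fun k => pairAt (𝓡 d) (coefG S k) x v w]
    exact pairAt_coefG_zero x v w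
  init_f x := by
    rw [borelF, sum_borelCoeff_zero fun k => coefF S k x, coefF_zero]
  symm ρ x v w := by
    refine (pairAt_borelG ρ x v w).trans (Eq.trans ?_ (pairAt_borelG ρ x w v).symm)
    exact Finset.sum_congr rfl fun k _ =>
      congrArg (borelCoeff l k ρ * ·) (pairAt_coefG_symm k x v w)
  smooth x := by
    obtain ⟨p, O, hO, hOt, hx, hxO, _, hs⟩ := hl.2 x
    refine ⟨p, O, hO, hOt, hx, hxO, fun i j => ?_, ?_⟩
    · refine (contDiffOn_pi.1 (contDiffOn_pi.1 hs.fst i) j).congr fun z hz => ?_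
      rw [chartMatrix_borelG z.2 p (hOt hz.1)]
      simp only [Prod.fst_sum, Prod.smul_fst, Finset.sum_apply, Pi.smul_apply, smul_eq_mul]
    · refine hs.snd.congr fun z hz => ?_
      rw [borelF_symm z.2 p (hOt hz.1)]
      simp only [Prod.snd_sum, Prod.smul_snd, smul_eq_mul]

/-- The Borel sum has the tensors and functions of the formal solution as expansion coefficients. -/
lemma IsGoodScale.expansion (hl : IsGoodScale S l) (x : M) (N : ℕ) :
    (∀ v w, (fun ρ : ℝ => pairAt (𝓡 d) (borelG S l ρ) x v w
      - ∑ k ∈ Finset.range N, ρ ^ k * pairAt (𝓡 d) (coefG S k) x v w) =O[𝓝 0] fun ρ => ρ ^ N) ∧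
    (fun ρ : ℝ => borelF S l ρ x - ∑ k ∈ Finset.range N, ρ ^ k * coefF S k x)
      =O[𝓝 0] fun ρ => ρ ^ N := by
  obtain ⟨p, O, hO, hOt, hx, hxO, hb, _⟩ := hl.2 x
  set y := extChartAt (𝓡 d) p x with hy
  have hyt : y ∈ baseOpen p := hOt hxO
  have hyx : (extChartAt (𝓡 d) p).symm y = x := (extChartAt (𝓡 d) p).left_inv hx
  have h1 := Asymptotics.isBigO_prod_left.1 (borel_expansion hl.1 (hb y hxO) N)
  refine ⟨fun v w => ?_, ?_⟩
  · obtain ⟨v, rfl⟩ := symmDeriv_surjective (𝓡 d) p hyt v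
    obtain ⟨w, rfl⟩ := symmDeriv_surjective (𝓡 d) p hyt w
    have e : ∀ h : TwoTensor (𝓡 d) M, pairAt (𝓡 d) h x (symmDeriv (𝓡 d) p y v)
        (symmDeriv (𝓡 d) p y w) = ∑ i, ∑ j, (baseBasis d).repr v i * (baseBasis d).repr w j
          * chartMatrix (𝓡 d) (baseBasis d) h p y i j := by
      intro h
      have := LinearMap.sum_repr_mul_repr_mul (baseBasis d) (baseBasis d)
        (B := (bilinAt (𝓡 d) h ((extChartAt (𝓡 d) p).symm y)).compl₁₂
          (symmDeriv (𝓡 d) p y).toLinearMap (symmDeriv (𝓡 d) p y).toLinearMap) v w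
      refine (pairAt_congr (𝓡 d) h hyx.symm rfl rfl).trans (this.symm.trans ?_)
      rw [Finsupp.sum_fintype _ _ (by simp)]
      refine Finset.sum_congr rfl fun i _ => ?_
      rw [Finsupp.sum_fintype _ _ (by simp)]
      exact Finset.sum_congr rfl fun j _ => (mul_assoc _ _ _).symm
    have h2 : (fun ρ : ℝ => ∑ i, ∑ j, (baseBasis d).repr v i * (baseBasis d).repr w j *
        (chartMatrix (𝓡 d) (baseBasis d) (borelG S l ρ) p y i j - ∑ k ∈ Finset.range N,
          ρ ^ k * chartMatrix (𝓡 d) (baseBasis d) (coefG S k) p y i j))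
        =O[𝓝 0] fun ρ => ρ ^ N := by
      refine Asymptotics.IsBigO.fun_sum fun i _ => Asymptotics.IsBigO.fun_sum fun j _ =>
        Asymptotics.IsBigO.const_mul_left ?_ _
      refine (Asymptotics.isBigO_pi.1 (Asymptotics.isBigO_pi.1 h1.1 i) j).congr_left fun ρ => ?_
      rw [chartMatrix_borelG ρ p hyt]
      simp only [Prod.fst_sub, Prod.fst_sum, Prod.smul_fst, Finset.sum_apply, Pi.smul_apply,
        Pi.sub_apply, smul_eq_mul, chartMatrix_coefG S p hyt, coefVec, ← eval_apply hyt]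
      rfl
    refine h2.congr_left fun ρ => ?_
    simp only [e, mul_sub, Finset.sum_sub_distrib]
    congr 1
    simp only [Finset.mul_sum]
    rw [Finset.sum_comm]
    refine (Finset.sum_congr rfl fun j _ => Finset.sum_comm).trans ?_
    rw [Finset.sum_comm]
    refine Finset.sum_congr rfl fun k _ => ?_
    rw [Finset.sum_comm]
    exact Finset.sum_congr rfl fun i _ => Finset.sum_congr rfl fun j _ => by ring
  · refine h1.2.congr_left fun ρ => ?_
    have e1 : borelF S l ρ x = ∑ k ∈ Finset.range (⌈|ρ|⁻¹⌉₊ + 1),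
        borelCoeff l k ρ * (coefVec S p k y).2 := by rw [← borelF_symm ρ p hyt, hyx]
    have e2 : ∀ k, coefF S k x = (coefVec S p k y).2 := fun k => by
      rw [← hyx, coefF_symm S p hyt, eval_apply]; rfl
    rw [e1]
    simp only [Prod.snd_sub, Prod.snd_sum, Prod.smul_snd, smul_eq_mul, e2]

end Existence

/-! ### The orders of vanishing -/

section Orders

open TopologicalSpace smoothFun PowerSeries

variable {d : ℕ} {M : Type*} [TopologicalSpace M] [ChartedSpace (BaseVec d) M]
  [IsManifold (𝓡 d) ∞ M] {S : SmoothMetricMeasureSpace d M} {l : ℕ → ℝ}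

/-- The ambient space of the Borel sum has the expansion given by the formal solution. -/
lemma IsGoodScale.radExpand_eq (hl : IsGoodScale S l) {t : ℝ} (ht : 0 < t) (x : M) :
    (locg hl.isFamily.isPreAmbient x).map (radExpand hl.isFamily.isPreAmbient ht x)
        = (baseFormal S x).1 ∧
      radExpand hl.isFamily.isPreAmbient ht x (locf hl.isFamily.isPreAmbient x)
        = (baseFormal S x).2 := by
  set hA := hl.isFamily.isPreAmbient with hAdef
  have hev : ∀ y ∈ baseOpen x, ∀ᶠ ρ in 𝓝 (0 : ℝ), ((t, y, ρ) : AmbVec d) ∈ ambOpen hA x :=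
    fun y hy => eventually_rad_mem (init_mem_ambOpen hA ht y hy)
  refine ⟨Matrix.ext fun i j => PowerSeries.ext fun k => ext_eval fun y hy => ?_,
    PowerSeries.ext fun k => ext_eval fun y hy => ?_⟩
  · have e : eval y hy (coeff k ((baseFormal S x).1 i j))
        = chartMatrix (𝓡 d) (baseBasis d) (coefG S k) x y i j := by
      rw [chartMatrix_coefG S x hy]; rfl
    rw [e]
    refine eval_coeff_of_expansion (init_mem_ambOpen hA ht) hy (locg hA x i j)
      (c := fun k => chartMatrix (𝓡 d) (baseBasis d) (coefG S k) x y i j) (fun N => ?_) k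
    refine Asymptotics.IsBigO.congr' ((hl.expansion ((extChartAt (𝓡 d) x).symm y) N).1
      (symmDeriv (𝓡 d) x y (baseBasis d i)) (symmDeriv (𝓡 d) x y (baseBasis d j))) ?_
      Filter.EventuallyEq.rfl
    filter_upwards [hev y hy] with ρ hρ
    rw [← eval_apply hρ, eval_locg, pairAt_ambientSpace]
    simp only [chartMatrix_eq]
    congr 1
    field_simp
    ring
  · have e : eval y hy (coeff k (baseFormal S x).2)
        = coefF S k ((extChartAt (𝓡 d) x).symm y) := (coefF_symm S x hy k).symm
    rw [e]
    refine eval_coeff_of_expansion (init_mem_ambOpen hA ht) hy (locf hA x)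
      (c := fun k => coefF S k ((extChartAt (𝓡 d) x).symm y)) (fun N => ?_) k
    refine Asymptotics.IsBigO.congr' (hl.expansion ((extChartAt (𝓡 d) x).symm y) N).2 ?_
      Filter.EventuallyEq.rfl
    filter_upwards [hev y hy] with ρ hρ
    rw [← eval_apply hρ, eval_locf]
    congr 1
    change _ = t⁻¹ * (t * _)
    rw [inv_mul_cancel_left₀ ht.ne']

/-- The expansions of the curvatures of the ambient space of the Borel sum vanish to the order below
the critical one, and their weighted trace vanishes to the next order. -/
lemma IsGoodScale.dvd_radExpand (hl : IsGoodScale S l) (hd : 3 ≤ d) {t : ℝ} (ht : 0 < t) (x : M)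
    {N : ℕ} (hN : ∀ s < N, (d : ℝ) + S.m ≠ 2 * (s + 1)) :
    let hA := hl.isFamily.isPreAmbient
    let T := radExpand hA ht x
    let P := ambRic (der (ambOpen hA x) (ambBasis d)) (coordT _) (locTi hA x) (coordR _) (locg hA x)
      (locgi hA x) (locf hA x) (locfi hA x) S.m
    let W := wF (der (ambOpen hA x) (ambBasis d)) (ambMat (coordT _) (coordR _) (locg hA x))
      (ambInv (locTi hA x) (coordR _) (locgi hA x)) (coordT _ * locf hA x) S.m S.μ
    (∀ I J, X ^ N ∣ T (P I J)) ∧ X ^ N ∣ T W ∧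
    algebraMap ℝ _ S.m * Ring.inverse (baseF S x) ^ 2 * coeff N (T W)
      - ∑ i, ∑ j, (baseG S x)⁻¹ i j * coeff N (T (P (.inr (.inl i)) (.inr (.inl j)))) = 0 := by
  intro hA T P W
  have hF := isNormalFrame hA isReduced_ambientSpace x
  have hT : IsExpansion T _ _ _ := isExpansion_ambTaylor (init_mem_ambOpen hA (x := x) ht)
  obtain ⟨hG, hf⟩ := hl.radExpand_eq ht x
  have hd' : (3 : ℝ) ≤ d := by exact_mod_cast hd
  have hm := S.m_nonneg
  have hgi : (locg hA x).map T * (locgi hA x).map T = 1 := by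
    rw [← Matrix.map_mul, hF.hgi, Matrix.map_one _ (map_zero _) (map_one _)]
  have hfi : T (locf hA x) * T (locfi hA x) = 1 := by rw [← map_mul, hF.hf, map_one]
  have hc : (d : ℝ) + S.m = (Fintype.card (Fin d) : ℝ) + S.m := by rw [Fintype.card_fin]
  have hn0 : (d : ℝ) + S.m ≠ 0 := by linarith
  have hn1 : (d : ℝ) + S.m ≠ 1 := fun h => by linarith
  obtain ⟨h1, h2, h3⟩ := formal_solves (isInitial_base S x) hc hn0 hn1 hN hG hf hgi hfi
  obtain ⟨h4, h5, h6⟩ := hT.dvd_ambRic hF S.μ hc hn0 hn1 hN h1 h2 h3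
  refine ⟨h4, h5, ?_⟩
  have h0 := coeff_zero_formal (D := der (baseOpen x) (baseBasis d)) (m := S.m) (μ := S.μ)
    (g := baseG S x) (gi := (baseG S x)⁻¹) (f := baseF S x) (fi := Ring.inverse (baseF S x))
  obtain ⟨e1, e2⟩ := coeff_zero_inv (p := ((locg hA x).map T, T (locf hA x))) (isInitial_base S x)
    (by rw [hG]; exact h0.1) (by rw [hf]; exact h0.2) hgi hfi
  have e1' : ∀ i j, coeff 0 (T (locgi hA x i j)) = (baseG S x)⁻¹ i j := fun i j =>
    congrFun (congrFun e1 i) j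
  rw [e2] at h6
  simp only [e1'] at h6
  exact h6

/-- The ambient space of the Borel sum of the formal solution is a weighted ambient space. -/
theorem IsGoodScale.isWeightedAmbient (hl : IsGoodScale S l) (hd : 3 ≤ d) :
    IsWeightedAmbient S (ambientSpace (borelG S l) (borelF S l)) := by
  have hA := hl.isFamily.isPreAmbient
  have hR : IsReduced (ambientSpace (borelG S l) (borelF S l)) := isReduced_ambientSpace
  have key : ∀ N : ℕ, (∀ s < N, (d : ℝ) + S.m ≠ 2 * (s + 1)) →
      PairIsOrder (ambRicci S (ambientSpace (borelG S l) (borelF S l)))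
        (ambF S (ambientSpace (borelG S l) (borelF S l))) N := by
    intro N hN
    refine ⟨fun I J t ht x => ?_, fun t ht x => ?_⟩
    · refine (isOrder_iff hA ht x _ (fun ρ hρ => ambRicci_eq hA hR hρ I J) N).2 fun j hj => ?_
      rw [X_pow_dvd_iff.1 ((hl.dvd_radExpand hd ht x hN).1 I J) j hj, map_zero]
    · refine (isOrder_iff hA ht x _ (fun ρ hρ => ambF_eq hA hR hρ) N).2 fun j hj => ?_
      rw [X_pow_dvd_iff.1 (hl.dvd_radExpand hd ht x hN).2.1 j hj, map_zero]
  have hzero : ∀ J N, IsOrder (fun p =>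
      ambRicci S (ambientSpace (borelG S l) (borelF S l)) p (.inl ()) J) N := by
    intro J N t ht x
    refine (isOrder_iff hA ht x 0 (fun ρ hρ => ?_) N).2 fun j _ => by rw [map_zero, map_zero, map_zero]
    dsimp only
    rw [ambRicci_eq hA hR hρ, (isNormalFrame hA hR x).ambRic_zero]
  -- the critical order `s + 1` would be `(d + m) / 2`
  refine ⟨hA, fun hn N => key N fun s _ h => hn ⟨s + 1, by rw [h]; push_cast; ring⟩, fun n hn => ?_⟩
  have hN : ∀ s < n - 1, (d : ℝ) + S.m ≠ 2 * (s + 1) := fun s hs h => by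
    rw [hn] at h
    have : (n : ℝ) = s + 1 := by linarith
    have : n = s + 1 := by exact_mod_cast this
    omega
  -- for `d + m = 2 n` it remains to gain one order in the weighted trace
  refine ⟨key _ hN, hzero _ _, fun i => hzero _ _, fun t ht x => ?_⟩
  set gi := (Matrix.of (componentsAt (𝓡 d) (baseBasis d) S.g.inner x))⁻¹ with hgi
  set c := S.m * (S.f x ^ 2)⁻¹ with hc
  set T := radExpand hA ht x
  set P := ambRic (der (ambOpen hA x) (ambBasis d)) (coordT _) (locTi hA x) (coordR _) (locg hA x)
      (locgi hA x) (locf hA x) (locfi hA x) S.m with hP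
  set W := wF (der (ambOpen hA x) (ambBasis d)) (ambMat (coordT _) (coordR _) (locg hA x))
      (ambInv (locTi hA x) (coordR _) (locgi hA x)) (coordT _ * locf hA x) S.m S.μ with hW
  obtain ⟨h1, h2, h3⟩ := hl.dvd_radExpand hd ht x hN
  set e := eval (U := baseOpen (d := d) x) (extChartAt (𝓡 d) x x) (self_mem_baseOpen x) with he
  have egi : ∀ i j, e ((baseG S x)⁻¹ i j) = gi i j := by
    have h4 : (baseG S x).map e * (baseG S x)⁻¹.map e = 1 := by
      rw [← map_mul_alg, (isInitial_base S x).hgi, map_one_alg]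
    have h5 : (baseG S x).map e = Matrix.of (componentsAt (𝓡 d) (baseBasis d) S.g.inner x) :=
      Matrix.ext fun i j => chartMatrix_self (𝓡 d) (baseBasis d) S.g.inner x i j
    rw [h5] at h4
    intro i j
    rw [hgi, Matrix.inv_eq_right_inv h4, Matrix.map_apply]
  have ef : e (Ring.inverse (baseF S x)) = (S.f x)⁻¹ := by
    have h4 := congrArg e (isInitial_base S x).hf
    rw [map_mul, map_one] at h4
    have h5 : e (baseF S x) = S.f x := by rw [he, eval_baseF, extChartAt_to_inv]
    rw [h5] at h4
    exact eq_inv_of_mul_eq_one_right h4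
  -- the weighted trace, with the coefficients at `x`, as a function of the chart coordinates
  set Y : smoothFun (ambOpen hA x) := algebraMap ℝ _ c * W
    - ∑ i, ∑ j, algebraMap ℝ _ (gi i j) * P (.inr (.inl i)) (.inr (.inl j)) with hY
  have eY : ∀ j, e (coeff j (T Y)) = c * e (coeff j (T W))
      - ∑ a, ∑ b, gi a b * e (coeff j (T (P (.inr (.inl a)) (.inr (.inl b))))) := by
    intro j
    simp only [hY, map_sub, map_mul, map_sum, AlgHom.commutes, PowerSeries.algebraMap_apply,
      coeff_C_mul]
    simp
  refine (isOrder_iff hA ht x Y (fun ρ hρ => ?_) (n - 1 + 1)).2 fun j hj => ?_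
  · have hz := self_mem_ambOpen hA hρ
    simp only [idxM]
    rw [← eval_apply hz, hY, ambF_eq hA hR hρ, ← hW, ← eval_apply hz]
    simp only [ambRicci_eq hA hR hρ, ← hP, ← eval_apply hz, map_sub, map_sum, map_mul,
      AlgHom.commutes]
    rfl
  · change e (coeff j (T Y)) = 0
    rw [eY]
    rcases Nat.lt_succ_iff_lt_or_eq.1 hj with hj | rfl
    · rw [X_pow_dvd_iff.1 h2 j hj]
      have : ∀ a b, coeff j (T (P (.inr (.inl a)) (.inr (.inl b)))) = 0 := fun a b =>
        X_pow_dvd_iff.1 (h1 _ _) j hj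
      simp [this]
    · have h6 := congrArg e h3
      simp only [map_sub, map_mul, map_sum, map_pow, AlgHom.commutes, egi, ef, map_zero] at h6
      rw [← h6, hc, inv_pow]
      rfl

theorem existence [SecondCountableTopology M] (S : SmoothMetricMeasureSpace d M) (hd : 3 ≤ d) :
    ∃ A : MetricMeasureStructure d M, IsWeightedAmbient S A ∧ IsStraight A ∧ IsNormal S A ∧
      HasStraightNormalForm S A := by
  obtain ⟨l, hl⟩ := exists_isGoodScale S
  exact ⟨ambientSpace (borelG S l) (borelF S l), hl.isWeightedAmbient hd, hl.isFamily.isStraight,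
    hl.isFamily.isNormal, hl.isFamily.hasStraightNormalForm⟩

end Orders

end WeightedAmbient

end

theorem mainTheorem2 (d : ℕ) (hd : 3 ≤ d) (M : Type*) [TopologicalSpace M] [T2Space M]
    [SecondCountableTopology M] [ChartedSpace (BaseVec d) M]
    [IsManifold (𝓡 d) ∞ M] (S : SmoothMetricMeasureSpace d M) :
    (∃ A : MetricMeasureStructure d M,
      IsWeightedAmbient S A ∧ IsStraight A ∧
      IsNormal S A ∧ HasStraightNormalForm S A) ∧
    ∀ A₁ A₂ : MetricMeasureStructure d M,
      IsWeightedAmbient S A₁ → IsStraight A₁ →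
      IsNormal S A₁ →
      IsWeightedAmbient S A₂ → IsStraight A₂ →
      IsNormal S A₂ →
      ((¬ ∃ n : ℕ, (d : ℝ) + S.m = 2 * n) → ∀ k : ℕ,
        PairIsOrder
          (componentsAt (ambI d) (ambBasis d)
            (fun p => A₁.g p - A₂.g p))
          (fun p => -2 * (A₁.f p - A₂.f p)) k) ∧
      (∀ n : ℕ, (d : ℝ) + S.m = 2 * n →
        PairIsOrderPlus S 1
          (componentsAt (ambI d) (ambBasis d)
            (fun p => A₁.g p - A₂.g p))
          (fun p => -2 * (A₁.f p - A₂.f p)) (n - 1)) :=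
  ⟨existence S hd, fun _ _ h₁ hS₁ hN₁ h₂ hS₂ hN₂ => uniqueness hd h₁ hS₁ hN₁ h₂ hS₂ hN₂⟩
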